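/- **Proposition (BKW correspondence).** Let $q\ge 1$, $p=\frac{\sqrt q}{1+\sqrt q}$ and $c=\sqrt{2+\sqrt q}$. For positive even integers $L,M$ let $\mathbb T_{L,M}=(\mathbb Z/L\mathbb Z)\times(\mathbb Z/M\mathbb Z)$ be the torus of width $L$ and height $M$. *Six-vertex model.* A six-vertex configuration orients every edge of $\mathbb T_{L,M}$ so that each vertex has exactly two incoming and two outgoing edges; its weight is $c^{n}$, where $n$ is the number of vertices at which the two horizontal arrows have opposite directions (the vertices of type $c$; here $a=b=1$). Let $Z^{(k)}_{\rm 6V}(\mathbb T_{L,M})$ be the sum of the weights of the configurations with $L/2+k$ up-arrows in each row of vertical edges, and $Z_{\rm 6V}=\sum_{k=-L/2}^{L/2}Z_{\rm 6V}^{(k)}$. Set $$f_{\rm 6V}=\lim_{L\to\infty}\lim_{M\to\infty}\tfrac1{LM}\log Z_{\rm 6V}(\mathbb T_{L,M}),\qquad f_{\rm 6V}(\alpha)=\lim_{L\to\infty}\lim_{M\to\infty}\tfrac1{LM}\log Z^{(\lceil\alpha L\rceil)}_{\rm 6V}(\mathbb T_{L,M})\quad(|\alpha|\le\tfrac12),$$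 where $L,M$ run through even integers. *FK-percolation.* Let $\mathbb T^\bullet_{L,M}$ be the graph on the vertices $(x,y)$ of $\mathbb T_{L,M}$ with $x+y$ even, with edges joining $(x,y)$ to $(x\pm1,y+1)$ ($LM$ edges in total). A set $\omega$ of open edges has weight $p^{|\omega|}(1-p)^{LM-|\omega|}q^{k(\omega)}$, where $k(\omega)$ is the number of clusters. Let $Z_{\rm FK}(\mathbb T_{L,M})$ be the sum of these weights, $\phi_{\mathbb T_{L,M}}$ the corresponding probability measure, and $$f_{\rm FK}=\lim_{L\to\infty}\lim_{M\to\infty}\tfrac1{LM}\log Z_{\rm FK}(\mathbb T_{L,M}).$$ For real $t$ let $\mathcal E_t$ be the event that at least $t$ clusters cross vertically from bottom to top the cylinder obtained by cutting $\mathbb T_{L,M}$ horizontally at height $0$ (clusters being counted on the cylinder). Then all the limits above exist (in $\mathbb R$), $$f_{\rm FK}=f_{\rm 6V}+\tfrac14\log q-\log(1+\sqrt q),$$ and, for every $0<\alpha\le\frac12$, $$\phi_{\mathbb T_{L,M}}[\mathcal E_{\alpha L}]^{1/LM}=\exp\big(f_{\rm 6V}(\alpha)-f_{\rm 6V}(0)+o(1)\big)\qquad\text{for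 all positive even } L,M,$$ where $o(1)$ is a quantity depending on $L$ and $M$ that converges to $0$ as $M\to\infty$ and then $L\to\infty$, i.e. its limit as $M\to\infty$ exists for every $L$, and this limit tends to $0$ as $L\to\infty$. -/

import Mathlib

open Filter Topology

noncomputable section

namespace BKW

/-- Vertices of the torus `(ℤ/Lℤ) × (ℤ/Mℤ)` of width `L` and height `M`. -/
abbrev Torus (L M : ℕ) : Type := ZMod L × ZMod M

/-! ### The six-vertex model -/

/-- An assignment of a direction to every edge of the torus. For a vertex `v`,
`ω.1 v = true` means that the horizontal edge between `v` and `v + (1, 0)` points to the right,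
`ω.2 v = true` means that the vertical edge between `v` and `v + (0, 1)` points upwards. -/
abbrev Arrows (L M : ℕ) : Type := (Torus L M → Bool) × (Torus L M → Bool)

/-- The number of arrows pointing towards the vertex `v` (from the left, the right, below, above). -/
def inDegree {L M : ℕ} (ω : Arrows L M) (v : Torus L M) : ℕ :=
  (if ω.1 (v - (1, 0)) = true then 1 else 0) + (if ω.1 v = false then 1 else 0) +
  (if ω.2 (v - (0, 1)) = true then 1 else 0) + (if ω.2 v = false then 1 else 0)

/-- Ice rule: every vertex has exactly two incoming (hence two outgoing) arrows. -/
def IceRule {L M : ℕ} (ω : Arrows L M) : Prop :=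
  ∀ v, inDegree ω v = 2

/-- Under the ice rule, the vertices of type `c` are those where the two horizontal arrows
have opposite directions (equivalently, the two vertical arrows have opposite directions);
at vertices of type `a` and `b` both pairs of arrows go straight through. -/
def IsTypeC {L M : ℕ} (ω : Arrows L M) (v : Torus L M) : Prop :=
  ω.1 (v - (1, 0)) ≠ ω.1 v

/-- Six-vertex weight with `a = b = 1`: `c` to the number of vertices of type `c`. -/
def sixVertexWeight {L M : ℕ} (c : ℝ) (ω : Arrows L M) : ℝ :=
  c ^ Nat.card {v : Torus L M // IsTypeC ω v}

/-- The number of up-arrows in the row of vertical edges above height `y`. -/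
def upArrows {L M : ℕ} (ω : Arrows L M) (y : ZMod M) : ℕ :=
  Nat.card {x : ZMod L // ω.2 (x, y) = true}

open Classical in
/-- The partition function over six-vertex configurations with `L / 2 + k` up-arrows
in every row (`L` is even wherever this is used). -/
def slopedZ (L M : ℕ) [NeZero L] [NeZero M] (c : ℝ) (k : ℤ) : ℝ :=
  ∑ ω : Arrows L M,
    if IceRule ω ∧ ∀ y, (upArrows ω y : ℤ) = (L : ℤ) / 2 + k then sixVertexWeight c ω else 0

/-- The partition function of the six-vertex model, `∑_{k = -L/2}^{L/2} Z^{(k)}`. -/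
def sixVertexZ (L M : ℕ) [NeZero L] [NeZero M] (c : ℝ) : ℝ :=
  ∑ k ∈ Finset.Icc (-((L : ℤ) / 2)) ((L : ℤ) / 2), slopedZ L M c k

/-! ### FK-percolation on the black sublattice of the torus -/

/-- The black vertices of the torus (`L` and `M` are even wherever this is used, so that
this is one class of a bipartite colouring). -/
abbrev Black (L M : ℕ) : Type := {v : Torus L M // Even (v.1.val + v.2.val)}

/-- The edges of the graph on the black vertices: `(v, true)` joins `v` to `v + (1, 1)` and
`(v, false)` joins `v` to `v + (-1, 1)`. -/
abbrev BlackEdge (L M : ℕ) : Type := Black L M × Bool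

/-- Horizontal displacement along an edge, travelled upwards. -/
def hshift {L M : ℕ} (e : BlackEdge L M) : ZMod L := if e.2 = true then 1 else -1

/-- The subgraph formed by the open edges of a configuration `ω` (a set of edges). -/
def openGraph {L M : ℕ} (ω : Finset (BlackEdge L M)) : SimpleGraph (Black L M) :=
  SimpleGraph.fromRel fun u w => ∃ e ∈ ω, u = e.1 ∧ w.1 = u.1 + (hshift e, 1)

/-- The number of clusters `k(ω)`, isolated vertices included. -/
def numClusters {L M : ℕ} (ω : Finset (BlackEdge L M)) : ℕ :=
  Nat.card (openGraph ω).ConnectedComponent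

open Classical in
/-- FK weight `p^{|ω|} (1 - p)^{|E \ ω|} q^{k(ω)}`. -/
def fkWeight {L M : ℕ} [NeZero L] [NeZero M] (p q : ℝ) (ω : Finset (BlackEdge L M)) : ℝ :=
  p ^ ω.card * (1 - p) ^ (ωᶜ).card * q ^ numClusters ω

open Classical in
/-- The partition function of FK-percolation on the torus. -/
def fkZ (L M : ℕ) [NeZero L] [NeZero M] (p q : ℝ) : ℝ :=
  ∑ ω : Finset (BlackEdge L M), fkWeight p q ω

open Classical in
/-- The probability of an event under the FK-percolation measure on the torus. -/
def fkProb (L M : ℕ) [NeZero L] [NeZero M] (p q : ℝ) (A : Set (Finset (BlackEdge L M))) : ℝ :=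
  (∑ ω : Finset (BlackEdge L M), if ω ∈ A then fkWeight p q ω else 0) / fkZ L M p q

/-! ### Vertically crossing clusters -/

/-- The black vertices of the cylinder obtained by cutting the torus at height `0`. Its rows have
heights `0, …, M`; rows `0` and `M` are the two copies of the row of the torus at height `0`. -/
abbrev CylBlack (L M : ℕ) : Type :=
  {v : ZMod L × Fin (M + 1) // Even (v.1.val + v.2.val)}

/-- The open edges of `ω`, seen as a subgraph of the cylinder: the edge going up from the
torus vertex `(x, y)`, with `0 ≤ y < M`, goes up from the cylinder vertex `(x, y)`. -/
def cylGraph {L M : ℕ} (ω : Finset (BlackEdge L M)) : SimpleGraph (CylBlack L M) :=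
  SimpleGraph.fromRel fun u w => ∃ e ∈ ω,
    u.1.1 = e.1.1.1 ∧ u.1.2.val = e.1.1.2.val ∧
    w.1.1 = u.1.1 + hshift e ∧ w.1.2.val = u.1.2.val + 1

/-- The number of clusters of `ω` on the cylinder that contain both a vertex of the bottom row
and a vertex of the top row. -/
def numCrossing {L M : ℕ} (ω : Finset (BlackEdge L M)) : ℕ :=
  Nat.card {C : (cylGraph ω).ConnectedComponent //
    (∃ u : CylBlack L M, u.1.2 = 0 ∧ (cylGraph ω).connectedComponentMk u = C) ∧
    (∃ u : CylBlack L M, u.1.2 = Fin.last M ∧ (cylGraph ω).connectedComponentMk u = C)}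

/-- The event that there are at least `t` vertically crossing clusters. -/
def crossingEvent (L M : ℕ) (t : ℝ) : Set (Finset (BlackEdge L M)) :=
  {ω | t ≤ (numCrossing ω : ℝ)}

/-! ### Limits `M → ∞`, then `L → ∞` -/

/-- `lim_{L → ∞} lim_{M → ∞} u L M = a`, where `L` and `M` run through the positive even
integers; the inner limits are required to exist. -/
def HasIteratedLimit (u : (L M : ℕ) → [NeZero L] → [NeZero M] → ℝ) (a : ℝ) : Prop :=
  ∃ g : ℕ → ℝ,
    (∀ l : ℕ, Tendsto (fun m : ℕ => u (2 * (l + 1)) (2 * (m + 1))) atTop (𝓝 (g l))) ∧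
    Tendsto g atTop (𝓝 a)

end BKW

end

noncomputable section

namespace BKW

/-! ### Periodic non-crossing pairings of the integers -/

/-! Put `r = √q`. Then `p / (1 - p) = r`, `c² = 2 + r`, and there is a complex `y` with `y² + y⁻² =
c` and `y⁴ + y⁻⁴ = r`. The cap-cup operators `e_j = capOp y j` act on spins placed on a circle of `N
= L + 2` points and are of Temperley-Lieb type with loop weight `r`. They are multiplied in helical
order `t = 0, 1, 2, …`, with the factor `e_t` when `L + 1` divides `t` and the factor `1 + e_t`
otherwise, and the product is applied to the constant vector. The result is read in two ways.

As vertices: two of the points carry horizontal arrows and the other `L` carry vertical arrows. Each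
`1 + e_t` is a six-vertex vertex up to a gauge, and each forced `e_t` closes a row and opens the
next (`opSeq_eq_rowState`). Summing over spins of flux `2n` gives the entries of a power of the
transfer matrix.

As loops: each term of the expansion is a multiple of the vector of a non-crossing pairing on the
annulus, with a factor `r` for each contractible loop and a factor `c` whenever two unpaired points
(defects) are joined (`pathOp_eq`). Loops around the annulus have weight `2`, but they occur only
when no defect is left. For `n ≥ 1` the flux `2n` keeps exactly the pairings with at least `2n`
defects, so such loops play no role. The odd faces between the points are percolation vertices:
connections are read off the pairing (`helix_invariant`), having `n ≥ 2` crossing clusters amounts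
to having `n` odd defects (`manyCrossings_iff`), and Euler's relation converts `r ^ loops` into `r ^
(|ω| + 2 k(ω))` up to a factor depending on `N` only (`loopCount_bounds`). Unrolling the cylinder
onto the helix, and gluing the cylinder into the torus, changes the number of clusters by at most
`2L`. Hence for `n ≥ 2` the sector `n` of the six-vertex model and percolation with at least `n`
crossing clusters have the same growth rate in `M`, up to explicit terms (`fkRate_eq`).

Fewer than two crossings are handled by finite energy: forcing four columns creates two crossing
clusters at a cost exponential in `M` alone (`helixSum_zero_le_two`), which is invisible after
division by `L`. This also shows that slope zero dominates the full six-vertex partition function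
(`totalRate_le`).

The limits in `M` come from Fekete's lemma: traces of even powers of a symmetric matrix are squared
Hilbert-Schmidt norms, and the helical sums are submultiplicative. The limits in `L` come from
gluing strips with the same horizontal arrows along their seams; choosing a best seam costs `log 2`
per row and strip (`stripRate_superadditive`). Slopes `±1/2` leave no room for gluing and are
computed directly. -/

/-- The integers in `(a, b]` are mapped into `(a, b]` by `f`, without fixed points. -/
def ClosedUnder (f : ℤ → ℤ) (a b : ℤ) : Prop :=
  ∀ i, a < i → i ≤ b → a < f i ∧ f i ≤ b ∧ f i ≠ i

/-- A non-crossing partial pairing of the integers with period `N`, that is, of `N` points around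
a circle. Fixed points ("defects") are unpaired, and no pair surrounds a defect. -/
structure AnnularPairing (N : ℕ) where
  toFun : ℤ → ℤ
  two_le : 2 ≤ N
  invol : ∀ i, toFun (toFun i) = i
  shift : ∀ i, toFun (i + N) = toFun i + N
  nc : ∀ i, i < toFun i → ClosedUnder toFun i (toFun i - 1)

instance (N : ℕ) : CoeFun (AnnularPairing N) (fun _ => ℤ → ℤ) := ⟨AnnularPairing.toFun⟩

/-- `T` is a translate of `t` by a multiple of the period. -/
def Translate (N : ℕ) (t T : ℤ) : Prop := ∃ k : ℤ, T = t + k * N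

theorem Translate.refl (N : ℕ) (t : ℤ) : Translate N t t := ⟨0, by simp⟩

theorem Translate.sep {N : ℕ} {t T T' : ℤ} (h : Translate N t T) (h' : Translate N t T') :
    T = T' ∨ T + N ≤ T' ∨ T' + N ≤ T := by
  obtain ⟨k, rfl⟩ := h
  obtain ⟨l, rfl⟩ := h'
  rcases lt_trichotomy k l with h | h | h
  · right; left; nlinarith [mul_le_mul_of_nonneg_right (show k + 1 ≤ l by omega) (Int.natCast_nonneg N)]
  · left; rw [h]
  · right; right; nlinarith [mul_le_mul_of_nonneg_right (show l + 1 ≤ k by omega) (Int.natCast_nonneg N)]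

theorem Translate.not_succ {N : ℕ} (hN : 2 ≤ N) {t T : ℤ} (h : Translate N t T) :
    ¬ Translate N t (T + 1) := by
  intro h'
  have := h.sep h'
  omega

theorem Translate.symm {N : ℕ} {t T : ℤ} (h : Translate N t T) : Translate N T t := by
  obtain ⟨k, rfl⟩ := h
  exact ⟨-k, by ring⟩

theorem Translate.trans {N : ℕ} {t T U : ℤ} (h : Translate N t T) (h' : Translate N T U) :
    Translate N t U := by
  obtain ⟨k, rfl⟩ := h
  obtain ⟨l, rfl⟩ := h'
  exact ⟨k + l, by ring⟩

theorem Translate.add {N : ℕ} {t T : ℤ} (h : Translate N t T) (k : ℤ) :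
    Translate N t (T + k * N) := h.trans ⟨k, rfl⟩

theorem Translate.add_const {N : ℕ} {t T : ℤ} (h : Translate N t T) (k : ℤ) :
    Translate N (t + k) (T + k) := by
  obtain ⟨l, rfl⟩ := h
  exact ⟨l, by ring⟩

namespace ClosedUnder

variable {f : ℤ → ℤ} {a b c : ℤ}

theorem of_le (h : b ≤ a) : ClosedUnder f a b := fun i h1 h2 => by omega

theorem trans (hab : a ≤ b) (hbc : b ≤ c) (h : ClosedUnder f a b) (h' : ClosedUnder f b c) :
    ClosedUnder f a c := fun i h1 h2 => by
  rcases le_or_gt i b with hi | hi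
  · have := h i h1 hi; omega
  · have := h' i hi h2; omega

theorem diff_left (hf : ∀ i, f (f i) = i) (hab : a ≤ b) (h : ClosedUnder f a c)
    (h' : ClosedUnder f a b) : ClosedUnder f b c := fun i h1 h2 => by
  have h3 := h i (by omega) h2
  refine ⟨?_, h3.2.1, h3.2.2⟩
  by_contra h4
  have := h' (f i) h3.1 (by omega)
  rw [hf] at this
  omega

theorem diff_right (hf : ∀ i, f (f i) = i) (hbc : b ≤ c) (h : ClosedUnder f a c)
    (h' : ClosedUnder f b c) : ClosedUnder f a b := fun i h1 h2 => by
  have h3 := h i h1 (by omega)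
  refine ⟨h3.1, ?_, h3.2.2⟩
  by_contra h4
  have := h' (f i) (by omega) h3.2.1
  rw [hf] at this
  omega

/-- A fixed-point-free involution pairs off the points, which is seen by summing `1` in `ZMod 2`.
This parity later keeps odd (percolation) and even (dual) faces in different regions. -/
theorem even (hf : ∀ i, f (f i) = i) (hab : a ≤ b) (h : ClosedUnder f a b) :
    Even (b - a) := by
  have h1 : ∑ i ∈ Finset.Ioc a b, (1 : ZMod 2) = 0 := by
    refine Finset.sum_involution (fun i _ => f i) (fun i _ => by decide) ?_ ?_ ?_
    · intro i hi _
      rw [Finset.mem_Ioc] at hi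
      exact (h i hi.1 hi.2).2.2
    · intro i hi
      rw [Finset.mem_Ioc] at hi ⊢
      have := h i hi.1 hi.2
      exact ⟨this.1, this.2.1⟩
    · intro i _
      exact hf i
  rw [Finset.sum_const, Int.card_Ioc, nsmul_eq_mul, mul_one, ZMod.natCast_eq_zero_iff_even] at h1
  have h2 : ((b - a).toNat : ℤ) = b - a := Int.toNat_of_nonneg (by omega)
  rw [← h2]
  exact_mod_cast h1

end ClosedUnder

/-! ### Annular pairings and the action of a cap and a cup. -/

namespace AnnularPairing

variable {N : ℕ} (π : AnnularPairing N)

theorem shift_mul (i k : ℤ) : π (i + k * N) = π i + k * N := by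
  induction k using Int.induction_on with
  | zero => simp
  | succ k ih =>
    have := π.shift (i + k * N)
    rw [show i + ((k : ℤ) + 1) * N = i + k * N + N by ring, this, ih]; ring
  | pred k ih =>
    have := π.shift (i + (-(k : ℤ) - 1) * N)
    rw [show i + (-(k : ℤ) - 1) * N + N = i + (-k) * N by ring, ih] at this
    linarith

theorem injective : Function.Injective π := fun a b h => by
  rw [← π.invol a, h, π.invol]

theorem translate_apply {a b : ℤ} (h : Translate N a b) : Translate N (π a) (π b) := by
  obtain ⟨k, rfl⟩ := h
  exact ⟨k, π.shift_mul a k⟩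

theorem nc' {i j : ℤ} (h1 : i < j) (h2 : j < π i) : i < π j ∧ π j < π i ∧ π j ≠ j := by
  have := π.nc i (by omega) j h1 (by omega)
  omega

/-- A pair and its translate do not cross. -/
theorem apply_lt_add (i : ℤ) : π i < i + N := by
  have h2 := π.two_le
  by_contra h
  have h1 := π.shift i
  -- A partner exactly one period away contradicts involutivity. Further away, the point `i + N`
  -- lies under the arc of `i` while its partner `π i + N` does not.
  rcases eq_or_lt_of_le (not_lt.mp h) with h3 | h3
  · rw [h3, π.invol] at h1; omega
  · have := π.nc' (by omega) h3; omega

theorem sub_lt_apply (i : ℤ) : i < π i + N := by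
  have := π.apply_lt_add (π i)
  rwa [π.invol] at this

open Classical in
/-- The action of a cap and a cup on a pairing: join the partners of `t` and `t + 1`
(an unpaired partner stays unpaired), then pair `t` and `t + 1`; and periodically. -/
def capFun (t i : ℤ) : ℤ :=
  if Translate N t i then i + 1
  else if Translate N t (i - 1) then i - 1
  else if Translate N t (π i) then (if π (π i + 1) = π i + 1 then i else π (π i + 1))
  else if Translate N t (π i - 1) then (if π (π i - 1) = π i - 1 then i else π (π i - 1))
  else π i

variable {π} {t T : ℤ}

theorem capFun_left (h : Translate N t T) : π.capFun t T = T + 1 := by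
  simp [capFun, h]

theorem capFun_right (h : Translate N t T) : π.capFun t (T + 1) = T := by
  simp [capFun, h, h.not_succ π.two_le]

/-- Neither `i` nor `i - 1` is a translate of `t`. -/
def Off (N : ℕ) (t i : ℤ) : Prop := ¬ Translate N t i ∧ ¬ Translate N t (i - 1)

theorem Off.ne {i : ℤ} (h : Off N t i) (hT : Translate N t T) : i ≠ T ∧ i ≠ T + 1 :=
  ⟨fun e => h.1 (e ▸ hT), fun e => h.2 (by rw [e]; simpa using hT)⟩

theorem capFun_off {i : ℤ} (h : Off N t i) (h' : Off N t (π i)) : π.capFun t i = π i := by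
  simp [capFun, h.1, h.2, h'.1, h'.2]

theorem capFun_partner_left (h : Translate N t T) (h' : Off N t (π T)) :
    π.capFun t (π T) = if π (T + 1) = T + 1 then π T else π (T + 1) := by
  simp [capFun, h'.1, h'.2, π.invol, h]

theorem capFun_partner_right (h : Translate N t T) (h' : Off N t (π (T + 1))) :
    π.capFun t (π (T + 1)) = if π T = T then π (T + 1) else π T := by
  simp [capFun, h'.1, h'.2, π.invol, h, h.not_succ π.two_le]

theorem off_or (t i : ℤ) : Off N t i ∨ ∃ T, Translate N t T ∧ (i = T ∨ i = T + 1) := by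
  by_cases h : Translate N t i
  · exact Or.inr ⟨i, h, Or.inl rfl⟩
  by_cases h' : Translate N t (i - 1)
  · exact Or.inr ⟨i - 1, h', Or.inr (by ring)⟩
  exact Or.inl ⟨h, h'⟩

/-- The five possibilities for the position of `i` relative to the cap. -/
theorem cap_cases (π : AnnularPairing N) (t i : ℤ) :
    (∃ T, Translate N t T ∧ (i = T ∨ i = T + 1)) ∨
    (Off N t i ∧ Off N t (π i)) ∨
    (∃ T, Translate N t T ∧ Off N t i ∧ i = π T) ∨
    (∃ T, Translate N t T ∧ Off N t i ∧ i = π (T + 1)) := by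
  rcases off_or (N := N) t i with h | h
  · rcases off_or (N := N) t (π i) with h' | ⟨T, hT, h' | h'⟩
    · exact Or.inr (Or.inl ⟨h, h'⟩)
    · exact Or.inr (Or.inr (Or.inl ⟨T, hT, h, by rw [← h', π.invol]⟩))
    · exact Or.inr (Or.inr (Or.inr ⟨T, hT, h, by rw [← h', π.invol]⟩))
  · exact Or.inl h

theorem off_translate {i j : ℤ} (h : Translate N i j) (hi : Off N t i) : Off N t j := by
  refine ⟨fun h' => hi.1 (h'.trans h.symm), fun h' => hi.2 (h'.trans ?_)⟩
  exact h.symm.add_const (-1)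

/-- If the partner of `T` is off the cap, so is that of `T + 1` unless it is a defect. -/
theorem off_right (h : Translate N t T) (h' : Off N t (π T)) (hd : π (T + 1) ≠ T + 1) :
    Off N t (π (T + 1)) := by
  rcases off_or (N := N) t (π (T + 1)) with h1 | ⟨U, hU, h1 | h1⟩
  · exact h1
  · exfalso
    have h2 := π.translate_apply (hU.symm.trans h)
    rw [← h1, π.invol] at h2
    exact (off_translate h2.symm h').2 (by simpa using h)
  · exfalso
    -- If the partner of `T + 1` were its own translate by `-k` periods, applying the pairing twice
    -- would translate by `-2k` periods; so `k = 0` and `T + 1` is a defect.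
    obtain ⟨k, hk⟩ := hU.symm.trans h
    have h4 := π.shift_mul (U + 1) k
    have h5 : π (U + 1) = π (T+1) - k * N := by
      rw [show T + 1 = U + 1 + k * N by rw [hk]; ring, h4]; ring
    have h6 : π (π (T + 1)) = U + 1 - k * N := by
      rw [h1, h5, h1]
    rw [π.invol] at h6
    rcases eq_or_ne k 0 with rfl | hk0
    · apply hd; rw [h1, hk]; ring
    · have : (2 * k) * N = 0 := by rw [hk] at h6; linarith
      have hN := π.two_le
      rcases mul_eq_zero.mp this with h | h <;> omega

theorem off_left (h : Translate N t T) (h' : Off N t (π (T + 1))) (hd : π T ≠ T) :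
    Off N t (π T) := by
  rcases off_or (N := N) t (π T) with h1 | ⟨U, hU, h1 | h1⟩
  · exact h1
  · exfalso
    obtain ⟨k, hk⟩ := hU.symm.trans h
    have h4 := π.shift_mul U k
    have h5 : π U = π T - k * N := by
      rw [show T = U + k * N by rw [hk], h4]; ring
    have h6 : π (π T) = U - k * N := by rw [h1, h5, h1]
    rw [π.invol] at h6
    rcases eq_or_ne k 0 with rfl | hk0
    · apply hd; rw [h1, hk]; ring
    · have : (2 * k) * N = 0 := by rw [hk] at h6; linarith
      have hN := π.two_le
      rcases mul_eq_zero.mp this with h | h <;> omega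
  · exfalso
    have h2 := π.translate_apply ((hU.symm.trans h).add_const 1)
    rw [← h1, π.invol] at h2
    exact (off_translate h2.symm h').1 h

theorem capFun_invol (i : ℤ) : π.capFun t (π.capFun t i) = i := by
  rcases cap_cases π t i with ⟨T, hT, rfl | rfl⟩ | ⟨h, h'⟩ | ⟨T, hT, h, rfl⟩ | ⟨T, hT, h, rfl⟩
  · rw [capFun_left hT, capFun_right hT]
  · rw [capFun_right hT, capFun_left hT]
  · rw [capFun_off h h', capFun_off h' (by rwa [π.invol]), π.invol]
  · rw [capFun_partner_left hT h]
    split_ifs with h1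
    · rw [capFun_partner_left hT h, if_pos h1]
    · rw [capFun_partner_right hT (off_right hT h h1), if_neg]
      intro h2; rw [h2] at h; exact h.1 hT
  · rw [capFun_partner_right hT h]
    split_ifs with h1
    · rw [capFun_partner_right hT h, if_pos h1]
    · rw [capFun_partner_left hT (off_left hT h h1), if_neg]
      intro h2; rw [h2] at h; exact h.2 (by simpa using hT)

theorem capFun_shift (i : ℤ) : π.capFun t (i + N) = π.capFun t i + N := by
  have tr : ∀ x : ℤ, Translate N x (x + N) := fun x => ⟨1, by ring⟩
  rcases cap_cases π t i with ⟨T, hT, rfl | rfl⟩ | ⟨h, h'⟩ | ⟨T, hT, h, rfl⟩ | ⟨T, hT, h, rfl⟩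
  · rw [capFun_left (hT.trans (tr i)), capFun_left hT]; ring
  · rw [show T + 1 + N = T + N + 1 by ring, capFun_right (hT.trans (tr T)), capFun_right hT]
  · rw [capFun_off h h', capFun_off (off_translate (tr i) h), π.shift]
    rw [π.shift]; exact off_translate (tr _) h'
  · have h1 := off_translate (tr _) h
    rw [← π.shift] at h1 ⊢
    rw [capFun_partner_left (hT.trans (tr T)) h1, capFun_partner_left hT h,
      show T + N + 1 = T + 1 + N by ring, π.shift, π.shift]
    split_ifs <;> omega
  · have h1 := off_translate (tr _) h
    rw [← π.shift, show T + 1 + N = T + N + 1 by ring] at h1 ⊢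
    rw [capFun_partner_right (hT.trans (tr T)) h1, capFun_partner_right hT h,
      show T + N + 1 = T + 1 + N by ring, π.shift, π.shift]
    split_ifs <;> omega

theorem capFun_fixed {i : ℤ} (h : Off N t i) (h' : π i = i) : π.capFun t i = i := by
  rw [capFun_off h (by rwa [h']), h']

/-- A closed interval whose ends do not separate a cap stays closed. -/
theorem ClosedUnder.cap {a b : ℤ} (h : ClosedUnder π a b) (ha : ¬ Translate N t a)
    (hb : ¬ Translate N t b) : ClosedUnder (π.capFun t) a b := by
  intro i h1 h2
  have hN := π.two_le
  rcases cap_cases π t i with ⟨T, hT, rfl | rfl⟩ | ⟨h3, h'⟩ | ⟨T, hT, h3, rfl⟩ | ⟨T, hT, h3, rfl⟩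
  · rw [capFun_left hT]
    have : i ≠ b := fun e => hb (e ▸ hT)
    omega
  · rw [capFun_right hT]
    have : T ≠ a := fun e => ha (e ▸ hT)
    omega
  · rw [capFun_off h3 h']
    exact h i h1 h2
  · have h4 := h _ h1 h2
    rw [π.invol] at h4
    have h7 : T ≠ b := fun e => hb (e ▸ hT)
    have h5 := h (T + 1) (by omega) (by omega)
    have h6 : π T ≠ π (T + 1) := fun e => by have := π.injective e; omega
    rw [capFun_partner_left hT h3, if_neg h5.2.2]
    exact ⟨h5.1, h5.2.1, h6.symm⟩
  · have h4 := h _ h1 h2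
    rw [π.invol] at h4
    have h7 : T ≠ a := fun e => ha (e ▸ hT)
    have h5 := h T (by omega) (by omega)
    have h6 : π T ≠ π (T + 1) := fun e => by have := π.injective e; omega
    rw [capFun_partner_right hT h3, if_neg h5.2.2]
    exact ⟨h5.1, h5.2.1, h6⟩

theorem capFun_closed_pair (h : Translate N t T) : ClosedUnder (π.capFun t) (T - 1) (T + 1) := by
  intro i h1 h2
  rcases (show i = T ∨ i = T + 1 by omega) with rfl | rfl
  · rw [capFun_left h]; omega
  · rw [capFun_right h]; omega

/-- The possible relative positions of the partners of `T` and `T + 1`. -/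
theorem partner_order (π : AnnularPairing N) (T : ℤ) (h0 : π T ≠ T + 1) :
    (π T < T → π (T + 1) ≠ T + 1 → π (T + 1) < π T ∨ T + 1 < π (T + 1)) ∧
    (T < π T → T + 1 < π (T + 1) ∧ π (T + 1) < π T) ∧
    (π (T + 1) < T + 1 → π (T + 1) < π T ∧ π T < T) := by
  have hx := π.invol T
  have hy := π.invol (T + 1)
  have hne : π T ≠ π (T + 1) := fun e => by have := π.injective e; omega
  have h01 : π (T + 1) ≠ T := fun e => by rw [e] at hy; omega
  refine ⟨fun h1 h2 => ?_, fun h1 => ?_, fun h1 => ?_⟩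
  · rcases lt_or_ge (π (T + 1)) (T + 1) with h3 | h3
    · left
      by_contra h4
      have := π.nc' (i := π T) (j := π (T + 1)) (by omega) (by rw [hx]; omega)
      rw [hx, hy] at this
      omega
    · right; omega
  · have h3 := π.nc' (i := T) (j := T + 1) (by omega) (by omega)
    omega
  · have h3 := π.nc' (i := π (T + 1)) (j := T) (by omega) (by rw [hy]; omega)
    rw [hy] at h3
    omega

/-- Only the arc created between the partners of `T` and `T + 1` needs an argument. If the two old
arcs point away from each other, the new arc covers both interiors and the cap, three consecutive
closed intervals. If they are nested, it covers the interior of the outer arc minus a closed block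
at one end, made of the inner arc and one end of the cap. -/
theorem capFun_nc (i : ℤ) (h0 : i < π.capFun t i) :
    ClosedUnder (π.capFun t) i (π.capFun t i - 1) := by
  have hN := π.two_le
  have arc : ∀ {i : ℤ}, Off N t i → Off N t (π i) → i < π i →
      ClosedUnder (π.capFun t) i (π i - 1) := fun h h' h1 =>
    ClosedUnder.cap (π.nc _ h1) h.1 h'.2
  rcases cap_cases π t i with ⟨T, hT, rfl | rfl⟩ | ⟨h, h'⟩ | ⟨T, hT, h, rfl⟩ | ⟨T, hT, h, rfl⟩
  · rw [capFun_left hT]; exact ClosedUnder.of_le (by omega)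
  · rw [capFun_right hT]; exact ClosedUnder.of_le (by omega)
  · rw [capFun_off h h'] at h0 ⊢
    exact arc h h' h0
  · rw [capFun_partner_left hT h] at h0 ⊢
    split_ifs at h0 ⊢ with h1
    · omega
    have hoff := off_right hT h h1
    have hx := π.invol T
    have hy := π.invol (T + 1)
    have ho := h.ne hT
    have ho' := hoff.ne hT
    obtain ⟨p1, p2, p3⟩ := partner_order π T ho.2
    have hlt : π T < T ∧ T + 1 < π (T + 1) := by omega
    have c1 := π.nc (π T) (by rw [hx]; omega)
    have c2 := π.nc (T + 1) hlt.2
    rw [hx] at c1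
    have d1 := ClosedUnder.cap (t := t) c1 h.1 (fun h' => h'.not_succ hN (by simpa using hT))
    have d2 := ClosedUnder.cap (t := t) c2 (hT.not_succ hN) hoff.2
    exact (d1.trans (by omega) (by omega) (capFun_closed_pair hT)).trans (by omega) (by omega) d2
  · rw [capFun_partner_right hT h] at h0 ⊢
    split_ifs at h0 ⊢ with h1
    · omega
    have hoff := off_left hT h h1
    have hx := π.invol T
    have hy := π.invol (T + 1)
    have ho := h.ne hT
    have ho' := hoff.ne hT
    obtain ⟨p1, p2, p3⟩ := partner_order π T ho'.2
    rcases lt_or_gt_of_ne h1 with h2 | h2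
    · have hlt : π (T + 1) < π T ∧ π T < T := by omega
      have c1 := π.nc (π (T + 1)) (by rw [hy]; omega)
      have c2 := π.nc (π T) (by rw [hx]; omega)
      rw [hy] at c1
      rw [hx] at c2
      have c3 : ClosedUnder π (π T - 1) T := by
        intro i h3 h4
        rcases eq_or_ne i T with rfl | h5
        · omega
        rcases eq_or_ne i (π T) with rfl | h6
        · rw [hx]; omega
        have := c2 i (by omega) (by omega)
        omega
      have c4 := ClosedUnder.diff_right π.invol (by omega) (by simpa using c1) c3
      exact ClosedUnder.cap c4 h.1 hoff.2
    · have hlt := p2 h2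
      have c1 := π.nc T h2
      have c2 := π.nc (T + 1) hlt.1
      have c3 : ClosedUnder π T (π (T + 1)) := by
        intro i h3 h4
        rcases eq_or_ne i (T + 1) with rfl | h5
        · omega
        rcases eq_or_ne i (π (T + 1)) with rfl | h6
        · rw [hy]; omega
        have := c2 i (by omega) (by omega)
        omega
      have c4 := ClosedUnder.diff_left π.invol (by omega) c1 c3
      exact ClosedUnder.cap c4 h.1 hoff.2

/-- The action of a cap and a cup at `t` on pairings. -/
def cap (π : AnnularPairing N) (t : ℤ) : AnnularPairing N where
  toFun := π.capFun t
  two_le := π.two_le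
  invol := capFun_invol
  shift := capFun_shift
  nc := capFun_nc

end AnnularPairing

end BKW

end

noncomputable section

namespace BKW

namespace AnnularPairing

variable {N : ℕ} {π : AnnularPairing N} {t T a b c : ℤ}

@[simp] theorem cap_apply (π : AnnularPairing N) (t i : ℤ) : π.cap t i = π.capFun t i := rfl

/-! ### Regions cut out by the pairs -/

/-- The faces `a` and `b` (the face `a` lies between the points `a` and `a + 1`) belong to the same
region of the half plane cut along the arcs of the pairing and along half-lines at the defects. -/
def SameRegion (π : AnnularPairing N) (a b : ℤ) : Prop :=
  ClosedUnder π a b ∧ ClosedUnder π b a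

/-- `a` and a translate of `b` belong to the same region. -/
def Connected (π : AnnularPairing N) (a b : ℤ) : Prop := ∃ k : ℤ, π.SameRegion a (b + k * N)

/-- No arc of the pairing surrounds the face `a`. -/
def Exposed (π : AnnularPairing N) (a : ℤ) : Prop := ∀ i, i ≤ a → ¬ a < π i

/-- The pairing has an unpaired point. -/
def HasDefect (π : AnnularPairing N) : Prop := ∃ d, π d = d

theorem SameRegion.of_closed (hab : a ≤ b) (h : ClosedUnder π a b) : π.SameRegion a b :=
  ⟨h, ClosedUnder.of_le hab⟩

theorem SameRegion.symm (h : π.SameRegion a b) : π.SameRegion b a := ⟨h.2, h.1⟩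

theorem SameRegion.refl (π : AnnularPairing N) (a : ℤ) : π.SameRegion a a :=
  SameRegion.of_closed le_rfl (ClosedUnder.of_le le_rfl)

theorem SameRegion.trans (h : π.SameRegion a b) (h' : π.SameRegion b c) : π.SameRegion a c := by
  rcases le_total a b with h1 | h1 <;> rcases le_total b c with h2 | h2 <;>
    rcases le_total a c with h3 | h3
  · exact of_closed h3 (h.1.trans h1 h2 h'.1)
  · exact (of_closed h3 (ClosedUnder.of_le (by omega))).symm
  · exact of_closed h3 (ClosedUnder.diff_right π.invol h2 h.1 h'.2)
  · exact (of_closed h3 (ClosedUnder.diff_right π.invol h1 h'.2 h.1)).symm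
  · exact of_closed h3 (ClosedUnder.diff_left π.invol h1 h'.1 h.2)
  · exact (of_closed h3 (ClosedUnder.diff_left π.invol h2 h.2 h'.1)).symm
  · exact of_closed h3 (ClosedUnder.of_le (by omega))
  · exact (of_closed h3 (h'.2.trans h2 h1 h.2)).symm

theorem ClosedUnder.shift (h : ClosedUnder π a b) (k : ℤ) :
    ClosedUnder π (a + k * N) (b + k * N) := by
  intro i h1 h2
  have h3 := h (i - k * N) (by linarith) (by linarith)
  have h4 := π.shift_mul (i - k * N) k
  rw [sub_add_cancel] at h4
  omega

theorem SameRegion.shift (h : π.SameRegion a b) (k : ℤ) :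
    π.SameRegion (a + k * N) (b + k * N) := ⟨ClosedUnder.shift h.1 k, ClosedUnder.shift h.2 k⟩

theorem SameRegion.connected (h : π.SameRegion a b) : π.Connected a b := ⟨0, by simpa using h⟩

theorem Connected.refl (π : AnnularPairing N) (a : ℤ) : π.Connected a a :=
  (SameRegion.refl π a).connected

theorem Connected.symm (h : π.Connected a b) : π.Connected b a := by
  obtain ⟨k, h⟩ := h
  refine ⟨-k, ?_⟩
  have := h.symm.shift (-k)
  rwa [show b + k * N + -k * N = b by ring] at this

theorem Connected.trans (h : π.Connected a b) (h' : π.Connected b c) : π.Connected a c := by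
  obtain ⟨k, h⟩ := h
  obtain ⟨l, h'⟩ := h'
  refine ⟨l + k, h.trans ?_⟩
  have := h'.shift k
  rwa [show c + l * N + k * N = c + (l + k) * N by ring] at this

theorem Connected.of_translate (h : Translate N a b) : π.Connected a b := by
  obtain ⟨k, rfl⟩ := h
  exact ⟨-k, by rw [show a + k * N + -k * N = a by ring]; exact SameRegion.refl π a⟩

theorem SameRegion.even (h : π.SameRegion a b) : Even (b - a) := by
  rcases le_total a b with h1 | h1
  · exact h.1.even π.invol h1
  · have := h.2.even π.invol h1
    rw [← neg_sub]; exact this.neg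

theorem Connected.even (hN : Even N) (h : π.Connected a b) : Even (b - a) := by
  obtain ⟨k, h⟩ := h
  have h1 := h.even
  have h2 : Even (k * N) := (Int.even_coe_nat N |>.mpr hN).mul_left k
  have := h1.sub h2
  rwa [show b + k * N - a - k * N = b - a by ring] at this

theorem exists_translate_Ioc (hN : 0 < N) (d a : ℤ) : ∃ k : ℤ, a < d + k * N ∧ d + k * N ≤ a + N := by
  have h : (0 : ℤ) < N := by exact_mod_cast hN
  refine ⟨(a - d) / N + 1, ?_, ?_⟩
  · have := Int.lt_ediv_add_one_mul_self (a - d) h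
    linarith
  · have := Int.ediv_mul_le (a - d) h.ne'
    linarith

theorem defect_shift {d : ℤ} (h : π d = d) (k : ℤ) : π (d + k * N) = d + k * N := by
  rw [π.shift_mul, h]

/-- Every window of `N` consecutive points contains a translate of the defect, and closed intervals
contain no defect. -/
theorem HasDefect.length_lt (hd : π.HasDefect) (h : ClosedUnder π a b) : b < a + N := by
  obtain ⟨d, hd⟩ := hd
  obtain ⟨k, h1, h2⟩ := exists_translate_Ioc (N := N) (by have := π.two_le; omega) d a
  by_contra h3
  exact (h _ h1 (by omega)).2.2 (defect_shift hd k)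

/-- A cap can move or destroy defects but never produces a first one: a newly unpaired point was the
partner of a point joined to a defect. -/
theorem HasDefect.of_cap (hd : (π.cap t).HasDefect) : π.HasDefect := by
  obtain ⟨d, hd⟩ := hd
  rw [cap_apply] at hd
  rcases cap_cases π t d with ⟨T, hT, rfl | rfl⟩ | ⟨h, h'⟩ | ⟨T, hT, h, rfl⟩ | ⟨T, hT, h, rfl⟩
  · rw [capFun_left hT] at hd; omega
  · rw [capFun_right hT] at hd; omega
  · rw [capFun_off h h'] at hd; exact ⟨d, hd⟩
  · rw [capFun_partner_left hT h] at hd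
    split_ifs at hd with h1
    · exact ⟨_, h1⟩
    · have := π.injective hd; omega
  · rw [capFun_partner_right hT h] at hd
    split_ifs at hd with h1
    · exact ⟨_, h1⟩
    · have := π.injective hd; omega

/-- If a defect remains after the cap, then `T` is not paired with a translate of `T + 1` around
the circle. -/
theorem not_wrap (hd : (π.cap t).HasDefect) (hT : Translate N t T) : π T ≠ T + 1 - N := by
  intro hw
  have hN := π.two_le
  have hi := π.invol T
  -- The arc from `T + 1 - N` to `T` covers all other points of a period, so a defect could only sit
  -- on the two points paired by the cap.
  have h1 := π.nc (π T) (by rw [hi]; omega)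
  rw [hi, hw] at h1
  obtain ⟨d, hd⟩ := hd
  obtain ⟨k, h2, h3⟩ := exists_translate_Ioc (N := N) (by omega) d (T - N)
  have hd' := defect_shift hd k
  generalize d + k * N = e at *
  rw [cap_apply] at hd'
  rw [sub_add_cancel] at h3
  rcases eq_or_ne e T with rfl | h4
  · rw [capFun_left hT] at hd'; omega
  have hT' := hT.add (-1)
  rcases eq_or_ne e (T - N + 1) with rfl | h5
  · rw [show T - N = T + (-1 : ℤ) * N by ring, capFun_right hT'] at hd'; omega
  have h6 := h1 e (by omega) (by omega)
  have off : ∀ f : ℤ, T - N + 1 < f → f < T → Off N t f := fun f g1 g2 =>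
    ⟨fun g => by have := g.sep hT; have := g.sep hT'; omega,
      fun g => by have := g.sep hT; have := g.sep hT'; omega⟩
  rw [capFun_off (off e (by omega) (by omega)) (off _ (by omega) (by omega))] at hd'
  exact h6.2.2 hd'

/-- The partner of `T` is less than a period away, so the only place on the cap besides `T` and `T +
1` is `T + 1 - N`, which `not_wrap` excludes. -/
theorem off_partner_left (hd : (π.cap t).HasDefect) (hT : Translate N t T) (h1 : π T ≠ T)
    (h2 : π T ≠ T + 1) : Off N t (π T) := by
  have hw := not_wrap hd hT
  have l1 := π.apply_lt_add T
  have l2 := π.sub_lt_apply T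
  rcases off_or (N := N) t (π T) with h | ⟨U, hU, h | h⟩
  · exact h
  · have := hU.sep hT; omega
  · obtain ⟨k, rfl⟩ := hT.symm.trans hU
    have e1 : k < 1 := by by_contra h'; nlinarith [Int.natCast_nonneg N]
    have e2 : -2 < k := by by_contra h'; nlinarith [Int.natCast_nonneg N, π.two_le]
    rcases (show k = 0 ∨ k = -1 by omega) with rfl | rfl
    · exact absurd h (by simpa using h2)
    · exact absurd h (by rw [show T + -1 * (N : ℤ) + 1 = T + 1 - N by ring]; exact hw)

theorem off_partner_right (hd : (π.cap t).HasDefect) (hT : Translate N t T)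
    (h1 : π (T + 1) ≠ T + 1) (h2 : π T ≠ T + 1) : Off N t (π (T + 1)) := by
  rcases eq_or_ne (π T) T with h | h
  · have l1 := π.apply_lt_add (T + 1)
    have l2 := π.sub_lt_apply (T + 1)
    have i1 := π.invol (T + 1)
    rcases off_or (N := N) t (π (T + 1)) with h' | ⟨U, hU, h' | h'⟩
    · exact h'
    · obtain ⟨k, rfl⟩ := hT.symm.trans hU
      rw [h', defect_shift h] at i1
      have := (hT.trans ⟨k, rfl⟩ : Translate N t (T + k * N))
      rw [i1] at this
      exact absurd this (hT.not_succ π.two_le)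
    · have := hU.sep hT; omega
  · exact off_right hT (off_partner_left hd hT h h2) h1

/-- A closed interval of the pairing after a cap is either closed before, or its ends are connected
before to the two sides of the cap. -/
theorem sameRegion_of_cap (hd : (π.cap t).HasDefect) (hab : a ≤ b) (ha : ¬ Translate N t a)
    (hb : ¬ Translate N t b) (h : ClosedUnder (π.cap t) a b) :
    ClosedUnder π a b ∨ ∃ T, Translate N t T ∧
      ((π.SameRegion a (T - 1) ∧ π.SameRegion (T + 1) b) ∨
       (π.SameRegion a (T + 1) ∧ π.SameRegion (T - 1) b)) := by
  have hN := π.two_le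
  have hlen := hd.length_lt h
  have h : ∀ i, a < i → i ≤ b → a < π.capFun t i ∧ π.capFun t i ≤ b ∧ π.capFun t i ≠ i := h
  have noswap : ∀ T k : ℤ, π T = T + 1 → Translate N t T → π (T + 1) = T := fun T k h1 _ => by
    rw [← h1, π.invol]
  -- Either a translate of the cap lies inside the interval, or the interval avoids all of them. The
  -- ends never separate a cap, so a cap meeting the interval lies entirely inside.
  by_cases hA : ∃ T, Translate N t T ∧ a < T ∧ T ≤ b
  · obtain ⟨T, hT, ha', hb'⟩ := hA
    have hbT : b ≠ T := fun e => hb (e ▸ hT)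
    have uniq : ∀ U, Translate N t U → (a < U ∧ U ≤ b ∨ a < U + 1 ∧ U + 1 ≤ b) → U = T := by
      intro U hU h1
      have h2 : U ≠ a := fun e => ha (e ▸ hU)
      have := hU.sep hT
      omega
    -- If the partner of `T` is inside the interval, the old arcs at the cap stay inside and the
    -- interval was already closed.
    by_cases hx : a < π T ∧ π T ≤ b ∧ π T ≠ T
    · left
      rcases eq_or_ne (π T) (T + 1) with h1 | h1
      · have h1' := noswap T 0 h1 hT
        intro i hi1 hi2
        rcases cap_cases π t i with ⟨U, hU, e⟩ | ⟨g, g'⟩ | ⟨U, hU, g, rfl⟩ | ⟨U, hU, g, rfl⟩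
        · obtain rfl := uniq U hU (by rcases e with rfl | rfl <;> omega)
          rcases e with rfl | rfl <;> omega
        · have := h i hi1 hi2
          rwa [capFun_off g g'] at this
        · exfalso
          obtain ⟨k, rfl⟩ := hT.symm.trans hU
          rw [π.shift_mul, h1] at g
          exact g.2 (by rw [show T + 1 + k * N - 1 = T + k * N by ring]; exact hU)
        · exfalso
          obtain ⟨k, rfl⟩ := hT.symm.trans hU
          rw [show T + k * N + 1 = T + 1 + k * N by ring, π.shift_mul, h1'] at g
          exact g.1 hU
      · have ox := off_partner_left hd hT hx.2.2 h1
        have h2 := h _ hx.1 hx.2.1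
        rw [capFun_partner_left hT ox] at h2
        split_ifs at h2 with h3
        · exact absurd rfl h2.2.2
        intro i hi1 hi2
        rcases cap_cases π t i with ⟨U, hU, e⟩ | ⟨g, g'⟩ | ⟨U, hU, g, rfl⟩ | ⟨U, hU, g, rfl⟩
        · obtain rfl := uniq U hU (by rcases e with rfl | rfl <;> omega)
          rcases e with rfl | rfl <;> omega
        · have := h i hi1 hi2
          rwa [capFun_off g g'] at this
        · have := (π.translate_apply (hT.symm.trans hU)).sep (Translate.refl N (π T))
          have : U = T := π.injective (by omega)
          subst this
          rw [π.invol]; omega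
        · have := (π.translate_apply ((hT.symm.trans hU).add_const 1)).sep
            (Translate.refl N (π (T + 1)))
          have : U + 1 = T + 1 := π.injective (by omega)
          rw [this, π.invol]
          rw [this] at hi1 hi2
          omega
    -- Otherwise both old arcs at the cap leave the interval or end in defects. The interval is then
    -- cut at the cap into two pieces, each closed before.
    · have hy : ¬ (a < π (T + 1) ∧ π (T + 1) ≤ b ∧ π (T + 1) ≠ T + 1) := by
        intro hy
        have h1 : π T ≠ T + 1 := fun e => hx (by omega)
        have oy := off_partner_right hd hT hy.2.2 h1
        have h2 := h _ hy.1 hy.2.1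
        rw [capFun_partner_right hT oy] at h2
        split_ifs at h2 with h3
        · exact h2.2.2 rfl
        · exact hx ⟨h2.1, h2.2.1, h3⟩
      -- Arcs arriving from another translate of the cap are excluded: in the period between `π T`
      -- and its translate `π U`, a surviving defect would lie in the closed interval or under the
      -- arc at `T`.
      have wind : ∀ U, Translate N t U → Off N t (π U) → π (U + 1) ≠ U + 1 →
          a < π U → π U ≤ b → False := by
        intro U hU ou hdU h1 h2
        obtain ⟨d, hdd⟩ := hd
        rw [cap_apply] at hdd
        have hdp : ∀ k : ℤ, π.capFun t (d + k * N) = d + k * N := fun k => defect_shift (π := π.cap t) hdd k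
        have hUT : U ≠ T := by
          rintro rfl
          exact hx ⟨h1, h2, fun e => by rw [e] at ou; exact ou.1 hU⟩
        have hdo : ∀ e : ℤ, π.capFun t e = e → π e = e := by
          intro e he
          rcases cap_cases π t e with ⟨V, hV, rfl | rfl⟩ | ⟨g, g'⟩ | ⟨V, hV, g, rfl⟩ | ⟨V, hV, g, rfl⟩
          · rw [capFun_left hV] at he; omega
          · rw [capFun_right hV] at he; omega
          · rwa [capFun_off g g'] at he
          · rw [capFun_partner_left hV g] at he
            split_ifs at he with h3
            · obtain ⟨k, rfl⟩ := hU.symm.trans hV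
              rw [show U + k * N + 1 = U + 1 + k * N by ring, π.shift_mul] at h3
              omega
            · have := π.injective he; omega
          · rw [capFun_partner_right hV g] at he
            split_ifs at he with h3
            · obtain ⟨k, rfl⟩ := hV.symm.trans hU
              rw [π.shift_mul, h3] at ou
              exact absurd hU ou.1
            · have := π.injective he; omega
        have hxU := (π.translate_apply (hU.symm.trans hT)).sep (Translate.refl N (π U))
        have hne : π U ≠ π T := fun e => hUT (π.injective e)
        have l1 := π.apply_lt_add T
        have l2 := π.sub_lt_apply T
        have l3 : π U ≠ T := fun e => by rw [e] at ou; exact ou.1 hT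
        have i1 := π.invol T
        have hxT : π T ≠ T := fun e => by
          obtain ⟨k, rfl⟩ := hT.symm.trans hU
          rw [π.shift_mul, e] at ou
          exact ou.1 hU
        rcases lt_or_gt_of_ne l3 with h3 | h3
        · obtain ⟨k, k1, k2⟩ := exists_translate_Ioc (N := N) (by omega) d (π U)
          have k3 := hdp k
          generalize d + k * N = e at *
          have k4 := hdo e k3
          rcases lt_trichotomy e T with h4 | rfl | h4
          · exact (h e (by omega) (by omega)).2.2 k3
          · exact hxT k4
          · rcases eq_or_ne e (π T) with rfl | h5
            · rw [i1] at k4; omega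
            · have := π.nc' h4 (by
                obtain ⟨m, hm⟩ := π.translate_apply (hU.symm.trans hT)
                have : m = 1 := by
                  have m1 : 0 < m := by
                    by_contra h'
                    have : m ≠ 0 := by rintro rfl; omega
                    nlinarith [show m ≤ -1 by omega]
                  have m2 : m < 2 := by by_contra h'; nlinarith
                  omega
                subst this; omega)
              omega
        · obtain ⟨m, hm⟩ := π.translate_apply (hU.symm.trans hT)
          have hm1 : m = -1 := by
            have m1 : m < 0 := by
              by_contra h'
              have : m ≠ 0 := by rintro rfl; omega
              nlinarith [show 1 ≤ m by omega]
            have m2 : -2 < m := by by_contra h'; nlinarith [show m ≤ -2 by omega]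
            omega
          subst hm1
          obtain ⟨k, k1, k2⟩ := exists_translate_Ioc (N := N) (by omega) d (π T)
          have k3 := hdp k
          generalize d + k * N = e at *
          have k4 := hdo e k3
          rcases lt_trichotomy e T with h4 | rfl | h4
          · have := π.nc' (i := π T) k1 (by omega)
            omega
          · exact hxT k4
          · exact (h e (by omega) (by omega)).2.2 k3
      have rest : ∀ i, a < i → i ≤ b → i ≠ T → i ≠ T + 1 →
          a < π i ∧ π i ≤ b ∧ π i ≠ i ∧ π i ≠ T ∧ π i ≠ T + 1 := by
        intro i h1 h2 h3 h4
        rcases cap_cases π t i with ⟨U, hU, e⟩ | ⟨g, g'⟩ | ⟨U, hU, g, rfl⟩ | ⟨U, hU, g, rfl⟩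
        · obtain rfl := uniq U hU (by rcases e with rfl | rfl <;> omega)
          omega
        · have := h i h1 h2
          rw [capFun_off g g'] at this
          have := g'.ne hT
          omega
        · have h5 := h _ h1 h2
          rw [capFun_partner_left hU g] at h5
          split_ifs at h5 with h6
          · exact absurd rfl h5.2.2
          exact (wind U hU g h6 h1 h2).elim
        · have h5 := h _ h1 h2
          rw [capFun_partner_right hU g] at h5
          split_ifs at h5 with h6
          · exact absurd rfl h5.2.2
          refine (wind U hU (off_left hU g h6) ?_ h5.1 h5.2.1).elim
          intro e; rw [e] at g; exact g.2 (by simpa using hU)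
      right
      refine ⟨T, hT, Or.inl ⟨SameRegion.of_closed (by omega) ?_, SameRegion.of_closed (by omega) ?_⟩⟩
      · intro i h1 h2
        have h3 := rest i h1 (by omega) (by omega) (by omega)
        refine ⟨h3.1, ?_, h3.2.2.1⟩
        by_contra h4
        have := π.nc' (i := i) (j := T) (by omega) (by omega)
        exact hx (by omega)
      · intro i h1 h2
        have h3 := rest i (by omega) h2 (by omega) (by omega)
        refine ⟨?_, h3.2.1, h3.2.2.1⟩
        by_contra h4
        have := π.nc' (i := π i) (j := T) (by omega) (by rw [π.invol]; omega)
        rw [π.invol] at this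
        exact hx (by omega)
  -- The cap is outside. The interval fails to be closed before only if it contains the partners of
  -- both `T` and `T + 1`, which the cap has joined to each other.
  · push Not at hA
    have off : ∀ i, a < i → i ≤ b → Off N t i := fun i h1 h2 =>
      ⟨fun h3 => by have := hA i h3 h1; omega, fun h3 => by
        have h4 : i - 1 ≠ a := fun e => ha (e ▸ h3)
        have := hA (i - 1) h3 (by omega); omega⟩
    by_cases hB : ∀ i, a < i → i ≤ b → Off N t (π i)
    · left
      intro i h1 h2
      have := h i h1 h2
      rwa [capFun_off (off i h1 h2) (hB i h1 h2)] at this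
    right
    obtain ⟨T, hT, hx1, hx2, hy1, hy2⟩ : ∃ T, Translate N t T ∧ a < π T ∧ π T ≤ b ∧
        a < π (T + 1) ∧ π (T + 1) ≤ b := by
      push Not at hB
      obtain ⟨i, h1, h2, h3⟩ := hB
      rcases cap_cases π t i with ⟨U, hU, e⟩ | ⟨g, g'⟩ | ⟨U, hU, g, rfl⟩ | ⟨U, hU, g, rfl⟩
      · have := (off i h1 h2).ne hU; omega
      · exact absurd g' h3
      · have h5 := h _ h1 h2
        rw [capFun_partner_left hU g] at h5
        split_ifs at h5 with h6
        · exact absurd rfl h5.2.2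
        exact ⟨U, hU, h1, h2, h5.1, h5.2.1⟩
      · have h5 := h _ h1 h2
        rw [capFun_partner_right hU g] at h5
        split_ifs at h5 with h6
        · exact absurd rfl h5.2.2
        exact ⟨U, hU, h5.1, h5.2.1, h1, h2⟩
    have ox := off _ hx1 hx2
    have oy := off _ hy1 hy2
    have hTI : ¬ (a < T ∧ T ≤ b) := fun g => (off _ g.1 g.2).1 hT
    have hTa : T ≠ a := fun e => ha (e ▸ hT)
    have i1 := π.invol T
    have i2 := π.invol (T + 1)
    have hneT := ox.ne hT
    have hneT' := oy.ne hT
    have rest : ∀ i, a < i → i ≤ b → i ≠ π T → i ≠ π (T + 1) →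
        a < π i ∧ π i ≤ b ∧ π i ≠ i := by
      intro i h1 h2 h3 h4
      rcases cap_cases π t i with ⟨U, hU, e⟩ | ⟨g, g'⟩ | ⟨U, hU, g, rfl⟩ | ⟨U, hU, g, rfl⟩
      · have := (off i h1 h2).ne hU; omega
      · have := h i h1 h2
        rwa [capFun_off g g'] at this
      · have := (π.translate_apply (hT.symm.trans hU)).sep (Translate.refl N (π T))
        omega
      · have := (π.translate_apply ((hT.symm.trans hU).add_const 1)).sep
          (Translate.refl N (π (T + 1)))
        omega
    obtain ⟨p1, p2, p3⟩ := partner_order π T hneT.2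
    -- The two arcs are nested and enter from the same side. The end of the interval nearer to the
    -- cap shares the region under the inner arc with the near side of the cap, and the other end
    -- shares the region beyond the outer arc with its far side.
    rcases (show T + 1 ≤ a ∨ b ≤ T - 1 by omega) with hs | hs
    · have hlt := p2 (by omega)
      have hK : ClosedUnder π (T + 1) a := by
        intro i g1 g2
        have g3 := π.nc' (i := T + 1) (j := i) (by omega) (by omega)
        refine ⟨g3.1, ?_, g3.2.2⟩
        by_contra g4
        have g5 := rest (π i) (by omega) (by omega) (by omega) (by omega)
        rw [π.invol] at g5
        omega
      refine ⟨T, hT, Or.inr ⟨(SameRegion.of_closed hs hK).symm, SameRegion.of_closed (by omega) ?_⟩⟩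
      intro i g1 g2
      rcases eq_or_ne i T with rfl | e1
      · omega
      rcases eq_or_ne i (T + 1) with rfl | e2
      · omega
      rcases le_or_gt i a with e3 | e3
      · have := hK i (by omega) e3; omega
      rcases eq_or_ne i (π T) with rfl | e4
      · omega
      rcases eq_or_ne i (π (T + 1)) with rfl | e5
      · omega
      have := rest i e3 g2 e4 e5
      omega
    · have hlt := p3 (by omega)
      have hK : ClosedUnder π b (T - 1) := by
        intro i g1 g2
        have g3 := π.nc' (i := π T) (j := i) (by omega) (by omega)
        rw [i1] at g3
        refine ⟨?_, by omega, g3.2.2⟩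
        by_contra g4
        have g5 := rest (π i) (by omega) (by omega) (by omega) (by omega)
        rw [π.invol] at g5
        omega
      refine ⟨T, hT, Or.inr ⟨SameRegion.of_closed (by omega) ?_, (SameRegion.of_closed hs hK).symm⟩⟩
      intro i g1 g2
      rcases eq_or_ne i T with rfl | e1
      · omega
      rcases eq_or_ne i (T + 1) with rfl | e2
      · omega
      rcases lt_or_ge b i with e3 | e3
      · have := hK i e3 (by omega); omega
      rcases eq_or_ne i (π T) with rfl | e4
      · omega
      rcases eq_or_ne i (π (T + 1)) with rfl | e5
      · omega
      have := rest i g1 e3 e4 e5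
      omega

end AnnularPairing

end BKW

end

noncomputable section

namespace BKW

namespace AnnularPairing

variable {N : ℕ} {π : AnnularPairing N} {t T a b c : ℤ}

/-! ### How a cap changes the regions -/

theorem not_translate_add (ha : ¬ Translate N t a) (k : ℤ) : ¬ Translate N t (a + k * N) :=
  fun h => ha (h.trans ⟨-k, by ring⟩)

theorem Connected.cap (h : π.Connected a b) (ha : ¬ Translate N t a) (hb : ¬ Translate N t b) :
    (π.cap t).Connected a b := by
  obtain ⟨k, h⟩ := h
  exact ⟨k, ClosedUnder.cap h.1 ha (not_translate_add hb k),
    ClosedUnder.cap h.2 (not_translate_add hb k) ha⟩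

theorem cap_connected_sides (π : AnnularPairing N) (t : ℤ) :
    (π.cap t).Connected (t - 1) (t + 1) :=
  (SameRegion.of_closed (by omega) (capFun_closed_pair (Translate.refl N t))).connected

/-- With `Connected.cap` and `cap_connected_sides` this describes the effect of a cap completely
away from its middle face: the regions of its two sides are merged and nothing else changes. The
remaining defect rules out connections that wind around the annulus. -/
theorem connected_of_cap (hd : (π.cap t).HasDefect) (h : (π.cap t).Connected a b)
    (ha : ¬ Translate N t a) (hb : ¬ Translate N t b) :
    π.Connected a b ∨ (π.Connected a (t - 1) ∧ π.Connected (t + 1) b) ∨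
      (π.Connected a (t + 1) ∧ π.Connected (t - 1) b) := by
  obtain ⟨k, h⟩ := h
  have hb' := not_translate_add hb k
  have side : ∀ {T : ℤ} (e : ℤ), Translate N t T → π.Connected (T + e) (t + e) := fun e hT =>
    (Connected.of_translate (hT.add_const e)).symm
  have hbb : π.Connected (b + k * N) b := (Connected.of_translate ⟨k, rfl⟩).symm
  rcases le_total a (b + k * N) with h1 | h1
  · rcases sameRegion_of_cap hd h1 ha hb' h.1 with h2 | ⟨T, hT, ⟨h2, h3⟩ | ⟨h2, h3⟩⟩
    · exact Or.inl ⟨k, SameRegion.of_closed h1 h2⟩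
    · exact Or.inr (Or.inl ⟨h2.connected.trans (side (-1) hT),
        (side 1 hT).symm.trans (h3.connected.trans hbb)⟩)
    · exact Or.inr (Or.inr ⟨h2.connected.trans (side 1 hT),
        (side (-1) hT).symm.trans (h3.connected.trans hbb)⟩)
  · rcases sameRegion_of_cap hd h1 hb' ha h.2 with h2 | ⟨T, hT, ⟨h2, h3⟩ | ⟨h2, h3⟩⟩
    · exact Or.inl ⟨k, (SameRegion.of_closed h1 h2).symm⟩
    · exact Or.inr (Or.inr ⟨h3.symm.connected.trans (side 1 hT),
        (side (-1) hT).symm.trans (h2.symm.connected.trans hbb)⟩)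
    · exact Or.inr (Or.inl ⟨h3.symm.connected.trans (side (-1) hT),
        (side 1 hT).symm.trans (h2.symm.connected.trans hbb)⟩)

/-- The new pair encloses its middle face, so an interval from that face to any other face contains
exactly one end of the pair. -/
theorem translate_of_cap_connected (h : (π.cap t).Connected a t) : Translate N t a := by
  obtain ⟨k, h1, h2⟩ := h
  have hT : Translate N t (t + k * N) := ⟨k, rfl⟩
  generalize t + k * N = T at *
  rcases lt_trichotomy a T with h3 | rfl | h3
  · have := h1 T h3 le_rfl
    rw [cap_apply, capFun_left hT] at this
    omega
  · exact hT
  · have := h2 (T + 1) (by omega) (by omega)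
    rw [cap_apply, capFun_right hT] at this
    omega

theorem Exposed.of_sameRegion (ha : π.Exposed a) (h : π.SameRegion a b) : π.Exposed b := by
  intro i h1 h2
  have h0 := ha i
  rcases le_total a b with h3 | h3
  · rcases le_or_gt i a with h4 | h4
    · exact h0 h4 (by omega)
    · have := h.1 i h4 h1; omega
  · rcases lt_or_ge a (π i) with h4 | h4
    · exact h0 (by omega) h4
    · have := h.2 (π i) h2 h4
      rw [π.invol] at this; omega

theorem Exposed.shift (ha : π.Exposed a) (k : ℤ) : π.Exposed (a + k * N) := by
  intro i h1 h2
  have := π.shift_mul (i - k * N) k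
  rw [sub_add_cancel] at this
  exact ha (i - k * N) (by omega) (by omega)

theorem Exposed.of_connected (ha : π.Exposed a) (h : π.Connected a b) : π.Exposed b := by
  obtain ⟨k, h⟩ := h
  have := (ha.of_sameRegion h).shift (-k)
  rwa [show b + k * N + -k * N = b by ring] at this

theorem Exposed.cap (ha : π.Exposed a) (h : ¬ Translate N t a) : (π.cap t).Exposed a := by
  intro i h1 h2
  rw [cap_apply] at h2
  rcases cap_cases π t i with ⟨T, hT, rfl | rfl⟩ | ⟨g, g'⟩ | ⟨T, hT, g, rfl⟩ | ⟨T, hT, g, rfl⟩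
  · rw [capFun_left hT] at h2
    exact h (by rwa [show a = i by omega])
  · rw [capFun_right hT] at h2; omega
  · rw [capFun_off g g'] at h2; exact ha i h1 h2
  all_goals
    have hne : a ≠ T := fun e => h (e ▸ hT)
    have g' := g.ne hT
    have i1 := π.invol T
    have i2 := π.invol (T + 1)
    have q0 := ha T
    have q1 := ha (T + 1)
    have q2 := ha (π T)
    have q3 := ha (π (T + 1))
    rw [i1] at q2
    rw [i2] at q3
  · rw [capFun_partner_left hT g] at h2
    split_ifs at h2 with h3
    · omega
    obtain ⟨p1, p2, p3⟩ := partner_order π T g'.2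
    omega
  · rw [capFun_partner_right hT g] at h2
    split_ifs at h2 with h3
    · omega
    obtain ⟨p1, p2, p3⟩ := partner_order π T (fun e => by rw [e] at i1; omega)
    omega

theorem not_exposed_cap (π : AnnularPairing N) (t : ℤ) : ¬ (π.cap t).Exposed t := fun h =>
  h t le_rfl (by rw [cap_apply, capFun_left (Translate.refl N t)]; omega)

/-- A face that the cap uncovers was covered by an arc ending at the cap. It lay in the region on
one side of the cap, and the region on the other side was already exposed. -/
theorem exposed_of_cap (hd : (π.cap t).HasDefect) (h : (π.cap t).Exposed a)
    (ha : ¬ Translate N t a) :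
    π.Exposed a ∨ (π.Connected a (t - 1) ∧ π.Exposed (t + 1)) ∨
      (π.Connected a (t + 1) ∧ π.Exposed (t - 1)) := by
  have hN := π.two_le
  have hO : ∀ i, i ≤ a → ¬ a < π.capFun t i := h
  have side : ∀ {T : ℤ} (e : ℤ), Translate N t T → π.Connected (T + e) (t + e) := fun e hT =>
    (Connected.of_translate (hT.add_const e)).symm
  have clsR : ∀ T, Translate N t T → T + 1 ≤ a → a < π (T + 1) →
      ClosedUnder π (T + 1) a := by
    intro T hT h1 h2 i h3 h4
    have h5 := π.nc' (i := T + 1) (j := i) (by omega) (by omega)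
    refine ⟨h5.1, ?_, h5.2.2⟩
    by_contra h6
    have l := π.apply_lt_add (T + 1)
    have off : ∀ j, T + 1 < j → j < π (T + 1) → Off N t j := fun j g1 g2 =>
      ⟨fun g => by have := g.sep hT; omega, fun g => by have := g.sep hT; omega⟩
    have := hO i h4
    rw [capFun_off (off i h3 (by omega)) (off _ h5.1 h5.2.1)] at this
    omega
  have clsL : ∀ T, Translate N t T → a < T → π T ≤ a → ClosedUnder π a (T - 1) := by
    intro T hT h1 h2 i h3 h4
    have h5 := π.nc' (i := π T) (j := i) (by omega) (by rw [π.invol]; omega)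
    rw [π.invol] at h5
    refine ⟨?_, by omega, h5.2.2⟩
    by_contra h6
    have l := π.sub_lt_apply T
    have off : ∀ j, π T < j → j < T → Off N t j := fun j g1 g2 =>
      ⟨fun g => by have := g.sep hT; omega, fun g => by have := g.sep hT; omega⟩
    have := hO (π i) (by omega)
    rw [capFun_off (off _ h5.1 h5.2.1) (by rw [π.invol]; exact off i (by omega) (by omega)),
      π.invol] at this
    omega
  have R : ∀ T, Translate N t T → T + 1 ≤ a → a < π (T + 1) → π.Exposed (T - 1) →
      π.Connected a (t + 1) ∧ π.Exposed (t - 1) := fun T hT h1 h2 h3 =>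
    ⟨(SameRegion.of_closed h1 (clsR T hT h1 h2)).symm.connected.trans (side 1 hT),
      h3.of_connected (side (-1) hT)⟩
  have L : ∀ T, Translate N t T → a < T → π T ≤ a → π.Exposed (T + 1) →
      π.Connected a (t - 1) ∧ π.Exposed (t + 1) := fun T hT h1 h2 h3 =>
    ⟨(SameRegion.of_closed (by omega) (clsL T hT h1 h2)).connected.trans (side (-1) hT),
      h3.of_connected (side 1 hT)⟩
  -- Here the arc going right from `T` covers `a`. The inner arc from `T + 1` must cover `a` as
  -- well, since otherwise the new arc between the two far ends would cover it. So `a` is in the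
  -- region of `T + 1`.
  have C1 : ∀ T, Translate N t T → T ≤ a → a < π T →
      π.Connected a (t + 1) ∧ π.Exposed (t - 1) := by
    intro T hT h1 h2
    have hne : a ≠ T := fun e => ha (e ▸ hT)
    obtain ⟨p1, p2, p3⟩ := partner_order π T (by omega)
    have hlt := p2 (by omega)
    have oy := off_partner_right hd hT (by omega) (by omega)
    have h3 := hO (π (T + 1))
    rw [capFun_partner_right hT oy, if_neg (by omega)] at h3
    refine R T hT (by omega) (by omega) ?_
    intro p g1 g2
    have l1 := π.apply_lt_add p
    rcases cap_cases π t p with ⟨U, hU, rfl | rfl⟩ | ⟨g, g'⟩ | ⟨U, hU, g, rfl⟩ | ⟨U, hU, g, rfl⟩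
    · have := hU.sep hT; omega
    · have := hU.sep hT
      have h4 : π (U + 1) = T := by omega
      rw [← h4, π.invol] at h2; omega
    · have h4 := hO p (by omega)
      rw [capFun_off g g'] at h4
      have h5 := g'.ne hT
      have := π.nc' (i := p) (j := T) (by omega) (by omega)
      omega
    · have := π.sub_lt_apply U
      have h4 := hU.sep hT
      rw [π.invol] at g2
      rcases h4 with rfl | h4 | h4 <;> omega
    · have := π.sub_lt_apply (U + 1)
      have h4 := hU.sep hT
      rw [π.invol] at g2
      rcases h4 with rfl | h4 | h4 <;> omega
  -- The mirror situation: the arc arriving at `T` from the left covers `a`, so `a` is in the region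
  -- of `T - 1`.
  have C3 : ∀ T, Translate N t T → π T ≤ a → a < T →
      π.Connected a (t - 1) ∧ π.Exposed (t + 1) := by
    intro T hT h1 h2
    have ox := off_partner_left hd hT (by omega) (by omega)
    refine L T hT h2 h1 ?_
    intro p g1 g2
    rcases eq_or_ne (π (T + 1)) (T + 1) with h3 | h3
    · have : p ≠ T := by rintro rfl; omega
      have : p ≠ T + 1 := by rintro rfl; omega
      have := π.nc' (i := p) (j := T + 1) (by omega) (by omega)
      omega
    obtain ⟨p1, p2, p3⟩ := partner_order π T (by omega)
    have h4 := hO (π T) h1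
    rw [capFun_partner_left hT ox, if_neg h3] at h4
    have hlt : π (T + 1) < π T := by omega
    have l1 := π.apply_lt_add p
    rcases cap_cases π t p with ⟨U, hU, rfl | rfl⟩ | ⟨g, g'⟩ | ⟨U, hU, g, rfl⟩ | ⟨U, hU, g, rfl⟩
    · have h5 := hU.sep hT
      rcases h5 with rfl | h5 | h5 <;> omega
    · have h5 := hU.sep hT
      rcases h5 with rfl | h5 | h5 <;> omega
    · have h6 := g.ne hT
      have := π.nc' (i := p) (j := T + 1) (by omega) (by omega)
      have h7 := hO p (by omega)
      rw [capFun_off g g'] at h7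
      omega
    · have := π.sub_lt_apply U
      have h4 := hU.sep hT
      have h5 := g.ne hT
      rw [π.invol] at g2
      rcases h4 with rfl | h4 | h4 <;> omega
    · have := π.sub_lt_apply (U + 1)
      have h4 := hU.sep hT
      rw [π.invol] at g2
      rcases h4 with rfl | h4 | h4 <;> omega
  by_cases hE : π.Exposed a
  · exact Or.inl hE
  right
  unfold Exposed at hE
  push Not at hE
  obtain ⟨i, h1, h2⟩ := hE
  rcases cap_cases π t i with ⟨T, hT, rfl | rfl⟩ | ⟨g, g'⟩ | ⟨T, hT, g, rfl⟩ | ⟨T, hT, g, rfl⟩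
  · exact Or.inr (C1 _ hT h1 h2)
  · right
    have hT1 : π T ≠ T + 1 := fun e => by rw [← e, π.invol] at h2; omega
    rcases lt_trichotomy (π T) T with h3 | h3 | h3
    · have ox := off_partner_left hd hT (by omega) (by omega)
      have h4 := hO (π T) (by omega)
      rw [capFun_partner_left hT ox, if_neg (by omega)] at h4
      omega
    · refine R T hT h1 h2 ?_
      intro p g1 g2
      have h4 : π p ≠ T := fun e => by rw [← e, π.invol] at h3; omega
      have := π.nc' (i := p) (j := T) (by omega) (by omega)
      omega
    · obtain ⟨p1, p2, p3⟩ := partner_order π T hT1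
      exact C1 T hT (by omega) (by omega)
  · have := hO i h1
    rw [capFun_off g g'] at this
    omega
  · rw [π.invol] at h2
    exact Or.inl (C3 T hT h1 h2)
  · rw [π.invol] at h2
    left
    have hne : a ≠ T := fun e => ha (e ▸ hT)
    have i2 := π.invol (T + 1)
    have hT1 : π T ≠ T + 1 := fun e => by rw [← e, π.invol] at h1; omega
    obtain ⟨p1, p2, p3⟩ := partner_order π T hT1
    have hlt := p3 (by omega)
    have h3 := hO (π (T + 1)) h1
    rw [capFun_partner_right hT g, if_neg (by omega)] at h3
    exact C3 T hT (by omega) (by omega)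

end AnnularPairing

end BKW

end

noncomputable section

namespace BKW

/-! ### The percolation process on a helix -/

/-- The pairing of `N` points without pairs. -/
def emptyPairing (N : ℕ) (hN : 2 ≤ N) : AnnularPairing N where
  toFun := id
  two_le := hN
  invol := fun _ => rfl
  shift := fun _ => rfl
  nc := fun i hi => absurd hi (lt_irrefl i)

/-- The pairing obtained from the empty one by applying, for `s = 0, 1, …, t - 1`, a cap at `s`
whenever `ε s` is true. -/
def pairingAt (N : ℕ) (hN : 2 ≤ N) (ε : ℕ → Bool) : ℕ → AnnularPairing N
  | 0 => emptyPairing N hN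
  | t + 1 => if ε t = true then (pairingAt N hN ε t).cap t else pairingAt N hN ε t

/-- The edges of the helical graph created in the steps before time `t`. Its black vertices are
the odd numbers. -/
def HelixEdge (N : ℕ) (ε : ℕ → Bool) (t a b : ℕ) : Prop :=
  ∃ s < t, (Odd s ∧ ε s = false ∧ a = s ∧ b = s + N) ∨
    (Even s ∧ ε s = true ∧ a = s + N - 1 ∧ b = s + 1)

/-- Connection in the helical graph at time `t`. -/
def HelixRel (N : ℕ) (ε : ℕ → Bool) (t : ℕ) : ℕ → ℕ → Prop := Relation.EqvGen (HelixEdge N ε t)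

/-- A path never needs the additional edge more than once, in one of its two directions. -/
theorem eqvGen_insert {α : Type*} {r r' : α → α → Prop} {u v : α}
    (h : ∀ a b, r' a b ↔ r a b ∨ (a = u ∧ b = v)) (a b : α) :
    Relation.EqvGen r' a b ↔ Relation.EqvGen r a b ∨
      (Relation.EqvGen r a u ∧ Relation.EqvGen r v b) ∨
      (Relation.EqvGen r a v ∧ Relation.EqvGen r u b) := by
  have hs : ∀ {x y}, Relation.EqvGen r x y → Relation.EqvGen r y x := fun h => h.symm
  have ht : ∀ {x y z}, Relation.EqvGen r x y → Relation.EqvGen r y z → Relation.EqvGen r x z :=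
    fun h h' => h.trans _ _ _ h'
  constructor
  · intro h1
    induction h1 with
    | rel x y hxy =>
      rcases (h x y).mp hxy with h2 | ⟨rfl, rfl⟩
      · exact Or.inl (.rel _ _ h2)
      · exact Or.inr (Or.inl ⟨.refl _, .refl _⟩)
    | refl x => exact Or.inl (.refl _)
    | symm x y _ ih =>
      rcases ih with h2 | ⟨h2, h3⟩ | ⟨h2, h3⟩
      · exact Or.inl (hs h2)
      · exact Or.inr (Or.inr ⟨hs h3, hs h2⟩)
      · exact Or.inr (Or.inl ⟨hs h3, hs h2⟩)
    | trans x y z _ _ ih1 ih2 =>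
      rcases ih1 with h2 | ⟨h2, h3⟩ | ⟨h2, h3⟩ <;> rcases ih2 with h4 | ⟨h4, h5⟩ | ⟨h4, h5⟩
      · exact Or.inl (ht h2 h4)
      · exact Or.inr (Or.inl ⟨ht h2 h4, h5⟩)
      · exact Or.inr (Or.inr ⟨ht h2 h4, h5⟩)
      · exact Or.inr (Or.inl ⟨h2, ht h3 h4⟩)
      · exact Or.inr (Or.inl ⟨h2, h5⟩)
      · exact Or.inl (ht h2 h5)
      · exact Or.inr (Or.inr ⟨h2, ht h3 h4⟩)
      · exact Or.inl (ht h2 h5)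
      · exact Or.inr (Or.inr ⟨h2, h5⟩)
  · have mono : ∀ {x y}, Relation.EqvGen r x y → Relation.EqvGen r' x y := fun h2 =>
      Relation.EqvGen.mono (fun x y hxy => (h x y).mpr (Or.inl hxy)) _ _ h2
    have huv : Relation.EqvGen r' u v := .rel _ _ ((h u v).mpr (Or.inr ⟨rfl, rfl⟩))
    rintro (h2 | ⟨h2, h3⟩ | ⟨h2, h3⟩)
    · exact mono h2
    · exact ((mono h2).trans _ _ _ huv).trans _ _ _ (mono h3)
    · exact ((mono h2).trans _ _ _ huv.symm).trans _ _ _ (mono h3)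

namespace HelixRel

variable {N : ℕ} {ε : ℕ → Bool} {t a b c : ℕ}

theorem refl (a : ℕ) : HelixRel N ε t a a := Relation.EqvGen.refl a
theorem symm (h : HelixRel N ε t a b) : HelixRel N ε t b a := Relation.EqvGen.symm _ _ h
theorem trans (h : HelixRel N ε t a b) (h' : HelixRel N ε t b c) : HelixRel N ε t a c :=
  Relation.EqvGen.trans _ _ _ h h'

theorem mono {t' : ℕ} (htt : t ≤ t') (h : HelixRel N ε t a b) : HelixRel N ε t' a b :=
  Relation.EqvGen.mono (fun _ _ ⟨s, hs, h⟩ => ⟨s, hs.trans_le htt, h⟩) _ _ h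

theorem zero_iff : HelixRel N ε 0 a b ↔ a = b := by
  constructor
  · intro h
    induction h with
    | rel x y h => obtain ⟨s, hs, _⟩ := h; omega
    | refl => rfl
    | symm _ _ _ ih => exact ih.symm
    | trans _ _ _ _ _ ih ih' => exact ih.trans ih'
  · rintro rfl; exact refl a

/-- Vertices not yet created are isolated. -/
theorem fresh (hN : 2 ≤ N) (h : HelixRel N ε t a b) : a = b ∨ (a < t + N ∧ b < t + N) := by
  induction h with
  | rel x y h => obtain ⟨s, hs, h | h⟩ := h <;> omega
  | refl => exact Or.inl rfl
  | symm _ _ _ ih => omega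
  | trans _ _ _ _ _ ih ih' => omega

theorem odd (hN : 2 ≤ N) (hE : Even N) (h : HelixRel N ε t a b) : Odd a ↔ Odd b := by
  induction h with
  | rel x y h =>
    obtain ⟨s, hs, ⟨h1, _, rfl, rfl⟩ | ⟨h1, _, rfl, rfl⟩⟩ := h
    · simp [h1, h1.add_even hE]
    · have e1 : Odd (s + N - 1) := Nat.Even.sub_odd (by omega) (h1.add hE) odd_one
      simp [e1, h1.add_one]
  | refl => rfl
  | symm _ _ _ ih => exact ih.symm
  | trans _ _ _ _ _ ih ih' => exact ih.trans ih'

theorem succ_up (h1 : Odd t) (h2 : ε t = false) : HelixRel N ε (t + 1) a b ↔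
    HelixRel N ε t a b ∨ (HelixRel N ε t a t ∧ HelixRel N ε t (t + N) b) ∨
      (HelixRel N ε t a (t + N) ∧ HelixRel N ε t t b) := by
  refine eqvGen_insert (fun x y => ⟨?_, ?_⟩) a b
  · rintro ⟨s, hs, h⟩
    rcases Nat.lt_succ_iff_lt_or_eq.mp hs with h3 | rfl
    · exact Or.inl ⟨s, h3, h⟩
    · rcases h with h | h
      · exact Or.inr h.2.2
      · simp_all
  · rintro (⟨s, hs, h⟩ | h)
    · exact ⟨s, by omega, h⟩
    · exact ⟨t, by omega, Or.inl ⟨h1, h2, h⟩⟩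

theorem succ_across (h1 : Even t) (h2 : ε t = true) : HelixRel N ε (t + 1) a b ↔
    HelixRel N ε t a b ∨ (HelixRel N ε t a (t + N - 1) ∧ HelixRel N ε t (t + 1) b) ∨
      (HelixRel N ε t a (t + 1) ∧ HelixRel N ε t (t + N - 1) b) := by
  refine eqvGen_insert (fun x y => ⟨?_, ?_⟩) a b
  · rintro ⟨s, hs, h⟩
    rcases Nat.lt_succ_iff_lt_or_eq.mp hs with h3 | rfl
    · exact Or.inl ⟨s, h3, h⟩
    · rcases h with h | h
      · simp_all
      · exact Or.inr h.2.2
  · rintro (⟨s, hs, h⟩ | h)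
    · exact ⟨s, by omega, h⟩
    · exact ⟨t, by omega, Or.inr ⟨h1, h2, h⟩⟩

theorem succ_none (h : ¬ (Odd t ∧ ε t = false)) (h' : ¬ (Even t ∧ ε t = true)) :
    HelixRel N ε (t + 1) a b ↔ HelixRel N ε t a b := by
  refine ⟨?_, mono (by omega)⟩
  refine Relation.EqvGen.mono ?_ _ _
  rintro x y ⟨s, hs, h3⟩
  rcases Nat.lt_succ_iff_lt_or_eq.mp hs with h4 | rfl
  · exact ⟨s, h4, h3⟩
  · tauto

end HelixRel

/-- `a` is connected to one of the initial vertices. -/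
def Rooted (N : ℕ) (ε : ℕ → Bool) (t a : ℕ) : Prop := ∃ c < N, Odd c ∧ HelixRel N ε t a c

/-- The black vertices on the frontier at time `t`. -/
def Frontier (N t a : ℕ) : Prop := Odd a ∧ t ≤ a ∧ a < t + N

section process

variable {N : ℕ} {ε : ℕ → Bool} {t a b c : ℕ}

theorem not_translate_of_parity (hE : Even N) (h : Odd a ↔ Even t) : ¬ Translate N t a := by
  rintro ⟨k, hk⟩
  have h1 : Even ((a : ℤ) - t) := by
    rw [hk, add_sub_cancel_left]; exact ((Int.even_coe_nat N).mpr hE).mul_left k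
  rw [Int.even_sub, Int.even_coe_nat, Int.even_coe_nat] at h1
  rw [← Nat.not_even_iff_odd] at h
  tauto

theorem not_translate_of_ne (h : t ≤ a) (h1 : a < t + N) (h2 : a ≠ t) : ¬ Translate N t a := by
  intro h3
  have := h3.sep (Translate.refl N t)
  omega

theorem not_connected_of_parity (hE : Even N) {π : AnnularPairing N} {x y : ℤ} (h : Odd (y - x)) :
    ¬ π.Connected x y := fun h1 => by
  have := h1.even hE
  exact Int.not_even_iff_odd.mpr h this

/-- The state of the process: connections between frontier vertices, and connections to the
initial vertices, can be read off from the pairing. -/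
theorem helix_invariant (hN : 2 ≤ N) (hE : Even N) (hd : (pairingAt N hN ε t).HasDefect) :
    (∀ a b, Frontier N t a → Frontier N t b →
      (HelixRel N ε t a b ↔ (pairingAt N hN ε t).Connected a b)) ∧
    (∀ a, Frontier N t a → (Rooted N ε t a ↔ (pairingAt N hN ε t).Exposed a)) := by
  induction t with
  | zero =>
    refine ⟨fun a b ha hb => ?_, fun a ha => ?_⟩
    · rw [HelixRel.zero_iff]
      constructor
      · rintro rfl; exact .refl _ _
      · rintro ⟨k, h1, h2⟩
        have e : (a : ℤ) = b + k * N := by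
          rcases lt_trichotomy (a : ℤ) (b + k * N) with h3 | h3 | h3
          · exact absurd rfl (h1 _ h3 le_rfl).2.2
          · exact h3
          · exact absurd rfl (h2 _ h3 le_rfl).2.2
        have h5 : Translate N b a := ⟨k, e⟩
        have := h5.sep (Translate.refl N b)
        have := ha.2; have := hb.2
        omega
    · refine ⟨fun _ i h1 h2 => ?_, fun _ => ⟨a, by have := ha.2.2; omega, ha.1, .refl a⟩⟩
      exact absurd h2 (not_lt.mpr h1)
  | succ t ih =>
    have hsame : ε t = false → pairingAt N hN ε (t + 1) = pairingAt N hN ε t := fun h => by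
      simp [pairingAt, h]
    have hcap : ε t = true → pairingAt N hN ε (t + 1) = (pairingAt N hN ε t).cap t := fun h => by
      simp [pairingAt, h]
    have trN : ∀ x : ℤ, Translate N x (x + N) := fun x => ⟨1, by ring⟩
    -- At even times the middle face `t` is not a percolation vertex: a cap joins the vertices on
    -- its two sides, and the identity changes nothing. At odd times `t` leaves the frontier and `t
    -- + N` enters it: the identity joins them by an edge, while a cap finishes the face `t` and
    -- opens `t + N` as an isolated vertex.
    rcases Nat.even_or_odd t with hp | hp
    · have hfr : ∀ {a}, Frontier N (t + 1) a → Frontier N t a ∧ ¬ Translate N t a := by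
        intro a ha
        refine ⟨⟨ha.1, by have := ha.2; omega, ?_⟩, ?_⟩
        · have h1 : a ≠ t + N := by
            rintro rfl
            exact Nat.not_even_iff_odd.mpr ha.1 (hp.add hE)
          have := ha.2; omega
        · exact not_translate_of_parity hE (by simp [hp, ha.1])
      cases hε : ε t with
      | false =>
        rw [hsame hε] at hd ⊢
        obtain ⟨ih1, ih2⟩ := ih hd
        have hr : ∀ a b, HelixRel N ε (t + 1) a b ↔ HelixRel N ε t a b := fun a b =>
          HelixRel.succ_none (by simp [hε, Nat.not_odd_iff_even.mpr hp]) (by simp [hε])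
        refine ⟨fun a b ha hb => ?_, fun a ha => ?_⟩
        · rw [hr, ih1 a b (hfr ha).1 (hfr hb).1]
        · rw [← ih2 a (hfr ha).1]; simp only [Rooted, hr]
      | true =>
        rw [hcap hε] at hd ⊢
        obtain ⟨ih1, ih2⟩ := ih hd.of_cap
        set π := pairingAt N hN ε t with hπ
        have fl : Frontier N t (t + N - 1) :=
          ⟨Nat.Even.sub_odd (by omega) (hp.add hE) odd_one, by omega, by omega⟩
        have f2 : Frontier N t (t + 1) := ⟨hp.add_one, by omega, by
          have : N ≠ 1 := by rintro rfl; simp at hE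
          omega⟩
        have cl : ∀ x : ℤ, π.Connected x ((t + N - 1 : ℕ) : ℤ) ↔ π.Connected x (t - 1) := by
          intro x
          have : Translate N ((t : ℤ) - 1) ((t + N - 1 : ℕ) : ℤ) := ⟨1, by push_cast [show 1 ≤ t + N by omega]; ring⟩
          exact ⟨fun h => h.trans (AnnularPairing.Connected.of_translate this).symm,
            fun h => h.trans (AnnularPairing.Connected.of_translate this)⟩
        have el : π.Exposed ((t + N - 1 : ℕ) : ℤ) ↔ π.Exposed ((t : ℤ) - 1) := by
          have := (cl ((t + N - 1 : ℕ) : ℤ)).mp (.refl _ _)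
          exact ⟨fun h => h.of_connected this, fun h => h.of_connected this.symm⟩
        have hr : ∀ a b, HelixRel N ε (t + 1) a b ↔ _ := fun a b =>
          HelixRel.succ_across (N := N) hp hε
        have sl : ¬ Translate N (t : ℤ) (t - 1) := fun h => h.not_succ hN (by
          rw [sub_add_cancel]; exact .refl _ _)
        have sr : ¬ Translate N (t : ℤ) (t + 1) := (Translate.refl N t).not_succ hN
        have sides := π.cap_connected_sides (t : ℤ)
        refine ⟨fun a b ha hb => ?_, fun a ha => ?_⟩
        · obtain ⟨ha1, ha2⟩ := hfr ha
          obtain ⟨hb1, hb2⟩ := hfr hb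
          rw [hr, ih1 a b ha1 hb1, ih1 _ _ ha1 fl, ih1 _ _ f2 hb1, ih1 _ _ ha1 f2]
          rw [show HelixRel N ε t (t + N - 1) b ↔ HelixRel N ε t b (t + N - 1) from
            ⟨.symm, .symm⟩, ih1 _ _ hb1 fl, cl, cl]
          push_cast
          constructor
          · rintro (h | ⟨h, h'⟩ | ⟨h, h'⟩)
            · exact h.cap ha2 hb2
            · exact ((h.cap ha2 sl).trans sides).trans (h'.cap sr hb2)
            · exact ((h.cap ha2 sr).trans sides.symm).trans (h'.symm.cap sl hb2)
          · intro h
            rcases AnnularPairing.connected_of_cap hd h ha2 hb2 with h | h | ⟨h, h'⟩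
            · exact Or.inl h
            · exact Or.inr (Or.inl h)
            · exact Or.inr (Or.inr ⟨h, h'.symm⟩)
        · obtain ⟨ha1, ha2⟩ := hfr ha
          have hroot : Rooted N ε (t + 1) a ↔ Rooted N ε t a ∨
              (HelixRel N ε t a (t + N - 1) ∧ Rooted N ε t (t + 1)) ∨
              (HelixRel N ε t a (t + 1) ∧ Rooted N ε t (t + N - 1)) := by
            simp only [Rooted, hr]
            constructor
            · rintro ⟨c, h1, h2, h | h | h⟩
              · exact Or.inl ⟨c, h1, h2, h⟩
              · exact Or.inr (Or.inl ⟨h.1, c, h1, h2, h.2⟩)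
              · exact Or.inr (Or.inr ⟨h.1, c, h1, h2, h.2⟩)
            · rintro (⟨c, h1, h2, h⟩ | ⟨h, c, h1, h2, h'⟩ | ⟨h, c, h1, h2, h'⟩)
              · exact ⟨c, h1, h2, Or.inl h⟩
              · exact ⟨c, h1, h2, Or.inr (Or.inl ⟨h, h'⟩)⟩
              · exact ⟨c, h1, h2, Or.inr (Or.inr ⟨h, h'⟩)⟩
          rw [hroot, ih2 a ha1, ih2 _ fl, ih2 _ f2, ih1 _ _ ha1 fl, ih1 _ _ ha1 f2, cl, el]
          push_cast
          constructor
          · rintro (h | ⟨h, h'⟩ | ⟨h, h'⟩)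
            · exact h.cap ha2
            · exact (h'.cap sr).of_connected (((h.cap ha2 sl).trans sides).symm)
            · exact (h'.cap sl).of_connected (((h.cap ha2 sr).trans sides.symm).symm)
          · exact fun h => AnnularPairing.exposed_of_cap hd h ha2
    · have hfr : ∀ {a}, Frontier N (t + 1) a → a ≠ t + N → Frontier N t a ∧ ¬ Translate N t a := by
        intro a ha h1
        refine ⟨⟨ha.1, by have := ha.2; omega, by have := ha.2; omega⟩, ?_⟩
        exact not_translate_of_ne (by have := ha.2; omega) (by have := ha.2; omega)
          (by have := ha.2; omega)
      have ft : Frontier N t t := ⟨hp, le_rfl, by omega⟩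
      have fresh : ∀ b, HelixRel N ε t (t + N) b → t + N = b := fun b h => by
        have := h.fresh hN; omega
      cases hε : ε t with
      | false =>
        rw [hsame hε] at hd ⊢
        obtain ⟨ih1, ih2⟩ := ih hd
        set π := pairingAt N hN ε t with hπ
        have hr : ∀ a b, HelixRel N ε (t + 1) a b ↔ _ := fun a b =>
          HelixRel.succ_up (N := N) hp hε
        -- On the circle `t + N` is the face `t`, so the new frontier is compared with the old one
        -- by renaming.
        let ρ : ℕ → ℕ := fun a => if a = t + N then t else a
        have hρf : ∀ {a}, Frontier N (t + 1) a → Frontier N t (ρ a) := by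
          intro a ha
          by_cases h : a = t + N
          · simp only [ρ, h, if_true]; exact ft
          · simp only [ρ, h, if_false]; exact (hfr ha h).1
        have hρc : ∀ a : ℕ, π.Connected (a : ℤ) (ρ a : ℕ) := by
          intro a
          by_cases h : a = t + N
          · simp only [ρ, h, if_true]; push_cast
            exact (AnnularPairing.Connected.of_translate (trN t)).symm
          · simp only [ρ, h, if_false]; exact .refl _ _
        have hρr : ∀ a, HelixRel N ε (t + 1) a (ρ a) := by
          intro a
          by_cases h : a = t + N
          · simp only [ρ, h, if_true]
            exact (hr _ _).mpr (Or.inr (Or.inr ⟨.refl _, .refl _⟩))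
          · simp only [ρ, h, if_false]; exact .refl _
        have hlow : ∀ a b, a < t + N → b < t + N → HelixRel N ε (t + 1) a b → HelixRel N ε t a b := by
          intro a b ha hb h
          rcases (hr a b).mp h with h | h | h
          · exact h
          · have := fresh b h.2; omega
          · have := fresh a h.1.symm; omega
        have hρlt : ∀ {a}, Frontier N (t + 1) a → ρ a < t + N := fun ha => (hρf ha).2.2
        refine ⟨fun a b ha hb => ?_, fun a ha => ?_⟩
        · rw [show π.Connected (a : ℤ) b ↔ π.Connected (ρ a : ℕ) (ρ b : ℕ) from
            ⟨fun h => ((hρc a).symm.trans h).trans (hρc b),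
              fun h => ((hρc a).trans h).trans (hρc b).symm⟩, ← ih1 _ _ (hρf ha) (hρf hb)]
          exact ⟨fun h => hlow _ _ (hρlt ha) (hρlt hb) (((hρr a).symm.trans h).trans (hρr b)),
            fun h => ((hρr a).trans (h.mono (by omega))).trans (hρr b).symm⟩
        · rw [show π.Exposed (a : ℤ) ↔ π.Exposed (ρ a : ℕ) from
            ⟨fun h => h.of_connected (hρc a), fun h => h.of_connected (hρc a).symm⟩,
            ← ih2 _ (hρf ha)]
          constructor
          · rintro ⟨c, h1, h2, h⟩
            exact ⟨c, h1, h2, hlow _ _ (hρlt ha) (by omega) ((hρr a).symm.trans h)⟩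
          · rintro ⟨c, h1, h2, h⟩
            exact ⟨c, h1, h2, (hρr a).trans (h.mono (by omega))⟩
      | true =>
        rw [hcap hε] at hd ⊢
        obtain ⟨ih1, ih2⟩ := ih hd.of_cap
        set π := pairingAt N hN ε t with hπ
        have hr : ∀ a b, HelixRel N ε (t + 1) a b ↔ HelixRel N ε t a b := fun a b =>
          HelixRel.succ_none (by simp [hε]) (by simp [Nat.not_even_iff_odd.mpr hp])
        -- The sides of this cap are even faces. Regions respect parity, so merging them does not
        -- affect the odd faces.
        have oddl : ∀ {a}, Frontier N t a → Odd (((t : ℤ) - 1) - a) := by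
          intro a ha
          have h1 : Odd (t : ℤ) := by exact_mod_cast hp
          have h2 : Odd (a : ℤ) := by exact_mod_cast ha.1
          exact (h1.sub_odd odd_one).sub_odd h2
        have oddr : ∀ {a}, Frontier N t a → Odd (((t : ℤ) + 1) - a) := by
          intro a ha
          have h1 : Odd (t : ℤ) := by exact_mod_cast hp
          have h2 : Odd (a : ℤ) := by exact_mod_cast ha.1
          exact (h1.add_odd odd_one).sub_odd h2
        refine ⟨fun a b ha hb => ?_, fun a ha => ?_⟩
        · rw [hr]
          by_cases ea : a = t + N
          · by_cases eb : b = t + N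
            · rw [ea, eb]; exact ⟨fun _ => .refl _ _, fun _ => .refl _⟩
            · refine ⟨fun h => absurd (fresh b (ea ▸ h)).symm eb, fun h => ?_⟩
              exfalso
              rw [ea] at h
              push_cast at h
              exact (hfr hb eb).2 (AnnularPairing.translate_of_cap_connected (h.symm.trans
                (AnnularPairing.Connected.of_translate (trN t)).symm))
          · by_cases eb : b = t + N
            · refine ⟨fun h => absurd (fresh a (eb ▸ h).symm).symm ea, fun h => ?_⟩
              exfalso
              rw [eb] at h
              push_cast at h
              exact (hfr ha ea).2 (AnnularPairing.translate_of_cap_connected (h.trans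
                (AnnularPairing.Connected.of_translate (trN t)).symm))
            · obtain ⟨ha1, ha2⟩ := hfr ha ea
              obtain ⟨hb1, hb2⟩ := hfr hb eb
              rw [ih1 a b ha1 hb1]
              refine ⟨fun h => h.cap ha2 hb2, fun h => ?_⟩
              rcases AnnularPairing.connected_of_cap hd h ha2 hb2 with h | h | h
              · exact h
              · exact absurd h.1 (not_connected_of_parity hE (oddl ha1))
              · exact absurd h.1 (not_connected_of_parity hE (oddr ha1))
        · have hroot : Rooted N ε (t + 1) a ↔ Rooted N ε t a := by simp only [Rooted, hr]
          rw [hroot]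
          by_cases ea : a = t + N
          · subst ea
            constructor
            · rintro ⟨c, h1, h2, h⟩
              have := fresh c h; omega
            · intro h
              exfalso
              push_cast at h
              exact π.not_exposed_cap t (h.of_connected
                (AnnularPairing.Connected.of_translate (trN t)).symm)
          · obtain ⟨ha1, ha2⟩ := hfr ha ea
            rw [ih2 a ha1]
            refine ⟨fun h => h.cap ha2, fun h => ?_⟩
            rcases AnnularPairing.exposed_of_cap hd h ha2 with h | h | h
            · exact h
            · exact absurd h.1 (not_connected_of_parity hE (oddl ha1))
            · exact absurd h.1 (not_connected_of_parity hE (oddr ha1))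

end process

end BKW

end

/-! ### Defects, crossing clusters and loops of the helical process. -/

noncomputable section

namespace BKW

section process

variable {N : ℕ} {ε : ℕ → Bool} {t T a b c : ℕ}

theorem pairingAt_cap (hN : 2 ≤ N) (h : ε t = true) :
    pairingAt N hN ε (t + 1) = (pairingAt N hN ε t).cap t := by simp [pairingAt, h]

theorem pairingAt_id (hN : 2 ≤ N) (h : ε t = false) :
    pairingAt N hN ε (t + 1) = pairingAt N hN ε t := by simp [pairingAt, h]

theorem AnnularPairing.HasDefect.of_le (hN : 2 ≤ N) (htT : t ≤ T)
    (hd : (pairingAt N hN ε T).HasDefect) : (pairingAt N hN ε t).HasDefect := by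
  induction T, htT using Nat.le_induction with
  | base => exact hd
  | succ T _ ih =>
    apply ih
    cases h : ε T with
    | false => rwa [pairingAt_id hN h] at hd
    | true => rw [pairingAt_cap hN h] at hd; exact hd.of_cap

namespace AnnularPairing

variable {π : AnnularPairing N}

/-- An exposed face is connected to a face adjacent to a defect. -/
theorem Exposed.exists_defect (hd : π.HasDefect) {x : ℤ} (hx : π.Exposed x) :
    ∃ d, π d = d ∧ π.Connected x d := by
  obtain ⟨d, hd⟩ := hd
  obtain ⟨k, h1, h2⟩ := exists_translate_Ioc (N := N) (by have := π.two_le; omega) d (x - N)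
  -- The last defect to the left of an exposed face bounds its region: no arc from the interval
  -- between them can pass over the defect or over the face.
  obtain ⟨e, ⟨he1, he2⟩, hmax⟩ := Int.exists_greatest_of_bdd (P := fun z => π z = z ∧ z ≤ x)
    ⟨x, fun z hz => hz.2⟩ ⟨d + k * N, defect_shift hd k, by omega⟩
  refine ⟨e, he1, (SameRegion.of_closed he2 ?_).symm.connected⟩
  intro i g1 g2
  have hne : π i ≠ i := fun h => by have := hmax i ⟨h, g2⟩; omega
  refine ⟨?_, ?_, hne⟩
  · by_contra h
    have h3 : π i ≠ e := fun h => by rw [← h, π.invol] at he1; omega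
    have := π.nc' (i := π i) (j := e) (by omega) (by rw [π.invol]; omega)
    omega
  · by_contra h
    exact hx i g2 (by omega)

theorem exposed_of_defect {d : ℤ} (h : π d = d) : π.Exposed d := by
  intro i h1 h2
  have : i ≠ d := by rintro rfl; omega
  have := π.nc' (i := i) (j := d) (by omega) h2
  omega

theorem translate_of_defects {d e : ℤ} (h : π d = d) (h' : π e = e) (hc : π.Connected d e) :
    Translate N e d := by
  obtain ⟨k, h1, h2⟩ := hc
  have h3 := defect_shift h' k
  refine ⟨k, ?_⟩
  rcases lt_trichotomy d (e + k * N) with h4 | h4 | h4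
  · exact absurd h3 (h1 _ h4 le_rfl).2.2
  · exact h4
  · exact absurd h (h2 _ h4 le_rfl).2.2

/-- If the two sides of a cap are connected, the cap closes a loop. -/
theorem apply_eq_of_connected_sides (hd : (π.cap t).HasDefect)
    (h : π.Connected ((t : ℤ) - 1) (t + 1)) : π t = t + 1 := by
  have hN := π.two_le
  obtain ⟨k, h1, h2⟩ := h
  -- `k` counts the turns made by the region joining the two sides. No turn means that `{t, t + 1}`
  -- is closed, hence a loop. One turn with `k = -1` gives an interval covering everything except
  -- the cap, which leaves no place for the surviving defect. All other values give intervals too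
  -- long to be closed.
  rcases lt_trichotomy k 0 with hk | rfl | hk
  · exfalso
    rcases eq_or_ne k (-1) with rfl | hk1
    · have hc : ClosedUnder (π.cap t) (t + 1 + (-1 : ℤ) * N) (t - 1) := by
        refine ClosedUnder.cap h2 ?_ ?_
        · exact not_translate_add ((Translate.refl N (t : ℤ)).not_succ hN) _
        · intro h; exact h.not_succ hN (by simpa using Translate.refl N (t : ℤ))
      obtain ⟨d, hd⟩ := hd
      obtain ⟨l, h3, h4⟩ := exists_translate_Ioc (N := N) (by omega) d ((t : ℤ) + 1 - N)
      have h5 := defect_shift (π := π.cap t) hd l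
      have c1 := capFun_left (π := π) (Translate.refl N (t : ℤ))
      have c2 := capFun_right (π := π) (Translate.refl N (t : ℤ))
      rw [← cap_apply] at c1 c2
      generalize d + l * N = e at *
      have e1 : e ≠ t := by rintro rfl; omega
      have e2 : e ≠ t + 1 := by rintro rfl; omega
      exact (hc e (by linarith) (by omega)).2.2 h5
    · have := hd.of_cap.length_lt h2
      nlinarith [show k ≤ -2 by omega]
  · have := h1 t (by omega) (by omega)
    omega
  · exfalso
    have := hd.of_cap.length_lt h1
    nlinarith

/-- If the middle face of a cap is connected to no other face and the cap does not join two
defects, then the cap closes a loop. -/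
theorem exists_connected_of_apply_ne (hd : (π.cap t).HasDefect) (h1 : π t ≠ t + 1)
    (h2 : ¬ (π t = t ∧ π (t + 1) = t + 1)) :
    ∃ x, π.Connected t x ∧ ¬ Translate N t x := by
  have hT := Translate.refl N (t : ℤ)
  have i1 := π.invol t
  have i2 := π.invol (t + 1)
  by_cases h3 : π (t + 1) = t + 1
  · have h4 : π t ≠ t := fun h => h2 ⟨h, h3⟩
    have ox := off_partner_left hd hT h4 h1
    -- The arc at `t` is followed to its other end, on the side where the face `t` lies.
    refine ⟨π t - 1, ?_, ox.2⟩
    rcases lt_or_gt_of_ne h4 with h5 | h5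
    · refine (SameRegion.of_closed (by omega) ?_).symm.connected
      have := π.nc (π t) (by omega)
      rw [i1] at this
      intro i g1 g2
      rcases eq_or_ne i t with rfl | g3
      · omega
      rcases eq_or_ne i (π t) with rfl | g4
      · omega
      have := this i (by omega) (by omega)
      omega
    · exact (SameRegion.of_closed (by omega) (π.nc t h5)).connected
  · have oy := off_partner_right hd hT h3 h1
    refine ⟨π (t + 1), ?_, oy.1⟩
    rcases lt_or_gt_of_ne h3 with h5 | h5
    · have := π.nc (π (t + 1)) (by omega)
      rw [i2] at this
      exact (SameRegion.of_closed (by omega) (by simpa using this)).symm.connected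
    · refine (SameRegion.of_closed (by omega) ?_).connected
      have := π.nc (t + 1) (by omega)
      intro i g1 g2
      rcases eq_or_ne i (t + 1) with rfl | g3
      · omega
      rcases eq_or_ne i (π (t + 1)) with rfl | g4
      · omega
      have := this i (by omega) (by omega)
      omega

theorem translate_of_connected_of_apply_eq {x : ℤ} (h : π t = t + 1) (hc : π.Connected t x) :
    Translate N t x := by
  obtain ⟨k, h1, h2⟩ := hc
  have i1 := π.invol t
  rcases lt_trichotomy (t : ℤ) (x + k * N) with h3 | h3 | h3
  · have := h1 (t + 1) (by omega) (by omega)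
    rw [← h, i1] at this; omega
  · exact ⟨-k, by rw [h3]; ring⟩
  · have := h2 t (by omega) le_rfl
    omega

end AnnularPairing

theorem exists_translate_frontier (hN : 2 ≤ N) (hE : Even N) {x : ℤ} (hx : Odd x) (t : ℕ) :
    ∃ a : ℕ, Frontier N t a ∧ Translate N x a := by
  obtain ⟨k, h1, h2⟩ := AnnularPairing.exists_translate_Ioc (N := N) (by omega) x ((t : ℤ) - 1)
  have h3 : ((x + k * N).toNat : ℤ) = x + k * N := Int.toNat_of_nonneg (by omega)
  refine ⟨(x + k * N).toNat, ⟨?_, by omega, by omega⟩, k, h3⟩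
  have : Odd ((x + k * N).toNat : ℤ) := by
    rw [h3]; exact hx.add_even (((Int.even_coe_nat N).mpr hE).mul_left k)
  exact_mod_cast this

theorem Frontier.eq_of_translate (ha : Frontier N t a) (hb : Frontier N t b)
    (h : Translate N a b) : a = b := by
  have := h.sep (Translate.refl N (a : ℤ))
  have := ha.2; have := hb.2
  omega

theorem Frontier.exists_of_connected (hN : 2 ≤ N) (hE : Even N) {π : AnnularPairing N} {x : ℤ}
    (ha : Frontier N t a) (h : π.Connected a x) :
    ∃ b, Frontier N t b ∧ π.Connected a b ∧ Translate N x b := by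
  have h1 := h.even hE
  have h2 : Odd (a : ℤ) := by exact_mod_cast ha.1
  have h3 : Odd x := by
    have := h1.add_odd h2
    rwa [sub_add_cancel] at this
  obtain ⟨b, hb, hx⟩ := exists_translate_frontier hN hE h3 t
  exact ⟨b, hb, h.trans (AnnularPairing.Connected.of_translate hx), hx⟩

/-- Each rooted frontier vertex is connected to a defect. -/
theorem Rooted.exists_defect (hN : 2 ≤ N) (hE : Even N) (hd : (pairingAt N hN ε t).HasDefect)
    (ha : Frontier N t a) (h : Rooted N ε t a) :
    ∃ d, Frontier N t d ∧ pairingAt N hN ε t d = d ∧ HelixRel N ε t a d := by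
  obtain ⟨h1, h2⟩ := helix_invariant hN hE hd
  obtain ⟨x, hx, hc⟩ := ((h2 a ha).mp h).exists_defect hd
  obtain ⟨d, hd', hc', ⟨k, hk⟩⟩ := ha.exists_of_connected hN hE hc
  refine ⟨d, hd', ?_, (h1 a d ha hd').mpr hc'⟩
  rw [hk, AnnularPairing.defect_shift hx]

theorem rooted_of_defect (hN : 2 ≤ N) (hE : Even N) (hd : (pairingAt N hN ε t).HasDefect)
    (ha : Frontier N t a) (h : pairingAt N hN ε t a = a) : Rooted N ε t a :=
  ((helix_invariant hN hE hd).2 a ha).mpr (AnnularPairing.exposed_of_defect h)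

theorem eq_of_defects (hN : 2 ≤ N) (hE : Even N) (ha : Frontier N t a) (hb : Frontier N t b)
    (h : pairingAt N hN ε t a = a) (h' : pairingAt N hN ε t b = b) (hr : HelixRel N ε t a b) :
    a = b := by
  have hc := ((helix_invariant hN hE ⟨a, h⟩).1 a b ha hb).mp hr
  exact (hb.eq_of_translate ha (AnnularPairing.translate_of_defects h h' hc)).symm

/-- A rooted frontier vertex is connected to a vertex that was rooted and on the frontier one step
earlier. -/
theorem Rooted.exists_prev (hN : 2 ≤ N) (hE : Even N) (ha : Frontier N (t + 1) a)
    (h : Rooted N ε (t + 1) a) :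
    ∃ z, Frontier N t z ∧ HelixRel N ε (t + 1) a z ∧ Rooted N ε t z := by
  have hfresh : ∀ b, HelixRel N ε t (t + N) b → t + N = b := fun b h => by
    have := h.fresh hN; omega
  obtain ⟨c, hc, hco, hr⟩ := h
  rcases Nat.even_or_odd t with hp | hp
  · have ha1 : Frontier N t a := by
      have h1 : a ≠ t + N := by
        rintro rfl
        exact Nat.not_even_iff_odd.mpr ha.1 (hp.add hE)
      exact ⟨ha.1, by have := ha.2; omega, by have := ha.2; omega⟩
    cases hε : ε t with
    | false =>
      rw [HelixRel.succ_none (by simp [Nat.not_odd_iff_even.mpr hp]) (by simp [hε])] at hr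
      exact ⟨a, ha1, .refl a, c, hc, hco, hr⟩
    | true =>
      have fl : Frontier N t (t + N - 1) :=
        ⟨Nat.Even.sub_odd (by omega) (hp.add hE) odd_one, by omega, by omega⟩
      have f2 : Frontier N t (t + 1) := ⟨hp.add_one, by omega, by
        have : N ≠ 1 := by rintro rfl; simp at hE
        omega⟩
      rcases (HelixRel.succ_across hp hε).mp hr with h | ⟨h, h'⟩ | ⟨h, h'⟩
      · exact ⟨a, ha1, .refl a, c, hc, hco, h⟩
      · exact ⟨_, f2, (HelixRel.succ_across hp hε).mpr (Or.inr (Or.inl ⟨h, .refl _⟩)),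
          c, hc, hco, h'⟩
      · exact ⟨_, fl, (HelixRel.succ_across hp hε).mpr (Or.inr (Or.inr ⟨h, .refl _⟩)),
          c, hc, hco, h'⟩
  · cases hε : ε t with
    | false =>
      rcases (HelixRel.succ_up hp hε).mp hr with h | ⟨_, h'⟩ | ⟨h, h'⟩
      · by_cases e : a = t + N
        · subst e
          have := hfresh c h; omega
        · exact ⟨a, ⟨ha.1, by have := ha.2; omega, by have := ha.2; omega⟩, .refl a, c, hc, hco, h⟩
      · have := hfresh c h'; omega
      · exact ⟨t, ⟨hp, le_rfl, by omega⟩,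
          (HelixRel.succ_up hp hε).mpr (Or.inr (Or.inr ⟨h, .refl _⟩)), c, hc, hco, h'⟩
    | true =>
      rw [HelixRel.succ_none (by simp [hε]) (by simp [Nat.not_even_iff_odd.mpr hp])] at hr
      by_cases e : a = t + N
      · subst e
        have := hfresh c hr; omega
      · exact ⟨a, ⟨ha.1, by have := ha.2; omega, by have := ha.2; omega⟩, .refl a, c, hc, hco, hr⟩

/-- Without defects, at most one cluster joins the frontier to the initial vertices. -/
theorem helixRel_of_rooted (hN : 2 ≤ N) (hE : Even N) (hd : ¬ (pairingAt N hN ε t).HasDefect)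
    (ha : Frontier N t a) (hb : Frontier N t b) (hra : Rooted N ε t a) (hrb : Rooted N ε t b) :
    HelixRel N ε t a b := by
  induction t generalizing a b with
  | zero => exact absurd ⟨0, rfl⟩ hd
  | succ t ih =>
    obtain ⟨a', ha', haa, hra'⟩ := hra.exists_prev hN hE ha
    obtain ⟨b', hb', hbb, hrb'⟩ := hrb.exists_prev hN hE hb
    suffices HelixRel N ε t a' b' from (haa.trans (this.mono (by omega))).trans hbb.symm
    -- The interesting moment is the step that destroys the last defects: every earlier defect must
    -- then sit on the cap.
    by_cases hd' : (pairingAt N hN ε t).HasDefect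
    · obtain ⟨d, fd, hdd, hd1⟩ := hra'.exists_defect hN hE hd' ha'
      obtain ⟨e, fe, hee, he1⟩ := hrb'.exists_defect hN hE hd' hb'
      have hε : ε t = true := by
        cases h : ε t with
        | false => rw [pairingAt_id hN h] at hd; exact absurd hd' hd
        | true => rfl
      rw [pairingAt_cap hN hε] at hd
      set π := pairingAt N hN ε t with hπ
      have key : ∀ x : ℕ, Frontier N t x → π x = x → Translate N t x ∨ Translate N t ((x : ℤ) - 1) := by
        intro x fx hx
        by_contra h
        push Not at h
        exact hd ⟨x, AnnularPairing.capFun_fixed h hx⟩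
      have par : ∀ x : ℕ, Frontier N t x → (Translate N t x → Odd t) ∧
          (Translate N t ((x : ℤ) - 1) → Even t) := by
        intro x fx
        refine ⟨fun h => ?_, fun h => ?_⟩
        · by_contra h1
          exact not_translate_of_parity hE (by simp [fx.1, Nat.not_odd_iff_even.mp h1]) h
        · by_contra h1
          have h2 := Nat.not_even_iff_odd.mp h1
          obtain ⟨k, hk⟩ := h
          have h3 : Even ((x : ℤ) - 1 - t) := by
            rw [hk, add_sub_cancel_left]; exact ((Int.even_coe_nat N).mpr hE).mul_left k
          have h4 : Odd (x : ℤ) := by exact_mod_cast fx.1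
          have h5 : Odd (t : ℤ) := by exact_mod_cast h2
          exact Int.not_even_iff_odd.mpr ((h4.sub_odd odd_one).sub_odd h5) h3
      -- The two points of the cap have opposite parities, so only one of them can be an odd defect;
      -- both clusters pass through it.
      have hde : d = e := by
        rcases key d fd hdd with h1 | h1 <;> rcases key e fe hee with h2 | h2
        · exact fd.eq_of_translate fe (h1.symm.trans h2)
        · exact absurd ((par e fe).2 h2) (Nat.not_even_iff_odd.mpr ((par d fd).1 h1))
        · exact absurd ((par d fd).2 h1) (Nat.not_even_iff_odd.mpr ((par e fe).1 h2))
        · have := (h1.symm.trans h2).add_const 1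
          simp only [sub_add_cancel] at this
          exact fd.eq_of_translate fe this
      subst hde
      exact hd1.trans he1.symm
    · exact ih hd' ha' hb' hra' hrb'

/-! ### Counting loops -/

open Classical in
/-- The number of loops closed before time `T`. -/
def loopCount (N : ℕ) (hN : 2 ≤ N) (ε : ℕ → Bool) (T : ℕ) : ℕ :=
  ((Finset.range T).filter fun s => ε s = true ∧ pairingAt N hN ε s s = s + 1).card

open Classical in
/-- The number of edges created before time `T`. -/
def openCount (ε : ℕ → Bool) (T : ℕ) : ℕ :=
  ((Finset.range T).filter fun s => (Odd s ∧ ε s = false) ∨ (Even s ∧ ε s = true)).card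

/-- `a` is the largest vertex of its cluster. -/
def IsTop (N : ℕ) (ε : ℕ → Bool) (T a : ℕ) : Prop := ∀ b, HelixRel N ε T a b → b ≤ a

open Classical in
/-- The number of clusters of the helical graph on the vertices created before time `T`. -/
def clusterCount (N : ℕ) (ε : ℕ → Bool) (T K : ℕ) : ℕ :=
  ((Finset.range K).filter fun a => Odd a ∧ IsTop N ε T a).card

theorem exists_top (hN : 2 ≤ N) (a : ℕ) : ∃ b, HelixRel N ε t a b ∧ IsTop N ε t b := by
  classical
  have hb : ∀ b, HelixRel N ε t a b → b ≤ a + t + N := fun b h => by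
    have := h.fresh hN; omega
  have hne : ∃ b, HelixRel N ε t a b := ⟨a, .refl a⟩
  refine ⟨Nat.findGreatest (fun b => HelixRel N ε t a b) (a + t + N), ?_, ?_⟩
  · exact Nat.findGreatest_spec (P := fun b => HelixRel N ε t a b) (hb a (.refl a)) (.refl a)
  · intro c hc
    refine Nat.le_findGreatest ?_ ?_
    · refine hb c (HelixRel.trans ?_ hc)
      exact Nat.findGreatest_spec (P := fun b => HelixRel N ε t a b) (hb a (.refl a)) (.refl a)
    · refine HelixRel.trans ?_ hc
      exact Nat.findGreatest_spec (P := fun b => HelixRel N ε t a b) (hb a (.refl a)) (.refl a)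

/-- Adding an edge between two clusters decreases the number of clusters by one. -/
theorem clusterCount_insert (hN : 2 ≤ N) (hE : Even N) {K u v : ℕ} (hK : t + 1 + N ≤ K) (hu : u < t + 1 + N)
    (hv : v < t + 1 + N) (huo : Odd u) (hvo : Odd v)
    (h : ∀ a b, HelixRel N ε (t + 1) a b ↔ HelixRel N ε t a b ∨
      (HelixRel N ε t a u ∧ HelixRel N ε t v b) ∨ (HelixRel N ε t a v ∧ HelixRel N ε t u b))
    (hne : ¬ HelixRel N ε t u v) :
    clusterCount N ε (t + 1) K + 1 = clusterCount N ε t K := by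
  classical
  -- When two clusters merge, exactly the smaller of their two largest vertices stops being the top
  -- of a cluster.
  have hgen : ∀ u v : ℕ, u < t + 1 + N → v < t + 1 + N → Odd u → Odd v →
    (∀ a b, HelixRel N ε (t + 1) a b ↔ HelixRel N ε t a b ∨
      (HelixRel N ε t a u ∧ HelixRel N ε t v b) ∨ (HelixRel N ε t a v ∧ HelixRel N ε t u b)) →
    ¬ HelixRel N ε t u v → ∀ mu mv, HelixRel N ε t u mu → IsTop N ε t mu →
      HelixRel N ε t v mv → IsTop N ε t mv → mu < mv →
      clusterCount N ε (t + 1) K + 1 = clusterCount N ε t K := by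
    intro u v hu hv huo hvo h hne mu mv hmu tmu hmv tmv hlt
    have hmuK : mu < K := by have := hmu.fresh hN; omega
    have hmem : mu ∈ (Finset.range K).filter fun a => Odd a ∧ IsTop N ε t a := by
      simp only [Finset.mem_filter, Finset.mem_range]
      exact ⟨hmuK, (hmu.odd hN hE).mp huo, tmu⟩
    have : (Finset.range K).filter (fun a => Odd a ∧ IsTop N ε (t + 1) a) =
        ((Finset.range K).filter fun a => Odd a ∧ IsTop N ε t a).erase mu := by
      ext a
      simp only [Finset.mem_filter, Finset.mem_range, Finset.mem_erase]
      constructor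
      · rintro ⟨h1, h2, h3⟩
        refine ⟨?_, h1, h2, fun b hb => h3 b (hb.mono (by omega))⟩
        rintro rfl
        have := h3 mv ((h _ _).mpr (Or.inr (Or.inl ⟨hmu.symm, hmv⟩)))
        omega
      · rintro ⟨h0, h1, h2, h3⟩
        refine ⟨h1, h2, fun b hb => ?_⟩
        rcases (h _ _).mp hb with g | ⟨g, g'⟩ | ⟨g, g'⟩
        · exact h3 b g
        · exfalso
          have e1 := h3 mu (g.trans hmu)
          have e2 := tmu a (hmu.symm.trans g.symm)
          omega
        · have e1 := h3 mv (g.trans hmv)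
          have e2 := tmu b (hmu.symm.trans g')
          omega
    rw [clusterCount, clusterCount, this, Finset.card_erase_add_one hmem]
  obtain ⟨mu, hmu, tmu⟩ := exists_top (ε := ε) (t := t) hN u
  obtain ⟨mv, hmv, tmv⟩ := exists_top (ε := ε) (t := t) hN v
  rcases lt_trichotomy mu mv with h1 | h1 | h1
  · exact hgen u v hu hv huo hvo h hne mu mv hmu tmu hmv tmv h1
  · exact absurd (hmu.trans (h1 ▸ hmv.symm)) hne
  · refine hgen v u hv hu hvo huo (fun a b => ?_) (fun g => hne g.symm) mv mu hmv tmv hmu tmu h1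
    rw [h]; tauto

theorem clusterCount_congr {ε' : ℕ → Bool} {t' K : ℕ}
    (h : ∀ a b, HelixRel N ε t a b ↔ HelixRel N ε' t' a b) :
    clusterCount N ε t K = clusterCount N ε' t' K := by
  classical
  unfold clusterCount
  refine congrArg Finset.card (Finset.filter_congr fun a _ => ?_)
  simp only [IsTop, h]

theorem clusterCount_of_related {K u v : ℕ}
    (h : ∀ a b, HelixRel N ε (t + 1) a b ↔ HelixRel N ε t a b ∨
      (HelixRel N ε t a u ∧ HelixRel N ε t v b) ∨ (HelixRel N ε t a v ∧ HelixRel N ε t u b))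
    (huv : HelixRel N ε t u v) :
    clusterCount N ε (t + 1) K = clusterCount N ε t K := by
  have : ∀ a b, HelixRel N ε (t + 1) a b ↔ HelixRel N ε t a b := fun a b => by
    rw [h]
    constructor
    · rintro (g | ⟨g, g'⟩ | ⟨g, g'⟩)
      · exact g
      · exact (g.trans huv).trans g'
      · exact (g.trans huv.symm).trans g'
    · exact Or.inl
  exact clusterCount_congr this

open Classical in
/-- The number of edges closing a cycle. -/
def cycleCount (N : ℕ) (ε : ℕ → Bool) (T : ℕ) : ℕ :=
  ((Finset.range T).filter fun s => Even s ∧ ε s = true ∧ HelixRel N ε s (s + N - 1) (s + 1)).card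

/-- Euler's relation. -/
theorem clusterCount_add_openCount (hN : 2 ≤ N) (hE : Even N) {K : ℕ} (hK : T + N ≤ K) :
    clusterCount N ε T K + openCount ε T = clusterCount N ε 0 K + cycleCount N ε T := by
  classical
  induction T with
  | zero => simp [openCount, cycleCount]
  | succ t ih =>
    specialize ih (by omega)
    simp only [openCount, cycleCount, Finset.range_add_one, Finset.filter_insert] at ih ⊢
    have hfresh : ∀ b, HelixRel N ε t (t + N) b → t + N = b := fun b h => by
      have := h.fresh hN; omega
    rcases Nat.even_or_odd t with hp | hp
    · have hnp := Nat.not_odd_iff_even.mpr hp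
      cases hε : ε t with
      | false =>
        have : clusterCount N ε (t + 1) K = clusterCount N ε t K := by
          exact clusterCount_congr fun a b => HelixRel.succ_none (by simp [hnp]) (by simp [hε])
        simp [hnp, this, ih]
      | true =>
        have hr : ∀ a b, HelixRel N ε (t + 1) a b ↔ _ := fun a b =>
          HelixRel.succ_across (N := N) hp hε
        have o1 : Odd (t + N - 1) := Nat.Even.sub_odd (by omega) (hp.add hE) odd_one
        by_cases h : HelixRel N ε t (t + N - 1) (t + 1)
        · rw [clusterCount_of_related hr h]
          simp [hp, h]
          omega
        · have := clusterCount_insert hN hE (by omega) (by omega) (by omega) o1 hp.add_one hr h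
            (K := K)
          simp [hp, h]
          omega
    · have hnp := Nat.not_even_iff_odd.mpr hp
      cases hε : ε t with
      | false =>
        have hr : ∀ a b, HelixRel N ε (t + 1) a b ↔ _ := fun a b =>
          HelixRel.succ_up (N := N) hp hε
        -- The endpoint `t + N` is a new vertex, so an edge created at an odd time never closes a
        -- cycle.
        have := clusterCount_insert hN hE (by omega) (by omega) (by omega) hp (hp.add_even hE) hr
          (fun h => by have := hfresh t h.symm; omega) (K := K)
        simp [hp, hnp]
        omega
      | true =>
        have : clusterCount N ε (t + 1) K = clusterCount N ε t K := by
          exact clusterCount_congr fun a b => HelixRel.succ_none (by simp [hε]) (by simp [hnp])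
        simp [hnp, this, ih]

/-- A loop closed at an odd time surrounds a finished cluster. At that moment `s` is its only vertex
on the frontier, and no later edge touches a label that is at most `s`. -/
theorem isTop_of_loop (hN : 2 ≤ N) (hE : Even N) {s : ℕ} (hs : s < T) (ho : Odd s)
    (hε : ε s = true) (hd : (pairingAt N hN ε s).HasDefect) (h : pairingAt N hN ε s s = s + 1) :
    IsTop N ε T s := by
  have h0 : IsTop N ε s s := by
    intro b hb
    by_contra hlt
    have hf := hb.fresh hN
    have fb : Frontier N s b := ⟨(hb.odd hN hE).mp ho, by omega, by omega⟩
    have fs : Frontier N s s := ⟨ho, le_rfl, by omega⟩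
    have hc := ((helix_invariant hN hE hd).1 s b fs fb).mp hb
    have := fs.eq_of_translate fb (AnnularPairing.translate_of_connected_of_apply_eq h hc)
    omega
  have h1 : ∀ t, s ≤ t → IsTop N ε t s := by
    intro t ht
    induction t, ht using Nat.le_induction with
    | base => exact h0
    | succ t hst ih =>
      intro b hb
      have key : ∀ u v, s < u → s < v → (HelixRel N ε t s b ∨
        (HelixRel N ε t s u ∧ HelixRel N ε t v b) ∨ (HelixRel N ε t s v ∧ HelixRel N ε t u b)) →
        b ≤ s := by
        rintro u v hu hv (g | g | g)
        · exact ih b g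
        · have := ih _ g.1; omega
        · have := ih _ g.1; omega
      by_cases hu : Odd t ∧ ε t = false
      · have hts : t ≠ s := by rintro rfl; simp [hε] at hu
        exact key _ _ (by omega) (by omega) ((HelixRel.succ_up hu.1 hu.2).mp hb)
      · by_cases hv : Even t ∧ ε t = true
        · have hts : t ≠ s := by rintro rfl; exact Nat.not_even_iff_odd.mpr ho hv.1
          exact key _ _ (by omega) (by omega) ((HelixRel.succ_across hv.1 hv.2).mp hb)
        · exact ih b ((HelixRel.succ_none hu hv).mp hb)
  exact h1 T hs.le

/-- If `s` is the last vertex of its cluster, the face `s` is connected to no other frontier face.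
Then the cap closes a loop or joins two defects, and next to a defect the cluster reaches the
initial vertices. -/
theorem loop_or_rooted_of_isTop (hN : 2 ≤ N) (hE : Even N) {s : ℕ} (hs : s < T) (ho : Odd s)
    (hd : (pairingAt N hN ε (s + 1)).HasDefect) (h : IsTop N ε T s) :
    ε s = true ∧ (pairingAt N hN ε s s = s + 1 ∨ Rooted N ε T s) := by
  have hε : ε s = true := by
    by_contra hε
    have := h (s + N) (Relation.EqvGen.rel _ _ ⟨s, hs, Or.inl ⟨ho, by simpa using hε, rfl, rfl⟩⟩)
    omega
  refine ⟨hε, ?_⟩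
  rw [pairingAt_cap hN hε] at hd
  have hd' := hd.of_cap
  have fs : Frontier N s s := ⟨ho, le_rfl, by omega⟩
  by_contra hcon
  push Not at hcon
  obtain ⟨hc1, hc2⟩ := hcon
  have hnd : ¬ (pairingAt N hN ε s s = s ∧ pairingAt N hN ε s (s + 1) = s + 1) := by
    rintro ⟨g, _⟩
    obtain ⟨c, hc, hco, hr⟩ := rooted_of_defect hN hE hd' fs g
    exact hc2 ⟨c, hc, hco, hr.mono hs.le⟩
  obtain ⟨x, hx1, hx2⟩ := AnnularPairing.exists_connected_of_apply_ne hd hc1 hnd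
  obtain ⟨b, fb, hb1, hb2⟩ := fs.exists_of_connected hN hE hx1
  have hr := ((helix_invariant hN hE hd').1 s b fs fb).mpr hb1
  have h5 := h b (hr.mono hs.le)
  have : b = s := by have := fb.2; omega
  subst this
  exact hx2 hb2.symm

/-- The number of loops in terms of edges and clusters, up to a bounded error. -/
theorem loopCount_bounds (hN : 2 ≤ N) (hE : Even N) (hd : (pairingAt N hN ε T).HasDefect) :
    loopCount N hN ε T + clusterCount N ε 0 (T + N) ≤
      openCount ε T + 2 * clusterCount N ε T (T + N) ∧
    openCount ε T + 2 * clusterCount N ε T (T + N) ≤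
      loopCount N hN ε T + clusterCount N ε 0 (T + N) + 2 * N := by
  classical
  have heuler := clusterCount_add_openCount (ε := ε) (T := T) hN hE le_rfl
  set A := (Finset.range T).filter fun s => Odd s ∧ ε s = true ∧ pairingAt N hN ε s s = s + 1
    with hA
  -- Loops closed at odd times surround clusters and are counted by `A`; loops closed at even times
  -- correspond to cycles. With Euler's relation, the quantity to be bounded is the number of
  -- clusters minus `A.card`.
  have hsplit : loopCount N hN ε T = A.card + cycleCount N ε T := by
    rw [loopCount, ← Finset.card_filter_add_card_filter_not (fun s => Odd s), cycleCount]
    congr 1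
    · rw [Finset.filter_filter]
      refine congrArg _ (Finset.filter_congr fun s _ => ?_)
      tauto
    · rw [Finset.filter_filter]
      refine congrArg _ (Finset.filter_congr fun s hs => ?_)
      rw [Finset.mem_range] at hs
      rw [Nat.not_odd_iff_even]
      have main : Even s → ε s = true → (pairingAt N hN ε s s = s + 1 ↔
          HelixRel N ε s (s + N - 1) (s + 1)) := by
        intro hp hε
        have hd1 := AnnularPairing.HasDefect.of_le hN (show s + 1 ≤ T by omega) hd
        rw [pairingAt_cap hN hε] at hd1
        have fl : Frontier N s (s + N - 1) :=
          ⟨Nat.Even.sub_odd (by omega) (hp.add hE) odd_one, by omega, by omega⟩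
        have f2 : Frontier N s (s + 1) := ⟨hp.add_one, by omega, by
          have : N ≠ 1 := by rintro rfl; simp at hE
          omega⟩
        rw [(helix_invariant hN hE hd1.of_cap).1 _ _ fl f2]
        have htr : (pairingAt N hN ε s).Connected ((s + N - 1 : ℕ) : ℤ) ((s : ℤ) - 1) :=
          (AnnularPairing.Connected.of_translate
            ⟨1, by push_cast [show 1 ≤ s + N by omega]; ring⟩).symm
        constructor
        · intro h
          refine htr.trans ?_
          push_cast
          refine (AnnularPairing.SameRegion.of_closed (by omega) ?_).connected
          intro i g1 g2
          have i1 := (pairingAt N hN ε s).invol s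
          rcases (show i = s ∨ i = s + 1 by omega) with rfl | rfl
          · omega
          · rw [← h, i1]; omega
        · intro h
          refine AnnularPairing.apply_eq_of_connected_sides hd1 ?_
          have := htr.symm.trans h
          push_cast at this
          exact this
      constructor
      · rintro ⟨⟨h1, h2⟩, h3⟩; exact ⟨h3, h1, (main h3 h1).mp h2⟩
      · rintro ⟨h1, h2, h3⟩; exact ⟨⟨h2, (main h1 h2).mpr h3⟩, h1⟩
  have hle : A.card ≤ clusterCount N ε T (T + N) := by
    refine Finset.card_le_card fun s hs => ?_
    simp only [hA, Finset.mem_filter, Finset.mem_range] at hs ⊢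
    refine ⟨by omega, hs.2.1, isTop_of_loop hN hE hs.1 hs.2.1 hs.2.2.1
      (AnnularPairing.HasDefect.of_le hN hs.1.le hd) hs.2.2.2⟩
  -- A cluster not surrounded by a loop is rooted, which happens at most `N` times, or has its top
  -- on the last `N` labels.
  have hge : clusterCount N ε T (T + N) ≤ A.card + 2 * N := by
    set R := (Finset.range (T + N)).filter fun s => IsTop N ε T s ∧ Rooted N ε T s with hR
    have hRc : R.card ≤ N := by
      have hch : ∀ s ∈ R, ∃ c < N, HelixRel N ε T s c := by
        intro s hs
        simp only [hR, Finset.mem_filter] at hs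
        obtain ⟨c, h1, _, h2⟩ := hs.2.2
        exact ⟨c, h1, h2⟩
      choose! f hf1 hf2 using hch
      have := Finset.card_le_card_of_injOn (t := Finset.range N) f
        (fun s hs => by simpa using hf1 s hs) (fun s hs s' hs' e => by
          have h1 : HelixRel N ε T s s' := (hf2 s hs).trans (e ▸ (hf2 s' hs').symm)
          simp only [hR, Finset.coe_filter, Set.mem_ofPred_eq] at hs hs'
          have := hs.2.1 s' h1
          have := hs'.2.1 s h1.symm
          omega)
      simpa using this
    have hsub : ((Finset.range (T + N)).filter fun a => Odd a ∧ IsTop N ε T a) ⊆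
        A ∪ R ∪ Finset.Ico T (T + N) := by
      intro s hs
      simp only [Finset.mem_filter, Finset.mem_range] at hs
      simp only [Finset.mem_union, Finset.mem_Ico]
      by_cases hsT : T ≤ s
      · exact Or.inr ⟨hsT, hs.1⟩
      · left
        have h1 := loop_or_rooted_of_isTop hN hE (show s < T by omega) hs.2.1
          (AnnularPairing.HasDefect.of_le hN (show s + 1 ≤ T by omega) hd) hs.2.2
        rcases h1.2 with h2 | h2
        · left; simp only [hA, Finset.mem_filter, Finset.mem_range]
          exact ⟨by omega, hs.2.1, h1.1, h2⟩
        · right; simp only [hR, Finset.mem_filter, Finset.mem_range]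
          exact ⟨hs.1, hs.2.2, h2⟩
    calc clusterCount N ε T (T + N) ≤ (A ∪ R ∪ Finset.Ico T (T + N)).card := Finset.card_le_card hsub
      _ ≤ A.card + R.card + (Finset.Ico T (T + N)).card :=
        (Finset.card_union_le _ _).trans (Nat.add_le_add_right (Finset.card_union_le _ _) _)
      _ ≤ A.card + 2 * N := by rw [Nat.card_Ico]; omega
  omega

end process

end BKW

end

noncomputable section

namespace BKW

/-! ### Spin configurations on the circle and the cap-cup operators -/

/-- The sign of a spin. -/
def sgn (b : Bool) : ℤ := if b = true then 1 else -1

@[simp] theorem sgn_true : sgn true = 1 := rfl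
@[simp] theorem sgn_false : sgn false = -1 := rfl
@[simp] theorem sgn_not (b : Bool) : sgn (!b) = -sgn b := by cases b <;> rfl

section spin

variable {N : ℕ} [NeZero N]

/-- The operator creating a pair at `j, j + 1` after annihilating one. -/
def capOp (y : ℂ) (j : ZMod N) (F : (ZMod N → Bool) → ℂ) (σ : ZMod N → Bool) : ℂ :=
  if σ (j + 1) = !σ j then
    y ^ (2 * sgn (σ j)) * ∑ b : Bool, y ^ (2 * sgn b) *
      F (Function.update (Function.update σ j b) (j + 1) (!b))
  else 0

open Classical in
/-- The vector attached to a pairing of the circle given by an involution `P` and directions `D`. -/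
def pairVec (y : ℂ) (P : ZMod N → ZMod N) (D : ZMod N → ℤ) (σ : ZMod N → Bool) : ℂ :=
  if ∀ i, P i ≠ i → σ (P i) = !σ i then y ^ (∑ i, D i * sgn (σ i)) else 0

theorem sum_split_two {M : Type*} [AddCommMonoid M] {α : Type*} [Fintype α] [DecidableEq α]
    {t u : α} (h : t ≠ u) (f : α → M) :
    ∑ i, f i = f t + f u + ∑ i ∈ Finset.univ \ {t, u}, f i := by
  rw [← Finset.sum_pair h, add_comm, Finset.sum_sdiff (Finset.subset_univ _)]

section step

variable {y : ℂ} {P P' : ZMod N → ZMod N} {D D' : ZMod N → ℤ} {t u x z : ZMod N}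

/-- Data common to the local steps: `u = t + 1` and after the step `t` and `u` are paired. -/
structure CapStep (P P' : ZMod N → ZMod N) (D D' : ZMod N → ℤ) (t u : ZMod N) : Prop where
  ne : t ≠ u
  succ : u = t + 1
  invol : ∀ i, P (P i) = i
  Pt : P' t = u
  Pu : P' u = t
  Dt : D' t = 1
  Du : D' u = -1

theorem CapStep.pt_inj (h : CapStep P P' D D' t u) {i j : ZMod N} (e : P i = P j) : i = j := by
  rw [← h.invol i, e, h.invol]

theorem capOp_apply (h : CapStep P P' D D' t u) (F : (ZMod N → Bool) → ℂ) {σ : ZMod N → Bool}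
    (hσ : σ u = !σ t) : capOp y t F σ = y ^ (2 * sgn (σ t)) *
      (y ^ (2 : ℤ) * F (Function.update (Function.update σ t true) u false) +
        y ^ (-2 : ℤ) * F (Function.update (Function.update σ t false) u true)) := by
  rw [capOp, ← h.succ, if_pos hσ, Fintype.sum_bool]
  simp

theorem capOp_eq_zero (h : CapStep P P' D D' t u) (F : (ZMod N → Bool) → ℂ) {σ : ZMod N → Bool}
    (hσ : σ u ≠ !σ t) : capOp y t F σ = 0 := by
  rw [capOp, ← h.succ, if_neg hσ]

theorem pairVec_eq_zero (h : CapStep P P' D D' t u) {σ : ZMod N → Bool}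
    (hσ : σ u ≠ !σ t) : pairVec y P' D' σ = 0 := by
  rw [pairVec, if_neg]
  intro h1
  have := h1 t (by rw [h.Pt]; exact h.ne.symm)
  rw [h.Pt] at this
  exact hσ this

/-- The spin configuration `σ` with the spins at `t`, `u` replaced by `b`, `!b`. -/
def setPair (σ : ZMod N → Bool) (t u : ZMod N) (b : Bool) : ZMod N → Bool :=
  Function.update (Function.update σ t b) u (!b)

theorem setPair_left (h : t ≠ u) (σ : ZMod N → Bool) (b : Bool) : setPair σ t u b t = b := by
  simp [setPair, Function.update_of_ne h]

theorem setPair_right (σ : ZMod N → Bool) (b : Bool) : setPair σ t u b u = !b := by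
  simp [setPair]

theorem setPair_of_ne {i : ZMod N} (h1 : i ≠ t) (h2 : i ≠ u) (σ : ZMod N → Bool) (b : Bool) :
    setPair σ t u b i = σ i := by
  simp [setPair, Function.update_of_ne h1, Function.update_of_ne h2]

/-- The exponent of `setPair` with the two special sites singled out. -/
theorem exponent_setPair (h : t ≠ u) (D : ZMod N → ℤ) (σ : ZMod N → Bool) (b : Bool) :
    ∑ i, D i * sgn (setPair σ t u b i) =
      (D t - D u) * sgn b + ∑ i ∈ Finset.univ \ {t, u}, D i * sgn (σ i) := by
  rw [sum_split_two h, setPair_left h, setPair_right]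
  congr 1
  · simp; ring
  · refine Finset.sum_congr rfl fun i hi => ?_
    simp only [Finset.mem_sdiff, Finset.mem_univ, Finset.mem_insert, Finset.mem_singleton,
      true_and, not_or] at hi
    rw [setPair_of_ne hi.1 hi.2]

theorem exponent_pair (h : CapStep P P' D D' t u) {σ : ZMod N → Bool} (hσ : σ u = !σ t) :
    ∑ i, D' i * sgn (σ i) =
      2 * sgn (σ t) + ∑ i ∈ Finset.univ \ {t, u}, D' i * sgn (σ i) := by
  rw [sum_split_two h.ne, h.Dt, h.Du, hσ, sgn_not]
  ring

/-- The result of a step as soon as the two terms are known. -/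
theorem capOp_pairVec_of (hy : y ≠ 0) (h : CapStep P P' D D' t u) (k : ℂ)
    (H : ∀ σ : ZMod N → Bool, σ u = !σ t →
      y ^ (2 : ℤ) * pairVec y P D (setPair σ t u true) +
        y ^ (-2 : ℤ) * pairVec y P D (setPair σ t u false) =
      k * (y ^ (-(2 * sgn (σ t))) * pairVec y P' D' σ)) :
    capOp y t (pairVec y P D) = k • pairVec y P' D' := by
  funext σ
  rw [Pi.smul_apply, smul_eq_mul]
  by_cases hσ : σ u = !σ t
  · have h1 := H σ hσ
    rw [capOp_apply h _ hσ]
    change y ^ (2 * sgn (σ t)) * (y ^ (2 : ℤ) * pairVec y P D (setPair σ t u true) +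
        y ^ (-2 : ℤ) * pairVec y P D (setPair σ t u false)) = _
    rw [h1, zpow_neg]
    have : y ^ (2 * sgn (σ t)) ≠ 0 := zpow_ne_zero _ hy
    field_simp
  · rw [capOp_eq_zero h _ hσ, pairVec_eq_zero h hσ, mul_zero]

/-- Closing a loop of type `ε = 1` (contractible) or `ε = -1` (around the circle), or joining two
unpaired points (`ε = 0`). -/
theorem capOp_pairVec_closed (hy : y ≠ 0) (h : CapStep P P' D D' t u) (e : ℤ)
    (h1 : (P t = u ∧ P u = t) ∨ (P t = t ∧ P u = u)) (hD : D t - D u = 2 * e)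
    (hP : ∀ i, i ≠ t → i ≠ u → P' i = P i) (hDD : ∀ i, i ≠ t → i ≠ u → D' i = D i) :
    capOp y t (pairVec y P D) = (y ^ (2 + 2 * e) + y ^ (-(2 + 2 * e))) • pairVec y P' D' := by
  refine capOp_pairVec_of hy h _ fun σ hσ => ?_
  have hcond : ∀ b, (∀ i, P i ≠ i → setPair σ t u b (P i) = !setPair σ t u b i) ↔
      (∀ i, P' i ≠ i → σ (P' i) = !σ i) := by
    intro b
    have hne : ∀ i, i ≠ t → i ≠ u → P i ≠ t ∧ P i ≠ u := by
      intro i hi1 hi2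
      rcases h1 with h1 | h1
      · exact ⟨fun g => hi2 (h.pt_inj (g.trans h1.2.symm)), fun g => hi1 (h.pt_inj (g.trans h1.1.symm))⟩
      · exact ⟨fun g => hi1 (h.pt_inj (g.trans h1.1.symm)), fun g => hi2 (h.pt_inj (g.trans h1.2.symm))⟩
    constructor
    · intro g i hi
      by_cases e1 : i = t
      · rw [e1, h.Pt, hσ]
      by_cases e2 : i = u
      · rw [e2, h.Pu, hσ, Bool.not_not]
      have := g i (by rwa [← hP i e1 e2])
      rwa [setPair_of_ne (hne i e1 e2).1 (hne i e1 e2).2, setPair_of_ne e1 e2, ← hP i e1 e2] at this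
    · intro g i hi
      by_cases e1 : i = t
      · rcases h1 with h1 | h1
        · rw [e1, h1.1, setPair_left h.ne, setPair_right]
        · rw [e1] at hi; exact absurd h1.1 hi
      by_cases e2 : i = u
      · rcases h1 with h1 | h1
        · rw [e2, h1.2, setPair_left h.ne, setPair_right, Bool.not_not]
        · rw [e2] at hi; exact absurd h1.2 hi
      have := g i (by rwa [hP i e1 e2])
      rwa [setPair_of_ne (hne i e1 e2).1 (hne i e1 e2).2, setPair_of_ne e1 e2, ← hP i e1 e2]
  have hsum : ∑ i ∈ Finset.univ \ {t, u}, D' i * sgn (σ i) =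
      ∑ i ∈ Finset.univ \ {t, u}, D i * sgn (σ i) := by
    refine Finset.sum_congr rfl fun i hi => ?_
    simp only [Finset.mem_sdiff, Finset.mem_univ, Finset.mem_insert, Finset.mem_singleton,
      true_and, not_or] at hi
    rw [hDD i hi.1 hi.2]
  simp only [pairVec, hcond]
  split_ifs with hc
  · rw [exponent_setPair h.ne, exponent_setPair h.ne, exponent_pair h hσ, hsum, hD]
    rw [← zpow_add₀ hy, ← zpow_add₀ hy, ← zpow_add₀ hy, add_mul, ← zpow_add₀ hy, ← zpow_add₀ hy]
    simp only [sgn_true, sgn_false]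
    congr 2 <;> ring
  · simp

/-- Joining an unpaired point with a paired one: the point `x` becomes unpaired. Here `v` is the
paired one among `t`, `u` and `w` is the other one. -/
theorem capOp_pairVec_move (hy : y ≠ 0) (h : CapStep P P' D D' t u) {v w : ZMod N}
    (hvw : (v = t ∧ w = u ∧ D v = -1) ∨ (v = u ∧ w = t ∧ D v = 1))
    (hw : P w = w) (hDw : D w = 0) (hv : P v = x) (hxt : x ≠ t) (hxu : x ≠ u)
    (hDx : D x = - D v) (hD'x : D' x = 0) (hP'x : P' x = x)
    (hP : ∀ i, i ≠ t → i ≠ u → i ≠ x → P' i = P i)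
    (hDD : ∀ i, i ≠ t → i ≠ u → i ≠ x → D' i = D i) :
    capOp y t (pairVec y P D) = (1 : ℂ) • pairVec y P' D' := by
  refine capOp_pairVec_of hy h _ fun σ hσ => ?_
  have hx : P x = v := by rw [← hv, h.invol]
  have hvne : v = t ∨ v = u := by rcases hvw with g | g <;> simp [g.1]
  have hxv : x ≠ v := by rcases hvne with g | g <;> rw [g] <;> assumption
  have hset : ∀ b, setPair σ t u b x = σ x := fun b => setPair_of_ne hxt hxu _ _
  -- The old arc forces the spin at `v` to be opposite to the one at `x`, so only one term of the
  -- sum over `b` survives.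
  set b₀ : Bool := if v = t then !σ x else σ x with hb₀
  have hsv : ∀ b, (setPair σ t u b v = !σ x) ↔ b = b₀ := by
    intro b
    rcases hvw with ⟨g, _⟩ | ⟨g, _⟩
    · rw [hb₀, if_pos g, g, setPair_left h.ne]
    · rw [hb₀, if_neg (by rw [g]; exact h.ne.symm), g, setPair_right]
      exact ⟨fun e => by simpa using e, fun e => by rw [e]⟩
  have hne : ∀ i, i ≠ t → i ≠ u → i ≠ x → P i ≠ t ∧ P i ≠ u ∧ P i ≠ x := by
    intro i hi1 hi2 hi3
    have a1 : P i ≠ v := fun g => hi3 (h.pt_inj (g.trans hx.symm))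
    have a2 : P i ≠ w := fun g => by
      have := h.pt_inj (g.trans hw.symm)
      rcases hvw with g | g <;> simp_all
    have a3 : P i ≠ x := fun g => by
      have := h.pt_inj (g.trans hv.symm)
      rcases hvw with g | g <;> simp_all
    rcases hvw with g | g
    · rw [← g.1, ← g.2.1]; exact ⟨a1, a2, a3⟩
    · rw [← g.1, ← g.2.1]; exact ⟨a2, a1, a3⟩
  have hcond : ∀ b, (∀ i, P i ≠ i → setPair σ t u b (P i) = !setPair σ t u b i) ↔
      (b = b₀ ∧ ∀ i, P' i ≠ i → σ (P' i) = !σ i) := by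
    intro b
    constructor
    · intro g
      refine ⟨?_, fun i hi => ?_⟩
      · have := g x (by rw [hx]; exact hxv.symm)
        rw [hx, hset] at this
        exact (hsv b).mp this
      by_cases e1 : i = t
      · rw [e1, h.Pt, hσ]
      by_cases e2 : i = u
      · rw [e2, h.Pu, hσ, Bool.not_not]
      by_cases e3 : i = x
      · rw [e3] at hi; exact absurd hP'x hi
      have := g i (by rwa [← hP i e1 e2 e3])
      have n := hne i e1 e2 e3
      rwa [setPair_of_ne n.1 n.2.1, setPair_of_ne e1 e2, ← hP i e1 e2 e3] at this
    · rintro ⟨hb, g⟩ i hi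
      have hbv := (hsv b).mpr hb
      by_cases e3 : i = x
      · rw [e3, hx, hset, hbv]
      by_cases e4 : i = v
      · rw [e4, hv, hset, hbv, Bool.not_not]
      by_cases e5 : i = w
      · rw [e5] at hi; exact absurd hw hi
      have e12 : i ≠ t ∧ i ≠ u := by
        rcases hvw with g | g
        · rw [← g.1, ← g.2.1]; exact ⟨e4, e5⟩
        · rw [← g.1, ← g.2.1]; exact ⟨e5, e4⟩
      have := g i (by rwa [hP i e12.1 e12.2 e3])
      have n := hne i e12.1 e12.2 e3
      rwa [setPair_of_ne n.1 n.2.1, setPair_of_ne e12.1 e12.2, ← hP i e12.1 e12.2 e3]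
  have hmem : x ∈ Finset.univ \ ({t, u} : Finset (ZMod N)) := by simp [hxt, hxu]
  have hsum : ∑ i ∈ Finset.univ \ {t, u}, D i * sgn (σ i) =
      - D v * sgn (σ x) + ∑ i ∈ Finset.univ \ {t, u}, D' i * sgn (σ i) := by
    rw [← Finset.add_sum_erase _ _ hmem, ← Finset.add_sum_erase _ (fun i => D' i * sgn (σ i)) hmem,
      hDx, hD'x, zero_mul, zero_add]
    congr 1
    refine Finset.sum_congr rfl fun i hi => ?_
    simp only [Finset.mem_erase, Finset.mem_sdiff, Finset.mem_univ, Finset.mem_insert,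
      Finset.mem_singleton, true_and, not_or] at hi
    rw [hDD i hi.2.1 hi.2.2 hi.1]
  by_cases hc : ∀ i, P' i ≠ i → σ (P' i) = !σ i
  swap
  · simp [pairVec, hcond, hc]
  -- The weight carried by the operator cancels the exponent of the destroyed arc between `v` and
  -- `x`.
  have hexp : 2 * sgn b₀ + ((D t - D u) * sgn b₀ + (- D v * sgn (σ x))) = 0 := by
    rcases hvw with ⟨g1, g2, g3⟩ | ⟨g1, g2, g3⟩
    · rw [hb₀, if_pos g1, ← g1, ← g2, g3, hDw, sgn_not]; ring
    · rw [hb₀, if_neg (by rw [g1]; exact h.ne.symm), ← g1, ← g2, g3, hDw]; ring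
  have hmain : y ^ (2 * sgn b₀) * y ^ (∑ i, D i * sgn (setPair σ t u b₀ i)) =
      y ^ (-(2 * sgn (σ t))) * y ^ (∑ i, D' i * sgn (σ i)) := by
    rw [exponent_setPair h.ne, exponent_pair h hσ, hsum, ← zpow_add₀ hy, ← zpow_add₀ hy]
    congr 1
    linarith
  have hcond' := fun b => (hcond b).trans (and_iff_left hc)
  clear_value b₀
  simp only [pairVec, hcond']
  rw [if_pos hc, one_mul, ← hmain]
  cases b₀ <;> simp

/-- Joining two paired points: their partners become paired. -/
theorem capOp_pairVec_join (hy : y ≠ 0) (h : CapStep P P' D D' t u)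
    (hx : P t = x) (hz : P u = z) (hxt : x ≠ t) (hxu : x ≠ u) (hzt : z ≠ t) (hzu : z ≠ u)
    (hDx : D x = - D t) (hDz : D z = - D u) (hD'x : D' x = D u - D t - 1)
    (hD'z : D' z = - D' x) (hP'x : P' x = z) (hP'z : P' z = x)
    (hP : ∀ i, i ≠ t → i ≠ u → i ≠ x → i ≠ z → P' i = P i)
    (hDD : ∀ i, i ≠ t → i ≠ u → i ≠ x → i ≠ z → D' i = D i) :
    capOp y t (pairVec y P D) = (1 : ℂ) • pairVec y P' D' := by
  refine capOp_pairVec_of hy h _ fun σ hσ => ?_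
  have hPx : P x = t := by rw [← hx, h.invol]
  have hPz : P z = u := by rw [← hz, h.invol]
  have hxz : x ≠ z := fun e => h.ne (h.pt_inj (by rw [hx, hz, e]))
  have hsx : ∀ b, setPair σ t u b x = σ x := fun b => setPair_of_ne hxt hxu _ _
  have hsz : ∀ b, setPair σ t u b z = σ z := fun b => setPair_of_ne hzt hzu _ _
  have hne : ∀ i, i ≠ t → i ≠ u → i ≠ x → i ≠ z → P i ≠ t ∧ P i ≠ u := by
    intro i hi1 hi2 hi3 hi4
    exact ⟨fun g => hi3 (h.pt_inj (g.trans hPx.symm)), fun g => hi4 (h.pt_inj (g.trans hPz.symm))⟩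
  have hcond : ∀ b, (∀ i, P i ≠ i → setPair σ t u b (P i) = !setPair σ t u b i) ↔
      (b = (!σ x) ∧ ∀ i, P' i ≠ i → σ (P' i) = !σ i) := by
    intro b
    constructor
    · intro g
      have g1 := g x (by rw [hPx]; exact hxt.symm)
      rw [hPx, setPair_left h.ne, hsx] at g1
      have g2 := g z (by rw [hPz]; exact hzu.symm)
      rw [hPz, setPair_right, hsz] at g2
      have g3 : σ z = !σ x := by
        rw [g1] at g2; simpa using g2.symm
      refine ⟨g1, fun i hi => ?_⟩
      by_cases e1 : i = t
      · rw [e1, h.Pt, hσ]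
      by_cases e2 : i = u
      · rw [e2, h.Pu, hσ, Bool.not_not]
      by_cases e3 : i = x
      · rw [e3, hP'x, g3]
      by_cases e4 : i = z
      · rw [e4, hP'z, g3, Bool.not_not]
      have := g i (by rwa [← hP i e1 e2 e3 e4])
      have n := hne i e1 e2 e3 e4
      rwa [setPair_of_ne n.1 n.2, setPair_of_ne e1 e2, ← hP i e1 e2 e3 e4] at this
    · rintro ⟨hb, g⟩ i hi
      have g3 := g x (by rw [hP'x]; exact hxz.symm)
      rw [hP'x] at g3
      by_cases e1 : i = t
      · rw [e1, hx, hsx, setPair_left h.ne, hb, Bool.not_not]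
      by_cases e2 : i = u
      · rw [e2, hz, hsz, setPair_right, hb, g3, Bool.not_not]
      by_cases e3 : i = x
      · rw [e3, hPx, setPair_left h.ne, hsx, hb]
      by_cases e4 : i = z
      · rw [e4, hPz, setPair_right, hsz, hb, g3]
      have := g i (by rwa [hP i e1 e2 e3 e4])
      have n := hne i e1 e2 e3 e4
      rwa [setPair_of_ne n.1 n.2, setPair_of_ne e1 e2, ← hP i e1 e2 e3 e4]
  by_cases hc : ∀ i, P' i ≠ i → σ (P' i) = !σ i
  swap
  · simp [pairVec, hcond, hc]
  have g3 := hc x (by rw [hP'x]; exact hxz.symm)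
  rw [hP'x] at g3
  have hmem : x ∈ Finset.univ \ ({t, u} : Finset (ZMod N)) := by simp [hxt, hxu]
  have hmem' : z ∈ (Finset.univ \ ({t, u} : Finset (ZMod N))).erase x := by
    simp [hzt, hzu, hxz.symm]
  have hsum : ∑ i ∈ Finset.univ \ {t, u}, D i * sgn (σ i) =
      (D u - D t) * sgn (σ x) - 2 * (D' x) * sgn (σ x) +
      ∑ i ∈ Finset.univ \ {t, u}, D' i * sgn (σ i) := by
    rw [← Finset.add_sum_erase _ _ hmem, ← Finset.add_sum_erase _ (fun i => D' i * sgn (σ i)) hmem,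
      ← Finset.add_sum_erase _ _ hmem', ← Finset.add_sum_erase _ (fun i => D' i * sgn (σ i)) hmem',
      hDx, hDz, hD'z, g3, sgn_not]
    have : ∑ i ∈ ((Finset.univ \ ({t, u} : Finset (ZMod N))).erase x).erase z, D i * sgn (σ i) =
        ∑ i ∈ ((Finset.univ \ ({t, u} : Finset (ZMod N))).erase x).erase z, D' i * sgn (σ i) := by
      refine Finset.sum_congr rfl fun i hi => ?_
      simp only [Finset.mem_erase, Finset.mem_sdiff, Finset.mem_univ, Finset.mem_insert,
        Finset.mem_singleton, true_and, not_or] at hi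
      rw [hDD i hi.2.2.1 hi.2.2.2 hi.2.1 hi.1]
    rw [this]; ring
  -- The exponents of the arcs `t`-`x` and `u`-`z`, together with the weight of the operator, add up
  -- to that of the arc `x`-`z`; the formula for `D' x` is what makes this work in every relative
  -- position.
  have hmain : y ^ (2 * sgn (!σ x)) * y ^ (∑ i, D i * sgn (setPair σ t u (!σ x) i)) =
      y ^ (-(2 * sgn (σ t))) * y ^ (∑ i, D' i * sgn (σ i)) := by
    rw [exponent_setPair h.ne, exponent_pair h hσ, hsum, ← zpow_add₀ hy, ← zpow_add₀ hy]
    congr 1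
    rw [hD'x, sgn_not]
    ring
  have hcond' := fun b => (hcond b).trans (and_iff_left hc)
  simp only [pairVec, hcond']
  rw [if_pos hc, one_mul, ← hmain]
  cases σ x <;> simp

end step

end spin

end BKW

end

/-! ### Pairings viewed on the circle, and the cap-cup operators acting on their vectors. -/

noncomputable section

namespace BKW

namespace AnnularPairing

variable {N : ℕ} [NeZero N] (π : AnnularPairing N) {t : ℤ}

theorem translate_iff {N : ℕ} (a b : ℤ) : Translate N a b ↔ (b : ZMod N) = a := by
  rw [eq_comm, ZMod.intCast_eq_intCast_iff_dvd_sub]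
  constructor
  · rintro ⟨k, rfl⟩
    exact ⟨k, by ring⟩
  · rintro ⟨k, hk⟩
    exact ⟨k, by linarith⟩

/-- The involution of the circle induced by a pairing. -/
def circle (i : ZMod N) : ZMod N := ((π (i.val : ℤ) : ℤ) : ZMod N)

/-- The direction from a point of the circle to its partner. -/
def dir (i : ZMod N) : ℤ := Int.sign (π (i.val : ℤ) - i.val)

theorem exists_intCast (i : ZMod N) : ∃ z : ℤ, (z : ZMod N) = i := ⟨i.val, by simp⟩

theorem translate_val (z : ℤ) : Translate N z ((z : ZMod N).val : ℤ) := by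
  rw [translate_iff]; simp

@[simp] theorem circle_intCast (z : ℤ) : π.circle (z : ZMod N) = (π z : ZMod N) := by
  have := π.translate_apply (translate_val (N := N) z)
  rwa [translate_iff] at this

@[simp] theorem dir_intCast (z : ℤ) : π.dir (z : ZMod N) = Int.sign (π z - z) := by
  obtain ⟨k, hk⟩ := translate_val (N := N) z
  rw [dir, hk, π.shift_mul]
  congr 1
  ring

theorem circle_invol (i : ZMod N) : π.circle (π.circle i) = i := by
  obtain ⟨z, rfl⟩ := exists_intCast i
  rw [circle_intCast, circle_intCast, π.invol]

theorem translate_self {z : ℤ} (h : Translate N z (π z)) : π z = z := by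
  have h1 := π.apply_lt_add z
  have h2 := π.sub_lt_apply z
  rcases h.sep (Translate.refl N z) with h | h | h <;> omega

theorem circle_eq_self_iff (z : ℤ) : π.circle (z : ZMod N) = z ↔ π z = z := by
  rw [circle_intCast, ← translate_iff]
  exact ⟨π.translate_self, fun h => by rw [h]; exact Translate.refl _ _⟩

theorem off_iff (z : ℤ) : Off N t z ↔ (z : ZMod N) ≠ t ∧ (z : ZMod N) ≠ t + 1 := by
  rw [Off, translate_iff, translate_iff]
  push_cast
  rw [sub_eq_iff_eq_add]

theorem hasDefect_iff : π.HasDefect ↔ ∃ i, π.circle i = i := by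
  constructor
  · rintro ⟨d, hd⟩
    exact ⟨d, (π.circle_eq_self_iff d).mpr hd⟩
  · rintro ⟨i, hi⟩
    obtain ⟨z, rfl⟩ := exists_intCast i
    exact ⟨z, (π.circle_eq_self_iff z).mp hi⟩

theorem capStep (t : ℤ) :
    CapStep π.circle (π.cap t).circle π.dir (π.cap t).dir (t : ZMod N) ((t + 1 : ℤ) : ZMod N) where
  ne := by
    rw [Ne, ← translate_iff]
    intro h
    have := π.two_le
    have h3 := h.symm
    have := (Translate.refl N t).not_succ π.two_le
    exact this h3
  succ := by push_cast; rfl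
  invol := π.circle_invol
  Pt := by rw [circle_intCast, cap_apply, capFun_left (Translate.refl N t)]
  Pu := by rw [circle_intCast, cap_apply, capFun_right (Translate.refl N t)]
  Dt := by rw [dir_intCast, cap_apply, capFun_left (Translate.refl N t)]; simp
  Du := by rw [dir_intCast, cap_apply, capFun_right (Translate.refl N t)]; simp

theorem cap_off {i : ZMod N} (h1 : i ≠ t) (h2 : i ≠ ((t + 1 : ℤ) : ZMod N))
    (h3 : π.circle i ≠ t) (h4 : π.circle i ≠ ((t + 1 : ℤ) : ZMod N)) :
    (π.cap t).circle i = π.circle i ∧ (π.cap t).dir i = π.dir i := by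
  obtain ⟨z, rfl⟩ := exists_intCast i
  push_cast at h2 h4
  rw [circle_intCast] at h3 h4
  have := π.capFun_off ((off_iff (t := t) z).mpr ⟨h1, h2⟩) ((off_iff _).mpr ⟨h3, h4⟩)
  simp [this]

open Classical in
/-- The set of defects of a pairing on the circle. -/
def defects : Finset (ZMod N) := Finset.univ.filter fun i => π.circle i = i

theorem mem_defects {i : ZMod N} : i ∈ π.defects ↔ π.circle i = i := by
  classical
  simp [defects]

/-- The vector attached to a pairing. -/
abbrev vec (y : ℂ) : (ZMod N → Bool) → ℂ := pairVec y π.circle π.dir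

theorem sign_one {a : ℤ} (h : 0 < a) : Int.sign a = 1 := Int.sign_eq_one_of_pos h
theorem sign_neg_one {a : ℤ} (h : a < 0) : Int.sign a = -1 := Int.sign_eq_neg_one_of_neg h

/-- The action of the cap-cup operators on the vectors attached to pairings. -/
theorem capOp_vec {y : ℂ} {r c : ℝ} (hy : y ≠ 0) (hr : y ^ (4 : ℤ) + y ^ (-4 : ℤ) = r)
    (hc : y ^ (2 : ℤ) + y ^ (-2 : ℤ) = c) (hr0 : 0 < r) (hc0 : 0 < c) (t : ℤ) :
    ∃ (k : ℝ) (e : ℕ), 0 < k ∧ capOp y (t : ZMod N) (π.vec y) = (k : ℂ) • (π.cap t).vec y ∧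
      ((π.cap t).HasDefect → k = (if π t = t + 1 then r else 1) * c ^ e ∧
        (π.cap t).defects.card + e ≤ π.defects.card) := by
  classical
  have hs := π.capStep t
  have hT := Translate.refl N t
  have i1 := π.invol t
  have i2 := π.invol (t + 1)
  have hN := π.two_le
  have l1 := π.apply_lt_add t
  have l2 := π.sub_lt_apply t
  set u : ZMod N := ((t + 1 : ℤ) : ZMod N) with hu
  -- defects after a step that closes a loop
  have closed : ((π.circle t = u ∧ π.circle u = t) ∨ (π.circle t = t ∧ π.circle u = u)) →
      (∀ i, i ≠ (t : ZMod N) → i ≠ u → (π.cap t).circle i = π.circle i) ∧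
      (∀ i, i ≠ (t : ZMod N) → i ≠ u → (π.cap t).dir i = π.dir i) ∧
      (π.cap t).defects ⊆ (π.defects.erase t).erase u := by
    intro hcl
    have hoff : ∀ i, i ≠ (t : ZMod N) → i ≠ u → π.circle i ≠ t ∧ π.circle i ≠ u := by
      intro i h1 h2
      rcases hcl with g | g
      · exact ⟨fun e => h2 (hs.pt_inj (e.trans g.2.symm)), fun e => h1 (hs.pt_inj (e.trans g.1.symm))⟩
      · exact ⟨fun e => h1 (hs.pt_inj (e.trans g.1.symm)), fun e => h2 (hs.pt_inj (e.trans g.2.symm))⟩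
    refine ⟨fun i h1 h2 => (π.cap_off h1 h2 (hoff i h1 h2).1 (hoff i h1 h2).2).1,
      fun i h1 h2 => (π.cap_off h1 h2 (hoff i h1 h2).1 (hoff i h1 h2).2).2, fun i hi => ?_⟩
    rw [mem_defects] at hi
    have h1 : i ≠ t := by rintro rfl; exact hs.ne (hi.symm.trans hs.Pt)
    have h2 : i ≠ u := by rintro rfl; exact hs.ne (hs.Pu.symm.trans hi)
    rw [(π.cap_off h1 h2 (hoff i h1 h2).1 (hoff i h1 h2).2).1] at hi
    simp [h1, h2, mem_defects, hi]
  -- A contractible loop is closed: both ends turn the same way and the factor is `y⁴ + y⁻⁴ = r`.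
  by_cases c1 : π t = t + 1
  · have g : π.circle t = u ∧ π.circle u = t := by
      rw [hu, circle_intCast, circle_intCast, c1, ← c1, i1]; simp
    obtain ⟨a1, a2, a3⟩ := closed (Or.inl g)
    refine ⟨r, 0, hr0, ?_, fun _ => ⟨by simp [c1], ?_⟩⟩
    · rw [← hr]
      have := capOp_pairVec_closed hy hs 1 (Or.inl g) (by
        rw [hu, dir_intCast, dir_intCast, ← c1, i1, c1, sign_one (by omega), sign_neg_one (by omega)]
        norm_num) a1 a2
      norm_num at this ⊢
      exact this
    · exact Finset.card_le_card (a3.trans ((Finset.erase_subset _ _).trans (Finset.erase_subset _ _)))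
  -- A loop around the annulus: the turning cancels and the factor is `2`. This needs the absence of
  -- defects after the step, so the second claim is vacuous.
  by_cases c2 : π t = t + 1 - N
  · have c2' : π (t + 1) = t + N := by
      have := π.shift (t + 1 - N)
      rw [← c2, i1, c2] at this
      rw [← this]; congr 1; ring
    have g : π.circle t = u ∧ π.circle u = t := by
      rw [hu, circle_intCast, circle_intCast, c2, c2']; simp
    obtain ⟨a1, a2, a3⟩ := closed (Or.inl g)
    refine ⟨2, 0, by norm_num, ?_, fun hd => absurd c2 (not_wrap hd hT)⟩
    have := capOp_pairVec_closed hy hs (-1) (Or.inl g) (by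
        rw [hu, dir_intCast, dir_intCast, c2, c2', sign_neg_one (by omega), sign_one (by omega)]
        norm_num) a1 a2
    norm_num at this ⊢
    exact this
  have htr : ∀ z, π t = z → z = t ∨ Off N t z := by
    intro z hz
    rcases off_or (N := N) t z with h | ⟨U, hU, h | h⟩
    · exact Or.inr h
    · left
      rw [← hz]
      exact π.translate_self (by rw [hz, h]; exact hU)
    · exfalso
      obtain ⟨k, hk⟩ := hU
      have h3 : k = 0 ∨ k = -1 := by
        have a : k < 1 := by
          by_contra hk1
          have := mul_le_mul_of_nonneg_right (show 1 ≤ k by omega) (Int.natCast_nonneg N)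
          omega
        have b : -2 < k := by
          by_contra hk1
          have := mul_le_mul_of_nonneg_right (show k ≤ -2 by omega) (Int.natCast_nonneg N)
          omega
        omega
      rcases h3 with rfl | rfl
      · apply c1; rw [hz, h, hk]; ring
      · apply c2; rw [hz, h, hk]; ring
  have hoffc : ∀ z, Off N t z → (z : ZMod N) ≠ t ∧ (z : ZMod N) ≠ u := by
    intro z hz
    have := (off_iff z).mp hz
    rw [hu]; push_cast; exact this
  -- joining an arc and a defect
  have moved : ∀ v w x : ZMod N, ((v = t ∧ w = u) ∨ (v = u ∧ w = t)) → π.circle w = w →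
      π.circle v = x → x ≠ t → x ≠ u → (π.cap t).circle x = x →
      (∀ i, i ≠ (t : ZMod N) → i ≠ u → i ≠ x → (π.cap t).circle i = π.circle i) ∧
      (∀ i, i ≠ (t : ZMod N) → i ≠ u → i ≠ x → (π.cap t).dir i = π.dir i) ∧
      (π.cap t).defects.card ≤ π.defects.card := by
    intro v w x hvw hw hv hxt hxu hx'
    have hx : π.circle x = v := by rw [← hv, π.circle_invol]
    have hoff : ∀ i, i ≠ (t : ZMod N) → i ≠ u → i ≠ x → π.circle i ≠ t ∧ π.circle i ≠ u := by
      intro i h1 h2 h3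
      have a1 : π.circle i ≠ v := fun e => h3 (hs.pt_inj (e.trans hx.symm))
      have a2 : π.circle i ≠ w := fun e => by
        have := hs.pt_inj (e.trans hw.symm)
        rcases hvw with g | g
        · exact h2 (this.trans g.2)
        · exact h1 (this.trans g.2)
      rcases hvw with g | g
      · rw [← g.1, ← g.2]; exact ⟨a1, a2⟩
      · rw [← g.1, ← g.2]; exact ⟨a2, a1⟩
    refine ⟨fun i h1 h2 h3 => (π.cap_off h1 h2 (hoff i h1 h2 h3).1 (hoff i h1 h2 h3).2).1,
      fun i h1 h2 h3 => (π.cap_off h1 h2 (hoff i h1 h2 h3).1 (hoff i h1 h2 h3).2).2, ?_⟩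
    have hsub : (π.cap t).defects ⊆ insert x (π.defects.erase w) := by
      intro i hi
      rw [mem_defects] at hi
      have h1 : i ≠ t := by rintro rfl; exact hs.ne (hi.symm.trans hs.Pt)
      have h2 : i ≠ u := by rintro rfl; exact hs.ne (hs.Pu.symm.trans hi)
      by_cases h3 : i = x
      · simp [h3]
      rw [(π.cap_off h1 h2 (hoff i h1 h2 h3).1 (hoff i h1 h2 h3).2).1] at hi
      have h4 : i ≠ w := by
        rcases hvw with g | g
        · rw [g.2]; exact h2
        · rw [g.2]; exact h1
      simp [h3, h4, mem_defects, hi]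
    calc _ ≤ _ := Finset.card_le_card hsub
      _ ≤ (π.defects.erase w).card + 1 := Finset.card_insert_le _ _
      _ = _ := Finset.card_erase_add_one (π.mem_defects.mpr hw)
  obtain ⟨p1, p2, p3⟩ := partner_order π t c1
  by_cases c3 : π t = t
  -- Two defects are joined: the factor is `y² + y⁻² = c`. Two defects disappear, while the bound
  -- only needs one for each factor `c`.
  · by_cases c4 : π (t + 1) = t + 1
    · have g1 : π.circle t = t := (π.circle_eq_self_iff t).mpr c3
      have g2 : π.circle u = u := (π.circle_eq_self_iff (t + 1)).mpr c4
      obtain ⟨a1, a2, a3⟩ := closed (Or.inr ⟨g1, g2⟩)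
      refine ⟨c, 1, hc0, ?_, fun _ => ⟨by simp [c1], ?_⟩⟩
      · rw [← hc]
        have := capOp_pairVec_closed hy hs 0 (Or.inr ⟨g1, g2⟩) (by
          rw [hu, dir_intCast, dir_intCast, c3, c4]; simp) a1 a2
        norm_num at this ⊢
        exact this
      · have h5 := Finset.card_le_card (a3.trans (Finset.erase_subset _ _))
        have h6 := Finset.card_erase_add_one (π.mem_defects.mpr g1)
        omega
    · -- the partner of `t + 1` becomes a defect
      have ho : Off N t (π (t + 1)) := by
        rcases off_or (N := N) t (π (t + 1)) with h | ⟨U, hU, h | h⟩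
        · exact h
        · exfalso
          obtain ⟨k, hk⟩ := hU
          have := congrArg π.toFun h
          rw [i2, hk, π.shift_mul, c3, ← hk, ← h] at this
          exact c4 this.symm
        · exact absurd (π.translate_self (by rw [h]; exact hU.add_const 1)) c4
      have ho' := hoffc _ ho
      have hx' : (π.cap t).circle ((π (t + 1) : ℤ) : ZMod N) = (π (t + 1) : ℤ) := by
        rw [circle_eq_self_iff, cap_apply, capFun_partner_right hT ho, if_pos c3]
      have g1 : π.circle t = t := (π.circle_eq_self_iff t).mpr c3
      obtain ⟨a1, a2, a3⟩ := moved u t _ (Or.inr ⟨rfl, rfl⟩) g1 (by rw [hu, circle_intCast])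
        ho'.1 ho'.2 hx'
      have hlt : t + 1 < π (t + 1) := by omega
      refine ⟨1, 0, one_pos, ?_, fun _ => ⟨by simp [c1], by simpa using a3⟩⟩
      have := capOp_pairVec_move hy hs (v := u) (w := t) (x := ((π (t + 1) : ℤ) : ZMod N))
        (Or.inr ⟨rfl, rfl, by rw [hu, dir_intCast, sign_one (by omega)]⟩) g1
        (by rw [dir_intCast, c3]; simp) (by rw [hu, circle_intCast]) ho'.1 ho'.2
        (by rw [hu, dir_intCast, dir_intCast, i2, sign_neg_one (by omega), sign_one (by omega)])
        (by rw [dir_intCast, cap_apply, capFun_partner_right hT ho, if_pos c3]; simp) hx' a1 a2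
      simpa using this
  · have ho := (htr _ rfl).resolve_left c3
    have ho' := hoffc _ ho
    by_cases c4 : π (t + 1) = t + 1
    · have hx' : (π.cap t).circle ((π t : ℤ) : ZMod N) = (π t : ℤ) := by
        rw [circle_eq_self_iff, cap_apply, capFun_partner_left hT ho, if_pos c4]
      have g1 : π.circle u = u := (π.circle_eq_self_iff (t + 1)).mpr c4
      obtain ⟨a1, a2, a3⟩ := moved t u _ (Or.inl ⟨rfl, rfl⟩) g1 (by rw [circle_intCast])
        ho'.1 ho'.2 hx'
      have hlt : π t < t := by omega
      refine ⟨1, 0, one_pos, ?_, fun _ => ⟨by simp [c1], by simpa using a3⟩⟩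
      have := capOp_pairVec_move hy hs (v := t) (w := u) (x := ((π t : ℤ) : ZMod N))
        (Or.inl ⟨rfl, rfl, by rw [dir_intCast, sign_neg_one (by omega)]⟩) g1
        (by rw [hu, dir_intCast, c4]; simp) (by rw [circle_intCast]) ho'.1 ho'.2
        (by rw [dir_intCast, dir_intCast, i1, sign_one (by omega), sign_neg_one (by omega)]; rfl)
        (by rw [dir_intCast, cap_apply, capFun_partner_left hT ho, if_pos c4]; simp) hx' a1 a2
      simpa using this
    · have oz := off_right hT ho c4
      have oz' := hoffc _ oz
      have e1 : π.capFun t (π t) = π (t + 1) := by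
        rw [capFun_partner_left hT ho, if_neg c4]
      have e2 : π.capFun t (π (t + 1)) = π t := by
        rw [capFun_partner_right hT oz, if_neg c3]
      have hne : π t ≠ π (t + 1) := fun e => by have := π.injective e; omega
      have nz := oz.ne hT
      have b1 : π.circle ((π t : ℤ) : ZMod N) = t := by rw [circle_intCast, i1]
      have b2 : π.circle ((π (t + 1) : ℤ) : ZMod N) = u := by rw [circle_intCast, i2]
      have hoff : ∀ i, i ≠ (t : ZMod N) → i ≠ u → i ≠ ((π t : ℤ) : ZMod N) →
          i ≠ ((π (t + 1) : ℤ) : ZMod N) → π.circle i ≠ t ∧ π.circle i ≠ u :=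
        fun i h1 h2 h3 h4 =>
          ⟨fun e => h3 (hs.pt_inj (e.trans b1.symm)), fun e => h4 (hs.pt_inj (e.trans b2.symm))⟩
      have hsub : (π.cap t).defects ⊆ π.defects := by
        intro i hi
        rw [mem_defects] at hi ⊢
        have h1 : i ≠ t := by rintro rfl; exact hs.ne (hi.symm.trans hs.Pt)
        have h2 : i ≠ u := by rintro rfl; exact hs.ne (hs.Pu.symm.trans hi)
        have h3 : i ≠ ((π t : ℤ) : ZMod N) := by
          rintro rfl
          rw [circle_eq_self_iff, cap_apply, e1] at hi
          exact hne hi.symm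
        have h4 : i ≠ ((π (t + 1) : ℤ) : ZMod N) := by
          rintro rfl
          rw [circle_eq_self_iff, cap_apply, e2] at hi
          exact hne hi
        rwa [(π.cap_off h1 h2 (hoff i h1 h2 h3 h4).1 (hoff i h1 h2 h3 h4).2).1] at hi
      refine ⟨1, 0, one_pos, ?_, fun _ => ⟨by simp [c1], by simpa using Finset.card_le_card hsub⟩⟩
      have := capOp_pairVec_join (D' := (π.cap t).dir) (P' := (π.cap t).circle) hy hs
        (x := ((π t : ℤ) : ZMod N)) (z := ((π (t + 1) : ℤ) : ZMod N))
        (by rw [circle_intCast]) (by rw [hu, circle_intCast]) ho'.1 ho'.2 oz'.1 oz'.2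
        (by rw [dir_intCast, dir_intCast, i1, ← Int.sign_neg]; congr 1; ring)
        (by rw [hu, dir_intCast, dir_intCast, i2, ← Int.sign_neg]; congr 1; ring)
        (by
          rw [hu, dir_intCast, dir_intCast, dir_intCast, cap_apply, e1]
          rcases lt_or_gt_of_ne c3 with h1 | h1
          · rcases lt_or_gt_of_ne c4 with h2 | h2
            · have := p3 h2
              rw [sign_neg_one (a := π (t + 1) - π t) (by omega), sign_neg_one (by omega),
                sign_neg_one (by omega)]; rfl
            · rw [sign_one (a := π (t + 1) - π t) (by omega), sign_one (by omega),
                sign_neg_one (by omega)]; rfl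
          · have := p2 h1
            rw [sign_neg_one (a := π (t + 1) - π t) (by omega), sign_one (by omega),
                sign_one (by omega)]; rfl)
        (by rw [dir_intCast, dir_intCast, cap_apply, cap_apply, e1, e2, ← Int.sign_neg]; congr 1; ring)
        (by rw [circle_intCast, cap_apply, e1]) (by rw [circle_intCast, cap_apply, e2])
        (fun i h1 h2 h3 h4 => (π.cap_off h1 h2 (hoff i h1 h2 h3 h4).1 (hoff i h1 h2 h3 h4).2).1)
        (fun i h1 h2 h3 h4 => (π.cap_off h1 h2 (hoff i h1 h2 h3 h4).1 (hoff i h1 h2 h3 h4).2).2)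
      simpa using this

end AnnularPairing

end BKW

end

noncomputable section

namespace BKW

/-! ### Products of cap-cup operators -/

section expansion

variable {N : ℕ} [NeZero N]

/-- The cap-cup operator as a linear map. -/
def capLin (y : ℂ) (j : ZMod N) : ((ZMod N → Bool) → ℂ) →ₗ[ℂ] ((ZMod N → Bool) → ℂ) where
  toFun := capOp y j
  map_add' F G := by
    funext σ
    simp only [capOp, Pi.add_apply, Fintype.sum_bool]
    split_ifs <;> ring
  map_smul' a F := by
    funext σ
    simp only [capOp, Pi.smul_apply, Fintype.sum_bool, smul_eq_mul, RingHom.id_apply]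
    split_ifs <;> ring

/-- The ordered product of the cap-cup operators at the times where `ε` is true. -/
def pathOp (y : ℂ) (ε : ℕ → Bool) : ℕ → ((ZMod N → Bool) → ℂ)
  | 0 => 1
  | t + 1 => if ε t = true then capOp y (t : ZMod N) (pathOp y ε t) else pathOp y ε t

theorem vec_emptyPairing (y : ℂ) (hN : 2 ≤ N) : (emptyPairing N hN).vec y = 1 := by
  funext σ
  have h : ∀ i : ZMod N, (emptyPairing N hN).circle i = i := by
    intro i
    simp [AnnularPairing.circle, emptyPairing]
  have h' : ∀ i : ZMod N, (emptyPairing N hN).dir i = 0 := by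
    intro i
    simp [AnnularPairing.dir, emptyPairing]
  simp [AnnularPairing.vec, pairVec, h, h']

theorem loopCount_succ (hN : 2 ≤ N) (ε : ℕ → Bool) (T : ℕ) :
    loopCount N hN ε (T + 1) = loopCount N hN ε T +
      if ε T = true ∧ pairingAt N hN ε T T = T + 1 then 1 else 0 := by
  classical
  rw [loopCount, loopCount, Finset.range_add_one, Finset.filter_insert]
  split_ifs with h
  · rw [Finset.card_insert_of_notMem (by simp)]
  · rfl

/-- Iteration of `capOp_vec`. Each factor `c` uses up defects, so at most `N` of them occur. Once
the defects are gone, loops around the annulus may appear and only positivity of the constant is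
retained. -/
theorem pathOp_eq {y : ℂ} {r c : ℝ} (hy : y ≠ 0) (hr : y ^ (4 : ℤ) + y ^ (-4 : ℤ) = r)
    (hc : y ^ (2 : ℤ) + y ^ (-2 : ℤ) = c) (hr0 : 0 < r) (hc0 : 0 < c) (hN : 2 ≤ N)
    (ε : ℕ → Bool) (T : ℕ) :
    ∃ (k : ℝ) (e : ℕ), 0 < k ∧ pathOp y ε T = (k : ℂ) • (pairingAt N hN ε T).vec y ∧
      ((pairingAt N hN ε T).HasDefect → k = r ^ loopCount N hN ε T * c ^ e ∧
        (pairingAt N hN ε T).defects.card + e ≤ N) := by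
  induction T with
  | zero =>
    refine ⟨1, 0, one_pos, ?_, fun _ => ⟨?_, ?_⟩⟩
    · simp only [pathOp, pairingAt, vec_emptyPairing]; simp
    · simp [loopCount]
    · simpa using (pairingAt N hN ε 0).defects.card_le_univ
  | succ T ih =>
    obtain ⟨k, e, hk, h1, h2⟩ := ih
    cases h : ε T with
    | false =>
      refine ⟨k, e, hk, ?_, ?_⟩
      · simp [pathOp, h, pairingAt_id hN h, h1]
      · rw [pairingAt_id hN h, loopCount_succ]; simpa [h] using h2
    | true =>
      obtain ⟨k', e', hk', g1, g2⟩ := (pairingAt N hN ε T).capOp_vec hy hr hc hr0 hc0 T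
      refine ⟨k * k', e + e', mul_pos hk hk', ?_, ?_⟩
      · rw [pairingAt_cap hN h]
        simp only [pathOp, h, if_true, h1]
        have := (capLin y (T : ZMod N)).map_smul (k : ℂ) ((pairingAt N hN ε T).vec y)
        change capOp y (T : ZMod N) _ = (k : ℂ) • capOp y (T : ZMod N) _ at this
        rw [this]
        rw [Int.cast_natCast] at g1
        rw [g1, smul_smul]
        push_cast
        rfl
      · rw [pairingAt_cap hN h]
        intro hd
        obtain ⟨a1, a2⟩ := h2 hd.of_cap
        obtain ⟨b1, b2⟩ := g2 hd
        refine ⟨?_, by omega⟩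
        rw [a1, b1, loopCount_succ, pow_add, pow_add]
        simp only [h, true_and]
        split_ifs <;> ring

/-- The product of the operators `e_t` (at forced times) and `1 + e_t` (at the other times). -/
def opSeq (y : ℂ) (forced : ℕ → Bool) : ℕ → ((ZMod N → Bool) → ℂ)
  | 0 => 1
  | t + 1 => if forced t = true then capOp y (t : ZMod N) (opSeq y forced t)
      else opSeq y forced t + capOp y (t : ZMod N) (opSeq y forced t)

/-- The free times before `T`. -/
def freeTimes (forced : ℕ → Bool) (T : ℕ) : Finset ℕ := (Finset.range T).filter fun s => forced s = false

/-- The choice of operators given by a set of free times. -/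
def choice (forced : ℕ → Bool) (A : Finset ℕ) (s : ℕ) : Bool := forced s || decide (s ∈ A)

theorem pathOp_congr (y : ℂ) {ε ε' : ℕ → Bool} {T : ℕ} (h : ∀ s < T, ε s = ε' s) :
    (pathOp y ε T : (ZMod N → Bool) → ℂ) = pathOp y ε' T := by
  induction T with
  | zero => rfl
  | succ T ih => simp only [pathOp, h T (by omega), ih fun s hs => h s (by omega)]

theorem opSeq_eq_sum (y : ℂ) (forced : ℕ → Bool) (T : ℕ) :
    (opSeq y forced T : (ZMod N → Bool) → ℂ) =
      ∑ A ∈ (freeTimes forced T).powerset, pathOp y (choice forced A) T := by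
  induction T with
  | zero => simp [opSeq, freeTimes, pathOp]
  | succ T ih =>
    have hcap : ∀ A : Finset (Finset ℕ), capOp y (T : ZMod N) (∑ a ∈ A, pathOp y (choice forced a) T) =
        ∑ a ∈ A, capOp y (T : ZMod N) (pathOp y (choice forced a) T) :=
      fun A => map_sum (capLin y (T : ZMod N)) _ _
    cases h : forced T with
    | true =>
      have : freeTimes forced (T + 1) = freeTimes forced T := by
        simp [freeTimes, Finset.range_add_one, Finset.filter_insert, h]
      rw [this]
      simp only [opSeq, h, if_true, ih, hcap]
      refine Finset.sum_congr rfl fun A _ => ?_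
      simp [pathOp, choice, h]
    | false =>
      have : freeTimes forced (T + 1) = insert T (freeTimes forced T) := by
        simp [freeTimes, Finset.range_add_one, Finset.filter_insert, h]
      rw [this, Finset.sum_powerset_insert (by simp [freeTimes])]
      simp only [opSeq, h, ih, hcap, Bool.false_eq_true, if_false]
      congr 1
      · refine Finset.sum_congr rfl fun A hA => ?_
        have hT : T ∉ A := fun hT => by
          have := Finset.mem_powerset.mp hA hT
          simp [freeTimes] at this
        simp [pathOp, choice, h, hT]
      · refine Finset.sum_congr rfl fun A hA => ?_
        rw [pathOp_congr y (ε' := choice forced (insert T A)) (T := T)]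
        · simp [pathOp, choice, h]
        · intro s hs
          simp [choice, hs.ne]

/-! ### Spin sums in sectors of given flux. -/

/-- The total spin. -/
def flux {α : Type*} [Fintype α] (σ : α → Bool) : ℤ := ∑ i, sgn (σ i)

theorem flux_eq {α : Type*} [Fintype α] (σ : α → Bool) :
    flux σ = 2 * (Finset.univ.filter fun i => σ i = true).card - Fintype.card α := by
  rw [flux, Finset.card_filter, Finset.card_univ.symm, Finset.card_eq_sum_ones]
  push_cast
  rw [Finset.mul_sum, ← Finset.sum_sub_distrib]
  refine Finset.sum_congr rfl fun i _ => ?_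
  cases σ i <;> simp

theorem exists_flux_eq {α : Type*} [Fintype α] {m n : ℕ} (hm : Fintype.card α = 2 * m)
    (h : n ≤ m) : ∃ σ : α → Bool, flux σ = 2 * n := by
  classical
  obtain ⟨s, -, hs⟩ := Finset.exists_subset_card_eq (s := (Finset.univ : Finset α)) (n := m + n)
    (by rw [Finset.card_univ]; omega)
  refine ⟨fun i => decide (i ∈ s), ?_⟩
  rw [flux_eq]
  simp only [decide_eq_true_eq, Finset.filter_mem_eq_inter, Finset.univ_inter, hs, hm]
  push_cast; ring

theorem flux_le {α : Type*} [Fintype α] (σ : α → Bool) : flux σ ≤ Fintype.card α := by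
  rw [flux_eq]
  have : (Finset.univ.filter fun i => σ i = true).card ≤ Fintype.card α := Finset.card_le_univ _
  omega

/-- The sum of a function over the spin configurations of given flux. -/
def sectorSum (m : ℤ) (F : (ZMod N → Bool) → ℂ) : ℂ := ∑ σ, if flux σ = m then F σ else 0

theorem prod_zpow_eq {α : Type*} {y : ℂ} (hy : y ≠ 0) (s : Finset α) (f : α → ℤ) :
    ∏ i ∈ s, y ^ f i = y ^ ∑ i ∈ s, f i := by
  classical
  induction s using Finset.induction_on with
  | empty => simp
  | insert a s ha ih => rw [Finset.prod_insert ha, Finset.sum_insert ha, ih, zpow_add₀ hy]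

-- The two ends of an arc have opposite spins, so arcs do not contribute to the flux, and each arc
-- contributes `y² + y⁻²` independently of the rest. Only the spins of the defects have to produce
-- the flux `m`, and they carry no weight.
open Classical in
theorem sectorSum_pairVec {y : ℂ} (hy : y ≠ 0) {P : ZMod N → ZMod N} {D : ZMod N → ℤ}
    (hP : ∀ i, P (P i) = i) (h0 : ∀ i, P i = i → D i = 0)
    (h1 : ∀ i, P i ≠ i → D i = 1 ∨ D i = -1) (hD : ∀ i, D (P i) = - D i) (m : ℤ) :
    sectorSum m (pairVec y P D) =
      (Finset.univ.filter fun δ : {i // P i = i} → Bool => flux δ = m).card *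
        (y ^ (2 : ℤ) + y ^ (-2 : ℤ)) ^ Fintype.card {i // D i = 1} := by
  have hO : ∀ i, D i = 1 → P i ≠ i := fun i h g => by rw [h0 i g] at h; omega
  have hC : ∀ i, P i ≠ i → D i ≠ 1 → D (P i) = 1 := fun i g g' => by
    rw [hD, (h1 i g).resolve_left g']; rfl
  have hsum : ∀ (f : ZMod N → ℤ), (∀ i, P i ≠ i → f (P i) = - f i) →
      ∑ i, f i = ∑ i : {i // P i = i}, f i := by
    intro f hf
    rw [← Finset.sum_filter_add_sum_filter_not Finset.univ (fun i => P i = i),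
      Finset.sum_subtype (p := fun i => P i = i) _ (by simp)]
    have : ∑ i with ¬ P i = i, f i = 0 := by
      refine Finset.sum_involution (fun i _ => P i) ?_ ?_ ?_ ?_
      · intro i hi; rw [hf i (by simpa using hi)]; ring
      · intro i hi _; simpa using hi
      · intro i hi; simp only [Finset.mem_filter, Finset.mem_univ, true_and] at hi ⊢
        rw [hP]; exact Ne.symm hi
      · intro i _; exact hP i
    rw [this, add_zero]
  have hsum2 : ∀ (f : ZMod N → ℤ), (∀ i, P i ≠ i → f (P i) = f i) →
      (∀ i, P i = i → f i = 0) → ∑ i, f i = 2 * ∑ i : {i // D i = 1}, f i := by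
    intro f hf hf0
    have h2 := hsum (fun i => f i * D i) (fun i hi => by rw [hf i hi, hD]; ring)
    have h3 : ∑ i : {i // P i = i}, f i * D i = 0 :=
      Finset.sum_eq_zero fun i _ => by rw [hf0 i i.2]; ring
    have h4 : ∀ i, f i + f i * D i = if D i = 1 then 2 * f i else 0 := by
      intro i
      by_cases hi : P i = i
      · simp [hf0 i hi]
      · rcases h1 i hi with g | g
        · rw [g, if_pos rfl]; ring
        · rw [g, if_neg (by omega)]; ring
    have h5 : ∑ i, f i = ∑ i, (f i + f i * D i) := by
      rw [Finset.sum_add_distrib, h2, h3, add_zero]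
    rw [h5, Finset.sum_congr rfl fun i _ => h4 i, ← Finset.sum_filter, ← Finset.mul_sum]
    congr 1
    exact Finset.sum_subtype _ (by simp) _
  have key : sectorSum m (pairVec y P D) =
      ∑ x : ({i // P i = i} → Bool) × ({i // D i = 1} → Bool),
        if flux x.1 = m then ∏ i, y ^ (2 * sgn (x.2 i)) else 0 := by
    rw [sectorSum]
    have : ∀ σ : ZMod N → Bool, (if flux σ = m then pairVec y P D σ else 0) =
        if (∀ i, P i ≠ i → σ (P i) = !σ i) then
          (if flux (fun i : {i // P i = i} => σ i) = m then
            ∏ i : {i // D i = 1}, y ^ (2 * sgn (σ i)) else 0) else 0 := by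
      intro σ
      by_cases hv : ∀ i, P i ≠ i → σ (P i) = !σ i
      · have e1 : flux σ = flux (fun i : {i // P i = i} => σ i) := by
          rw [flux, flux, hsum (fun i => sgn (σ i)) (fun i hi => by rw [hv i hi, sgn_not])]
        have e2 := hsum2 (fun i => D i * sgn (σ i))
          (fun i hi => by rw [hv i hi, sgn_not, hD]; ring) (fun i hi => by rw [h0 i hi]; ring)
        rw [e1, if_pos hv, pairVec, if_pos hv, e2, prod_zpow_eq hy]
        rw [Finset.mul_sum]
        congr 2
        refine Finset.sum_congr rfl fun i _ => ?_
        rw [i.2, one_mul]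
      · rw [if_neg hv, pairVec, if_neg hv, ite_self]
    rw [Finset.sum_congr rfl fun σ _ => this σ, ← Finset.sum_filter]
    -- A configuration is rebuilt from the spins of the defects and the spins at the ends with
    -- direction `1`, one for each arc.
    let G : ({i // P i = i} → Bool) × ({i // D i = 1} → Bool) → ZMod N → Bool := fun x i =>
      if h : P i = i then x.1 ⟨i, h⟩ else
        if h' : D i = 1 then x.2 ⟨i, h'⟩ else !x.2 ⟨P i, hC i h h'⟩
    refine Finset.sum_nbij' (fun σ => (fun i => σ i, fun i => σ i)) G ?_ ?_ ?_ ?_ ?_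
    · intro σ _; exact Finset.mem_univ _
    · intro x _
      simp only [Finset.mem_filter, Finset.mem_univ, true_and]
      intro i hi
      have hi' : P (P i) ≠ P i := by rw [hP]; exact Ne.symm hi
      by_cases hd : D i = 1
      · have : D (P i) ≠ 1 := by rw [hD, hd]; decide
        simp only [G, dif_neg hi, dif_neg hi', dif_pos hd, dif_neg this, hP]
      · have : D (P i) = 1 := hC i hi hd
        simp only [G, dif_neg hi, dif_neg hi', dif_neg hd, dif_pos this, Bool.not_not]
    · intro σ hσ
      simp only [Finset.mem_filter, Finset.mem_univ, true_and] at hσ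
      funext i
      by_cases hi : P i = i
      · simp [G, hi]
      by_cases hd : D i = 1
      · simp [G, hi, hd]
      · simp [G, hi, hd, hσ i hi]
    · intro x _
      refine Prod.ext ?_ ?_
      · funext i; simp [G, i.2]
      · funext i; simp [G, i.2, hO i.1 i.2]
    · intro σ _; rfl
  rw [key, Fintype.sum_prod_type]
  have : ∀ δ : {i // P i = i} → Bool, ∑ o : {i // D i = 1} → Bool,
      (if flux δ = m then ∏ i, y ^ (2 * sgn (o i)) else 0) =
      if flux δ = m then (y ^ (2 : ℤ) + y ^ (-2 : ℤ)) ^ Fintype.card {i // D i = 1} else 0 := by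
    intro δ
    split_ifs
    · rw [← Finset.card_univ, ← Finset.prod_const]
      have := (Finset.prod_univ_sum (fun _ : {i // D i = 1} => (Finset.univ : Finset Bool))
        (fun _ b => y ^ (2 * sgn b))).symm
      rw [Fintype.piFinset_univ] at this
      rw [this]
      refine Finset.prod_congr rfl fun i _ => ?_
      rw [Fintype.sum_bool]; simp
    · simp
  rw [Finset.sum_congr rfl fun δ _ => this δ, ← Finset.sum_filter, Finset.sum_const, nsmul_eq_mul]

end expansion

/-! ### Parities of the defects, and loop sums by number of defects. -/

namespace AnnularPairing

variable {N : ℕ} [NeZero N] (π : AnnularPairing N)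

/-- The points strictly under an arc form a closed interval, which has an even number of points. -/
theorem odd_sub {i : ℤ} (h : π i ≠ i) : Odd (π i - i) := by
  have key : ∀ i, i < π i → Odd (π i - i) := by
    intro i h1
    have := (π.nc i h1).even π.invol (by omega)
    rw [← Int.not_even_iff_odd]
    intro h2
    have h3 := h2.sub this
    rw [show π i - i - (π i - 1 - i) = 1 by ring] at h3
    exact absurd h3 (by decide)
  rcases lt_or_gt_of_ne h with h1 | h1
  · have := key (π i) (by rw [π.invol]; exact h1)
    rw [π.invol] at this
    simpa using this.neg
  · exact key i h1

open Classical in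
/-- The odd defects, as points of the circle. -/
def oddDefects : Finset (ZMod N) := π.defects.filter fun i => Odd i.val

theorem odd_val_intCast (hE : Even N) (z : ℤ) : Odd (z : ZMod N).val ↔ Odd z := by
  obtain ⟨k, hk⟩ := translate_val (N := N) z
  have : Odd ((z : ZMod N).val : ℤ) ↔ Odd z := by
    rw [hk]
    have : Even (k * (N : ℤ)) := ((Int.even_coe_nat N).mpr hE).mul_left k
    rw [Int.odd_add]
    simp [this]
  rw [← this]
  exact (Int.odd_coe_nat _).symm

/-- Alternating signs sum to zero around a circle of even length, and the two ends of an arc cancel.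
Hence the defects alone also have sum zero: half of them are odd. -/
theorem card_defects (hE : Even N) : π.defects.card = 2 * π.oddDefects.card := by
  classical
  set χ : ZMod N → ℤ := fun i => if Odd i.val then 1 else -1 with hχ
  have hχz : ∀ z : ℤ, χ (z : ZMod N) = if Odd z then 1 else -1 := fun z => by
    simp only [hχ, odd_val_intCast hE]
  have h1 : ∑ i, χ i = 0 := by
    have h2 : ∑ i, χ (i + 1) = ∑ i, χ i := Equiv.sum_comp (Equiv.addRight (1 : ZMod N)) χ
    have h3 : ∀ i, χ (i + 1) = - χ i := by
      intro i
      obtain ⟨z, rfl⟩ := exists_intCast i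
      have := hχz (z + 1)
      push_cast at this
      rw [this, hχz]
      by_cases h : Odd z
      · have : ¬ Odd (z + 1) := by rw [Int.not_odd_iff_even]; exact h.add_one
        simp [h, this]
      · have : Odd (z + 1) := (Int.not_odd_iff_even.mp h).add_one
        simp [h, this]
    rw [Finset.sum_congr rfl fun i _ => h3 i, Finset.sum_neg_distrib] at h2
    omega
  have h4 : ∑ i with ¬ π.circle i = i, χ i = 0 := by
    refine Finset.sum_involution (fun i _ => π.circle i) ?_ ?_ ?_ ?_
    · intro i hi
      obtain ⟨z, rfl⟩ := exists_intCast i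
      simp only [Finset.mem_filter, Finset.mem_univ, true_and, circle_eq_self_iff] at hi
      have := π.odd_sub hi
      rw [circle_intCast, hχz, hχz]
      by_cases h : Odd z
      · have h' : ¬ Odd (π z) := fun h' => by
          have := this.add_odd h; simp only [sub_add_cancel] at this
          exact (Int.not_even_iff_odd.mpr h') this
        simp [h, h']
      · have h' : Odd (π z) := by
          have := this.add_even (Int.not_odd_iff_even.mp h); simpa using this
        simp [h, h']
    · intro i hi _; simpa using hi
    · intro i hi; simp only [Finset.mem_filter, Finset.mem_univ, true_and] at hi ⊢
      rw [π.circle_invol]; exact Ne.symm hi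
    · intro i _; exact π.circle_invol i
  rw [← Finset.sum_filter_add_sum_filter_not Finset.univ (fun i => π.circle i = i), h4, add_zero] at h1
  have h5 : ∑ i ∈ π.defects, χ i = 2 * π.oddDefects.card - π.defects.card := by
    rw [oddDefects, Finset.card_filter, Finset.card_eq_sum_ones]
    push_cast
    rw [Finset.mul_sum, ← Finset.sum_sub_distrib]
    refine Finset.sum_congr rfl fun i _ => ?_
    simp only [hχ]
    split_ifs <;> simp
  have h6 : ∑ i ∈ π.defects, χ i = 0 := h1
  omega

/-- The spin sums of the vectors attached to pairings. -/
theorem sectorSum_vec {y : ℂ} {c : ℝ} (hy : y ≠ 0) (hc : y ^ (2 : ℤ) + y ^ (-2 : ℤ) = c)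
    (hE : Even N) (hc1 : 1 ≤ c) (n : ℕ) :
    ∃ x : ℝ, sectorSum (2 * n) (π.vec y) = x ∧ (¬ n ≤ π.oddDefects.card → x = 0) ∧
      (n ≤ π.oddDefects.card → 1 ≤ x ∧ x ≤ 2 ^ N * c ^ N) := by
  classical
  have h := sectorSum_pairVec hy (P := π.circle) (D := π.dir) π.circle_invol
    (fun i hi => by
      obtain ⟨z, rfl⟩ := exists_intCast i
      rw [circle_eq_self_iff] at hi
      rw [dir_intCast, hi]; simp)
    (fun i hi => by
      obtain ⟨z, rfl⟩ := exists_intCast i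
      rw [Ne, circle_eq_self_iff] at hi
      rw [dir_intCast]
      rcases lt_or_gt_of_ne hi with h | h
      · right; exact sign_neg_one (by omega)
      · left; exact sign_one (by omega))
    (fun i => by
      obtain ⟨z, rfl⟩ := exists_intCast i
      rw [circle_intCast, dir_intCast, dir_intCast, π.invol, ← Int.sign_neg]; congr 1; ring)
    (2 * n)
  rw [hc] at h
  have hcard : Fintype.card {i // π.circle i = i} = 2 * π.oddDefects.card := by
    rw [← π.card_defects hE, Fintype.card_subtype]
    congr 1
  refine ⟨(Finset.univ.filter fun δ : {i // π.circle i = i} → Bool => flux δ = 2 * n).card *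
    c ^ Fintype.card {i // π.dir i = 1}, by rw [h]; push_cast; rfl, fun hn => ?_, fun hn => ?_⟩
  · rw [Finset.filter_eq_empty_iff.mpr]
    · simp
    intro δ _ hδ
    have := flux_le δ
    rw [hcard, hδ] at this
    push_cast at this
    omega
  · obtain ⟨δ, hδ⟩ := exists_flux_eq hcard hn
    have h1 : 1 ≤ (Finset.univ.filter fun δ : {i // π.circle i = i} → Bool => flux δ = 2 * n).card :=
      Finset.card_pos.mpr ⟨δ, by simp [hδ]⟩
    have h2 : (Finset.univ.filter fun δ : {i // π.circle i = i} → Bool => flux δ = 2 * n).card ≤ 2 ^ N := by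
      refine (Finset.card_le_univ _).trans ?_
      rw [Fintype.card_fun, Fintype.card_bool]
      refine Nat.pow_le_pow_right (by norm_num) ?_
      simpa using Fintype.card_subtype_le (fun i : ZMod N => π.circle i = i)
    have h3 : Fintype.card {i // π.dir i = 1} ≤ N := by
      simpa using Fintype.card_subtype_le (fun i : ZMod N => π.dir i = 1)
    constructor
    · exact one_le_mul_of_one_le_of_one_le (by exact_mod_cast h1) (one_le_pow₀ hc1)
    · exact mul_le_mul (by exact_mod_cast h2) (pow_le_pow_right₀ hc1 h3) (by positivity) (by positivity)

end AnnularPairing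

open Classical in
/-- The loop expansion restricted to choices with at least `2 n` defects. -/
def loopSum (N : ℕ) [NeZero N] (hN : 2 ≤ N) (r : ℝ) (forced : ℕ → Bool) (T n : ℕ) : ℝ :=
  ∑ A ∈ (freeTimes forced T).powerset,
    if n ≤ (pairingAt N hN (choice forced A) T).oddDefects.card then
      r ^ loopCount N hN (choice forced A) T else 0

/-- The spin sums in a sector of positive flux are comparable to the loop sums. -/
theorem sectorSum_opSeq {N : ℕ} [NeZero N] {y : ℂ} {r c : ℝ} (hy : y ≠ 0)
    (hr : y ^ (4 : ℤ) + y ^ (-4 : ℤ) = r)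
    (hc : y ^ (2 : ℤ) + y ^ (-2 : ℤ) = c) (hr0 : 0 < r) (hc1 : 1 ≤ c) (hN : 2 ≤ N) (hE : Even N)
    (forced : ℕ → Bool) (T n : ℕ) (hn : 1 ≤ n) :
    ∃ x : ℝ, sectorSum (2 * n) (opSeq y forced T : (ZMod N → Bool) → ℂ) = x ∧
      loopSum N hN r forced T n ≤ x ∧
      x ≤ c ^ N * (2 ^ N * c ^ N) * loopSum N hN r forced T n := by
  classical
  have hc0 : 0 < c := by linarith
  have hlin : ∀ (A : Finset (Finset ℕ)) (f : Finset ℕ → (ZMod N → Bool) → ℂ),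
      sectorSum (2 * n) (∑ a ∈ A, f a) = ∑ a ∈ A, sectorSum (2 * n) (f a) := by
    intro A f
    simp only [sectorSum]
    rw [Finset.sum_comm]
    refine Finset.sum_congr rfl fun σ _ => ?_
    split_ifs
    · rw [Finset.sum_apply]
    · simp
  have hsmul : ∀ (k : ℂ) (f : (ZMod N → Bool) → ℂ),
      sectorSum (2 * n) (k • f) = k * sectorSum (2 * n) f := by
    intro k f
    simp only [sectorSum, Finset.mul_sum]
    refine Finset.sum_congr rfl fun σ _ => ?_
    split_ifs <;> simp
  have hterm : ∀ A : Finset ℕ, ∃ x : ℝ,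
      sectorSum (2 * n) (pathOp y (choice forced A) T : (ZMod N → Bool) → ℂ) = x ∧
      (if n ≤ (pairingAt N hN (choice forced A) T).oddDefects.card then
        r ^ loopCount N hN (choice forced A) T else 0) ≤ x ∧
      x ≤ c ^ N * (2 ^ N * c ^ N) *
        (if n ≤ (pairingAt N hN (choice forced A) T).oddDefects.card then
        r ^ loopCount N hN (choice forced A) T else 0) := by
    intro A
    obtain ⟨k, e, hk, h1, h2⟩ := pathOp_eq hy hr hc hr0 hc0 hN (choice forced A) T
    obtain ⟨x, g1, g2, g3⟩ := (pairingAt N hN (choice forced A) T).sectorSum_vec hy hc hE hc1 n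
    refine ⟨k * x, by rw [h1, hsmul, g1]; push_cast; rfl, ?_⟩
    by_cases hle : n ≤ (pairingAt N hN (choice forced A) T).oddDefects.card
    · obtain ⟨g4, g5⟩ := g3 hle
      -- This is where `n ≥ 1` enters: a defect is present at the end, hence no loop around the
      -- annulus was ever closed and the constant in `pathOp_eq` is explicit.
      have hd : (pairingAt N hN (choice forced A) T).HasDefect := by
        rw [AnnularPairing.hasDefect_iff]
        obtain ⟨i, hi⟩ := Finset.card_pos.mp (show 0 < (pairingAt N hN (choice forced A) T).oddDefects.card by omega)
        exact ⟨i, (AnnularPairing.mem_defects _).mp (Finset.mem_filter.mp hi).1⟩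
      obtain ⟨h3, h4⟩ := h2 hd
      rw [if_pos hle, h3]
      have hrl : 0 < r ^ loopCount N hN (choice forced A) T := by positivity
      have he1 : 1 ≤ c ^ e := one_le_pow₀ hc1
      have he2 : c ^ e ≤ c ^ N := pow_le_pow_right₀ hc1 (by omega)
      constructor
      · calc r ^ loopCount N hN (choice forced A) T
            = r ^ loopCount N hN (choice forced A) T * 1 * 1 := by ring
          _ ≤ _ := by gcongr
      · calc r ^ loopCount N hN (choice forced A) T * c ^ e * x
            ≤ r ^ loopCount N hN (choice forced A) T * c ^ N * (2 ^ N * c ^ N) := by gcongr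
          _ = _ := by ring
    · rw [if_neg hle, g2 hle]; simp
  choose x hx1 hx2 hx3 using hterm
  refine ⟨∑ A ∈ (freeTimes forced T).powerset, x A, ?_, ?_, ?_⟩
  · rw [opSeq_eq_sum, hlin]
    push_cast
    exact Finset.sum_congr rfl fun A _ => hx1 A
  · exact Finset.sum_le_sum fun A _ => hx2 A
  · rw [loopSum, Finset.mul_sum]
    exact Finset.sum_le_sum fun A _ => hx3 A

end BKW

end

noncomputable section

namespace BKW

/-! ### Cyclic sums as traces -/

section cyclic

variable {S : Type*} [Fintype S] [DecidableEq S] {R : Type*} [CommRing R]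

/-- The ordered product of the first `n` matrices of a sequence. -/
def matProd (A : ℕ → Matrix S S R) : ℕ → Matrix S S R
  | 0 => 1
  | n + 1 => matProd A n * A n

theorem matProd_const (A : Matrix S S R) (n : ℕ) : matProd (fun _ => A) n = A ^ n := by
  induction n with
  | zero => rfl
  | succ n ih => rw [matProd, ih, pow_succ]

theorem matProd_congr {A B : ℕ → Matrix S S R} {n : ℕ} (h : ∀ i < n, A i = B i) :
    matProd A n = matProd B n := by
  induction n with
  | zero => rfl
  | succ n ih => rw [matProd, matProd, ih fun i hi => h i (by omega), h n (by omega)]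

theorem matProd_succ_apply (A : ℕ → Matrix S S R) (n : ℕ) (a b : S) :
    matProd A (n + 1) a b = ∑ g : Fin (n + 1) → S, if g (Fin.last n) = b then
      ∏ i : Fin (n + 1), A i ((Fin.cons a g : Fin (n + 2) → S) i.castSucc) (g i) else 0 := by
  induction n generalizing b with
  | zero =>
    rw [matProd, matProd, Matrix.one_mul, ← (Equiv.funUnique (Fin 1) S).symm.sum_comp]
    simp
  | succ n ih =>
    rw [matProd, Matrix.mul_apply, ← (Fin.snocEquiv (fun _ : Fin (n + 2) => S)).sum_comp,
      Fintype.sum_prod_type]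
    have h1 : ∀ (s : S) (g : Fin (n + 1) → S),
        ∏ i : Fin (n + 2), A i
          ((Fin.cons a (Fin.snoc g s : Fin (n + 2) → S) : Fin (n + 3) → S) i.castSucc)
          ((Fin.snoc g s : Fin (n + 2) → S) i) =
        (∏ i : Fin (n + 1), A i ((Fin.cons a g : Fin (n + 2) → S) i.castSucc) (g i)) *
          A (n + 1) (g (Fin.last n)) s := by
      intro s g
      rw [Fin.prod_univ_castSucc]
      congr 1
      · refine Finset.prod_congr rfl fun i _ => ?_
        rw [Fin.cons_snoc_eq_snoc_cons, Fin.snoc_castSucc, Fin.snoc_castSucc]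
        rfl
      · rw [Fin.cons_snoc_eq_snoc_cons, Fin.snoc_castSucc, Fin.snoc_last]
        rfl
    have h2 : ∀ s : S, ∑ g : Fin (n + 1) → S,
        (if (Fin.snocEquiv (fun _ : Fin (n + 2) => S)) (s, g) (Fin.last (n + 1)) = b then
          ∏ i : Fin (n + 2), A i ((Fin.cons a ((Fin.snocEquiv (fun _ : Fin (n + 2) => S)) (s, g)) :
            Fin (n + 3) → S) i.castSucc) ((Fin.snocEquiv (fun _ : Fin (n + 2) => S)) (s, g) i)
          else 0) = if s = b then ∑ g : Fin (n + 1) → S,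
        (∏ i : Fin (n + 1), A i ((Fin.cons a g : Fin (n + 2) → S) i.castSucc) (g i)) *
          A (n + 1) (g (Fin.last n)) s else 0 := by
      intro s
      have h3 : ∀ g : Fin (n + 1) → S, (Fin.snocEquiv (fun _ : Fin (n + 2) => S)) (s, g) =
        (Fin.snoc g s : Fin (n + 2) → S) := fun g => rfl
      simp only [h3, Fin.snoc_last, h1]
      split_ifs <;> simp
    rw [Finset.sum_congr rfl fun s _ => h2 s]
    rw [Finset.sum_ite_eq' Finset.univ b, if_pos (Finset.mem_univ _)]
    simp only [ih, Finset.sum_mul]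
    rw [Finset.sum_comm]
    refine Finset.sum_congr rfl fun g _ => ?_
    simp only [ite_mul, zero_mul]
    rw [Finset.sum_ite_eq Finset.univ, if_pos (Finset.mem_univ _)]

theorem sum_cyclic (A : ℕ → Matrix S S R) (L : ℕ) [NeZero L] :
    ∑ h : ZMod L → S, ∏ x : ZMod L, A x.val (h (x - 1)) (h x) = (matProd A L).trace := by
  obtain ⟨n, rfl⟩ : ∃ n, L = n + 1 := ⟨L - 1, by have := NeZero.pos L; omega⟩
  rw [Matrix.trace]
  simp only [Matrix.diag_apply, matProd_succ_apply]
  rw [Finset.sum_comm]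
  change ∑ h : Fin (n + 1) → S, ∏ x : Fin (n + 1), A x.val (h (x - 1)) (h x) = _
  refine Finset.sum_congr rfl fun g _ => ?_
  rw [Finset.sum_ite_eq Finset.univ, if_pos (Finset.mem_univ _)]
  refine Finset.prod_congr rfl fun i _ => ?_
  congr 1
  refine Fin.cases ?_ (fun j => ?_) i
  · rw [Fin.castSucc_zero, Fin.cons_zero]; congr 1
    exact Fin.ext (by simp)
  · rw [Fin.castSucc_succ, Fin.cons_succ]
    congr 1
    rw [Fin.ext_iff, Fin.coe_sub_one]
    simp

end cyclic

/-! ### Transfer matrices of the six-vertex model -/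

/-- The weight of a vertex with incoming (from left and below) and outgoing (to the right and above)
spins. -/
def vertexWeight (c : ℝ) (h v h' v' : Bool) : ℝ :=
  if sgn h + sgn v = sgn h' + sgn v' then (if h = h' then 1 else c) else 0

section transfer

variable {L : ℕ} [NeZero L]

/-- The entries of the row-to-row transfer matrix. -/
def rowWeight (c : ℝ) (w w' : ZMod L → Bool) : ℝ :=
  ∑ h : ZMod L → Bool, ∏ x, vertexWeight c (h (x - 1)) (w x) (h x) (w' x)

theorem vertexWeight_nonneg {c : ℝ} (hc : 0 ≤ c) (h v h' v' : Bool) :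
    0 ≤ vertexWeight c h v h' v' := by
  unfold vertexWeight
  split_ifs <;> norm_num [hc]

theorem rowWeight_nonneg {c : ℝ} (hc : 0 ≤ c) (w w' : ZMod L → Bool) : 0 ≤ rowWeight c w w' :=
  Finset.sum_nonneg fun _ _ => Finset.prod_nonneg fun _ _ => vertexWeight_nonneg hc _ _ _ _

/-- Reversing all horizontal arrows exchanges the roles of the lower and the upper row and preserves
every vertex weight. The symmetry makes Hilbert-Schmidt norms available. -/
theorem rowWeight_comm (c : ℝ) (w w' : ZMod L → Bool) : rowWeight c w w' = rowWeight c w' w := by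
  have e := Equiv.sum_comp (Equiv.arrowCongr (Equiv.refl (ZMod L)) Equiv.boolNot)
    (fun h => ∏ x, vertexWeight c (h (x - 1)) (w x) (h x) (w' x))
  rw [rowWeight, ← e, rowWeight]
  refine Finset.sum_congr rfl fun h _ => Finset.prod_congr rfl fun x _ => ?_
  simp only [Equiv.arrowCongr_apply, Function.comp, Equiv.refl_symm, Equiv.refl_apply,
    Equiv.boolNot_apply]
  cases h (x - 1) <;> cases h x <;> cases w x <;> cases w' x <;> simp [vertexWeight]

theorem rowWeight_self_ge {c : ℝ} (hc : 0 ≤ c) (w : ZMod L → Bool) : 1 ≤ rowWeight c w w := by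
  have : ∏ x : ZMod L, vertexWeight c true (w x) true (w x) = 1 := by simp [vertexWeight]
  rw [← this]
  exact Finset.single_le_sum (f := fun h : ZMod L → Bool =>
    ∏ x, vertexWeight c (h (x - 1)) (w x) (h x) (w x))
    (fun _ _ => Finset.prod_nonneg fun _ _ => vertexWeight_nonneg hc _ _ _ _)
    (Finset.mem_univ (fun _ : ZMod L => true))

/-- Summing the ice rule along the row, the horizontal spins cancel cyclically. -/
theorem flux_eq_of_rowWeight_ne_zero {c : ℝ} {w w' : ZMod L → Bool} (h : rowWeight c w w' ≠ 0) :
    flux w = flux w' := by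
  obtain ⟨g, -, hg⟩ := Finset.exists_ne_zero_of_sum_ne_zero h
  have h1 : ∀ x, sgn (g (x - 1)) + sgn (w x) = sgn (g x) + sgn (w' x) := by
    intro x
    have := Finset.prod_ne_zero_iff.mp hg x (Finset.mem_univ x)
    by_contra h2
    exact this (by rw [vertexWeight, if_neg h2])
  have h2 : ∑ x, (sgn (g (x - 1)) + sgn (w x)) = ∑ x, (sgn (g x) + sgn (w' x)) :=
    Finset.sum_congr rfl fun x _ => h1 x
  have h3 : ∑ x, sgn (g (x - 1)) = ∑ x, sgn (g x) :=
    Equiv.sum_comp (Equiv.subRight (1 : ZMod L)) (fun x => sgn (g x))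
  rw [Finset.sum_add_distrib, Finset.sum_add_distrib, h3] at h2
  exact add_left_cancel h2

/-- The rows of vertical arrows of given flux. -/
abbrev Sector (L : ℕ) (m : ℤ) [NeZero L] : Type := {w : ZMod L → Bool // flux w = m}

/-- The transfer matrix in a sector. -/
def transferMatrix (L : ℕ) [NeZero L] (c : ℝ) (m : ℤ) : Matrix (Sector L m) (Sector L m) ℝ :=
  fun w w' => rowWeight c w.1 w'.1

end transfer

/-! ### Partition functions of the torus as traces. -/

section torus

variable {L M : ℕ} [NeZero L] [NeZero M]

/-- The product of the vertex weights. -/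
def arrowsWeight (c : ℝ) (ω : Arrows L M) : ℝ :=
  ∏ v : Torus L M, vertexWeight c (ω.1 (v - (1, 0))) (ω.2 (v - (0, 1))) (ω.1 v) (ω.2 v)

open Classical in
theorem arrowsWeight_eq (c : ℝ) (ω : Arrows L M) :
    arrowsWeight c ω = if IceRule ω then sixVertexWeight c ω else 0 := by
  have key : ∀ v, inDegree ω v = 2 ↔
      sgn (ω.1 (v - (1, 0))) + sgn (ω.2 (v - (0, 1))) = sgn (ω.1 v) + sgn (ω.2 v) := by
    intro v
    unfold inDegree
    cases ω.1 (v - (1, 0)) <;> cases ω.2 (v - (0, 1)) <;> cases ω.1 v <;> cases ω.2 v <;> simp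
  split_ifs with h
  · have h1 : ∀ v, vertexWeight c (ω.1 (v - (1, 0))) (ω.2 (v - (0, 1))) (ω.1 v) (ω.2 v) =
        if IsTypeC ω v then c else 1 := by
      intro v
      rw [vertexWeight, if_pos ((key v).mp (h v)), IsTypeC]
      by_cases h2 : ω.1 (v - (1, 0)) = ω.1 v <;> simp [h2]
    rw [arrowsWeight, Finset.prod_congr rfl fun v _ => h1 v, Finset.prod_ite, Finset.prod_const,
      Finset.prod_const_one, mul_one, sixVertexWeight, Nat.card_eq_fintype_card, Fintype.card_subtype]
  · rw [IceRule, not_forall] at h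
    obtain ⟨v, hv⟩ := h
    refine Finset.prod_eq_zero (Finset.mem_univ v) ?_
    rw [vertexWeight, if_neg fun h => hv ((key v).mpr h)]

theorem upArrows_iff (hL : Even L) (ω : Arrows L M) (y : ZMod M) (k : ℤ) :
    (upArrows ω y : ℤ) = (L : ℤ) / 2 + k ↔ flux (fun x => ω.2 (x, y)) = 2 * k := by
  rw [flux_eq, upArrows, Nat.card_eq_fintype_card, Fintype.card_subtype, ZMod.card]
  obtain ⟨l, rfl⟩ := hL
  push_cast
  omega

open Classical in
theorem slopedZ_eq (hL : Even L) (c : ℝ) (k : ℤ) :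
    slopedZ L M c k = ∑ ω : Arrows L M,
      if ∀ y, flux (fun x => ω.2 (x, y)) = 2 * k then arrowsWeight c ω else 0 := by
  rw [slopedZ]
  refine Finset.sum_congr rfl fun ω _ => ?_
  simp only [upArrows_iff hL, arrowsWeight_eq]
  by_cases h1 : IceRule ω <;> simp [h1]

/-- Configurations of spins on the torus as sequences of rows. -/
def rowsEquiv (L M : ℕ) : (ZMod M → ZMod L → Bool) ≃ (Torus L M → Bool) where
  toFun f v := f v.2 v.1
  invFun g y x := g (x, y)
  left_inv _ := rfl
  right_inv _ := rfl

theorem slopedZ_eq_trace (hL : Even L) (c : ℝ) (k : ℤ) :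
    slopedZ L M c k = ((transferMatrix L c (2 * k)) ^ M).trace := by
  classical
  rw [slopedZ_eq hL, ← matProd_const, ← sum_cyclic, Fintype.sum_prod_type, Finset.sum_comm,
    ← (rowsEquiv L M).sum_comp]
  have h1 : ∀ f : ZMod M → ZMod L → Bool,
      ∑ h : Torus L M → Bool, (if ∀ y, flux (fun x => rowsEquiv L M f (x, y)) = 2 * k then
        arrowsWeight c (h, rowsEquiv L M f) else 0) =
      if ∀ y, flux (f y) = 2 * k then ∏ y, rowWeight c (f (y - 1)) (f y) else 0 := by
    intro f
    have h2 : (∀ y, flux (fun x => rowsEquiv L M f (x, y)) = 2 * k) ↔ ∀ y, flux (f y) = 2 * k :=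
      Iff.rfl
    by_cases hf : ∀ y, flux (f y) = 2 * k
    · simp only [h2.mpr hf, hf, implies_true, if_true]
      rw [← (rowsEquiv L M).sum_comp]
      simp only [rowWeight]
      rw [Finset.prod_univ_sum, Fintype.piFinset_univ]
      refine Finset.sum_congr rfl fun h _ => ?_
      rw [arrowsWeight, Fintype.prod_prod_type, Finset.prod_comm]
      refine Finset.prod_congr rfl fun y _ => Finset.prod_congr rfl fun x _ => ?_
      simp [rowsEquiv]
    · rw [if_neg hf]
      refine Finset.sum_eq_zero fun h _ => if_neg fun h3 => hf (h2.mp h3)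
  rw [Finset.sum_congr rfl fun f _ => h1 f, ← Finset.sum_filter,
    Finset.sum_subtype (p := fun f : ZMod M → ZMod L → Bool => ∀ y, flux (f y) = 2 * k) _ (by simp)]
  exact Equiv.sum_comp (Equiv.subtypePiEquivPi (p := fun (_ : ZMod M) (w : ZMod L → Bool) =>
    flux w = 2 * k)) (fun h => ∏ x, transferMatrix L c (2 * k) (h (x - 1)) (h x))

end torus

end BKW

end

noncomputable section

namespace BKW

/-! ### A row of operators as a row of the six-vertex model -/

section row

variable {L : ℕ} [NeZero L]

/-- The transfer matrix of a column, acting on horizontal spins. -/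
def columnMatrix (c : ℝ) (w w' : ZMod L → Bool) (i : ℕ) : Matrix Bool Bool ℝ :=
  fun h h' => vertexWeight c h (w i) h' (w' i)

open Classical in
/-- The action of the first `x` vertices of a row. -/
def partialRow (c : ℝ) (G : (ZMod L → Bool) → ℝ) (w' : ZMod L → Bool) (x : ℕ) (h₀ h : Bool) : ℝ :=
  ∑ w : ZMod L → Bool, if ∀ i : ZMod L, x ≤ i.val → w i = w' i then
    matProd (columnMatrix c w w') x h₀ h * G w else 0

/-- The action of a full row. -/
def rowAction (c : ℝ) (G : (ZMod L → Bool) → ℝ) (w' : ZMod L → Bool) : ℝ :=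
  ∑ w, rowWeight c w w' * G w

theorem partialRow_zero (c : ℝ) (G : (ZMod L → Bool) → ℝ) (w' : ZMod L → Bool) (h₀ h : Bool) :
    partialRow c G w' 0 h₀ h = if h₀ = h then G w' else 0 := by
  classical
  have : ∀ w : ZMod L → Bool, (∀ i : ZMod L, 0 ≤ i.val → w i = w' i) ↔ w = w' := fun w =>
    ⟨fun h => funext fun i => h i (Nat.zero_le _), fun h i _ => by rw [h]⟩
  simp only [partialRow, this, matProd]
  rw [Finset.sum_ite_eq' Finset.univ w', if_pos (Finset.mem_univ _), Matrix.one_apply]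
  simp

theorem partialRow_succ (c : ℝ) (G : (ZMod L → Bool) → ℝ) (w' : ZMod L → Bool) {x : ℕ}
    (hx : x < L) (h₀ h' : Bool) :
    partialRow c G w' (x + 1) h₀ h' = ∑ h, ∑ v, vertexWeight c h v h' (w' x) *
      partialRow c G (Function.update w' (x : ZMod L) v) x h₀ h := by
  classical
  have hval : (x : ZMod L).val = x := ZMod.val_cast_of_lt hx
  have h1 : ∀ (v : Bool) (w : ZMod L → Bool),
      (∀ i : ZMod L, x ≤ i.val → w i = Function.update w' (x : ZMod L) v i) ↔
      (w x = v ∧ ∀ i : ZMod L, x + 1 ≤ i.val → w i = w' i) := by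
    intro v w
    constructor
    · refine fun h => ⟨by simpa using h x hval.ge, fun i hi => ?_⟩
      have : i ≠ x := by rintro rfl; omega
      simpa [this] using h i (by omega)
    · rintro ⟨h1, h2⟩ i hi
      by_cases hix : i = x
      · rw [hix, h1]; simp
      · have : i.val ≠ x := fun h => hix (by rw [← h]; simp)
        rw [Function.update_of_ne hix]
        exact h2 i (by omega)
  have h2 : ∀ (v : Bool) (w : ZMod L → Bool),
      matProd (columnMatrix c w (Function.update w' (x : ZMod L) v)) x =
      matProd (columnMatrix c w w') x := by
    intro v w
    refine matProd_congr fun i hi => ?_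
    have : (i : ZMod L) ≠ x := fun h => by
      have := congrArg ZMod.val h
      rw [hval, ZMod.val_cast_of_lt (by omega)] at this
      omega
    funext a b
    simp [columnMatrix, this]
  simp only [partialRow, h1, h2, Finset.mul_sum]
  have h3 : ∀ h : Bool, ∑ v : Bool, ∑ w : ZMod L → Bool, vertexWeight c h v h' (w' x) *
      (if w x = v ∧ ∀ i : ZMod L, x + 1 ≤ i.val → w i = w' i then
        matProd (columnMatrix c w w') x h₀ h * G w else 0) =
      ∑ w : ZMod L → Bool, if ∀ i : ZMod L, x + 1 ≤ i.val → w i = w' i then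
        matProd (columnMatrix c w w') x h₀ h * columnMatrix c w w' x h h' * G w else 0 := by
    intro h
    rw [Finset.sum_comm]
    refine Finset.sum_congr rfl fun w _ => ?_
    by_cases hw : ∀ i : ZMod L, x + 1 ≤ i.val → w i = w' i
    · rw [if_pos hw]
      simp only [and_iff_left hw, mul_ite, mul_zero]
      rw [Finset.sum_ite_eq Finset.univ (w x), if_pos (Finset.mem_univ _), columnMatrix]
      ring
    · rw [if_neg hw]
      exact Finset.sum_eq_zero fun v _ => by rw [if_neg fun h => hw h.2, mul_zero]
  rw [Finset.sum_congr rfl fun h _ => h3 h, Finset.sum_comm]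
  refine Finset.sum_congr rfl fun w _ => ?_
  by_cases hw : ∀ i : ZMod L, x + 1 ≤ i.val → w i = w' i
  · simp only [if_pos hw]
    rw [matProd, Matrix.mul_apply, Finset.sum_mul]
  · simp only [if_neg hw, Finset.sum_const_zero]

theorem sum_partialRow (c : ℝ) (G : (ZMod L → Bool) → ℝ) (w' : ZMod L → Bool) :
    ∑ h, partialRow c G w' L h h = rowAction c G w' := by
  classical
  have : ∀ w : ZMod L → Bool, (∀ i : ZMod L, L ≤ i.val → w i = w' i) := fun w i hi =>
    absurd (ZMod.val_lt i) (by omega)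
  simp only [partialRow, rowAction]
  rw [Finset.sum_comm]
  refine Finset.sum_congr rfl fun w _ => ?_
  simp only [if_pos (this w)]
  rw [← Finset.sum_mul]
  congr 1
  have h := sum_cyclic (columnMatrix c w w') L
  rw [Matrix.trace] at h
  simp only [Matrix.diag_apply] at h
  rw [← h, rowWeight]
  refine Finset.sum_congr rfl fun g _ => Finset.prod_congr rfl fun x _ => ?_
  simp [columnMatrix]

/-- The site at distance `a` from `J`. -/
def site (L J a : ℕ) : ZMod (L + 2) := ((J + a : ℕ) : ZMod (L + 2))

theorem site_inj {J a b : ℕ} (ha : a < L + 2) (hb : b < L + 2) (h : site L J a = site L J b) :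
    a = b := by
  rw [site, site, Nat.cast_add, Nat.cast_add, add_right_inj] at h
  have := congrArg ZMod.val h
  rwa [ZMod.val_cast_of_lt ha, ZMod.val_cast_of_lt hb] at this

/-- The vertical spins seen at stage `x` of a row. -/
def readout (J x : ℕ) (σ : ZMod (L + 2) → Bool) : ZMod L → Bool := fun i =>
  σ (site L J (1 + (if i.val < x then i.val else i.val + 1)))

/-- The state at stage `x` of a row. -/
def rowState (y : ℂ) (c : ℝ) (G : (ZMod L → Bool) → ℝ) (J x : ℕ) (σ : ZMod (L + 2) → Bool) : ℂ :=
  y ^ (sgn (σ (site L J 0)) - sgn (σ (site L J (1 + x)))) *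
    (partialRow c G (readout J x σ) x (!σ (site L J 0)) (σ (site L J (1 + x))) : ℝ)

/-- Before the step, site `1 + x` carries the incoming horizontal spin and its right neighbour the
incoming vertical one; after it, the two outgoing spins sit there with the roles exchanged. The
identity is a turn at the vertex. When the outgoing spins differ, the entries of `1 + e` are `1` for
a horizontal arrow going straight and `1 + y ^ (±4)` for a turn; the gauge factor of `rowState`
changes the latter into `y² + y⁻² = c`. -/
theorem rowState_step {y : ℂ} {c : ℝ} (hy : y ≠ 0) (hc : y ^ (2 : ℤ) + y ^ (-2 : ℤ) = c)
    (G : (ZMod L → Bool) → ℝ) (J : ℕ) {x : ℕ} (hx : x < L) (σ : ZMod (L + 2) → Bool) :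
    rowState y c G J x σ + capOp y (site L J (1 + x)) (rowState y c G J x) σ =
      rowState y c G J (x + 1) σ := by
  have hval : (x : ZMod L).val = x := ZMod.val_cast_of_lt hx
  have hs : site L J (1 + x) + 1 = site L J (1 + (x + 1)) := by simp [site, add_assoc]
  have n0 : site L J 0 ≠ site L J (1 + x) := fun h => by
    have := site_inj (by omega) (by omega) h; omega
  have n1 : site L J 0 ≠ site L J (1 + (x + 1)) := fun h => by
    have := site_inj (by omega) (by omega) h; omega
  have n2 : site L J (1 + x) ≠ site L J (1 + (x + 1)) := fun h => by
    have := site_inj (by omega) (by omega) h; omega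
  have hv : readout J (x + 1) σ (x : ZMod L) = σ (site L J (1 + x)) := by
    simp [readout, hval]
  have r1 : readout J x σ =
      Function.update (readout J (x + 1) σ) (x : ZMod L) (σ (site L J (1 + (x + 1)))) := by
    funext i
    by_cases hi : i = x
    · subst hi; simp [readout, hval]
    · rw [Function.update_of_ne hi]
      have : i.val ≠ x := fun h => hi (by rw [← h]; simp)
      simp only [readout]
      by_cases h1 : i.val < x
      · rw [if_pos h1, if_pos (by omega)]
      · rw [if_neg h1, if_neg (by omega)]
  have r2 : ∀ b, readout J x (Function.update (Function.update σ (site L J (1 + x)) b)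
      (site L J (1 + (x + 1))) (!b)) =
      Function.update (readout J (x + 1) σ) (x : ZMod L) (!b) := by
    intro b
    funext i
    by_cases hi : i = x
    · subst hi; simp [readout, hval]
    · rw [Function.update_of_ne hi]
      have : i.val ≠ x := fun h => hi (by rw [← h]; simp)
      have hiL := ZMod.val_lt i
      simp only [readout]
      by_cases h1 : i.val < x
      · rw [if_pos h1, if_pos (by omega), Function.update_of_ne, Function.update_of_ne]
        · exact fun h => by have := site_inj (by omega) (by omega) h; omega
        · exact fun h => by have := site_inj (by omega) (by omega) h; omega
      · rw [if_neg h1, if_neg (by omega), Function.update_of_ne, Function.update_of_ne]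
        · exact fun h => by have := site_inj (by omega) (by omega) h; omega
        · exact fun h => by have := site_inj (by omega) (by omega) h; omega
  have e1 : ∀ b, Function.update (Function.update σ (site L J (1 + x)) b)
      (site L J (1 + (x + 1))) (!b) (site L J 0) = σ (site L J 0) := fun b => by
    rw [Function.update_of_ne n1, Function.update_of_ne n0]
  have e2 : ∀ b, Function.update (Function.update σ (site L J (1 + x)) b)
      (site L J (1 + (x + 1))) (!b) (site L J (1 + x)) = b := fun b => by
    rw [Function.update_of_ne n2, Function.update_self]
  rw [capOp, hs]
  simp only [rowState, r2, e1, e2]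
  rw [partialRow_succ c G _ hx, hv, r1]
  generalize readout J (x + 1) σ = w
  generalize σ (site L J (1 + (x + 1))) = h'
  generalize σ (site L J (1 + x)) = v'
  generalize σ (site L J 0) = s₀
  simp only [Fintype.sum_bool]
  set A : Bool → Bool → ℝ := fun v h => partialRow c G (Function.update w (x : ZMod L) v) x (!s₀) h
    with hA
  have hA' : ∀ v h, partialRow c G (Function.update w (x : ZMod L) v) x (!s₀) h = A v h :=
    fun _ _ => rfl
  simp only [hA']
  clear_value A
  have z1 : ∀ n : ℤ, y ^ (sgn s₀ - n) = y ^ sgn s₀ * y ^ (-n) := fun n => by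
    rw [← zpow_add₀ hy, sub_eq_add_neg]
  have z2 : y * y⁻¹ = 1 := mul_inv_cancel₀ hy
  have z3 : y ^ (2 : ℤ) = y * y := by rw [zpow_ofNat]; ring
  have z4 : y ^ (-2 : ℤ) = y⁻¹ * y⁻¹ := by rw [zpow_neg, z3, mul_inv]
  rw [z3, z4] at hc
  simp only [z1]
  generalize y ^ sgn s₀ = u
  cases h' <;> cases v' <;>
    simp only [vertexWeight, Bool.not_true, Bool.not_false, sgn_true, sgn_false, if_true,
      reduceCtorEq, if_false, add_zero, mul_one, mul_neg, neg_neg, zpow_one, zpow_neg_one, z3, z4,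
      one_mul, zero_mul, Bool.true_eq_false, Bool.false_eq_true, zero_add] <;> norm_num <;>
    rw [← hc] <;> field_simp <;> ring

theorem rowState_zero (y : ℂ) (c : ℝ) (G : (ZMod L → Bool) → ℝ) (J : ℕ)
    (σ : ZMod (L + 2) → Bool) :
    rowState y c G J 0 σ = if σ (site L J 1) = !σ (site L J 0) then
      y ^ (2 * sgn (σ (site L J 0))) * (G (readout J 0 σ) : ℝ) else 0 := by
  rw [rowState, partialRow_zero]
  by_cases h : σ (site L J 1) = !σ (site L J 0)
  · rw [if_pos h.symm, if_pos h]
    congr 2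
    rw [h, sgn_not]; ring
  · rw [if_neg (Ne.symm h), if_neg h]; simp

/-- The cap contracts the first and the last horizontal spin, which closes the row periodically, and
the cup creates the pair of horizontal spins of the next row. Since the circle has `L + 2` sites,
the next row starts `L + 1` sites further. -/
theorem capOp_rowState {y : ℂ} (hy : y ≠ 0) (c : ℝ) (G : (ZMod L → Bool) → ℝ) (J : ℕ)
    (σ : ZMod (L + 2) → Bool) :
    capOp y (site L J (1 + L)) (rowState y c G J L) σ =
      rowState y c (rowAction c G) (J + (L + 1)) 0 σ := by
  have hs : site L J (1 + L) + 1 = site L J 0 := by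
    have : ((L + 2 : ℕ) : ZMod (L + 2)) = 0 := ZMod.natCast_self _
    push_cast at this
    simp only [site]
    push_cast
    linear_combination this
  have h0 : site L (J + (L + 1)) 0 = site L J (1 + L) := by
    simp only [site]; congr 1; omega
  have h1 : site L (J + (L + 1)) 1 = site L J 0 := by
    rw [← hs, ← h0]; simp [site]
  have n0 : site L J (1 + L) ≠ site L J 0 := fun h => by
    have := site_inj (by omega) (by omega) h; omega
  have r1 : readout (L := L) (J + (L + 1)) 0 σ = readout J L σ := by
    funext i
    have := ZMod.val_lt i
    simp only [readout, Nat.not_lt_zero, if_false, if_pos this]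
    congr 1
    have h2 : ((L + 2 : ℕ) : ZMod (L + 2)) = 0 := ZMod.natCast_self _
    push_cast at h2
    simp only [site]
    push_cast
    linear_combination h2
  have r2 : ∀ b, readout (L := L) J L (Function.update (Function.update σ (site L J (1 + L)) b)
      (site L J 0) (!b)) = readout J L σ := by
    intro b
    funext i
    have hi := ZMod.val_lt i
    simp only [readout, if_pos hi]
    rw [Function.update_of_ne, Function.update_of_ne]
    · exact fun h => by have := site_inj (by omega) (by omega) h; omega
    · exact fun h => by have := site_inj (by omega) (by omega) h; omega
  rw [rowState_zero y, capOp, hs, h0, h1, r1]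
  simp only [rowState, r2, Function.update_self, Function.update_of_ne n0]
  refine if_congr Iff.rfl ?_ rfl
  congr 1
  rw [← sum_partialRow]
  push_cast
  refine Finset.sum_congr rfl fun b _ => ?_
  rw [Bool.not_not, sgn_not, ← mul_assoc, ← zpow_add₀ hy]
  have : 2 * sgn b + (-sgn b - sgn b) = 0 := by ring
  rw [this]; simp

/-- The times at which the operators are forced. -/
def forcedTime (L t : ℕ) : Bool := decide (t % (L + 1) = 0)

/-- The spin vectors of the loop expansion are given by the six-vertex transfer matrix. -/
theorem opSeq_eq_rowState {y : ℂ} {c : ℝ} (hy : y ≠ 0) (hc : y ^ (2 : ℤ) + y ^ (-2 : ℤ) = c)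
    (Y : ℕ) : opSeq y (forcedTime L) ((L + 1) * Y + 1) =
      (c : ℂ) • rowState y c ((rowAction c)^[Y] (1 : (ZMod L → Bool) → ℝ)) ((L + 1) * Y) 0 := by
  induction Y with
  | zero =>
    funext σ
    simp only [Nat.mul_zero, zero_add, Function.iterate_zero, id, Pi.smul_apply, smul_eq_mul]
    rw [rowState_zero y]
    have h0 : site L 0 0 = 0 := by simp [site]
    have h1 : site L 0 1 = 1 := by simp [site]
    -- The first operator acts on the constant vector; its sum over `b` produces the overall factor
    -- `c`.
    have hstep : (opSeq y (forcedTime L) 1 : (ZMod (L + 2) → Bool) → ℂ) = capOp y 0 1 := by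
      simp [opSeq, forcedTime]
    rw [hstep, capOp, h0, h1, zero_add, ← hc, Fintype.sum_bool]
    simp only [Pi.one_apply, Complex.ofReal_one, sgn_true, sgn_false, mul_one, mul_neg]
    split_ifs <;> ring
  | succ Y ih =>
    set G := (rowAction c)^[Y] (1 : (ZMod L → Bool) → ℝ) with hG
    have inner : ∀ x ≤ L, opSeq y (forcedTime L) ((L + 1) * Y + 1 + x) =
        (c : ℂ) • rowState y c G ((L + 1) * Y) x := by
      intro x hx
      induction x with
      | zero => exact ih
      | succ x ih' =>
        have hf : forcedTime L ((L + 1) * Y + 1 + x) = false := by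
          simp only [forcedTime, add_assoc, Nat.mul_add_mod]
          rw [Nat.mod_eq_of_lt (by omega)]
          simp
        rw [← add_assoc, opSeq, if_neg (by simp [hf]), ih' (by omega)]
        have h2 := (capLin y (((L + 1) * Y + 1 + x : ℕ) : ZMod (L + 2))).map_smul (c : ℂ)
          (rowState y c G ((L + 1) * Y) x)
        change capOp y _ _ = (c : ℂ) • capOp y _ _ at h2
        rw [h2, ← smul_add]
        congr 1
        funext σ
        rw [← rowState_step hy hc G _ (by omega) σ]
        simp only [Pi.add_apply, site, add_assoc]
    have hf : forcedTime L ((L + 1) * Y + 1 + L) = true := by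
      have : (L + 1) * Y + 1 + L = (L + 1) * (Y + 1) := by ring
      rw [this]; simp [forcedTime]
    have hT : (L + 1) * (Y + 1) + 1 = (L + 1) * Y + 1 + L + 1 := by ring
    rw [hT, opSeq, if_pos hf, inner L le_rfl]
    have h2 := (capLin y (((L + 1) * Y + 1 + L : ℕ) : ZMod (L + 2))).map_smul (c : ℂ)
      (rowState y c G ((L + 1) * Y) L)
    change capOp y _ _ = (c : ℂ) • capOp y _ _ at h2
    rw [h2]
    congr 1
    funext σ
    rw [Function.iterate_succ_apply', ← hG]
    have := capOp_rowState hy c G ((L + 1) * Y) σ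
    simp only [site, add_assoc] at this ⊢
    rw [this]
    congr 1

/-- The sites of the circle, split into the two sites of a cup and the others. -/
def siteMap (L J : ℕ) : Bool ⊕ ZMod L → ZMod (L + 2)
  | .inl b => site L J (if b = true then 1 else 0)
  | .inr i => site L J (1 + (i.val + 1))

theorem siteMap_bijective (J : ℕ) : Function.Bijective (siteMap L J) := by
  rw [Fintype.bijective_iff_injective_and_card]
  constructor
  · rintro (a | i) (b | j) h
    · have := site_inj (by split_ifs <;> omega) (by split_ifs <;> omega) h
      cases a <;> cases b <;> simp_all
    · have hj := ZMod.val_lt j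
      have := site_inj (by split_ifs <;> omega) (by omega) h
      split_ifs at this <;> omega
    · have hi := ZMod.val_lt i
      have := site_inj (by omega) (by split_ifs <;> omega) h
      split_ifs at this <;> omega
    · have hi := ZMod.val_lt i
      have hj := ZMod.val_lt j
      have := site_inj (by omega) (by omega) h
      rw [Sum.inr.injEq]
      exact ZMod.val_injective L (by omega)
  · rw [Fintype.card_sum, ZMod.card, ZMod.card, Fintype.card_bool, add_comm]

/-- The pair of horizontal spins is opposite, so it has no flux, and summing its weight `y ^ (±2)`
gives the factor `c`. -/
theorem sectorSum_rowState {y : ℂ} {c : ℝ} (hy : y ≠ 0) (hc : y ^ (2 : ℤ) + y ^ (-2 : ℤ) = c)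
    (G : (ZMod L → Bool) → ℝ) (J : ℕ) (m : ℤ) :
    sectorSum m (rowState y c G J 0) = c * ∑ w : Sector L m, (G w.1 : ℂ) := by
  classical
  let e := Equiv.ofBijective _ (siteMap_bijective (L := L) J)
  rw [sectorSum, ← (Equiv.arrowCongr e (Equiv.refl Bool)).sum_comp,
    ← (Equiv.sumArrowEquivProdArrow Bool (ZMod L) Bool).symm.sum_comp, Fintype.sum_prod_type]
  have hσ : ∀ (s : Bool → Bool) (w : ZMod L → Bool) (z : Bool ⊕ ZMod L),
      (Equiv.arrowCongr e (Equiv.refl Bool)) ((Equiv.sumArrowEquivProdArrow Bool (ZMod L) Bool).symm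
        (s, w)) (siteMap L J z) = Sum.elim s w z := by
    intro s w z
    have : e.symm (siteMap L J z) = z := e.symm_apply_apply z
    simp [Equiv.arrowCongr, this, Equiv.sumArrowEquivProdArrow]
  have hflux : ∀ (s : Bool → Bool) (w : ZMod L → Bool),
      flux ((Equiv.arrowCongr e (Equiv.refl Bool))
        ((Equiv.sumArrowEquivProdArrow Bool (ZMod L) Bool).symm (s, w))) =
      sgn (s true) + sgn (s false) + flux w := by
    intro s w
    rw [flux, ← e.sum_comp, Fintype.sum_sum_type, Fintype.sum_bool, flux]
    exact congrArg₂ (· + ·) (congrArg₂ (· + ·) (congrArg sgn (hσ s w (.inl true)))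
      (congrArg sgn (hσ s w (.inl false))))
      (Finset.sum_congr rfl fun i _ => congrArg sgn (hσ s w (.inr i)))
  have h0 : ∀ (s : Bool → Bool) (w : ZMod L → Bool), _ = s false := fun s w => hσ s w (.inl false)
  have h1 : ∀ (s : Bool → Bool) (w : ZMod L → Bool), _ = s true := fun s w => hσ s w (.inl true)
  simp only [siteMap, if_true, Bool.false_eq_true, if_false] at h0 h1
  have h2 : ∀ (s : Bool → Bool) (w : ZMod L → Bool), readout J 0
      ((Equiv.arrowCongr e (Equiv.refl Bool))
        ((Equiv.sumArrowEquivProdArrow Bool (ZMod L) Bool).symm (s, w))) = w := by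
    intro s w
    funext i
    exact hσ s w (.inr i)
  have hterm : ∀ s : Bool → Bool, ∑ w : ZMod L → Bool,
      (if flux ((Equiv.arrowCongr e (Equiv.refl Bool))
        ((Equiv.sumArrowEquivProdArrow Bool (ZMod L) Bool).symm (s, w))) = m then
        rowState y c G J 0 ((Equiv.arrowCongr e (Equiv.refl Bool))
        ((Equiv.sumArrowEquivProdArrow Bool (ZMod L) Bool).symm (s, w))) else 0) =
      if s true = !s false then y ^ (2 * sgn (s false)) * ∑ w : Sector L m, (G w.1 : ℂ) else 0 := by
    intro s
    simp only [rowState_zero y, hflux, h0, h1, h2]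
    by_cases hs : s true = !s false
    · simp only [hs, sgn_not, neg_add_cancel, zero_add, if_true, Finset.mul_sum]
      rw [← Finset.sum_filter]
      exact Finset.sum_subtype _ (by simp) _
    · simp [hs]
  rw [Finset.sum_congr rfl fun s _ => hterm s,
    ← (Equiv.boolArrowEquivProd Bool).symm.sum_comp, Fintype.sum_prod_type]
  simp only [Fintype.sum_bool, Equiv.boolArrowEquivProd]
  simp only [Equiv.coe_fn_symm_mk, sgn_true, sgn_false]
  rw [← hc]
  simp
  ring

theorem iterate_rowAction_apply {c : ℝ} (m : ℤ) (Y : ℕ) (w : Sector L m) :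
    (rowAction c)^[Y] (1 : (ZMod L → Bool) → ℝ) w.1 = ∑ u, ((transferMatrix L c m) ^ Y) u w := by
  classical
  induction Y generalizing w with
  | zero => simp [Matrix.one_apply]
  | succ Y ih =>
    rw [Function.iterate_succ_apply', rowAction]
    have : ∑ u : ZMod L → Bool, rowWeight c u w.1 * (rowAction c)^[Y] 1 u =
        ∑ u : Sector L m, rowWeight c u.1 w.1 * (rowAction c)^[Y] 1 u.1 := by
      rw [← Finset.sum_subtype (p := fun u : ZMod L → Bool => flux u = m)
        (Finset.univ.filter fun u : ZMod L → Bool => flux u = m) (by simp)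
        (fun u => rowWeight c u w.1 * (rowAction c)^[Y] 1 u)]
      symm
      refine Finset.sum_subset (Finset.filter_subset _ _) fun u _ hu => ?_
      rw [Finset.mem_filter, not_and] at hu
      by_cases h : rowWeight c u w.1 = 0
      · rw [h, zero_mul]
      · exact absurd ((flux_eq_of_rowWeight_ne_zero h).trans w.2) (hu (Finset.mem_univ _))
    rw [this]
    simp only [ih, pow_succ, Matrix.mul_apply]
    rw [Finset.sum_comm]
    refine Finset.sum_congr rfl fun u _ => ?_
    rw [Finset.mul_sum]
    refine Finset.sum_congr rfl fun v _ => ?_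
    rw [mul_comm]; rfl

/-- The entries of the powers of the transfer matrix are comparable to the loop sums. -/
theorem loopSum_bounds {y : ℂ} {r c : ℝ} (hy : y ≠ 0) (hr : y ^ (4 : ℤ) + y ^ (-4 : ℤ) = r)
    (hc : y ^ (2 : ℤ) + y ^ (-2 : ℤ) = c) (hr0 : 0 < r) (hc1 : 1 ≤ c) (hE : Even L)
    (M n : ℕ) (hn : 1 ≤ n) :
    loopSum (L + 2) (by omega) r (forcedTime L) ((L + 1) * M + 1) n ≤
      c ^ 2 * ∑ w, ∑ u, ((transferMatrix L c (2 * n)) ^ M) u w ∧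
    c ^ 2 * ∑ w, ∑ u, ((transferMatrix L c (2 * n)) ^ M) u w ≤
      c ^ (L + 2) * (2 ^ (L + 2) * c ^ (L + 2)) *
      loopSum (L + 2) (by omega) r (forcedTime L) ((L + 1) * M + 1) n := by
  obtain ⟨x, h1, h2, h3⟩ := sectorSum_opSeq hy hr hc hr0 hc1 (N := L + 2) (by omega)
    (by simpa using hE.add (show Even 2 by decide)) (forcedTime L) ((L + 1) * M + 1) n hn
  have h4 : x = c ^ 2 * ∑ w, ∑ u, ((transferMatrix L c (2 * n)) ^ M) u w := by
    have h5 : sectorSum (N := L + 2) (2 * n) (opSeq y (forcedTime L) ((L + 1) * M + 1)) =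
        (c : ℂ) * sectorSum (2 * n) (rowState y c ((rowAction c)^[M] (1 : (ZMod L → Bool) → ℝ))
          ((L + 1) * M) 0) := by
      rw [opSeq_eq_rowState hy hc]
      simp only [sectorSum, Finset.mul_sum]
      refine Finset.sum_congr rfl fun σ _ => ?_
      split_ifs <;> simp
    rw [h1, sectorSum_rowState hy hc] at h5
    simp only [iterate_rowAction_apply] at h5
    rw [← mul_assoc, ← pow_two] at h5
    exact_mod_cast h5
  rw [← h4]
  exact ⟨h2, h3⟩

end row

end BKW

end

noncomputable section

namespace BKW

/-! ### Exponential growth rates -/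

section growth

variable {S : Type*} [Fintype S] [DecidableEq S] {A : Matrix S S ℝ}

/-- For symmetric `A` the trace of an even power is the squared Hilbert-Schmidt norm of a power.
This is the reason for grouping rows in pairs. -/
theorem trace_two_mul (hA : ∀ i j, A i j = A j i) (m : ℕ) :
    (A ^ (2 * m)).trace = ∑ i, ∑ j, (A ^ m) i j ^ 2 := by
  have hs : (A ^ m).transpose = A ^ m := by
    rw [Matrix.transpose_pow]; congr 1; ext i j; exact hA j i
  rw [two_mul, pow_add, Matrix.trace]
  refine Finset.sum_congr rfl fun i _ => ?_
  rw [Matrix.diag_apply, Matrix.mul_apply]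
  refine Finset.sum_congr rfl fun j _ => ?_
  have : (A ^ m) j i = (A ^ m) i j := congrFun (congrFun hs i) j
  rw [this, pow_two]

/-- Submultiplicativity of the Hilbert-Schmidt norm, by Cauchy-Schwarz. -/
theorem trace_two_mul_add_le (hA : ∀ i j, A i j = A j i) (m n : ℕ) :
    (A ^ (2 * (m + n))).trace ≤ (A ^ (2 * m)).trace * (A ^ (2 * n)).trace := by
  rw [trace_two_mul hA, trace_two_mul hA, trace_two_mul hA, Finset.sum_mul]
  refine Finset.sum_le_sum fun i _ => ?_
  have hs : ∀ j k, (A ^ n) j k = (A ^ n) k j := by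
    have hs : (A ^ n).transpose = A ^ n := by
      rw [Matrix.transpose_pow]; congr 1; ext i j; exact hA j i
    exact fun j k => congrFun (congrFun hs k) j
  rw [Finset.mul_sum]
  refine Finset.sum_le_sum fun j _ => ?_
  rw [pow_add, Matrix.mul_apply]
  refine (Finset.sum_mul_sq_le_sq_mul_sq _ _ _).trans (le_of_eq ?_)
  congr 1
  exact Finset.sum_congr rfl fun k _ => by rw [hs]

theorem pow_apply_nonneg (h0 : ∀ i j, 0 ≤ A i j) (m : ℕ) (i j : S) : 0 ≤ (A ^ m) i j := by
  induction m generalizing j with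
  | zero => rw [pow_zero, Matrix.one_apply]; split_ifs <;> norm_num
  | succ m ih =>
    rw [pow_succ, Matrix.mul_apply]
    exact Finset.sum_nonneg fun k _ => mul_nonneg (ih k) (h0 k j)

theorem one_le_pow_diag (h0 : ∀ i j, 0 ≤ A i j) (h1 : ∀ i, 1 ≤ A i i) (m : ℕ) (i : S) :
    1 ≤ (A ^ m) i i := by
  induction m with
  | zero => simp
  | succ m ih =>
    rw [pow_succ, Matrix.mul_apply]
    refine le_trans ?_ (Finset.single_le_sum (f := fun k => (A ^ m) i k * A k i)
      (fun k _ => mul_nonneg (pow_apply_nonneg h0 m i k) (h0 k i)) (Finset.mem_univ i))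
    nlinarith [h1 i]

theorem one_le_trace_pow [Nonempty S] (h0 : ∀ i j, 0 ≤ A i j) (h1 : ∀ i, 1 ≤ A i i) (m : ℕ) :
    1 ≤ (A ^ m).trace := by
  obtain ⟨i⟩ := ‹Nonempty S›
  exact (one_le_pow_diag h0 h1 m i).trans (Finset.single_le_sum (f := fun k => (A ^ m) k k)
    (fun k _ => pow_apply_nonneg h0 m k k) (Finset.mem_univ i))

theorem trace_le_sum_entries (h0 : ∀ i j, 0 ≤ A i j) (m : ℕ) :
    (A ^ m).trace ≤ ∑ i, ∑ j, (A ^ m) j i :=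
  Finset.sum_le_sum fun i _ => Finset.single_le_sum (f := fun j => (A ^ m) j i)
    (fun j _ => pow_apply_nonneg h0 m j i) (Finset.mem_univ i)

/-- Each entry of `A ^ (2 * m)` is a scalar product of two rows of `A ^ m`, hence at most the
squared Hilbert-Schmidt norm. So fixed sums of entries and traces have the same growth rate. -/
theorem sum_entries_le (hA : ∀ i j, A i j = A j i) (m : ℕ) :
    ∑ i, ∑ j, (A ^ (2 * m)) j i ≤ (Fintype.card S : ℝ) ^ 2 * (A ^ (2 * m)).trace := by
  have hs : ∀ j k, (A ^ m) j k = (A ^ m) k j := by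
    have hs : (A ^ m).transpose = A ^ m := by
      rw [Matrix.transpose_pow]; congr 1; ext i j; exact hA j i
    exact fun j k => congrFun (congrFun hs k) j
  have key : ∀ i j, (A ^ (2 * m)) j i ≤ (A ^ (2 * m)).trace := by
    intro i j
    rw [trace_two_mul hA, two_mul, pow_add, Matrix.mul_apply]
    have hrow : ∀ i, ∑ k, (A ^ m) i k ^ 2 ≤ ∑ i, ∑ k, (A ^ m) i k ^ 2 := fun i =>
      Finset.single_le_sum (f := fun i => ∑ k, (A ^ m) i k ^ 2)
        (fun i _ => Finset.sum_nonneg fun _ _ => sq_nonneg _) (Finset.mem_univ i)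
    have : ∑ k, (A ^ m) j k * (A ^ m) k i ≤ ∑ k, ((A ^ m) j k ^ 2 + (A ^ m) i k ^ 2) / 2 := by
      refine Finset.sum_le_sum fun k _ => ?_
      rw [hs k i]
      nlinarith [sq_nonneg ((A ^ m) j k - (A ^ m) i k)]
    rw [← Finset.sum_div, Finset.sum_add_distrib] at this
    linarith [hrow i, hrow j]
  calc ∑ i, ∑ j, (A ^ (2 * m)) j i ≤ ∑ _i : S, ∑ _j : S, (A ^ (2 * m)).trace :=
        Finset.sum_le_sum fun i _ => Finset.sum_le_sum fun j _ => key i j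
    _ = _ := by simp [pow_two, mul_assoc]

/-- Fekete's lemma for sequences that are submultiplicative up to a constant. -/
theorem exists_growth {u : ℕ → ℝ} {C b : ℝ} (hC : 0 < C) (hb : 0 < b) (hu : ∀ m, 0 < u m)
    (hlow : ∀ m, b ^ m ≤ u m) (hsub : ∀ m n, u (m + n) ≤ C * (u m * u n)) :
    ∃ a, Tendsto (fun m : ℕ => Real.log (u m) / m) atTop (𝓝 a) := by
  -- Multiplying the sequence by `C` absorbs the constant.
  have hS : Subadditive fun m => Real.log (C * u m) := by
    intro m n
    rw [← Real.log_mul (by have := hu m; positivity) (by have := hu n; positivity)]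
    refine Real.log_le_log (by have := hu (m + n); positivity) ?_
    calc C * u (m + n) ≤ C * (C * (u m * u n)) := by gcongr; exact hsub m n
      _ = _ := by ring
  have hbdd : BddBelow (Set.range fun n : ℕ => Real.log (C * u n) / n) := by
    refine ⟨-|Real.log C| - |Real.log b|, ?_⟩
    rintro _ ⟨n, rfl⟩
    rcases Nat.eq_zero_or_pos n with rfl | hn
    · simp only [Nat.cast_zero, div_zero]
      linarith [abs_nonneg (Real.log C), abs_nonneg (Real.log b)]
    have hn' : (1 : ℝ) ≤ n := by exact_mod_cast hn
    simp only
    rw [le_div_iff₀ (by linarith), Real.log_mul hC.ne' (hu n).ne']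
    have h1 := Real.log_le_log (by positivity) (hlow n)
    rw [Real.log_pow] at h1
    have h2 := neg_abs_le (Real.log C)
    have h3 := neg_abs_le (Real.log b)
    nlinarith [abs_nonneg (Real.log C)]
  have h := hS.tendsto_lim hbdd
  refine ⟨hS.lim, ?_⟩
  have h0 : Tendsto (fun n : ℕ => Real.log C / n) atTop (𝓝 0) :=
    tendsto_const_div_atTop_nhds_zero_nat _
  have := h.sub h0
  rw [sub_zero] at this
  refine this.congr fun n => ?_
  rw [Real.log_mul hC.ne' (hu n).ne']
  ring

/-- Sequences that are comparable up to constants have the same growth rate. -/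
theorem growth_congr {u v : ℕ → ℝ} {C₁ C₂ a : ℝ} (hC₁ : 0 < C₁) (hC₂ : 0 < C₂)
    (hu : ∀ m, 0 < u m) (h1 : ∀ m, C₁ * u m ≤ v m)
    (h2 : ∀ m, v m ≤ C₂ * u m)
    (h : Tendsto (fun m : ℕ => Real.log (u m) / m) atTop (𝓝 a)) :
    Tendsto (fun m : ℕ => Real.log (v m) / m) atTop (𝓝 a) := by
  have t1 : Tendsto (fun n : ℕ => Real.log C₁ / n + Real.log (u n) / n) atTop (𝓝 a) := by
    simpa using (tendsto_const_div_atTop_nhds_zero_nat (Real.log C₁)).add h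
  have t2 : Tendsto (fun n : ℕ => Real.log C₂ / n + Real.log (u n) / n) atTop (𝓝 a) := by
    simpa using (tendsto_const_div_atTop_nhds_zero_nat (Real.log C₂)).add h
  refine tendsto_of_tendsto_of_tendsto_of_le_of_le t1 t2 (fun m => ?_) (fun m => ?_)
  · simp only
    rw [← add_div, ← Real.log_mul hC₁.ne' (hu m).ne']
    have := hu m
    exact div_le_div_of_nonneg_right (Real.log_le_log (by positivity) (h1 m)) (Nat.cast_nonneg _)
  · simp only
    rw [← add_div, ← Real.log_mul hC₂.ne' (hu m).ne']
    have := hu m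
    exact div_le_div_of_nonneg_right
      (Real.log_le_log (lt_of_lt_of_le (by positivity) (h1 m)) (h2 m)) (Nat.cast_nonneg _)

theorem exists_trace_growth [Nonempty S] (hA : ∀ i j, A i j = A j i) (h0 : ∀ i j, 0 ≤ A i j)
    (h1 : ∀ i, 1 ≤ A i i) :
    ∃ a, Tendsto (fun m : ℕ => Real.log ((A ^ (2 * m)).trace) / m) atTop (𝓝 a) :=
  exists_growth (C := 1) (b := 1) one_pos one_pos
    (fun m => lt_of_lt_of_le one_pos (one_le_trace_pow h0 h1 _))
    (fun m => by rw [one_pow]; exact one_le_trace_pow h0 h1 _)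
    (fun m n => by rw [one_mul]; exact trace_two_mul_add_le hA m n)

end growth

/-! ### Growth rates of the six-vertex sectors on a strip. -/

section strip

variable {L : ℕ} [NeZero L]

theorem transferMatrix_symm (c : ℝ) (m : ℤ) (i j : Sector L m) :
    transferMatrix L c m i j = transferMatrix L c m j i := rowWeight_comm c _ _

theorem transferMatrix_nonneg {c : ℝ} (hc : 0 ≤ c) (m : ℤ) (i j : Sector L m) :
    0 ≤ transferMatrix L c m i j := rowWeight_nonneg hc _ _

theorem one_le_transferMatrix {c : ℝ} (hc : 0 ≤ c) (m : ℤ) (i : Sector L m) :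
    1 ≤ transferMatrix L c m i i := rowWeight_self_ge hc _

theorem sector_nonempty {k : ℤ} (hL : Even L) (h : 2 * |k| ≤ L) : Nonempty (Sector L (2 * k)) := by
  obtain ⟨l, hl⟩ := hL
  have habs := abs_le.mp (show |k| ≤ l by omega)
  obtain ⟨s, -, hs⟩ := Finset.exists_subset_card_eq (s := (Finset.univ : Finset (ZMod L)))
    (n := (l + k).toNat) (by rw [Finset.card_univ, ZMod.card]; omega)
  refine ⟨fun i => decide (i ∈ s), ?_⟩
  rw [flux_eq, ZMod.card]
  simp only [decide_eq_true_eq, Finset.filter_mem_eq_inter, Finset.univ_inter, hs]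
  omega

/-- The growth rate of a sector of the six-vertex model on a strip (per two rows). -/
def stripRate (L : ℕ) [NeZero L] (c : ℝ) (k : ℤ) : ℝ :=
  limUnder atTop fun m : ℕ => Real.log ((transferMatrix L c (2 * k) ^ (2 * m)).trace) / m

theorem tendsto_stripRate {c : ℝ} (hc : 0 ≤ c) {k : ℤ} (hL : Even L) (h : 2 * |k| ≤ L) :
    Tendsto (fun m : ℕ => Real.log ((transferMatrix L c (2 * k) ^ (2 * m)).trace) / m) atTop
      (𝓝 (stripRate L c k)) := by
  have := sector_nonempty hL h
  exact tendsto_nhds_limUnder (exists_trace_growth (transferMatrix_symm c _)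
    (transferMatrix_nonneg hc _) (one_le_transferMatrix hc _))

theorem one_le_trace {c : ℝ} (hc : 0 ≤ c) {k : ℤ} (hL : Even L) (h : 2 * |k| ≤ L) (m : ℕ) :
    1 ≤ (transferMatrix L c (2 * k) ^ m).trace := by
  have := sector_nonempty hL h
  exact one_le_trace_pow (transferMatrix_nonneg hc _) (one_le_transferMatrix hc _) m

/-- The loop sums have the growth rates of the six-vertex model. -/
theorem tendsto_loopSum {y : ℂ} {r c : ℝ} (hy : y ≠ 0) (hr : y ^ (4 : ℤ) + y ^ (-4 : ℤ) = r)
    (hc : y ^ (2 : ℤ) + y ^ (-2 : ℤ) = c) (hr0 : 0 < r) (hc1 : 1 ≤ c) (hL : Even L)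
    {n : ℕ} (hn : 1 ≤ n) (hnL : 2 * n ≤ L) :
    (∀ m, 0 < loopSum (L + 2) (by omega) r (forcedTime L) ((L + 1) * (2 * m) + 1) n) ∧
    Tendsto (fun m : ℕ => Real.log (loopSum (L + 2) (by omega) r (forcedTime L)
      ((L + 1) * (2 * m) + 1) n) / m) atTop (𝓝 (stripRate L c n)) := by
  have hc0 : 0 ≤ c := by linarith
  have habs : 2 * |(n : ℤ)| ≤ L := by rw [abs_of_nonneg (by omega)]; omega
  have ht := tendsto_stripRate hc0 hL habs
  have h1 := fun m => one_le_trace hc0 hL habs (2 * m)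
  set A := transferMatrix L c (2 * n) with hA
  have hb := fun m => loopSum_bounds hy hr hc hr0 hc1 hL (2 * m) n hn
  have hlow := fun m => trace_le_sum_entries (A := A) (transferMatrix_nonneg hc0 _) (2 * m)
  have hup := fun m => sum_entries_le (A := A) (transferMatrix_symm c _) m
  set K := c ^ (L + 2) * (2 ^ (L + 2) * c ^ (L + 2)) with hK
  have hKpos : 0 < K := by positivity
  have hcard : 0 < (Fintype.card (Sector L (2 * (n : ℤ))) : ℝ) := by
    have : Nonempty (Sector L (2 * (n : ℤ))) := sector_nonempty hL habs
    exact Nat.cast_pos.mpr Fintype.card_pos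
  have hlo : ∀ m, c ^ 2 / K * (A ^ (2 * m)).trace ≤
      loopSum (L + 2) (by omega) r (forcedTime L) ((L + 1) * (2 * m) + 1) n := by
    intro m
    rw [div_mul_eq_mul_div, div_le_iff₀ hKpos, mul_comm _ K]
    refine le_trans ?_ (hb m).2
    gcongr
    exact hlow m
  have hhi : ∀ m, loopSum (L + 2) (by omega) r (forcedTime L) ((L + 1) * (2 * m) + 1) n ≤
      c ^ 2 * (Fintype.card (Sector L (2 * (n : ℤ))) : ℝ) ^ 2 * (A ^ (2 * m)).trace := by
    intro m
    refine (hb m).1.trans ?_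
    rw [mul_assoc]
    gcongr
    exact hup m
  have hpos : ∀ m, 0 < (A ^ (2 * m)).trace := fun m => lt_of_lt_of_le one_pos (h1 m)
  refine ⟨fun m => lt_of_lt_of_le (mul_pos (by positivity) (hpos m)) (hlo m), ?_⟩
  exact growth_congr (C₁ := c ^ 2 / K) (by positivity) (by positivity) hpos hlo hhi ht

end strip

end BKW

end

noncomputable section

namespace BKW

/-! ### Crossing clusters of the helical graph -/

section crossings

variable {N : ℕ} {ε ε' : ℕ → Bool} {T : ℕ}

/-- There are at least `k` clusters joining the frontier to the initial vertices. -/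
def ManyCrossings (N : ℕ) (ε : ℕ → Bool) (T k : ℕ) : Prop :=
  ∃ f : Fin k → ℕ, (∀ i, Frontier N T (f i) ∧ Rooted N ε T (f i)) ∧
    ∀ i j, HelixRel N ε T (f i) (f j) → i = j

theorem manyCrossings_zero : ManyCrossings N ε T 0 := ⟨Fin.elim0, fun i => i.elim0, fun i => i.elim0⟩

theorem ManyCrossings.mono {k k' : ℕ} (h : ManyCrossings N ε T k) (hk : k' ≤ k) :
    ManyCrossings N ε T k' := by
  obtain ⟨f, h1, h2⟩ := h
  exact ⟨fun i => f (Fin.castLE hk i), fun i => h1 _, fun i j hij => Fin.castLE_injective hk (h2 _ _ hij)⟩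

/-- While defects exist, every crossing cluster touches an odd defect, distinct clusters touch
distinct ones, and every odd defect belongs to a crossing cluster. Without defects there is at most
one crossing cluster, and there may be one; hence the restriction to `n ≥ 2`. -/
theorem manyCrossings_iff [NeZero N] (hN : 2 ≤ N) (hE : Even N) {n : ℕ} (hn : 2 ≤ n) :
    ManyCrossings N ε T n ↔ n ≤ (pairingAt N hN ε T).oddDefects.card := by
  classical
  constructor
  · rintro ⟨f, h1, h2⟩
    by_cases hd : (pairingAt N hN ε T).HasDefect
    · have h3 := fun i => (h1 i).2.exists_defect hN hE hd (h1 i).1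
      choose d hd1 hd2 hd3 using h3
      have := Finset.card_le_card_of_injOn (s := (Finset.univ : Finset (Fin n)))
        (t := (pairingAt N hN ε T).oddDefects) (fun i => ((d i : ℤ) : ZMod N)) ?_ ?_
      · simpa using this
      · intro i _
        simp only [AnnularPairing.oddDefects, Finset.coe_filter, Set.mem_ofPred_eq,
          AnnularPairing.mem_defects, AnnularPairing.circle_eq_self_iff,
          AnnularPairing.odd_val_intCast hE]
        exact ⟨hd2 i, by exact_mod_cast (hd1 i).1⟩
      · intro i _ j _ hij
        have h4 : d i = d j := (hd1 i).eq_of_translate (hd1 j)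
          ((AnnularPairing.translate_iff _ _).mpr hij.symm)
        exact h2 i j ((hd3 i).trans (h4 ▸ (hd3 j).symm))
    · have := h2 ⟨0, by omega⟩ ⟨1, by omega⟩
        (helixRel_of_rooted hN hE hd (h1 _).1 (h1 _).1 (h1 _).2 (h1 _).2)
      simp at this
  · intro h
    have h3 : ∀ i : (pairingAt N hN ε T).oddDefects, ∃ a : ℕ, Frontier N T a ∧
        pairingAt N hN ε T a = a ∧ ((a : ℤ) : ZMod N) = i := by
      rintro ⟨i, hi⟩
      obtain ⟨z, rfl⟩ := AnnularPairing.exists_intCast i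
      simp only [AnnularPairing.oddDefects, Finset.mem_filter,
          AnnularPairing.mem_defects, AnnularPairing.circle_eq_self_iff,
          AnnularPairing.odd_val_intCast hE] at hi
      obtain ⟨a, ha, k, hk⟩ := exists_translate_frontier hN hE hi.2 T
      refine ⟨a, ha, by rw [hk]; exact AnnularPairing.defect_shift hi.1 k, ?_⟩
      exact (AnnularPairing.translate_iff _ _).mp ⟨k, hk⟩
    choose g hg1 hg2 hg3 using h3
    let e := (pairingAt N hN ε T).oddDefects.equivFin.symm
    refine ⟨fun i => g (e (Fin.castLE h i)), fun i => ⟨hg1 _, rooted_of_defect hN hE ?_ (hg1 _) (hg2 _)⟩,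
      fun i j hij => ?_⟩
    · exact ⟨_, hg2 (e (Fin.castLE h i))⟩
    · have h4 := eq_of_defects hN hE (hg1 _) (hg1 _) (hg2 _) (hg2 _) hij
      have h5 : e (Fin.castLE h i) = e (Fin.castLE h j) := Subtype.ext (by rw [← hg3, ← hg3, h4])
      exact Fin.castLE_injective h (e.injective h5)

/-- The weight of a configuration on the helix. -/
def helixWeight (N : ℕ) (r : ℝ) (ε : ℕ → Bool) (T : ℕ) : ℝ :=
  r ^ (openCount ε T + 2 * clusterCount N ε T (T + N))

open Classical in
/-- The sum of the weights of the configurations with at least `k` crossing clusters. -/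
def helixSum (N : ℕ) (r : ℝ) (forced : ℕ → Bool) (T k : ℕ) : ℝ :=
  ∑ A ∈ (freeTimes forced T).powerset,
    if ManyCrossings N (choice forced A) T k then helixWeight N r (choice forced A) T else 0

theorem clusterCount_zero_eq (ε ε' : ℕ → Bool) (K : ℕ) : clusterCount N ε 0 K = clusterCount N ε' 0 K :=
  clusterCount_congr fun a b => by rw [HelixRel.zero_iff, HelixRel.zero_iff]

/-- On the configurations counted by both sums a defect is present, and `loopCount_bounds` compares
the two exponents of `r`. -/
theorem helixSum_bounds [NeZero N] (hN : 2 ≤ N) (hE : Even N) {r : ℝ} (hr : 1 ≤ r)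
    (forced : ℕ → Bool) (T : ℕ) {n : ℕ} (hn : 2 ≤ n) :
    r ^ clusterCount N forced 0 (T + N) * loopSum N hN r forced T n ≤ helixSum N r forced T n ∧
    helixSum N r forced T n ≤
      r ^ (clusterCount N forced 0 (T + N) + 2 * N) * loopSum N hN r forced T n := by
  classical
  have key : ∀ A : Finset ℕ, n ≤ (pairingAt N hN (choice forced A) T).oddDefects.card →
      (r ^ clusterCount N forced 0 (T + N) * r ^ loopCount N hN (choice forced A) T ≤
        helixWeight N r (choice forced A) T ∧
      helixWeight N r (choice forced A) T ≤ r ^ (clusterCount N forced 0 (T + N) + 2 * N) *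
        r ^ loopCount N hN (choice forced A) T) := by
    intro A h
    have hd : (pairingAt N hN (choice forced A) T).HasDefect := by
      rw [AnnularPairing.hasDefect_iff]
      obtain ⟨i, hi⟩ := Finset.card_pos.mp
        (show 0 < (pairingAt N hN (choice forced A) T).oddDefects.card by omega)
      exact ⟨i, (AnnularPairing.mem_defects _).mp (Finset.mem_filter.mp hi).1⟩
    have hb := loopCount_bounds hN hE hd
    rw [clusterCount_zero_eq _ forced] at hb
    rw [← pow_add, ← pow_add, helixWeight]
    exact ⟨pow_le_pow_right₀ hr (by omega), pow_le_pow_right₀ hr (by omega)⟩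
  unfold helixSum loopSum
  simp only [manyCrossings_iff hN hE hn, Finset.mul_sum]
  constructor
  · refine Finset.sum_le_sum fun A _ => ?_
    split_ifs with h
    · exact (key A h).1
    · simp
  · refine Finset.sum_le_sum fun A _ => ?_
    split_ifs with h
    · exact (key A h).2
    · simp

/-! ### Restriction of crossings to parts of the helix -/

theorem HelixRel.add_shift {S t a b : ℕ} (hN : 2 ≤ N) (hS : Even S)
    (h : HelixRel N (fun s => ε (s + S)) t a b) : HelixRel N ε (t + S) (a + S) (b + S) := by
  induction h with
  | rel x y h =>
    obtain ⟨s, hs, ⟨h1, h2, h3, h4⟩ | ⟨h1, h2, h3, h4⟩⟩ := h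
    · exact .rel _ _ ⟨s + S, by omega, Or.inl ⟨h1.add_even hS, h2, by omega, by omega⟩⟩
    · exact .rel _ _ ⟨s + S, by omega, Or.inr ⟨h1.add hS, h2, by omega, by omega⟩⟩
  | refl => exact .refl _
  | symm _ _ _ ih => exact ih.symm
  | trans _ _ _ _ _ h1 h2 => exact h1.trans h2

/-- Each crossing cluster passes through every intermediate frontier, and distinct clusters do so at
unconnected vertices. -/
theorem ManyCrossings.of_le {k t : ℕ} (hN : 2 ≤ N) (hE : Even N) (htT : t ≤ T)
    (h : ManyCrossings N ε T k) : ManyCrossings N ε t k := by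
  induction T, htT using Nat.le_induction with
  | base => exact h
  | succ T _ ih =>
    apply ih
    obtain ⟨f, h1, h2⟩ := h
    have h3 := fun i => (h1 i).2.exists_prev hN hE (h1 i).1
    choose z hz1 hz2 hz3 using h3
    exact ⟨z, fun i => ⟨hz1 i, hz3 i⟩, fun i j hij =>
      h2 i j (((hz2 i).trans (hij.mono (by omega))).trans (hz2 j).symm)⟩

/-- A path from the frontier to the initial vertices passes through an intermediate frontier. -/
theorem Rooted.exists_shift {S a : ℕ} (hN : 2 ≤ N) (hE : Even N) (hS : Even S)
    (ha : Frontier N T a) (h : Rooted N ε (T + S) (a + S)) :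
    ∃ z < N, Odd z ∧ HelixRel N (fun s => ε (s + S)) T a z := by
  by_contra hno
  push Not at hno
  -- If the cluster of `a` in the upper part avoided the labels below `N`, no edge created before
  -- time `S` would touch it: it would be a whole cluster, unable to reach the initial vertices.
  have key : ∀ b, HelixRel N (fun s => ε (s + S)) T a b → N ≤ b := by
    intro b hb
    by_contra hlt
    exact hno b (by omega) ((hb.odd hN hE).mp ha.1) hb
  have key2 : ∀ x y, HelixRel N ε (T + S) x y →
      ((∃ b, x = b + S ∧ HelixRel N (fun s => ε (s + S)) T a b) ↔
        (∃ b, y = b + S ∧ HelixRel N (fun s => ε (s + S)) T a b)) := by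
    intro x y hxy
    induction hxy with
    | rel x y h =>
      obtain ⟨s, hs, h⟩ := h
      by_cases hsS : S ≤ s
      · obtain ⟨s', rfl⟩ := Nat.exists_eq_add_of_le' hsS
        have hpS : Odd (s' + S) ↔ Odd s' := by
          rw [Nat.odd_add]; simp [hS]
        have hpS' : Even (s' + S) ↔ Even s' := by
          rw [Nat.even_add]; simp [hS]
        rw [hpS, hpS'] at h
        have hedge : ∃ u v, x = u + S ∧ y = v + S ∧ HelixEdge N (fun s => ε (s + S)) T u v := by
          rcases h with ⟨g1, g2, g3, g4⟩ | ⟨g1, g2, g3, g4⟩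
          · exact ⟨s', s' + N, g3, by omega, s', by omega, Or.inl ⟨g1, g2, rfl, rfl⟩⟩
          · exact ⟨s' + N - 1, s' + 1, by omega, by omega, s', by omega, Or.inr ⟨g1, g2, rfl, rfl⟩⟩
        obtain ⟨u, v, rfl, rfl, huv⟩ := hedge
        constructor
        · rintro ⟨b, hb, hr⟩
          obtain rfl : u = b := by omega
          exact ⟨v, rfl, hr.trans (.rel _ _ huv)⟩
        · rintro ⟨b, hb, hr⟩
          obtain rfl : v = b := by omega
          exact ⟨u, rfl, hr.trans (Relation.EqvGen.rel _ _ huv).symm⟩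
      · constructor
        · rintro ⟨b, hb, hr⟩
          have := key b hr; omega
        · rintro ⟨b, hb, hr⟩
          have := key b hr; omega
    | refl => exact Iff.rfl
    | symm _ _ _ ih => exact ih.symm
    | trans _ _ _ _ _ h1 h2 => exact h1.trans h2
  obtain ⟨c, hc, hco, hr⟩ := h
  obtain ⟨b, hb, hr'⟩ := (key2 _ _ hr).mp ⟨a, rfl, .refl _⟩
  have := key b hr'
  omega

theorem ManyCrossings.shift {S k : ℕ} (hN : 2 ≤ N) (hE : Even N) (hS : Even S)
    (h : ManyCrossings N ε (T + S) k) : ManyCrossings N (fun s => ε (s + S)) T k := by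
  obtain ⟨f, h1, h2⟩ := h
  have h3 : ∀ i, ∃ a, f i = a + S ∧ Frontier N T a := by
    intro i
    obtain ⟨g1, g2, g3⟩ := (h1 i).1
    refine ⟨f i - S, by omega, ?_, by omega, by omega⟩
    exact Nat.Odd.sub_even (by omega) g1 hS
  choose a ha hf using h3
  refine ⟨a, fun i => ⟨hf i, ?_⟩, fun i j hij => h2 i j ?_⟩
  · obtain ⟨z, hz, hzo, hr⟩ := Rooted.exists_shift hN hE hS (hf i) (ha i ▸ (h1 i).2)
    exact ⟨z, hz, hzo, hr⟩
  · rw [ha, ha]; exact hij.add_shift hN hS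

/-- The largest vertex of a cluster remains the largest of its cluster within the part of the helix
where it is counted, as parts have fewer connections. -/
theorem clusterCount_add_le {S t : ℕ} (hN : 2 ≤ N) (hS : Even S) (ht : t ≤ T + S) (hSt : S ≤ t + N) :
    clusterCount N ε (T + S) (T + S + N) ≤ clusterCount N ε t (t + N) +
      clusterCount N (fun s => ε (s + S)) T (T + N) := by
  classical
  have : ((Finset.range (T + S + N)).filter fun a => Odd a ∧ IsTop N ε (T + S) a) ⊆
      ((Finset.range (t + N)).filter fun a => Odd a ∧ IsTop N ε t a) ∪
      ((Finset.range (T + N)).filter fun a => Odd a ∧ IsTop N (fun s => ε (s + S)) T a).image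
        (· + S) := by
    intro a ha
    simp only [Finset.mem_filter, Finset.mem_range, Finset.mem_union, Finset.mem_image] at ha ⊢
    by_cases h : a < t + N
    · exact Or.inl ⟨h, ha.2.1, fun b hb => ha.2.2 b (hb.mono ht)⟩
    · right
      refine ⟨a - S, ⟨by omega, Nat.Odd.sub_even (by omega) ha.2.1 hS, fun b hb => ?_⟩, by omega⟩
      have := ha.2.2 (b + S) (by
        have := hb.add_shift hN hS
        rwa [Nat.sub_add_cancel (by omega)] at this)
      omega
  unfold clusterCount
  calc _ ≤ _ := Finset.card_le_card this
    _ ≤ _ := Finset.card_union_le _ _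
    _ ≤ _ := Nat.add_le_add_left Finset.card_image_le _

theorem openCount_add_le {S t : ℕ} (hS : Even S) (hSt : S ≤ t) :
    openCount ε (T + S) ≤ openCount ε t + openCount (fun s => ε (s + S)) T := by
  classical
  unfold openCount
  have : ((Finset.range (T + S)).filter fun s => (Odd s ∧ ε s = false) ∨ (Even s ∧ ε s = true)) ⊆
      ((Finset.range t).filter fun s => (Odd s ∧ ε s = false) ∨ (Even s ∧ ε s = true)) ∪
      ((Finset.range T).filter fun s => (Odd s ∧ ε (s + S) = false) ∨
        (Even s ∧ ε (s + S) = true)).image (· + S) := by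
    intro s hs
    simp only [Finset.mem_filter, Finset.mem_range, Finset.mem_union, Finset.mem_image] at hs ⊢
    by_cases h : s < t
    · exact Or.inl ⟨h, hs.2⟩
    · right
      refine ⟨s - S, ⟨by omega, ?_⟩, by omega⟩
      rw [Nat.sub_add_cancel (by omega)]
      rcases hs.2 with h1 | h1
      · exact Or.inl ⟨Nat.Odd.sub_even (by omega) h1.1 hS, h1.2⟩
      · exact Or.inr ⟨(Nat.even_sub (by omega)).mpr (by simp [h1.1, hS]), h1.2⟩
  calc _ ≤ _ := Finset.card_le_card this
    _ ≤ _ := Finset.card_union_le _ _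
    _ ≤ _ := Nat.add_le_add_left Finset.card_image_le _

end crossings

end BKW

end

noncomputable section

namespace BKW

/-! ### Submultiplicativity of the helical sums -/

section submul

variable {N : ℕ} {ε ε' : ℕ → Bool} {T : ℕ}

theorem helixRel_congr (h : ∀ s < T, ε s = ε' s) (a b : ℕ) :
    HelixRel N ε T a b ↔ HelixRel N ε' T a b := by
  have key : ∀ {ε ε' : ℕ → Bool}, (∀ s < T, ε s = ε' s) → ∀ x y, HelixEdge N ε T x y →
      HelixEdge N ε' T x y := by
    rintro ε ε' h x y ⟨s, hs, h1⟩
    rw [h s hs] at h1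
    exact ⟨s, hs, h1⟩
  exact ⟨fun g => Relation.EqvGen.mono (key h) _ _ g,
    fun g => Relation.EqvGen.mono (key fun s hs => (h s hs).symm) _ _ g⟩

theorem manyCrossings_congr (h : ∀ s < T, ε s = ε' s) (k : ℕ) :
    ManyCrossings N ε T k ↔ ManyCrossings N ε' T k := by
  simp only [ManyCrossings, Rooted, helixRel_congr h]

theorem openCount_congr (h : ∀ s < T, ε s = ε' s) : openCount ε T = openCount ε' T := by
  classical
  unfold openCount
  refine congrArg _ (Finset.filter_congr fun s hs => ?_)
  rw [h s (Finset.mem_range.mp hs)]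

theorem helixWeight_congr (r : ℝ) (h : ∀ s < T, ε s = ε' s) :
    helixWeight N r ε T = helixWeight N r ε' T := by
  rw [helixWeight, helixWeight, openCount_congr h, clusterCount_congr (helixRel_congr h)]

theorem helixWeight_pos {r : ℝ} (hr : 0 < r) : 0 < helixWeight N r ε T := pow_pos hr _

theorem helixSum_nonneg {r : ℝ} (hr : 0 < r) (forced : ℕ → Bool) (T k : ℕ) :
    0 ≤ helixSum N r forced T k := by
  classical
  refine Finset.sum_nonneg fun A _ => ?_
  split_ifs
  · exact (helixWeight_pos hr).le
  · exact le_rfl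

/-- The helix is cut at the forced time `S`, which is shared by both parts and leaves no choice.
Crossing clusters of the whole cross each part, and both terms of the exponent of `r` are
subadditive. Positivity then allows summing over independent pairs of configurations. -/
theorem helixSum_add_le (hN : 2 ≤ N) (hE : Even N) {r : ℝ} (hr : 1 ≤ r) {forced : ℕ → Bool}
    {S : ℕ} (hS : Even S) (hT : 1 ≤ T) (hfS : forced S = true)
    (hf : ∀ s, forced (s + S) = forced s) (k : ℕ) :
    helixSum N r forced (T + S) k ≤ helixSum N r forced (S + 1) k * helixSum N r forced T k := by
  classical
  have hr0 : 0 < r := by linarith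
  set P := (freeTimes forced (S + 1)).powerset with hP
  set Q := (freeTimes forced T).powerset with hQ
  set F : Finset ℕ → ℝ := fun A => if ManyCrossings N (choice forced A) (S + 1) k then
    helixWeight N r (choice forced A) (S + 1) else 0 with hF
  set G : Finset ℕ → ℝ := fun A => if ManyCrossings N (choice forced A) T k then
    helixWeight N r (choice forced A) T else 0 with hG
  have hF0 : ∀ A, 0 ≤ F A := fun A => by
    simp only [hF]; split_ifs
    · exact (helixWeight_pos hr0).le
    · exact le_rfl
  have hG0 : ∀ A, 0 ≤ G A := fun A => by
    simp only [hG]; split_ifs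
    · exact (helixWeight_pos hr0).le
    · exact le_rfl
  -- The free times before `S`, and those after `S` shifted back; `S` itself is not free, so nothing
  -- is lost.
  let φ : Finset ℕ → Finset ℕ × Finset ℕ := fun A =>
    (A.filter fun s => s < S, (Finset.range T).filter fun s => s + S ∈ A)
  have hmem : ∀ A ∈ (freeTimes forced (T + S)).powerset, ∀ s ∈ A, s < T + S ∧ forced s = false := by
    intro A hA s hs
    have := Finset.mem_powerset.mp hA hs
    simpa [freeTimes] using this
  have h1 : ∀ A ∈ (freeTimes forced (T + S)).powerset,
      (∀ s < S + 1, choice forced A s = choice forced (φ A).1 s) ∧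
      (∀ s < T, choice forced A (s + S) = choice forced (φ A).2 s) := by
    intro A hA
    refine ⟨fun s hs => ?_, fun s hs => ?_⟩
    · by_cases h : s = S
      · simp [choice, h, hfS]
      · have : s < S := by omega
        simp [choice, φ, this]
    · simp [choice, φ, hs, hf]
  have hterm : ∀ A ∈ (freeTimes forced (T + S)).powerset,
      (if ManyCrossings N (choice forced A) (T + S) k then helixWeight N r (choice forced A) (T + S)
        else 0) ≤ F (φ A).1 * G (φ A).2 := by
    intro A hA
    split_ifs with h
    · have m1 := (manyCrossings_congr (h1 A hA).1 k).mp (h.of_le hN hE (show S + 1 ≤ T + S by omega))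
      have m2 := (manyCrossings_congr (h1 A hA).2 k).mp (h.shift hN hE hS)
      simp only [hF, hG]
      rw [if_pos m1, if_pos m2, ← helixWeight_congr r (h1 A hA).1, ← helixWeight_congr r (h1 A hA).2,
        helixWeight, helixWeight, helixWeight, ← pow_add]
      refine pow_le_pow_right₀ hr ?_
      have e1 := clusterCount_add_le (ε := choice forced A) (T := T) (t := S + 1) hN hS
        (by omega) (by omega)
      have e2 := openCount_add_le (ε := choice forced A) (T := T) (t := S + 1) hS (by omega)
      omega
    · exact mul_nonneg (hF0 _) (hG0 _)
  have hinj : Set.InjOn φ (freeTimes forced (T + S)).powerset := by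
    intro A hA B hB hAB
    have k1 : ∀ A B : Finset ℕ, A ∈ (freeTimes forced (T + S)).powerset → φ A = φ B → A ⊆ B := by
      intro A B hA hAB s hs
      obtain ⟨g1, g2⟩ := hmem A hA s hs
      by_cases h : s < S
      · have : s ∈ (φ A).1 := by simp [φ, hs, h]
        rw [hAB] at this
        exact (Finset.mem_filter.mp this).1
      · have : s - S ∈ (φ A).2 := by
          simp only [φ, Finset.mem_filter, Finset.mem_range]
          rw [Nat.sub_add_cancel (by omega)]
          exact ⟨by omega, hs⟩
        rw [hAB] at this
        have := (Finset.mem_filter.mp this).2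
        rwa [Nat.sub_add_cancel (by omega)] at this
    exact (k1 A B hA hAB).antisymm (k1 B A hB hAB.symm)
  have himg : (freeTimes forced (T + S)).powerset.image φ ⊆ P ×ˢ Q := by
    intro x hx
    obtain ⟨A, hA, rfl⟩ := Finset.mem_image.mp hx
    simp only [hP, hQ, Finset.mem_product, Finset.mem_powerset, φ]
    refine ⟨fun s hs => ?_, fun s hs => ?_⟩
    · have := hmem A hA s (Finset.mem_filter.mp hs).1
      have := (Finset.mem_filter.mp hs).2
      simp only [freeTimes, Finset.mem_filter, Finset.mem_range]
      exact ⟨by omega, (hmem A hA s (Finset.mem_filter.mp hs).1).2⟩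
    · obtain ⟨g1, g2⟩ := Finset.mem_filter.mp hs
      have := hmem A hA _ g2
      rw [hf] at this
      simp only [freeTimes, Finset.mem_filter]
      exact ⟨g1, this.2⟩
  calc helixSum N r forced (T + S) k
      ≤ ∑ A ∈ (freeTimes forced (T + S)).powerset, F (φ A).1 * G (φ A).2 := Finset.sum_le_sum hterm
    _ = ∑ x ∈ (freeTimes forced (T + S)).powerset.image φ, F x.1 * G x.2 :=
        (Finset.sum_image (f := fun x : Finset ℕ × Finset ℕ => F x.1 * G x.2) hinj).symm
    _ ≤ ∑ x ∈ P ×ˢ Q, F x.1 * G x.2 :=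
        Finset.sum_le_sum_of_subset_of_nonneg himg fun x _ _ => mul_nonneg (hF0 _) (hG0 _)
    _ = _ := by rw [Finset.sum_product, helixSum, helixSum, Finset.sum_mul_sum]

/-! ### Modifying a configuration -/

/-- Changing one step creates at most one edge. A vertex losing its status as top is the smaller of
the two tops joined by that edge, so there is at most one. -/
theorem clusterCount_update_le (hN : 2 ≤ N) {s : ℕ} (h : ∀ t, t ≠ s → ε t = ε' t) (K : ℕ) :
    clusterCount N ε T K ≤ clusterCount N ε' T K + 1 := by
  classical
  by_cases hs : (Odd s ∧ ε' s = false) ∨ (Even s ∧ ε' s = true)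
  swap
  · -- no new edge
    have hsub : ∀ a b, HelixRel N ε' T a b → HelixRel N ε T a b := fun a b hab =>
      Relation.EqvGen.mono (fun x y hxy => by
        obtain ⟨t, ht, h1⟩ := hxy
        have : t ≠ s := by
          rintro rfl
          rcases h1 with g | g
          · exact hs (Or.inl ⟨g.1, g.2.1⟩)
          · exact hs (Or.inr ⟨g.1, g.2.1⟩)
        rw [← h t this] at h1
        exact ⟨t, ht, h1⟩) _ _ hab
    refine (Finset.card_le_card ?_).trans (Nat.le_succ _)
    intro a ha
    simp only [Finset.mem_filter] at ha ⊢
    exact ⟨ha.1, ha.2.1, fun b hb => ha.2.2 b (hsub a b hb)⟩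
  obtain ⟨u, v, huv⟩ : ∃ u v, ∀ a b, HelixEdge N ε' T a b →
      HelixEdge N ε T a b ∨ (a = u ∧ b = v) := by
    rcases hs with hs | hs
    · refine ⟨s, s + N, fun a b => ?_⟩
      rintro ⟨t, ht, h1⟩
      by_cases e : t = s
      · subst e
        rcases h1 with g | g
        · exact Or.inr ⟨g.2.2.1, g.2.2.2⟩
        · exact absurd hs.1 (Nat.not_odd_iff_even.mpr g.1)
      · rw [← h t e] at h1; exact Or.inl ⟨t, ht, h1⟩
    · refine ⟨s + N - 1, s + 1, fun a b => ?_⟩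
      rintro ⟨t, ht, h1⟩
      by_cases e : t = s
      · subst e
        rcases h1 with g | g
        · exact absurd g.1 (Nat.not_odd_iff_even.mpr hs.1)
        · exact Or.inr ⟨g.2.2.1, g.2.2.2⟩
      · rw [← h t e] at h1; exact Or.inl ⟨t, ht, h1⟩
  have hrel : ∀ a b, HelixRel N ε' T a b → HelixRel N ε T a b ∨
      (HelixRel N ε T a u ∧ HelixRel N ε T v b) ∨ (HelixRel N ε T a v ∧ HelixRel N ε T u b) := by
    intro a b hab
    refine (eqvGen_insert (r := HelixEdge N ε T)
      (r' := fun a b => HelixEdge N ε T a b ∨ (a = u ∧ b = v)) (fun _ _ => Iff.rfl) a b).mp ?_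
    exact Relation.EqvGen.mono huv _ _ hab
  set X := (Finset.range K).filter fun a => Odd a ∧ IsTop N ε T a with hX
  set Y := (Finset.range K).filter fun a => Odd a ∧ IsTop N ε' T a with hY
  have hlost : (X \ Y).card ≤ 1 := by
    rw [Finset.card_le_one]
    have hinfo : ∀ a ∈ X \ Y, IsTop N ε T a ∧ ∃ b, a < b ∧
        ((HelixRel N ε T a u ∧ HelixRel N ε T v b) ∨ (HelixRel N ε T a v ∧ HelixRel N ε T u b)) := by
      intro a ha
      simp only [hX, hY, Finset.mem_sdiff, Finset.mem_filter, not_and] at ha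
      obtain ⟨⟨g1, g2, g3⟩, g4⟩ := ha
      refine ⟨g3, ?_⟩
      have := g4 g1 g2
      rw [IsTop] at this
      push Not at this
      obtain ⟨b, hb, hlt⟩ := this
      refine ⟨b, hlt, ?_⟩
      rcases hrel a b hb with h | h
      · have := g3 b h; omega
      · exact h
    intro a ha a' ha'
    obtain ⟨t1, b, l1, g⟩ := hinfo a ha
    obtain ⟨t2, b', l2, g'⟩ := hinfo a' ha'
    rcases g with ⟨g1, g2⟩ | ⟨g1, g2⟩ <;> rcases g' with ⟨g3, g4⟩ | ⟨g3, g4⟩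
    · have := t1 a' (g1.trans g3.symm); have := t2 a (g3.trans g1.symm); omega
    · have := t1 b' (g1.trans g4); have := t2 b (g3.trans g2); omega
    · have := t1 b' (g1.trans g4); have := t2 b (g3.trans g2); omega
    · have := t1 a' (g1.trans g3.symm); have := t2 a (g3.trans g1.symm); omega
  calc clusterCount N ε T K = X.card := rfl
    _ ≤ (X \ Y).card + Y.card := by
        have := Finset.card_le_card_sdiff_add_card (s := X) (t := Y)
        omega
    _ ≤ _ := by
        have : clusterCount N ε' T K = Y.card := rfl
        omega

theorem clusterCount_le_of_agree (hN : 2 ≤ N) (X : Finset ℕ) (h : ∀ t, t ∉ X → ε t = ε' t) (K : ℕ) :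
    clusterCount N ε T K ≤ clusterCount N ε' T K + X.card := by
  classical
  induction X using Finset.induction_on generalizing ε' with
  | empty =>
    have : ε = ε' := funext fun t => h t (by simp)
    simp [this]
  | insert s X hs ih =>
    have h1 := ih (ε' := Function.update ε' s (ε s)) (fun t ht => by
      by_cases e : t = s
      · subst e; simp
      · rw [Function.update_of_ne e]; exact h t (by simp [e, ht]))
    have h2 := clusterCount_update_le (T := T) (ε := Function.update ε' s (ε s)) (ε' := ε') (s := s) hN
      (fun t ht => Function.update_of_ne ht _ _) K
    rw [Finset.card_insert_of_notMem hs]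
    omega

theorem openCount_le_of_agree (X : Finset ℕ) (h : ∀ t, t ∉ X → ε t = ε' t) :
    openCount ε T ≤ openCount ε' T + X.card := by
  classical
  unfold openCount
  refine (Finset.card_le_card ?_).trans (Finset.card_union_le _ X)
  intro s hs
  simp only [Finset.mem_filter, Finset.mem_union] at hs ⊢
  by_cases e : s ∈ X
  · exact Or.inr e
  · left; rw [← h s e]; exact hs

theorem helixWeight_le_of_agree (hN : 2 ≤ N) {r : ℝ} (hr : 1 ≤ r) (X : Finset ℕ)
    (h : ∀ t, t ∉ X → ε t = ε' t) :
    helixWeight N r ε T ≤ r ^ (3 * X.card) * helixWeight N r ε' T := by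
  rw [helixWeight, helixWeight, ← pow_add]
  -- Each modified time costs one for the number of edges and two for twice the number of clusters.
  refine pow_le_pow_right₀ hr ?_
  have := clusterCount_le_of_agree (T := T) hN X h (T + N)
  have := openCount_le_of_agree (T := T) X h
  omega

/-- Forcing the configuration on a set of free times costs a factor exponential in its size. -/
theorem helixSum_zero_le (hN : 2 ≤ N) {r : ℝ} (hr : 1 ≤ r) {forced : ℕ → Bool} {X Y : Finset ℕ}
    (hX : X ⊆ freeTimes forced T) (hY : Y ⊆ X) (k : ℕ)
    (hk : ∀ A ⊆ freeTimes forced T, A ∩ X = Y → ManyCrossings N (choice forced A) T k) :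
    helixSum N r forced T 0 ≤ (2 * r ^ 3) ^ X.card * helixSum N r forced T k := by
  classical
  have hr0 : 0 < r := by linarith
  set P := (freeTimes forced T).powerset with hP
  have hmod : ∀ A ∈ P, (A \ X) ∪ Y ∈ P := by
    intro A hA
    rw [hP, Finset.mem_powerset] at hA ⊢
    exact Finset.union_subset (Finset.sdiff_subset.trans hA) (hY.trans hX)
  have hint : ∀ A : Finset ℕ, ((A \ X) ∪ Y) ∩ X = Y := by
    intro A; ext s
    simp only [Finset.mem_inter, Finset.mem_union, Finset.mem_sdiff]
    constructor
    · rintro ⟨⟨_, h⟩ | h, h'⟩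
      · exact absurd h' h
      · exact h
    · exact fun h => ⟨Or.inr h, hY h⟩
  have hw : ∀ A ∈ P, helixWeight N r (choice forced A) T ≤
      r ^ (3 * X.card) * (if ManyCrossings N (choice forced ((A \ X) ∪ Y)) T k then
        helixWeight N r (choice forced ((A \ X) ∪ Y)) T else 0) := by
    intro A hA
    rw [if_pos (hk _ (Finset.mem_powerset.mp (hmod A hA)) (hint A))]
    refine helixWeight_le_of_agree hN hr X fun t ht => ?_
    have : t ∉ Y := fun h => ht (hY h)
    simp [choice, ht, this]
  set G : Finset ℕ → ℝ := fun A => if ManyCrossings N (choice forced A) T k then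
    helixWeight N r (choice forced A) T else 0 with hG
  have hG0 : ∀ A, 0 ≤ G A := fun A => by
    simp only [hG]; split_ifs
    · exact (helixWeight_pos hr0).le
    · exact le_rfl
  calc helixSum N r forced T 0 = ∑ A ∈ P, helixWeight N r (choice forced A) T := by
        refine Finset.sum_congr rfl fun A _ => ?_
        rw [if_pos manyCrossings_zero]
    _ ≤ ∑ A ∈ P, r ^ (3 * X.card) * G ((A \ X) ∪ Y) := Finset.sum_le_sum hw
    _ = r ^ (3 * X.card) * ∑ A ∈ P, G ((A \ X) ∪ Y) := by rw [Finset.mul_sum]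
    _ = r ^ (3 * X.card) * ∑ B ∈ P, ∑ A ∈ P.filter (fun A => (A \ X) ∪ Y = B), G B := by
        congr 1
        rw [← Finset.sum_fiberwise_of_maps_to hmod]
        refine Finset.sum_congr rfl fun B _ => Finset.sum_congr rfl fun A hA => ?_
        rw [(Finset.mem_filter.mp hA).2]
    _ ≤ r ^ (3 * X.card) * ∑ B ∈ P, 2 ^ X.card * G B := by
        gcongr with B hB
        rw [Finset.sum_const, nsmul_eq_mul]
        refine mul_le_mul_of_nonneg_right ?_ (hG0 B)
        -- A modified configuration forgets only the original values on `X`, so it has at most `2 ^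
        -- X.card` preimages.
        have : (P.filter fun A => (A \ X) ∪ Y = B).card ≤ X.powerset.card := by
          refine Finset.card_le_card_of_injOn (fun A => A ∩ X) (fun A _ => by simp) ?_
          intro A hA A' hA' e
          simp only [Finset.coe_filter, Set.mem_ofPred_eq] at hA hA'
          have key : ∀ A A' : Finset ℕ, A \ X ∪ Y = A' \ X ∪ Y → A ∩ X = A' ∩ X → A ⊆ A' := by
            intro A A' h1 h2 s hs
            by_cases hsX : s ∈ X
            · have : s ∈ A ∩ X := by simp [hs, hsX]
              rw [h2] at this
              exact (Finset.mem_inter.mp this).1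
            · have : s ∈ A \ X ∪ Y := by simp [hs, hsX]
              rw [h1, Finset.mem_union, Finset.mem_sdiff] at this
              rcases this with h | h
              · exact h.1
              · exact absurd (hY h) hsX
          exact (key A A' (hA.2.trans hA'.2.symm) e).antisymm
            (key A' A (hA'.2.trans hA.2.symm) e.symm)
        rw [Finset.card_powerset] at this
        exact_mod_cast this
    _ = _ := by rw [← Finset.mul_sum, mul_pow, ← pow_mul, helixSum]; ring

end submul

end BKW

end

noncomputable section

namespace BKW

/-! ### Vertical crossings by zigzag paths -/

section zigzag

variable {L M : ℕ} {ε : ℕ → Bool}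

/-- The label of the vertex `(x, y)` on the helix. -/
def label (L x y : ℕ) : ℕ := (L + 1) * y + x + 1

theorem label_mod {x : ℕ} (hx : x ≤ L) (y : ℕ) : (label L x y - 1) % (L + 1) = x := by
  rw [label, Nat.add_sub_cancel, Nat.mul_add_mod, Nat.mod_eq_of_lt (by omega)]

theorem forcedTime_label {x : ℕ} (hx : x < L) (y : ℕ) : forcedTime L (label L x y) = false := by
  rw [forcedTime, label, add_assoc, Nat.mul_add_mod, Nat.mod_eq_of_lt (by omega)]
  simp

theorem label_lt {x y : ℕ} (hx : x < L) (hy : y < M) : label L x y < (L + 1) * M + 1 := by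
  have := Nat.mul_le_mul_left (L + 1) (show y + 1 ≤ M by omega)
  rw [label]
  linarith

theorem odd_label (hL : Even L) (x y : ℕ) : Odd (label L x y) ↔ Even (x + y) := by
  rw [label, Nat.odd_add_one, Nat.not_odd_iff_even]
  simp only [Nat.even_add, Nat.even_mul, hL]
  simp [iff_comm]

/-- Under the hypothesis all edges between the columns `x` and `x + 1` are open, and a path climbs
by alternating steps up to the right and up to the left. -/
theorem zigzag (hL : Even L) {x : ℕ} (hx : Even x) (hxL : x < L)
    (h : ∀ y < M, ε (label L x y) = decide (Even (label L x y))) {Y : ℕ} (hY : 2 * Y ≤ M) :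
    HelixRel (L + 2) ε ((L + 1) * M + 1) (label L x (2 * Y)) (label L x 0) := by
  induction Y with
  | zero => exact .refl _
  | succ Y ih =>
    refine HelixRel.trans ?_ (ih (by omega))
    have o1 : Odd (label L x (2 * Y)) := (odd_label hL _ _).mpr (hx.add (even_two_mul _))
    have e1 : Even (label L x (2 * Y + 1)) := by
      rw [← Nat.not_odd_iff_even, odd_label hL]
      rw [Nat.not_even_iff_odd, ← add_assoc]
      exact (hx.add (even_two_mul _)).add_one
    have h1 : HelixRel (L + 2) ε ((L + 1) * M + 1) (label L x (2 * Y)) (label L (x + 1) (2 * Y + 1)) :=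
      .rel _ _ ⟨_, label_lt hxL (by omega), Or.inl ⟨o1, by
        rw [h _ (by omega)]; simpa using o1, rfl, by simp only [label]; ring⟩⟩
    have h2 : HelixRel (L + 2) ε ((L + 1) * M + 1) (label L x (2 * (Y + 1))) (label L (x + 1) (2 * Y + 1)) :=
      .rel _ _ ⟨_, label_lt hxL (show 2 * Y + 1 < M by omega), Or.inr ⟨e1, by
        rw [h _ (by omega)]; simpa using e1, by simp only [label]; ring_nf; omega,
        by simp only [label]; ring⟩⟩
    exact h2.trans h1.symm

theorem crossing_of_zigzag (hL : Even L) (hM : Even M) {x : ℕ} (hx : Even x) (hxL : x < L)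
    (h : ∀ y < M, ε (label L x y) = decide (Even (label L x y))) :
    Frontier (L + 2) ((L + 1) * M + 1) (label L x M) ∧
      Rooted (L + 2) ε ((L + 1) * M + 1) (label L x M) := by
  refine ⟨⟨(odd_label hL _ _).mpr (hx.add hM), by rw [label]; omega, by rw [label]; omega⟩,
    label L x 0, by rw [label]; omega, (odd_label hL _ _).mpr (by simpa using hx), ?_⟩
  obtain ⟨Y, rfl⟩ := hM
  rw [← two_mul]
  exact zigzag hL hx hxL (by rwa [← two_mul] at h) (by omega)

theorem one_le_helixSum (hL : Even L) (hL2 : 2 ≤ L) (hM : Even M) {r : ℝ} (hr : 1 ≤ r) {k : ℕ}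
    (hk : k ≤ 1) : 1 ≤ helixSum (L + 2) r (forcedTime L) ((L + 1) * M + 1) k := by
  classical
  set T := (L + 1) * M + 1 with hT
  set A := (freeTimes (forcedTime L) T).filter Even with hA
  have hmany : ManyCrossings (L + 2) (choice (forcedTime L) A) T k := by
    refine ManyCrossings.mono ?_ hk
    refine ⟨fun _ => label L 0 M, fun i => crossing_of_zigzag hL hM (by simp) (by omega) ?_,
      fun i j _ => Subsingleton.elim i j⟩
    intro y hy
    have h1 := forcedTime_label (L := L) (x := 0) (by omega) y
    have h2 := label_lt (L := L) (M := M) (x := 0) (by omega) hy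
    simp [choice, h1, hA, freeTimes, h2, hT]
  have : 1 ≤ (if ManyCrossings (L + 2) (choice (forcedTime L) A) T k then
      helixWeight (L + 2) r (choice (forcedTime L) A) T else 0) := by
    rw [if_pos hmany]
    exact one_le_pow₀ hr
  refine this.trans (Finset.single_le_sum (f := fun A =>
    if ManyCrossings (L + 2) (choice (forcedTime L) A) T k then
      helixWeight (L + 2) r (choice (forcedTime L) A) T else 0) (fun B _ => ?_) ?_)
  · split_ifs
    · exact (helixWeight_pos (by linarith)).le
    · exact le_rfl
  · rw [Finset.mem_powerset]; exact Finset.filter_subset _ _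

/-- Closed columns separate the helix. -/
theorem separated (hL4 : 4 ≤ L) {T : ℕ} (hf : ∀ s < T, s % (L + 1) = 0 → ε s = true)
    (h1 : ∀ s < T, s % (L + 1) = 2 ∨ s % (L + 1) = L → ε s = decide (Odd s)) {a b : ℕ}
    (h : HelixRel (L + 2) ε T a b) :
    ((a - 1) % (L + 1) = 0 ∨ (a - 1) % (L + 1) = 1 ∨ (a - 1) % (L + 1) = L) ↔
    ((b - 1) % (L + 1) = 0 ∨ (b - 1) % (L + 1) = 1 ∨ (b - 1) % (L + 1) = L) := by
  induction h with
  | rel a b h =>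
    obtain ⟨s, hs, h⟩ := h
    have hm := Nat.mod_lt s (show 0 < L + 1 by omega)
    have hd := Nat.div_add_mod s (L + 1)
    set q := s / (L + 1)
    rcases Nat.eq_zero_or_pos (s % (L + 1)) with h0 | h0
    · have hε := hf s hs h0
      rcases h with ⟨_, g, _⟩ | ⟨_, _, ga, gb⟩
      · rw [hε] at g; exact absurd g (by simp)
      · have e1 : a = label L L q := by rw [label]; omega
        have e2 : b = label L 0 q := by rw [label]; omega
        rw [e1, e2, label_mod le_rfl, label_mod (by omega)]
        omega
    · obtain ⟨x, hx⟩ : ∃ x, s % (L + 1) = x + 1 := ⟨s % (L + 1) - 1, by omega⟩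
      have hq : (L + 1) * (q + 1) = (L + 1) * q + (L + 1) := by ring
      have hpair : (a = label L x q ∧ b = label L (x + 1) (q + 1)) ∨
          (a = label L x (q + 1) ∧ b = label L (x + 1) q) := by
        rcases h with ⟨_, _, ga, gb⟩ | ⟨_, _, ga, gb⟩
        · left; simp only [label]; omega
        · right; simp only [label]; omega
      have hmod : (a - 1) % (L + 1) = x ∧ (b - 1) % (L + 1) = x + 1 := by
        rcases hpair with ⟨rfl, rfl⟩ | ⟨rfl, rfl⟩ <;>
          exact ⟨label_mod (by omega) _, label_mod (by omega) _⟩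
      rw [hmod.1, hmod.2]
      -- An edge of column `x` joins the columns `x` and `x + 1`, so only the closed columns `1` and
      -- `L - 1` could connect the block `{0, 1, L}` with the others.
      have hne : x ≠ 1 ∧ x ≠ L - 1 := by
        by_contra hcon
        have hε := h1 s hs (by omega)
        rcases h with ⟨g1, g2, _⟩ | ⟨g1, g2, _⟩
        · rw [hε] at g2; simp [g1] at g2
        · rw [hε] at g2; simp only [decide_eq_true_eq] at g2
          exact Nat.not_even_iff_odd.mpr g2 g1
      omega
  | refl => exact Iff.rfl
  | symm _ _ _ ih => exact ih.symm
  | trans _ _ _ _ _ h1 h2 => exact h1.trans h2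

/-- Finite energy: two crossing clusters cost a factor exponential in the height only. -/
theorem helixSum_zero_le_two (hL : Even L) (hL4 : 4 ≤ L) (hM : Even M) {r : ℝ} (hr : 1 ≤ r) :
    helixSum (L + 2) r (forcedTime L) ((L + 1) * M + 1) 0 ≤
      (2 * r ^ 3) ^ (4 * M) * helixSum (L + 2) r (forcedTime L) ((L + 1) * M + 1) 2 := by
  classical
  set T := (L + 1) * M + 1 with hT
  -- Columns `0` and `2` are opened to give two vertical zigzags, and columns `1` and `L - 1` are
  -- closed to separate them on both sides. The bound `L ≥ 4` makes the four columns distinct.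
  set X := ((Finset.range M) ×ˢ ({0, 1, 2, L - 1} : Finset ℕ)).image fun z => label L z.2 z.1 with hX
  set Y := X.filter fun s => if (s - 1) % (L + 1) = 0 ∨ (s - 1) % (L + 1) = 2 then Even s else Odd s
    with hY
  have hXcard : X.card ≤ 4 * M := by
    refine Finset.card_image_le.trans ?_
    rw [Finset.card_product, Finset.card_range, mul_comm]
    exact Nat.mul_le_mul_right _ Finset.card_le_four
  have hmemX : ∀ y < M, ∀ x, x = 0 ∨ x = 1 ∨ x = 2 ∨ x = L - 1 → label L x y ∈ X := by
    intro y hy x hx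
    rw [hX, Finset.mem_image]
    exact ⟨(y, x), by simpa [hy] using hx, rfl⟩
  have hXfree : X ⊆ freeTimes (forcedTime L) T := by
    intro s hs
    obtain ⟨⟨y, x⟩, hz, rfl⟩ := Finset.mem_image.mp hs
    simp only [Finset.mem_product, Finset.mem_range, Finset.mem_insert, Finset.mem_singleton] at hz
    have hxL : x < L := by omega
    simp only [freeTimes, Finset.mem_filter, Finset.mem_range]
    exact ⟨label_lt hxL hz.1, forcedTime_label hxL y⟩
  refine (helixSum_zero_le (N := L + 2) (by omega) hr hXfree (Finset.filter_subset _ _ : Y ⊆ X) 2 ?_).trans ?_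
  swap
  · refine mul_le_mul_of_nonneg_right ?_ (helixSum_nonneg (by linarith) _ _ _)
    refine pow_le_pow_right₀ ?_ hXcard
    have : (1 : ℝ) ≤ r ^ 3 := one_le_pow₀ hr
    linarith
  intro A hA hAX
  set ε := choice (forcedTime L) A with hε
  have hval : ∀ y < M, ∀ x, x = 0 ∨ x = 1 ∨ x = 2 ∨ x = L - 1 → ε (label L x y) =
      if x = 0 ∨ x = 2 then decide (Even (label L x y)) else decide (Odd (label L x y)) := by
    intro y hy x hx
    have hxL : x < L := by omega
    have hXm := hmemX y hy x hx
    have h1 : label L x y ∈ A ↔ label L x y ∈ Y := by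
      rw [hY, ← hAX]; simp [hXm]
    have h2 : label L x y ∈ Y ↔ if x = 0 ∨ x = 2 then Even (label L x y) else Odd (label L x y) := by
      simp only [hY, Finset.mem_filter, hXm, true_and, label_mod hxL.le]
    rw [hε, choice, forcedTime_label hxL, Bool.false_or]
    split_ifs at h2 ⊢ <;> exact decide_eq_decide.mpr (h1.trans h2)
  have z0 := crossing_of_zigzag (ε := ε) hL hM (x := 0) (by simp) (by omega) (fun y hy => by
    rw [hval y hy 0 (by simp)]; simp)
  have z2 := crossing_of_zigzag (ε := ε) hL hM (x := 2) (by simp) (by omega) (fun y hy => by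
    rw [hval y hy 2 (by simp)]; simp)
  have hsep : ¬ HelixRel (L + 2) ε T (label L 0 M) (label L 2 M) := by
    intro h
    have := (separated (L := L) hL4 (T := T) (ε := ε) ?_ ?_ h).mp
      (Or.inl (label_mod (by omega) _))
    · rw [label_mod (by omega)] at this; omega
    · intro s _ hs
      simp [hε, choice, forcedTime, hs]
    · intro s hs hsm
      have hd := Nat.div_add_mod s (L + 1)
      set q := s / (L + 1)
      have hqM : q < M := by
        by_contra hq
        have := Nat.mul_le_mul_left (L + 1) (show M ≤ q by omega)
        omega
      rcases hsm with h2 | h2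
      · have e : s = label L 1 q := by rw [label]; omega
        rw [e, hval q hqM 1 (by simp)]; simp
      · have e : s = label L (L - 1) q := by rw [label]; omega
        rw [e, hval q hqM (L - 1) (by simp), if_neg (by omega)]
  refine ⟨![label L 0 M, label L 2 M], fun i => ?_, fun i j h => ?_⟩
  · fin_cases i
    · exact z0
    · exact z2
  · fin_cases i <;> fin_cases j
    · rfl
    · exact absurd h hsep
    · exact absurd h.symm hsep
    · rfl

end zigzag

end BKW

end

noncomputable section

namespace BKW

/-! ### The cylinder as a part of the helix -/

section unroll

variable {L M : ℕ} [NeZero L] [NeZero M]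

theorem cast_val_eq (hL : Even L) (x : ZMod L) :
    ((x.val : ℕ) : ZMod 2) = ZMod.castHom hL.two_dvd (ZMod 2) x := by
  rw [ZMod.natCast_val, ZMod.castHom_apply]

theorem even_val_natCast (hL : Even L) (n : ℕ) : Even (n : ZMod L).val ↔ Even n := by
  rw [← ZMod.natCast_eq_zero_iff_even, cast_val_eq hL, map_natCast, ZMod.natCast_eq_zero_iff_even]

theorem even_val_add_one (hL : Even L) (x : ZMod L) : Even (x + 1).val ↔ ¬ Even x.val := by
  have := even_val_natCast hL (x.val + 1)
  push_cast at this
  rw [ZMod.natCast_val, ZMod.cast_id] at this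
  rw [this, Nat.even_add_one]

theorem even_val_sub_one (hL : Even L) (x : ZMod L) : Even (x - 1).val ↔ ¬ Even x.val := by
  have := even_val_add_one hL (x - 1)
  rw [sub_add_cancel] at this
  rw [this, not_not]

/-- The time at which an edge is created. -/
def edgeTime (e : BlackEdge L M) : ℕ :=
  label L (if e.2 = true then e.1.1.1.val else (e.1.1.1 - 1).val) e.1.1.2.val

/-- An edge up to the right is created at the label of its lower end, which is odd; an edge up to
the left is created at the label just to the left of its lower end, which is even. -/
theorem odd_edgeTime (hL : Even L) (e : BlackEdge L M) : Odd (edgeTime e) ↔ e.2 = true := by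
  obtain ⟨⟨⟨x, y⟩, hv⟩, b⟩ := e
  rw [edgeTime, odd_label hL]
  cases b
  · simp only [Nat.even_add, Bool.false_eq_true, if_false, iff_false] at hv ⊢
    rw [even_val_sub_one hL]
    tauto
  · simpa using hv

theorem label_inj {x x' y y' : ℕ} (hx : x ≤ L) (hx' : x' ≤ L) (h : label L x y = label L x' y') :
    x = x' ∧ y = y' := by
  have h1 : x = x' := by rw [← label_mod hx y, h, label_mod hx' y']
  subst h1
  refine ⟨rfl, ?_⟩
  rw [label, label] at h
  exact Nat.eq_of_mul_eq_mul_left (show 0 < L + 1 by omega) (by omega)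

theorem edgeTime_injective (hL : Even L) : Function.Injective (edgeTime : BlackEdge L M → ℕ) := by
  intro e e' h
  have hb : e.2 = e'.2 := by
    have h1 := odd_edgeTime hL e
    rw [h, odd_edgeTime hL] at h1
    exact Bool.eq_iff_iff.mpr h1.symm
  obtain ⟨⟨⟨x, y⟩, hv⟩, b⟩ := e
  obtain ⟨⟨⟨x', y'⟩, hv'⟩, b'⟩ := e'
  simp only at hb
  subst hb
  have hlt : ∀ x : ZMod L, x.val ≤ L := fun x => (ZMod.val_lt x).le
  have h2 := label_inj (by split_ifs <;> exact hlt _) (by split_ifs <;> exact hlt _) h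
  simp only at h2
  have hy : y = y' := ZMod.val_injective M h2.2
  have hx : x = x' := by
    have h3 := h2.1
    cases b
    · simp only [Bool.false_eq_true, if_false] at h3
      exact sub_left_injective (ZMod.val_injective L h3)
    · simp only [if_true] at h3
      exact ZMod.val_injective L h3
  subst hx; subst hy; rfl

theorem exists_label {s : ℕ} (hs : s < (L + 1) * M + 1) (hf : forcedTime L s = false) :
    ∃ x < L, ∃ y < M, s = label L x y := by
  have h0 : s % (L + 1) ≠ 0 := by simpa [forcedTime] using hf
  have hm := Nat.mod_lt s (show 0 < L + 1 by omega)
  have hd := Nat.div_add_mod s (L + 1)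
  refine ⟨s % (L + 1) - 1, by omega, s / (L + 1), ?_, by rw [label]; omega⟩
  by_contra hq
  have := Nat.mul_le_mul_left (L + 1) (show M ≤ s / (L + 1) by omega)
  omega

theorem edgeTime_mem (e : BlackEdge L M) :
    edgeTime e ∈ freeTimes (forcedTime L) ((L + 1) * M + 1) := by
  have hx : (if e.2 = true then e.1.1.1.val else (e.1.1.1 - 1).val) < L := by
    split_ifs <;> exact ZMod.val_lt _
  simp only [freeTimes, Finset.mem_filter, Finset.mem_range]
  exact ⟨label_lt hx (ZMod.val_lt _), forcedTime_label hx _⟩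

theorem exists_edgeTime (hL : Even L) {s : ℕ}
    (hs : s ∈ freeTimes (forcedTime L) ((L + 1) * M + 1)) : ∃ e : BlackEdge L M, edgeTime e = s := by
  simp only [freeTimes, Finset.mem_filter, Finset.mem_range] at hs
  obtain ⟨x, hx, y, hy, rfl⟩ := exists_label hs.1 hs.2
  have vx := ZMod.val_cast_of_lt hx
  have vy := ZMod.val_cast_of_lt hy
  by_cases hp : Even (x + y)
  · exact ⟨(⟨((x : ZMod L), (y : ZMod M)), by simpa [vx, vy] using hp⟩, true), by
      simp [edgeTime, vx, vy]⟩
  · refine ⟨(⟨((x : ZMod L) + 1, (y : ZMod M)), ?_⟩, false), by simp [edgeTime, vx, vy]⟩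
    simp only [Nat.even_add, vy] at hp ⊢
    rw [even_val_add_one hL, vx]
    tauto

open Classical in
/-- The set of times encoding a set of open edges. -/
def edgeSet (ω : Finset (BlackEdge L M)) : Finset ℕ :=
  (Finset.univ.filter fun e => (e ∈ ω ↔ e.2 = false)).image edgeTime

/-- Choosing the operator `e_t` opens an edge up to the left but closes an edge up to the right, as
in `HelixEdge`. -/
theorem edgeTime_mem_edgeSet (hL : Even L) (ω : Finset (BlackEdge L M)) (e : BlackEdge L M) :
    edgeTime e ∈ edgeSet ω ↔ (e ∈ ω ↔ e.2 = false) := by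
  classical
  simp only [edgeSet, Finset.mem_image, Finset.mem_filter, Finset.mem_univ, true_and]
  exact ⟨fun ⟨e', h, he⟩ => edgeTime_injective hL he ▸ h, fun h => ⟨e, h, rfl⟩⟩

theorem sum_edgeSet (hL : Even L) (f : Finset ℕ → ℝ) :
    ∑ ω : Finset (BlackEdge L M), f (edgeSet ω) =
      ∑ A ∈ (freeTimes (forcedTime L) ((L + 1) * M + 1)).powerset, f A := by
  classical
  refine Finset.sum_nbij' edgeSet
    (fun A => Finset.univ.filter fun e : BlackEdge L M => (edgeTime e ∈ A ↔ e.2 = false))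
    ?_ ?_ ?_ ?_ ?_
  · intro ω _
    rw [Finset.mem_powerset]
    intro s hs
    obtain ⟨e, _, rfl⟩ := Finset.mem_image.mp hs
    exact edgeTime_mem e
  · intro A _; exact Finset.mem_univ _
  · intro ω _
    ext e
    simp only [Finset.mem_filter, Finset.mem_univ, true_and, edgeTime_mem_edgeSet hL]
    tauto
  · intro A hA
    rw [Finset.mem_powerset] at hA
    ext s
    constructor
    · intro hs
      obtain ⟨e, he, rfl⟩ := Finset.mem_image.mp hs
      simp only [Finset.mem_filter, Finset.mem_univ, true_and] at he
      tauto
    · intro hs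
      obtain ⟨e, rfl⟩ := exists_edgeTime hL (hA hs)
      rw [edgeTime_mem_edgeSet hL]
      simp only [Finset.mem_filter, Finset.mem_univ, true_and]
      tauto
  · intro ω _; rfl

/-- The choices of operators encoding a set of open edges. -/
abbrev helixConfig (ω : Finset (BlackEdge L M)) : ℕ → Bool := choice (forcedTime L) (edgeSet ω)

theorem helixConfig_edgeTime (hL : Even L) (ω : Finset (BlackEdge L M)) (e : BlackEdge L M) :
    helixConfig ω (edgeTime e) = true ↔ (e ∈ ω ↔ e.2 = false) := by
  have h : forcedTime L (edgeTime e) = false := (Finset.mem_filter.mp (edgeTime_mem e)).2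
  rw [helixConfig, choice, h, Bool.false_or, decide_eq_true_iff, edgeTime_mem_edgeSet hL]

theorem helixConfig_forced (ω : Finset (BlackEdge L M)) (y : ℕ) :
    helixConfig ω ((L + 1) * y) = true := by
  simp [helixConfig, choice, forcedTime]

/-- The extra `M / 2 + 1` edges come from the forced times at the even heights `0, 2, …, M`. They
join the two labels of a vertex in column `0`. -/
theorem openCount_helixConfig (hL : Even L) (hM : Even M) (ω : Finset (BlackEdge L M)) :
    openCount (helixConfig ω) ((L + 1) * M + 1) = ω.card + (M / 2 + 1) := by
  classical
  have h1 : ((Finset.range ((L + 1) * M + 1)).filter fun s =>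
      (Odd s ∧ helixConfig ω s = false) ∨ (Even s ∧ helixConfig ω s = true)) =
      ω.image edgeTime ∪ (Finset.range (M / 2 + 1)).image fun j => (L + 1) * (2 * j) := by
    ext s
    simp only [Finset.mem_filter, Finset.mem_range, Finset.mem_union, Finset.mem_image]
    cases hf : forcedTime L s with
    | false =>
      have hno : ¬ ∃ a < M / 2 + 1, (L + 1) * (2 * a) = s := by
        rintro ⟨a, _, rfl⟩
        simp [forcedTime] at hf
      rw [or_iff_left hno]
      have : s < (L + 1) * M + 1 → ∃ e : BlackEdge L M, edgeTime e = s := fun h =>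
        exists_edgeTime hL (by simp [freeTimes, h, hf])
      have hlt : ∀ e : BlackEdge L M, edgeTime e < (L + 1) * M + 1 := fun e =>
        Finset.mem_range.mp (Finset.mem_filter.mp (edgeTime_mem e)).1
      have main : ∀ e : BlackEdge L M, ((Odd (edgeTime e) ∧ helixConfig ω (edgeTime e) = false) ∨
          (Even (edgeTime e) ∧ helixConfig ω (edgeTime e) = true)) ↔ e ∈ ω := by
        intro e
        rw [← Nat.not_odd_iff_even, odd_edgeTime hL, ← Bool.not_eq_true, helixConfig_edgeTime hL]
        cases e.2 <;> simp
      constructor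
      · rintro ⟨h, h'⟩
        obtain ⟨e, rfl⟩ := this h
        exact ⟨e, (main e).mp h', rfl⟩
      · rintro ⟨e, he, rfl⟩
        exact ⟨hlt e, (main e).mpr he⟩
    | true =>
      have hno : ¬ ∃ e ∈ ω, edgeTime e = s := by
        rintro ⟨e, _, rfl⟩
        rw [(Finset.mem_filter.mp (edgeTime_mem e)).2] at hf
        simp at hf
      rw [or_iff_right hno]
      obtain ⟨y, rfl⟩ : ∃ y, s = (L + 1) * y := by
        simp only [forcedTime, decide_eq_true_eq] at hf
        exact (Nat.dvd_of_mod_eq_zero hf)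
      rw [helixConfig_forced]
      have hpar : Even ((L + 1) * y) ↔ Even y := by
        rw [Nat.even_mul, Nat.even_add_one]; simp [hL]
      simp only [reduceCtorEq, and_false, and_true, false_or, hpar]
      obtain ⟨m, rfl⟩ := hM
      constructor
      · rintro ⟨h, ⟨j, rfl⟩⟩
        refine ⟨j, ?_, by ring⟩
        have := Nat.le_of_mul_le_mul_left (show (L + 1) * (j + j) ≤ (L + 1) * (m + m) by omega)
          (by omega)
        omega
      · rintro ⟨j, hj, h⟩
        have h2 := Nat.eq_of_mul_eq_mul_left (show 0 < L + 1 by omega) h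
        have := Nat.mul_le_mul_left (L + 1) (show y ≤ m + m by omega)
        exact ⟨by omega, ⟨j, by omega⟩⟩
  rw [openCount, h1, Finset.card_union_of_disjoint,
    Finset.card_image_of_injective _ (edgeTime_injective hL), Finset.card_image_of_injective,
    Finset.card_range]
  · intro a b h
    have := Nat.eq_of_mul_eq_mul_left (show 0 < L + 1 by omega) h
    omega
  · rw [Finset.disjoint_left]
    intro s hs hs'
    obtain ⟨e, _, rfl⟩ := Finset.mem_image.mp hs
    obtain ⟨j, _, hj⟩ := Finset.mem_image.mp hs'
    have := (Finset.mem_filter.mp (edgeTime_mem e)).2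
    rw [← hj] at this
    simp [forcedTime] at this

theorem card_blackEdge (hL : Even L) : Fintype.card (BlackEdge L M) = L * M := by
  classical
  have h1 : Finset.univ.image (edgeTime : BlackEdge L M → ℕ) =
      ((Finset.range L) ×ˢ (Finset.range M)).image fun z => label L z.1 z.2 := by
    ext s
    simp only [Finset.mem_image, Finset.mem_univ, true_and, Finset.mem_product, Finset.mem_range]
    constructor
    · rintro ⟨e, rfl⟩
      have hx : (if e.2 = true then e.1.1.1.val else (e.1.1.1 - 1).val) < L := by
        split_ifs <;> exact ZMod.val_lt _
      exact ⟨(_, e.1.1.2.val), ⟨hx, ZMod.val_lt _⟩, rfl⟩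
    · rintro ⟨⟨x, y⟩, ⟨hx, hy⟩, rfl⟩
      exact exists_edgeTime hL (by
        simp only [freeTimes, Finset.mem_filter, Finset.mem_range]
        exact ⟨label_lt hx hy, forcedTime_label hx y⟩)
  have h2 := congrArg Finset.card h1
  rw [Finset.card_image_of_injective _ (edgeTime_injective hL), Finset.card_univ,
    Finset.card_image_of_injOn, Finset.card_product, Finset.card_range, Finset.card_range] at h2
  · exact h2
  · rintro ⟨x, y⟩ h ⟨x', y'⟩ h' e
    simp only [Finset.coe_product, Set.mem_prod, Finset.coe_range, Set.mem_Iio] at h h'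
    obtain ⟨e1, e2⟩ := label_inj h.1.le h'.1.le e
    exact Prod.ext e1 e2

/-! ### Clusters of the cylinder and of the helix -/

/-- `a` is a label of the vertex `v` of the cylinder. -/
def IsLabel (v : CylBlack L M) (a : ℕ) : Prop :=
  ∃ x ≤ L, a = label L x v.1.2.val ∧ (x : ZMod L) = v.1.1

/-- The standard label of a vertex of the cylinder. -/
def cylLabel (v : CylBlack L M) : ℕ := label L v.1.1.val v.1.2.val

theorem isLabel_cylLabel (v : CylBlack L M) : IsLabel v (cylLabel v) :=
  ⟨v.1.1.val, (ZMod.val_lt _).le, rfl, by simp⟩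

theorem IsLabel.odd (hL : Even L) {v : CylBlack L M} {a : ℕ} (h : IsLabel v a) : Odd a := by
  obtain ⟨x, _, rfl, hx⟩ := h
  rw [odd_label hL, Nat.even_add, ← even_val_natCast hL, hx, ← Nat.even_add]
  exact v.2

theorem IsLabel.lt {v : CylBlack L M} {a : ℕ} (h : IsLabel v a) :
    a < (L + 1) * M + 1 + (L + 2) := by
  obtain ⟨x, hx, rfl, _⟩ := h
  have := Nat.mul_le_mul_left (L + 1) (show v.1.2.val ≤ M by have := v.1.2.isLt; omega)
  rw [label]; omega

theorem exists_isLabel (hL : Even L) (hM : Even M) {a : ℕ} (ho : Odd a)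
    (ha : a < (L + 1) * M + 1 + (L + 2)) : ∃ v : CylBlack L M, IsLabel v a := by
  have hm := Nat.mod_lt (a - 1) (show 0 < L + 1 by omega)
  have hd := Nat.div_add_mod (a - 1) (L + 1)
  have hpos := ho.pos
  set x := (a - 1) % (L + 1)
  set y := (a - 1) / (L + 1)
  have e : a = label L x y := by rw [label]; omega
  have hpar : Even (x + y) := by rw [← odd_label hL, ← e]; exact ho
  have hy : y < M + 1 := by
    by_contra hy
    have h1 := Nat.mul_le_mul_left (L + 1) (show M + 1 ≤ y by omega)
    have h2 : (L + 1) * (M + 1) = (L + 1) * M + L + 1 := by ring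
    have hx0 : x = 0 := by rw [label] at e; omega
    have hy1 : y = M + 1 := by
      have h3 : (L + 1) * y < (L + 1) * (M + 2) := by rw [label] at e; nlinarith
      have := Nat.lt_of_mul_lt_mul_left h3
      omega
    rw [hx0, hy1, zero_add, Nat.even_add_one] at hpar
    exact hpar hM
  refine ⟨⟨((x : ZMod L), ⟨y, hy⟩), ?_⟩, x, by omega, e, rfl⟩
  rw [Nat.even_add] at hpar ⊢
  rw [even_val_natCast hL]
  exact hpar

theorem IsLabel.unique {v w : CylBlack L M} {a : ℕ} (h : IsLabel v a) (h' : IsLabel w a) : v = w := by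
  obtain ⟨x, hx, e, hxv⟩ := h
  obtain ⟨x', hx', e', hxw⟩ := h'
  obtain ⟨e1, e2⟩ := label_inj hx hx' (e.symm.trans e')
  refine Subtype.ext (Prod.ext ?_ (Fin.ext e2))
  rw [← hxv, ← hxw, e1]

/-- A vertex of column `0` has two labels, with `x = 0` and `x = L`. Its height is even, so the
forced operator at that height provides an edge between them. -/
theorem helixRel_of_isLabel (hL : Even L) (ω : Finset (BlackEdge L M)) {v : CylBlack L M} {a b : ℕ}
    (h : IsLabel v a) (h' : IsLabel v b) :
    HelixRel (L + 2) (helixConfig ω) ((L + 1) * M + 1) a b := by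
  have key : ∀ x ≤ L, ((x : ℕ) : ZMod L) = v.1.1 → HelixRel (L + 2) (helixConfig ω) ((L + 1) * M + 1)
      (label L x v.1.2.val) (cylLabel v) := by
    intro x hx hxv
    rcases hx.lt_or_eq with hx | rfl
    · have : v.1.1.val = x := by rw [← hxv, ZMod.val_cast_of_lt hx]
      rw [cylLabel, this]; exact .refl _
    · have h0 : v.1.1.val = 0 := by rw [← hxv, ZMod.natCast_self]; simp
      have hy : Even v.1.2.val := by have := v.2; rwa [h0, zero_add] at this
      rw [cylLabel, h0]
      have hle := Nat.mul_le_mul_left (x + 1) (show v.1.2.val ≤ M by have := v.1.2.isLt; omega)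
      exact .rel _ _ ⟨(x + 1) * v.1.2.val, by omega, Or.inr ⟨hy.mul_left _, helixConfig_forced ω _,
        by rw [label]; omega, by rw [label]⟩⟩
  obtain ⟨x, hx, rfl, hxv⟩ := h
  obtain ⟨x', hx', rfl, hxw⟩ := h'
  exact (key x hx hxv).trans (key x' hx' hxw).symm

theorem reachable_of_fromRel {V : Type*} {R : V → V → Prop} {u w : V} (h : R u w) :
    (SimpleGraph.fromRel R).Reachable u w := by
  by_cases e : u = w
  · rw [e]
  · exact SimpleGraph.Adj.reachable ((SimpleGraph.fromRel_adj _ _ _).mpr ⟨e, Or.inl h⟩)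

/-- Forced edges join two labels of the same vertex; all other edges of the helix are open edges of
the cylinder. -/
theorem reachable_of_helixEdge (hL : Even L) (ω : Finset (BlackEdge L M)) {u w : CylBlack L M}
    {a b : ℕ} (ha : IsLabel u a) (hb : IsLabel w b)
    (h : HelixEdge (L + 2) (helixConfig ω) ((L + 1) * M + 1) a b) : (cylGraph ω).Reachable u w := by
  obtain ⟨s, hs, h⟩ := h
  cases hf : forcedTime L s with
  | true =>
    obtain ⟨y, rfl⟩ : ∃ y, s = (L + 1) * y := by
      simp only [forcedTime, decide_eq_true_eq] at hf
      exact (Nat.dvd_of_mod_eq_zero hf)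
    rw [helixConfig_forced] at h
    rcases h with ⟨_, g, _⟩ | ⟨_, _, g, g'⟩
    · exact absurd g (by simp)
    · have e1 : a = label L L y := by rw [label]; omega
      have e2 : b = label L 0 y := by rw [label]; omega
      obtain ⟨x, hx, f1, f2⟩ := ha
      obtain ⟨x', hx', f1', f2'⟩ := hb
      obtain ⟨i1, i2⟩ := label_inj le_rfl hx (e1.symm.trans f1)
      obtain ⟨i1', i2'⟩ := label_inj (Nat.zero_le _) hx' (e2.symm.trans f1')
      have : u = w := by
        refine Subtype.ext (Prod.ext ?_ (Fin.ext (i2.symm.trans i2')))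
        rw [← f2, ← f2', ← i1, ← i1']
        simp
      rw [this]
  | false =>
    obtain ⟨e, rfl⟩ := exists_edgeTime (M := M) hL (s := s) (by simp [freeTimes, hs, hf])
    have hob : helixConfig ω (edgeTime e) = false ↔ ¬ (e ∈ ω ↔ e.2 = false) := by
      rw [← Bool.not_eq_true, helixConfig_edgeTime hL]
    rw [← Nat.not_odd_iff_even, odd_edgeTime hL, hob, helixConfig_edgeTime hL] at h
    obtain ⟨⟨⟨x, y⟩, hv⟩, d⟩ := e
    have hxl := ZMod.val_lt x
    have hxl' := ZMod.val_lt (x - 1)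
    obtain ⟨z, hz, f1, f2⟩ := ha
    obtain ⟨z', hz', f1', f2'⟩ := hb
    cases d
    · simp only [Bool.false_eq_true, false_and, not_false_eq_true, true_and, iff_true,
        false_or, edgeTime, if_false] at h
      obtain ⟨hω, g, g'⟩ := h
      have q1 : a = label L (x - 1).val (y.val + 1) := by rw [label, g, label, mul_add]; omega
      have q2 : b = label L ((x - 1).val + 1) y.val := by rw [label, g', label]; ring
      obtain ⟨i1, i2⟩ := label_inj (by omega) hz (q1.symm.trans f1)
      obtain ⟨i1', i2'⟩ := label_inj (by omega) hz' (q2.symm.trans f1')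
      have ex : w.1.1 = x := by rw [← f2', ← i1']; push_cast; simp
      have ex' : u.1.1 = x - 1 := by rw [← f2, ← i1]; simp
      refine (reachable_of_fromRel ⟨_, hω, ex, i2'.symm, ?_, by rw [← i2, ← i2']⟩).symm
      rw [ex, ex', hshift]; simp [sub_eq_add_neg]
    · simp only [Bool.true_eq_false, iff_false, not_not, true_and, not_true_eq_false, false_and,
        or_false, edgeTime, if_true] at h
      obtain ⟨hω, g, g'⟩ := h
      have q2 : b = label L (x.val + 1) (y.val + 1) := by rw [label, g', label, mul_add]; omega
      obtain ⟨i1, i2⟩ := label_inj (by omega) hz (g.symm.trans f1)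
      obtain ⟨i1', i2'⟩ := label_inj (by omega) hz' (q2.symm.trans f1')
      have ex : u.1.1 = x := by rw [← f2, ← i1]; simp
      have ex' : w.1.1 = x + 1 := by rw [← f2', ← i1']; push_cast; simp
      refine reachable_of_fromRel ⟨_, hω, ex, i2.symm, ?_, by rw [← i2, ← i2']⟩
      rw [ex, ex', hshift]; simp

theorem reachable_of_helixRel (hL : Even L) (hM : Even M) (ω : Finset (BlackEdge L M))
    {u w : CylBlack L M} {a b : ℕ} (ha : IsLabel u a) (hb : IsLabel w b)
    (h : HelixRel (L + 2) (helixConfig ω) ((L + 1) * M + 1) a b) : (cylGraph ω).Reachable u w := by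
  induction h generalizing u w with
  | rel _ _ h => exact reachable_of_helixEdge hL ω ha hb h
  | refl => rw [ha.unique hb]
  | symm _ _ _ ih => exact (ih hb ha).symm
  | trans x y z h1 h2 ih1 ih2 =>
    have ho := (HelixRel.odd (show 2 ≤ L + 2 by omega) (hL.add even_two) h1).mp (ha.odd hL)
    have hlt : y < (L + 1) * M + 1 + (L + 2) := by
      have := HelixRel.fresh (show 2 ≤ L + 2 by omega) h1
      have := ha.lt
      omega
    obtain ⟨v, hv⟩ := exists_isLabel hL hM ho hlt
    exact (ih1 ha hv).trans (ih2 hv hb)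

theorem helixRel_of_cylAdj (hL : Even L) (ω : Finset (BlackEdge L M)) {u w : CylBlack L M}
    (h : ∃ e ∈ ω, u.1.1 = e.1.1.1 ∧ u.1.2.val = e.1.1.2.val ∧
      w.1.1 = u.1.1 + hshift e ∧ w.1.2.val = u.1.2.val + 1) :
    HelixRel (L + 2) (helixConfig ω) ((L + 1) * M + 1) (cylLabel u) (cylLabel w) := by
  obtain ⟨e, he, h1, h2, h3, h4⟩ := h
  have hT : edgeTime e < (L + 1) * M + 1 := Finset.mem_range.mp (Finset.mem_filter.mp (edgeTime_mem e)).1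
  have hob := helixConfig_edgeTime hL ω e
  have ho := odd_edgeTime hL e
  obtain ⟨⟨⟨x, y⟩, hv⟩, d⟩ := e
  have hxl := ZMod.val_lt x
  have hxl' := ZMod.val_lt (x - 1)
  simp only at h1 h2
  cases d
  · have la : IsLabel w (label L (x - 1).val (y.val + 1)) :=
      ⟨_, hxl'.le, by rw [h4, h2], by rw [h3, h1, hshift]; simp [sub_eq_add_neg]⟩
    have lb : IsLabel u (label L ((x - 1).val + 1) y.val) :=
      ⟨_, hxl', by rw [h2], by rw [h1]; push_cast; simp⟩
    have hε := hob.mpr (by simpa using he)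
    have hev : Even (edgeTime ((⟨(x, y), hv⟩, false) : BlackEdge L M)) := by
      rw [← Nat.not_odd_iff_even, ho]; simp
    refine ((helixRel_of_isLabel hL ω (isLabel_cylLabel w) la).trans ?_ |>.trans
      (helixRel_of_isLabel hL ω lb (isLabel_cylLabel u))).symm
    exact .rel _ _ ⟨_, hT, Or.inr ⟨hev, hε, by simp only [edgeTime, label]; simp; ring,
      by simp only [edgeTime, label]; simp; ring⟩⟩
  · have la : IsLabel u (label L x.val y.val) := ⟨_, hxl.le, by rw [h2], by rw [h1]; simp⟩
    have lb : IsLabel w (label L (x.val + 1) (y.val + 1)) :=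
      ⟨_, hxl, by rw [h4, h2], by rw [h3, h1, hshift]; push_cast; simp⟩
    have hε : helixConfig ω (edgeTime ((⟨(x, y), hv⟩, true) : BlackEdge L M)) = false := by
      rw [← Bool.not_eq_true, hob]; simpa using he
    refine (helixRel_of_isLabel hL ω (isLabel_cylLabel u) la).trans (HelixRel.trans ?_
      (helixRel_of_isLabel hL ω lb (isLabel_cylLabel w)))
    exact .rel _ _ ⟨_, hT, Or.inl ⟨ho.mpr rfl, hε, by simp only [edgeTime, label]; simp,
      by simp only [edgeTime, label]; simp; ring⟩⟩

theorem helixRel_of_reachable (hL : Even L) (ω : Finset (BlackEdge L M)) {u w : CylBlack L M}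
    (h : (cylGraph ω).Reachable u w) :
    HelixRel (L + 2) (helixConfig ω) ((L + 1) * M + 1) (cylLabel u) (cylLabel w) := by
  obtain ⟨p⟩ := h
  induction p with
  | nil => exact .refl _
  | cons h _ ih =>
    refine HelixRel.trans ?_ ih
    rw [cylGraph, SimpleGraph.fromRel_adj] at h
    rcases h.2 with h | h
    · exact helixRel_of_cylAdj hL ω h
    · exact (helixRel_of_cylAdj hL ω h).symm

/-- The top label of a helical cluster serves as representative of the corresponding cluster of the
cylinder. -/
theorem clusterCount_helixConfig (hL : Even L) (hM : Even M) (ω : Finset (BlackEdge L M)) :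
    clusterCount (L + 2) (helixConfig ω) ((L + 1) * M + 1) ((L + 1) * M + 1 + (L + 2)) =
      Nat.card (cylGraph ω).ConnectedComponent := by
  classical
  set F := (Finset.range ((L + 1) * M + 1 + (L + 2))).filter fun a =>
    Odd a ∧ IsTop (L + 2) (helixConfig ω) ((L + 1) * M + 1) a with hF
  have hlab : ∀ a : F, ∃ v : CylBlack L M, IsLabel v a := by
    rintro ⟨a, ha⟩
    simp only [hF, Finset.mem_filter, Finset.mem_range] at ha
    exact exists_isLabel hL hM ha.2.1 ha.1
  choose ψ hψ using hlab
  have hcard : clusterCount (L + 2) (helixConfig ω) ((L + 1) * M + 1) ((L + 1) * M + 1 + (L + 2)) =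
      Nat.card F := by rw [Nat.card_eq_fintype_card, Fintype.card_coe]; rfl
  rw [hcard]
  refine Nat.card_eq_of_bijective (fun a => (cylGraph ω).connectedComponentMk (ψ a)) ⟨?_, ?_⟩
  · intro a b hab
    have h1 := helixRel_of_reachable hL ω (SimpleGraph.ConnectedComponent.exact hab)
    have h2 : HelixRel (L + 2) (helixConfig ω) ((L + 1) * M + 1) a b :=
      (helixRel_of_isLabel hL ω (hψ a) (isLabel_cylLabel _)).trans
        (h1.trans (helixRel_of_isLabel hL ω (isLabel_cylLabel _) (hψ b)))
    have ta := (Finset.mem_filter.mp a.2).2.2 b h2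
    have tb := (Finset.mem_filter.mp b.2).2.2 a h2.symm
    exact Subtype.ext (by omega)
  · intro C
    obtain ⟨v, rfl⟩ := C.exists_rep
    obtain ⟨b, hb, htop⟩ := exists_top (ε := helixConfig ω) (t := (L + 1) * M + 1)
      (show 2 ≤ L + 2 by omega) (cylLabel v)
    have lv := isLabel_cylLabel v
    have ho := (hb.odd (show 2 ≤ L + 2 by omega) (hL.add even_two)).mp (lv.odd hL)
    have hlt : b < (L + 1) * M + 1 + (L + 2) := by
      have := HelixRel.fresh (show 2 ≤ L + 2 by omega) hb
      have := lv.lt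
      omega
    refine ⟨⟨b, ?_⟩, ?_⟩
    · simp only [hF, Finset.mem_filter, Finset.mem_range]; exact ⟨hlt, ho, htop⟩
    · exact SimpleGraph.ConnectedComponent.sound
        (reachable_of_helixRel hL hM ω (hψ _) lv hb.symm)

/-- At time `(L + 1) * M + 1` the frontier consists of the labels of the top row, and the initial
vertices, with labels below `L + 2`, are those of the bottom row. -/
theorem le_numCrossing_iff (hL : Even L) (hM : Even M) (ω : Finset (BlackEdge L M)) (k : ℕ) :
    k ≤ numCrossing ω ↔ ManyCrossings (L + 2) (helixConfig ω) ((L + 1) * M + 1) k := by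
  classical
  constructor
  · intro h
    rw [numCrossing, Nat.card_eq_fintype_card] at h
    let g := fun i : Fin k => (Fintype.equivFin _).symm (Fin.castLE h i)
    have hg : Function.Injective g := fun i j hij =>
      Fin.castLE_injective h ((Fintype.equivFin _).symm.injective hij)
    have h1 := fun i => (g i).2.1
    have h2 := fun i => (g i).2.2
    choose w hw hw' using h1
    choose u hu hu' using h2
    refine ⟨fun i => cylLabel (u i), fun i => ⟨⟨(isLabel_cylLabel _).odd hL, ?_, (isLabel_cylLabel _).lt⟩,
      cylLabel (w i), ?_, (isLabel_cylLabel _).odd hL, ?_⟩, fun i j hij => ?_⟩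
    · simp only [cylLabel, label, hu, Fin.val_last]; omega
    · simp only [cylLabel, label, hw]
      have := ZMod.val_lt (w i).1.1
      simp only [Fin.val_zero]; omega
    · exact helixRel_of_reachable hL ω
        (SimpleGraph.ConnectedComponent.exact ((hu' i).trans (hw' i).symm))
    · have := reachable_of_helixRel hL hM ω (isLabel_cylLabel _) (isLabel_cylLabel _) hij
      refine hg (Subtype.ext ?_)
      rw [← hu' i, ← hu' j]
      exact SimpleGraph.ConnectedComponent.sound this
  · rintro ⟨f, h1, h2⟩
    have h3 : ∀ i, ∃ u : CylBlack L M, IsLabel u (f i) := fun i =>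
      exists_isLabel hL hM (h1 i).1.1 (h1 i).1.2.2
    choose u hu using h3
    have hrow : ∀ i, (u i).1.2 = Fin.last M := by
      intro i
      obtain ⟨x, hx, e, _⟩ := hu i
      have := (h1 i).1.2.1
      have hlt := (u i).1.2.isLt
      refine Fin.ext ?_
      rw [Fin.val_last]
      by_contra hne
      have := Nat.mul_le_mul_left (L + 1) (show (u i).1.2.val + 1 ≤ M by omega)
      rw [e, label] at *
      rw [mul_add] at this
      omega
    have hroot : ∀ i, ∃ w : CylBlack L M, w.1.2 = 0 ∧ (cylGraph ω).Reachable w (u i) := by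
      intro i
      obtain ⟨c, hc, hco, hr⟩ := (h1 i).2
      obtain ⟨w, hw⟩ := exists_isLabel (M := M) hL hM hco (by omega)
      refine ⟨w, ?_, reachable_of_helixRel hL hM ω hw (hu i) hr.symm⟩
      obtain ⟨x, hx, e, _⟩ := hw
      refine Fin.ext ?_
      rw [Fin.val_zero]
      by_contra hne
      have := Nat.mul_le_mul_left (L + 1) (show 1 ≤ w.1.2.val by omega)
      rw [label] at e
      have : 1 ≤ L + 1 := by omega
      have hc' : c = L + 2 ∨ L + 2 < c ∨ c < L + 2 := by omega
      omega
    rw [numCrossing]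
    have := Nat.card_le_card_of_injective (α := Fin k) (fun i =>
      (⟨(cylGraph ω).connectedComponentMk (u i), by
        obtain ⟨w, hw, hr⟩ := hroot i
        exact ⟨w, hw, SimpleGraph.ConnectedComponent.sound hr⟩, ⟨u i, hrow i, rfl⟩⟩ :
      {C : (cylGraph ω).ConnectedComponent //
        (∃ u : CylBlack L M, u.1.2 = 0 ∧ (cylGraph ω).connectedComponentMk u = C) ∧
        (∃ u : CylBlack L M, u.1.2 = Fin.last M ∧ (cylGraph ω).connectedComponentMk u = C)}))
      (fun i j hij => h2 i j ?_)
    · simpa using this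
    · have h4 := SimpleGraph.ConnectedComponent.exact (congrArg Subtype.val hij)
      exact (helixRel_of_isLabel hL ω (hu i) (isLabel_cylLabel _)).trans
        ((helixRel_of_reachable hL ω h4).trans
        (helixRel_of_isLabel hL ω (isLabel_cylLabel _) (hu j)))

end unroll

end BKW

end

noncomputable section

namespace BKW

/-! ### Clusters of the torus and of the cylinder -/

section cylinder

variable {L M : ℕ} [NeZero L] [NeZero M]

/-- The projection of the cylinder to the torus. -/
def project (hM : Even M) (v : CylBlack L M) : Black L M :=
  ⟨(v.1.1, ((v.1.2.val : ℕ) : ZMod M)), by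
    have := v.2
    rw [Nat.even_add] at this ⊢
    rw [even_val_natCast hM]
    exact this⟩

/-- The inclusion of the torus, cut open, into the cylinder. -/
def lift (v : Black L M) : CylBlack L M :=
  ⟨(v.1.1, ⟨v.1.2.val, (ZMod.val_lt _).trans (Nat.lt_succ_self M)⟩), v.2⟩

theorem project_lift (hM : Even M) (v : Black L M) : project hM (lift v) = v :=
  Subtype.ext (Prod.ext rfl (by simp [project, lift]))

theorem lift_project (hM : Even M) {v : CylBlack L M} (h : v.1.2 ≠ Fin.last M) :
    lift (project hM v) = v := by
  have hlt : v.1.2.val < M := by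
    have := v.1.2.isLt
    have h' : v.1.2.val ≠ M := fun e => h (Fin.ext e)
    omega
  exact Subtype.ext (Prod.ext rfl (Fin.ext (ZMod.val_cast_of_lt hlt)))

theorem reachable_project (hM : Even M) (ω : Finset (BlackEdge L M)) {u w : CylBlack L M}
    (h : (cylGraph ω).Reachable u w) : (openGraph ω).Reachable (project hM u) (project hM w) := by
  have key : ∀ u w : CylBlack L M, (∃ e ∈ ω, u.1.1 = e.1.1.1 ∧ u.1.2.val = e.1.1.2.val ∧
      w.1.1 = u.1.1 + hshift e ∧ w.1.2.val = u.1.2.val + 1) →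
      (openGraph ω).Reachable (project hM u) (project hM w) := by
    rintro u w ⟨e, he, h1, h2, h3, h4⟩
    refine reachable_of_fromRel ⟨e, he, ?_, ?_⟩
    · exact Subtype.ext (Prod.ext h1 (by simp [project, h2]))
    · exact Prod.ext (by simpa [project] using h3) (by simp [project, h4])
  obtain ⟨p⟩ := h
  induction p with
  | nil => exact .refl _
  | cons h _ ih =>
    refine SimpleGraph.Reachable.trans ?_ ih
    rw [cylGraph, SimpleGraph.fromRel_adj] at h
    rcases h.2 with h | h
    · exact key _ _ h
    · exact (key _ _ h).symm

theorem numClusters_le (hM : Even M) (ω : Finset (BlackEdge L M)) :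
    numClusters ω ≤ Nat.card (cylGraph ω).ConnectedComponent := by
  refine Nat.card_le_card_of_surjective (SimpleGraph.ConnectedComponent.lift
    (fun u => (openGraph ω).connectedComponentMk (project hM u)) ?_) ?_
  · intro u w p _
    exact SimpleGraph.ConnectedComponent.sound (reachable_project hM ω ⟨p⟩)
  · intro C
    obtain ⟨v, rfl⟩ := C.exists_rep
    exact ⟨(cylGraph ω).connectedComponentMk (lift v), by
      rw [SimpleGraph.ConnectedComponent.lift_mk, project_lift]; rfl⟩

/-- The cluster of `v` on the cylinder touches the boundary. -/
def Touches (ω : Finset (BlackEdge L M)) (v : CylBlack L M) : Prop :=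
  ∃ w, (cylGraph ω).Reachable v w ∧ (w.1.2 = 0 ∨ w.1.2 = Fin.last M)

/-- Either the path on the torus avoids the cut and lifts, or it uses an edge across the cut and the
clusters of both ends reach the boundary of the cylinder. -/
theorem reachable_lift (hME : Even M) (ω : Finset (BlackEdge L M)) {u w : Black L M}
    (h : (openGraph ω).Reachable u w) :
    (cylGraph ω).Reachable (lift u) (lift w) ∨ Touches ω (lift u) ∧ Touches ω (lift w) := by
  have key : ∀ u w : Black L M, (∃ e ∈ ω, u = e.1 ∧ w.1 = u.1 + (hshift e, 1)) →
      (cylGraph ω).Reachable (lift u) (lift w) ∨ Touches ω (lift u) ∧ Touches ω (lift w) := by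
    rintro u w ⟨e, he, rfl, h⟩
    have hx : w.1.1 = e.1.1.1 + hshift e := congrArg Prod.fst h
    have hy : w.1.2 = e.1.1.2 + 1 := congrArg Prod.snd h
    by_cases hlt : e.1.1.2.val + 1 < M
    · left
      refine reachable_of_fromRel ⟨e, he, rfl, rfl, hx, ?_⟩
      have : ((e.1.1.2.val + 1 : ℕ) : ZMod M) = w.1.2 := by rw [hy]; push_cast; simp
      simp only [lift]
      rw [← this, ZMod.val_cast_of_lt hlt]
    · right
      have hM : e.1.1.2.val + 1 = M := by have := ZMod.val_lt e.1.1.2; omega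
      have hw : w.1.2 = 0 := by
        have : ((e.1.1.2.val + 1 : ℕ) : ZMod M) = w.1.2 := by rw [hy]; push_cast; simp
        rw [← this, hM, ZMod.natCast_self]
      refine ⟨⟨⟨(w.1.1, Fin.last M), ?_⟩, reachable_of_fromRel ⟨e, he, rfl, rfl, hx, ?_⟩,
        Or.inr rfl⟩, ⟨lift w, .refl _, Or.inl (Fin.ext ?_)⟩⟩
      · have h0 := w.2
        rw [hw, ZMod.val_zero, add_zero] at h0
        exact h0.add hME
      · simp [lift, hM]
      · simp [lift, hw]
  obtain ⟨p⟩ := h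
  induction p with
  | nil => exact Or.inl (.refl _)
  | @cons a b c h _ ih =>
    have hab : (cylGraph ω).Reachable (lift a) (lift b) ∨ Touches ω (lift a) ∧ Touches ω (lift b) := by
      rw [openGraph, SimpleGraph.fromRel_adj] at h
      rcases h.2 with h | h
      · exact key _ _ h
      · exact (key _ _ h).imp SimpleGraph.Reachable.symm And.symm
    rcases hab with h1 | ⟨h1, h1'⟩ <;> rcases ih with h2 | ⟨h2, h2'⟩
    · exact Or.inl (h1.trans h2)
    · obtain ⟨w, hw, hb⟩ := h2
      exact Or.inr ⟨⟨w, h1.trans hw, hb⟩, h2'⟩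
    · obtain ⟨w, hw, hb⟩ := h1'
      exact Or.inr ⟨h1, ⟨w, h2.symm.trans hw, hb⟩⟩
    · exact Or.inr ⟨h1, h2'⟩

/-- Clusters of the cylinder that avoid its boundary stay distinct on the torus; the others are
distinguished by one of the `2 * L` possible boundary positions. -/
theorem le_numClusters (hM : Even M) (ω : Finset (BlackEdge L M)) :
    Nat.card (cylGraph ω).ConnectedComponent ≤ numClusters ω + 2 * L := by
  classical
  have hrep : ∀ C : (cylGraph ω).ConnectedComponent, ∃ v, (cylGraph ω).connectedComponentMk v = C ∧
      (Touches ω v → v.1.2 = 0 ∨ v.1.2 = Fin.last M) := by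
    intro C
    obtain ⟨v, rfl⟩ := C.exists_rep
    by_cases h : Touches ω v
    · obtain ⟨w, hw, hb⟩ := h
      exact ⟨w, SimpleGraph.ConnectedComponent.sound hw.symm, fun _ => hb⟩
    · exact ⟨v, rfl, fun h' => absurd h' h⟩
  choose v hv hb using hrep
  have hcard : Nat.card ((openGraph ω).ConnectedComponent ⊕ (ZMod L × Bool)) =
      numClusters ω + 2 * L := by
    rw [Nat.card_sum, Nat.card_prod, Nat.card_zmod, numClusters]
    simp [mul_comm]
  rw [← hcard]
  refine Nat.card_le_card_of_injective (fun C => if Touches ω (v C) then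
    Sum.inr ((v C).1.1, decide ((v C).1.2 = 0)) else
    Sum.inl ((openGraph ω).connectedComponentMk (project hM (v C)))) ?_
  intro C C' h
  simp only at h
  rw [← hv C, ← hv C']
  split_ifs at h with h1 h2 h2
  · simp only [Sum.inr.injEq, Prod.mk.injEq, decide_eq_decide] at h
    congr 1
    refine Subtype.ext (Prod.ext h.1 ?_)
    have g := hb C h1
    have g' := hb C' h2
    have := h.2
    by_cases e : (v C).1.2 = 0
    · rw [e, this.mp e]
    · rw [g.resolve_left e, g'.resolve_left (fun h => e (this.mpr h))]
  · simp only [Sum.inl.injEq] at h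
    have hnt : ∀ w, ¬ Touches ω w → w.1.2 ≠ Fin.last M := fun w hw h' =>
      hw ⟨w, .refl _, Or.inr h'⟩
    have h3 := reachable_lift hM ω (SimpleGraph.ConnectedComponent.exact h)
    rw [lift_project hM (hnt _ h1), lift_project hM (hnt _ h2)] at h3
    exact SimpleGraph.ConnectedComponent.sound (h3.resolve_right fun h => h1 h.1)

/-! ### Sums over percolation configurations -/

open Classical in
/-- The total weight of the configurations with at least `k` crossing clusters. -/
def fkSum (L M : ℕ) [NeZero L] [NeZero M] (p q : ℝ) (k : ℕ) : ℝ :=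
  ∑ ω : Finset (BlackEdge L M), if k ≤ numCrossing ω then fkWeight p q ω else 0

/-- At this value of `p` the ratio `p / (1 - p)` is `r`, and `q = r ^ 2`; so edges and clusters are
weighted by powers of the same number, as in `helixWeight`. -/
theorem fkWeight_eq (hL : Even L) {p q r : ℝ} (hr : 0 < r) (hp : p = r / (1 + r)) (hq : q = r ^ 2)
    (ω : Finset (BlackEdge L M)) :
    (1 + r) ^ (L * M) * fkWeight p q ω = r ^ (ω.card + 2 * numClusters ω) := by
  classical
  have h1 : 1 - p = 1 / (1 + r) := by rw [hp]; field_simp; ring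
  have h2 : ω.card + (ωᶜ).card = L * M := by rw [Finset.card_add_card_compl, card_blackEdge hL]
  rw [fkWeight, h1, hp, hq, ← h2, div_pow, div_pow, ← pow_mul, pow_add, pow_add]
  field_simp
  simp

/-- The factor `r ^ (4 * L)` is twice the difference `2 * L` between the numbers of clusters on the
cylinder and on the torus. -/
theorem helixWeight_bounds (hL : Even L) (hM : Even M) {p q r : ℝ} (hr : 1 ≤ r)
    (hp : p = r / (1 + r)) (hq : q = r ^ 2) (ω : Finset (BlackEdge L M)) :
    (1 + r) ^ (L * M) * r ^ (M / 2 + 1) * fkWeight p q ω ≤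
      helixWeight (L + 2) r (helixConfig ω) ((L + 1) * M + 1) ∧
    helixWeight (L + 2) r (helixConfig ω) ((L + 1) * M + 1) ≤
      r ^ (4 * L) * ((1 + r) ^ (L * M) * r ^ (M / 2 + 1) * fkWeight p q ω) := by
  have h0 := fkWeight_eq hL (by linarith) hp hq ω
  have h1 : (1 + r) ^ (L * M) * r ^ (M / 2 + 1) * fkWeight p q ω =
      r ^ (M / 2 + 1 + (ω.card + 2 * numClusters ω)) := by
    rw [mul_right_comm, h0, pow_add _ (M / 2 + 1), mul_comm]
  have h2 := numClusters_le hM ω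
  have h3 := le_numClusters hM ω
  rw [h1, helixWeight, openCount_helixConfig hL hM, clusterCount_helixConfig hL hM, ← pow_add]
  exact ⟨pow_le_pow_right₀ hr (by omega), pow_le_pow_right₀ hr (by omega)⟩

theorem helixSum_eq (hL : Even L) (hM : Even M) (r : ℝ) (k : ℕ) [DecidablePred fun ω : Finset (BlackEdge L M) => k ≤ numCrossing ω] :
    helixSum (L + 2) r (forcedTime L) ((L + 1) * M + 1) k =
      ∑ ω : Finset (BlackEdge L M), if k ≤ numCrossing ω then
        helixWeight (L + 2) r (helixConfig ω) ((L + 1) * M + 1) else 0 := by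
  classical
  rw [helixSum, ← sum_edgeSet hL]
  refine Finset.sum_congr rfl fun ω _ => ?_
  simp only [le_numCrossing_iff hL hM]

theorem fkSum_bounds (hL : Even L) (hM : Even M) {p q r : ℝ} (hr : 1 ≤ r)
    (hp : p = r / (1 + r)) (hq : q = r ^ 2) (k : ℕ) :
    (1 + r) ^ (L * M) * r ^ (M / 2 + 1) * fkSum L M p q k ≤
      helixSum (L + 2) r (forcedTime L) ((L + 1) * M + 1) k ∧
    helixSum (L + 2) r (forcedTime L) ((L + 1) * M + 1) k ≤
      r ^ (4 * L) * ((1 + r) ^ (L * M) * r ^ (M / 2 + 1) * fkSum L M p q k) := by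
  classical
  rw [helixSum_eq hL hM, fkSum, Finset.mul_sum, Finset.mul_sum]
  constructor
  · refine Finset.sum_le_sum fun ω _ => ?_
    split_ifs
    · exact (helixWeight_bounds hL hM hr hp hq ω).1
    · simp
  · refine Finset.sum_le_sum fun ω _ => ?_
    split_ifs
    · exact (helixWeight_bounds hL hM hr hp hq ω).2
    · simp

end cylinder

/-! ### Growth rates of percolation sums -/

section rates

variable {L : ℕ}

theorem clusterCount_zero (hL : Even L) (m : ℕ) :
    clusterCount (L + 2) (forcedTime L) 0 ((L + 1) * (2 * m) + 1 + (L + 2)) =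
      (L + 1) * m + (L / 2 + 1) := by
  classical
  have htop : ∀ a, IsTop (L + 2) (forcedTime L) 0 a := fun a b h => (HelixRel.zero_iff.mp h).ge
  have hodd : ∀ j, ((Finset.range (2 * j + 1)).filter fun a => Odd a).card = j := by
    intro j
    induction j with
    | zero => simp
    | succ j ih =>
      rw [show 2 * (j + 1) + 1 = 2 * j + 1 + 1 + 1 by ring, Finset.range_add_one, Finset.filter_insert,
        Finset.range_add_one (n := 2 * j + 1), Finset.filter_insert, if_neg (by rw [Nat.not_odd_iff_even]; exact ⟨j + 1, by ring⟩), if_pos (by simp),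
        Finset.card_insert_of_notMem (by simp), ih]
  obtain ⟨l, rfl⟩ := hL
  rw [clusterCount]
  simp only [htop, and_true]
  rw [show (l + l + 1) * (2 * m) + 1 + (l + l + 2) = 2 * ((l + l + 1) * m + (l + 1)) + 1 by ring, hodd]
  omega

variable [NeZero L]

/-- The growth rate of the helix sums (per two rows). -/
def helixRate (L : ℕ) (r : ℝ) (k : ℕ) : ℝ :=
  limUnder atTop fun m : ℕ =>
    Real.log (helixSum (L + 2) r (forcedTime L) ((L + 1) * (2 * m) + 1) k) / m

theorem growth_mul_pow {u : ℕ → ℝ} {a b : ℝ} {B : ℝ} (hB : 0 < B) (hb : 0 < b)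
    (hu : ∀ m, 0 < u m) (h : Tendsto (fun m : ℕ => Real.log (u m) / m) atTop (𝓝 a)) :
    Tendsto (fun m : ℕ => Real.log (B * b ^ m * u m) / m) atTop (𝓝 (a + Real.log b)) := by
  have h1 : Tendsto (fun m : ℕ => Real.log B / m + (Real.log (u m) / m + Real.log b)) atTop
      (𝓝 (0 + (a + Real.log b))) :=
    (tendsto_const_div_atTop_nhds_zero_nat _).add (h.add_const _)
  rw [zero_add] at h1
  refine h1.congr' ?_
  filter_upwards [eventually_gt_atTop 0] with m hm
  have hm' : (m : ℝ) ≠ 0 := by exact_mod_cast hm.ne'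
  rw [Real.log_mul (by positivity) (hu m).ne', Real.log_mul hB.ne' (by positivity), Real.log_pow]
  field_simp
  ring

theorem tendsto_helixSum_two {y : ℂ} {r c : ℝ} (hy : y ≠ 0) (hr : y ^ (4 : ℤ) + y ^ (-4 : ℤ) = r)
    (hc : y ^ (2 : ℤ) + y ^ (-2 : ℤ) = c) (hr1 : 1 ≤ r) (hc1 : 1 ≤ c) (hL : Even L)
    {n : ℕ} (hn : 2 ≤ n) (hnL : 2 * n ≤ L) :
    (∀ m, 0 < helixSum (L + 2) r (forcedTime L) ((L + 1) * (2 * m) + 1) n) ∧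
    Tendsto (fun m : ℕ => Real.log (helixSum (L + 2) r (forcedTime L) ((L + 1) * (2 * m) + 1) n) / m)
      atTop (𝓝 (stripRate L c n + (L + 1) * Real.log r)) := by
  have hr0 : 0 < r := by linarith
  obtain ⟨h1, h2⟩ := tendsto_loopSum hy hr hc hr0 hc1 hL (show 1 ≤ n by omega) hnL
  have h3 := fun m => helixSum_bounds (N := L + 2) (by omega) (hL.add even_two) hr1 (forcedTime L)
    ((L + 1) * (2 * m) + 1) hn
  simp only [clusterCount_zero hL] at h3
  have h4 := growth_mul_pow (B := r ^ (L / 2 + 1)) (b := r ^ (L + 1)) (by positivity) (by positivity) h1 h2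
  have e : Real.log (r ^ (L + 1)) = (L + 1) * Real.log r := by rw [Real.log_pow]; push_cast; ring
  rw [e] at h4
  have hpos : ∀ m, 0 < r ^ (L / 2 + 1) * (r ^ (L + 1)) ^ m *
      loopSum (L + 2) (by omega) r (forcedTime L) ((L + 1) * (2 * m) + 1) n := fun m =>
    mul_pos (by positivity) (h1 m)
  have hlo : ∀ m, 1 * (r ^ (L / 2 + 1) * (r ^ (L + 1)) ^ m *
      loopSum (L + 2) (by omega) r (forcedTime L) ((L + 1) * (2 * m) + 1) n) ≤
      helixSum (L + 2) r (forcedTime L) ((L + 1) * (2 * m) + 1) n := by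
    intro m
    refine le_trans (le_of_eq ?_) (h3 m).1
    rw [one_mul, ← pow_mul, ← pow_add, add_comm]
  refine ⟨fun m => lt_of_lt_of_le (by rw [one_mul]; exact hpos m) (hlo m), ?_⟩
  refine growth_congr (C₁ := 1) (C₂ := r ^ (2 * (L + 2))) one_pos (by positivity) hpos hlo
    (fun m => (h3 m).2.trans (le_of_eq ?_)) h4
  rw [pow_add, pow_add, pow_mul]
  ring

/-- For fewer than two crossings the comparison with the six-vertex model is not available, and
existence of the rate follows from submultiplicativity. -/
theorem exists_helixSum_growth (hL : Even L) {r : ℝ} (hr : 1 ≤ r) {k : ℕ} (hk : k ≤ 1) :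
    ∃ a, Tendsto (fun m : ℕ => Real.log (helixSum (L + 2) r (forcedTime L)
      ((L + 1) * (2 * m) + 1) k) / m) atTop (𝓝 a) := by
  have hL2 : 2 ≤ L := by
    obtain ⟨l, rfl⟩ := hL
    have := NeZero.ne (l + l)
    omega
  have h1 : ∀ m, 1 ≤ helixSum (L + 2) r (forcedTime L) ((L + 1) * (2 * m) + 1) k := fun m =>
    one_le_helixSum hL hL2 (even_two_mul m) hr hk
  refine exists_growth (C := 1) (b := 1) one_pos one_pos (fun m => by linarith [h1 m])
    (fun m => by rw [one_pow]; exact h1 m) fun m n => ?_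
  rw [one_mul]
  have := helixSum_add_le (N := L + 2) (T := (L + 1) * (2 * n) + 1) (S := (L + 1) * (2 * m)) (by omega)
    (hL.add even_two) hr (forced := forcedTime L) ((even_two_mul m).mul_left _) (by omega)
    (by simp [forcedTime]) (fun s => by simp [forcedTime]) k
  refine le_trans (le_of_eq ?_) this
  congr 1
  ring

theorem tendsto_helixRate {y : ℂ} {r c : ℝ} (hy : y ≠ 0) (hr : y ^ (4 : ℤ) + y ^ (-4 : ℤ) = r)
    (hc : y ^ (2 : ℤ) + y ^ (-2 : ℤ) = c) (hr1 : 1 ≤ r) (hc1 : 1 ≤ c) (hL : Even L)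
    {k : ℕ} (hk : 2 * k ≤ L) :
    (∀ m, 0 < helixSum (L + 2) r (forcedTime L) ((L + 1) * (2 * m) + 1) k) ∧
    Tendsto (fun m : ℕ => Real.log (helixSum (L + 2) r (forcedTime L)
      ((L + 1) * (2 * m) + 1) k) / m) atTop (𝓝 (helixRate L r k)) := by
  rcases Nat.lt_or_ge 1 k with h | h
  · obtain ⟨h1, h2⟩ := tendsto_helixSum_two hy hr hc hr1 hc1 hL h hk
    exact ⟨h1, tendsto_nhds_limUnder ⟨_, h2⟩⟩
  · have hL2 : 2 ≤ L := by
      obtain ⟨l, rfl⟩ := hL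
      have := NeZero.ne (l + l)
      omega
    exact ⟨fun m => lt_of_lt_of_le one_pos (one_le_helixSum hL hL2 (even_two_mul m) hr1 h),
      tendsto_nhds_limUnder (exists_helixSum_growth hL hr1 h)⟩

/-- The growth rate of the percolation sums (per row). -/
def fkRate (L : ℕ) (r : ℝ) (k : ℕ) : ℝ :=
  helixRate L r k / 2 - Real.log r / 2 - L * Real.log (1 + r)

theorem tendsto_fkSum {y : ℂ} {r c p q : ℝ} (hy : y ≠ 0) (hr : y ^ (4 : ℤ) + y ^ (-4 : ℤ) = r)
    (hc : y ^ (2 : ℤ) + y ^ (-2 : ℤ) = c) (hr1 : 1 ≤ r) (hc1 : 1 ≤ c)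
    (hp : p = r / (1 + r)) (hq : q = r ^ 2) (hL : Even L) {k : ℕ} (hk : 2 * k ≤ L) :
    Tendsto (fun m : ℕ => Real.log (fkSum L (2 * (m + 1)) p q k) / ((2 * (m + 1) : ℕ) : ℝ)) atTop
      (𝓝 (fkRate L r k)) := by
  have hr0 : 0 < r := by linarith
  obtain ⟨h1, h2⟩ := tendsto_helixRate hy hr hc hr1 hc1 hL hk
  have h3 := h2.comp (tendsto_add_atTop_nat 1)
  have hb := fun m : ℕ => fkSum_bounds (M := 2 * (m + 1)) hL (even_two_mul _) hr1 hp hq k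
  -- The logarithms differ by at most `4 L log r` uniformly in the height, which disappears on
  -- dividing by it.
  have hlog : ∀ m : ℕ, |Real.log (helixSum (L + 2) r (forcedTime L) ((L + 1) * (2 * (m + 1)) + 1) k) -
      (L * (2 * (m + 1)) * Real.log (1 + r) + (m + 2) * Real.log r +
        Real.log (fkSum L (2 * (m + 1)) p q k))| ≤ 4 * L * Real.log r := by
    intro m
    have e1 : 2 * (m + 1) / 2 + 1 = m + 2 := by omega
    obtain ⟨b1, b2⟩ := hb m
    rw [e1] at b1 b2
    have hf : 0 < fkSum L (2 * (m + 1)) p q k := by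
      have := lt_of_lt_of_le (h1 (m + 1)) b2
      by_contra hle
      have h5 : 0 ≤ r ^ (4 * L) * ((1 + r) ^ (L * (2 * (m + 1))) * r ^ (m + 2)) := by positivity
      rw [← mul_assoc] at this
      exact absurd this (not_lt.mpr (mul_nonpos_of_nonneg_of_nonpos h5 (not_lt.mp hle)))
    have eD : Real.log ((1 + r) ^ (L * (2 * (m + 1))) * r ^ (m + 2) * fkSum L (2 * (m + 1)) p q k) =
        L * (2 * (m + 1)) * Real.log (1 + r) + (m + 2) * Real.log r +
        Real.log (fkSum L (2 * (m + 1)) p q k) := by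
      rw [Real.log_mul (by positivity) hf.ne', Real.log_mul (by positivity) (by positivity),
        Real.log_pow, Real.log_pow]
      push_cast; ring
    have l1 := Real.log_le_log (by positivity) b1
    have l2 := Real.log_le_log (h1 (m + 1)) b2
    rw [Real.log_mul (by positivity) (by positivity), Real.log_pow] at l2
    rw [eD] at l1 l2
    push_cast at l2
    rw [abs_le]
    constructor <;> [skip; linarith]
    have : 0 ≤ Real.log r := Real.log_nonneg hr1
    have : 0 ≤ 4 * L * Real.log r := by positivity
    linarith
  set d : ℕ → ℝ := fun m => Real.log (helixSum (L + 2) r (forcedTime L) ((L + 1) * (2 * (m + 1)) + 1) k) -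
      (L * (2 * (m + 1)) * Real.log (1 + r) + (m + 2) * Real.log r +
        Real.log (fkSum L (2 * (m + 1)) p q k)) with hd
  have h0 : ∀ C : ℝ, Tendsto (fun m : ℕ => C / ((m + 1 : ℕ) : ℝ)) atTop (𝓝 0) := fun C =>
    (tendsto_const_div_atTop_nhds_zero_nat C).comp (tendsto_add_atTop_nat 1)
  have hd0 : Tendsto (fun m : ℕ => d m / ((m + 1 : ℕ) : ℝ)) atTop (𝓝 0) := by
    refine squeeze_zero_norm (fun m => ?_) (h0 (4 * L * Real.log r))
    rw [norm_div, Real.norm_eq_abs, Real.norm_natCast]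
    exact div_le_div_of_nonneg_right (hlog m) (Nat.cast_nonneg _)
  have h4 := (((h3.div_const 2).sub (hd0.div_const 2)).sub
    ((h0 (Real.log r)).div_const 2)).sub_const (Real.log r / 2 + L * Real.log (1 + r))
  rw [zero_div, sub_zero, sub_zero, ← sub_sub] at h4
  refine h4.congr fun m => ?_
  have hm : ((m : ℝ) + 1) ≠ 0 := by positivity
  simp only [Function.comp, hd]
  push_cast
  field_simp
  ring

theorem helixSum_anti {r : ℝ} (hr : 0 < r) (forced : ℕ → Bool) (N T : ℕ) {k k' : ℕ} (h : k ≤ k') :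
    helixSum N r forced T k' ≤ helixSum N r forced T k := by
  classical
  refine Finset.sum_le_sum fun A _ => ?_
  split_ifs with h1 h2 h2
  · exact le_rfl
  · exact absurd (h1.mono h) h2
  · exact (helixWeight_pos hr).le
  · exact le_rfl

end rates

end BKW

end

noncomputable section

namespace BKW

/-! ### Products of matrices along a seam -/

section seam

open scoped Kronecker

variable {S S' : Type*} [Fintype S] [DecidableEq S] [Fintype S'] [DecidableEq S']

theorem prod_map_nonneg {A : Bool → Matrix S S ℝ} (hA : ∀ b i j, 0 ≤ A b i j) (s : List Bool) (i j : S) :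
    0 ≤ (s.map A).prod i j := by
  induction s generalizing i with
  | nil => rw [List.map_nil, List.prod_nil, Matrix.one_apply]; split_ifs <;> norm_num
  | cons b s ih =>
    rw [List.map_cons, List.prod_cons, Matrix.mul_apply]
    exact Finset.sum_nonneg fun k _ => mul_nonneg (hA b i k) (ih k)

theorem sum_comp_le {ι : S → S'} (hι : Function.Injective ι) {f : S' → ℝ} (hf : ∀ x, 0 ≤ f x) :
    ∑ i, f (ι i) ≤ ∑ x, f x := by
  rw [← Finset.sum_image (s := Finset.univ) (g := ι) (f := f) fun _ _ _ _ h => hι h]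
  exact Finset.sum_le_univ_sum_of_nonneg hf

theorem prod_map_le {ι : S → S'} (hι : Function.Injective ι) {A : Bool → Matrix S S ℝ}
    {B : Bool → Matrix S' S' ℝ} (hA : ∀ b i j, 0 ≤ A b i j) (hB : ∀ b i j, 0 ≤ B b i j)
    (h : ∀ b i j, A b i j ≤ B b (ι i) (ι j)) (s : List Bool) (i j : S) :
    (s.map A).prod i j ≤ (s.map B).prod (ι i) (ι j) := by
  induction s generalizing i with
  | nil =>
    simp only [List.map_nil, List.prod_nil, Matrix.one_apply, hι.eq_iff, le_refl]
  | cons b s ih =>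
    simp only [List.map_cons, List.prod_cons, Matrix.mul_apply]
    refine le_trans (Finset.sum_le_sum fun k _ => ?_) (sum_comp_le hι
      (f := fun x => B b (ι i) x * (s.map B).prod x (ι j))
      fun x => mul_nonneg (hB _ _ _) (prod_map_nonneg hB _ _ _))
    exact mul_le_mul (h b i k) (ih k) (prod_map_nonneg hA _ _ _) (hB _ _ _)

theorem trace_prod_map_le {ι : S → S'} (hι : Function.Injective ι) {A : Bool → Matrix S S ℝ}
    {B : Bool → Matrix S' S' ℝ} (hA : ∀ b i j, 0 ≤ A b i j) (hB : ∀ b i j, 0 ≤ B b i j)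
    (h : ∀ b i j, A b i j ≤ B b (ι i) (ι j)) (s : List Bool) :
    (s.map A).prod.trace ≤ (s.map B).prod.trace :=
  (Finset.sum_le_sum fun i _ => prod_map_le hι hA hB h s i i).trans
    (sum_comp_le hι (f := fun x => (s.map B).prod x x) fun _ => prod_map_nonneg hB _ _ _)

theorem prod_map_kronecker (A : Bool → Matrix S S ℝ) (B : Bool → Matrix S' S' ℝ) (s : List Bool) :
    (s.map fun b => A b ⊗ₖ B b).prod = (s.map A).prod ⊗ₖ (s.map B).prod := by
  induction s with
  | nil => simp
  | cons b s ih => simp only [List.map_cons, List.prod_cons, ih, Matrix.mul_kronecker_mul]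

/-- Greedy pigeonhole: for each factor the larger of the two terms is kept, at the price of a factor
`2`. -/
theorem exists_seam (A : Bool → Matrix S S ℝ) (M : ℕ) (X : Matrix S S ℝ) :
    ∃ s : List Bool, s.length = M ∧
      (X * (A true + A false) ^ M).trace ≤ 2 ^ M * (X * (s.map A).prod).trace := by
  induction M generalizing X with
  | zero => exact ⟨[], rfl, by simp⟩
  | succ M ih =>
    obtain ⟨s, hs, h⟩ := ih (X * A true)
    obtain ⟨s', hs', h'⟩ := ih (X * A false)
    have e : (X * (A true + A false) ^ (M + 1)).trace =
        (X * A true * (A true + A false) ^ M).trace + (X * A false * (A true + A false) ^ M).trace := by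
      rw [← Matrix.trace_add, ← add_mul, ← mul_add, pow_succ', mul_assoc]
    rw [e]
    rcases le_total ((X * A true * (s.map A).prod).trace) ((X * A false * (s'.map A).prod).trace)
      with hle | hle
    · refine ⟨false :: s', by simp [hs'], ?_⟩
      rw [List.map_cons, List.prod_cons, ← mul_assoc, pow_succ]
      have := mul_le_mul_of_nonneg_left hle (show (0 : ℝ) ≤ 2 ^ M by positivity)
      linarith
    · refine ⟨true :: s, by simp [hs], ?_⟩
      rw [List.map_cons, List.prod_cons, ← mul_assoc, pow_succ]
      have := mul_le_mul_of_nonneg_left hle (show (0 : ℝ) ≤ 2 ^ M by positivity)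
      linarith

theorem matProd_add (A : ℕ → Matrix S S ℝ) (m n : ℕ) :
    matProd A (m + n) = matProd A m * matProd (fun i => A (m + i)) n := by
  induction n with
  | zero => simp [matProd]
  | succ n ih => rw [← add_assoc, matProd, ih, matProd, mul_assoc]

theorem matProd_nonneg {A : ℕ → Matrix S S ℝ} (h : ∀ i a b, 0 ≤ A i a b) (n : ℕ) (a b : S) :
    0 ≤ matProd A n a b := by
  induction n generalizing b with
  | zero => rw [matProd, Matrix.one_apply]; split_ifs <;> norm_num
  | succ n ih =>
    rw [matProd, Matrix.mul_apply]
    exact Finset.sum_nonneg fun k _ => mul_nonneg (ih k) (h n k b)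

theorem one_le_matProd {A : ℕ → Matrix S S ℝ} (h : ∀ i a b, 0 ≤ A i a b) (a : S)
    (h1 : ∀ i, 1 ≤ A i a a) (n : ℕ) : 1 ≤ matProd A n a a := by
  induction n with
  | zero => simp [matProd]
  | succ n ih =>
    rw [matProd, Matrix.mul_apply]
    refine le_trans ?_ (Finset.single_le_sum (f := fun k => matProd A n a k * A n k a)
      (fun k _ => mul_nonneg (matProd_nonneg h n a k) (h n k a)) (Finset.mem_univ a))
    nlinarith [h1 n]

end seam

/-! ### Gluing strips -/

section gluing

variable {L L₁ L₂ : ℕ} [NeZero L] [NeZero L₁] [NeZero L₂]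

/-- The transfer matrix with a given spin on the horizontal edge closing the row. -/
def seamMatrix (L : ℕ) [NeZero L] (c : ℝ) (m : ℤ) (s : Bool) : Matrix (Sector L m) (Sector L m) ℝ :=
  fun w w' => matProd (columnMatrix c w.1 w'.1) L s s

/-- The partition function with given spins along the seam. -/
def seamTrace (L : ℕ) [NeZero L] (c : ℝ) (m : ℤ) (s : List Bool) : ℝ :=
  (s.map (seamMatrix L c m)).prod.trace

theorem columnMatrix_nonneg {c : ℝ} (hc : 0 ≤ c) (w w' : ZMod L → Bool) (i : ℕ) (a b : Bool) :
    0 ≤ columnMatrix c w w' i a b := vertexWeight_nonneg hc _ _ _ _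

theorem seamMatrix_nonneg {c : ℝ} (hc : 0 ≤ c) (m : ℤ) (s : Bool) (w w' : Sector L m) :
    0 ≤ seamMatrix L c m s w w' := matProd_nonneg (columnMatrix_nonneg hc _ _) _ _ _

theorem transferMatrix_eq (c : ℝ) (m : ℤ) :
    transferMatrix L c m = seamMatrix L c m true + seamMatrix L c m false := by
  ext w w'
  have h := sum_cyclic (columnMatrix c w.1 w'.1) L
  rw [Matrix.trace, Fintype.sum_bool] at h
  refine Eq.trans (Finset.sum_congr rfl fun g _ => Finset.prod_congr rfl fun x _ => ?_) h
  rw [columnMatrix, ZMod.natCast_zmod_val]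

theorem sum_zmod (f : ZMod L → ℤ) : ∑ x, f x = ∑ i ∈ Finset.range L, f (i : ZMod L) := by
  obtain ⟨n, rfl⟩ : ∃ n, L = n + 1 := ⟨L - 1, by have := NeZero.pos L; omega⟩
  rw [← Fin.sum_univ_eq_sum_range (fun i => f (i : ZMod (n + 1)))]
  exact Finset.sum_congr rfl fun x _ => congrArg f (ZMod.natCast_zmod_val (n := n + 1) x).symm

/-- The juxtaposition of two rows of vertical edges. -/
def glue (w₁ : ZMod L₁ → Bool) (w₂ : ZMod L₂ → Bool) (x : ZMod (L₁ + L₂)) : Bool :=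
  if x.val < L₁ then w₁ (x.val : ZMod L₁) else w₂ ((x.val - L₁ : ℕ) : ZMod L₂)

theorem glue_left (w₁ : ZMod L₁ → Bool) (w₂ : ZMod L₂ → Bool) {i : ℕ} (hi : i < L₁) :
    glue w₁ w₂ (i : ZMod (L₁ + L₂)) = w₁ i := by
  rw [glue, ZMod.val_cast_of_lt (by omega), if_pos hi]

theorem glue_right (w₁ : ZMod L₁ → Bool) (w₂ : ZMod L₂ → Bool) {i : ℕ} (hi : i < L₂) :
    glue w₁ w₂ ((L₁ + i : ℕ) : ZMod (L₁ + L₂)) = w₂ i := by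
  rw [glue, ZMod.val_cast_of_lt (by omega), if_neg (by omega), Nat.add_sub_cancel_left]

theorem flux_glue (w₁ : ZMod L₁ → Bool) (w₂ : ZMod L₂ → Bool) :
    flux (glue w₁ w₂) = flux w₁ + flux w₂ := by
  rw [flux, flux, flux, sum_zmod, sum_zmod, sum_zmod, Finset.sum_range_add]
  refine congrArg₂ _ (Finset.sum_congr rfl fun i hi => ?_) (Finset.sum_congr rfl fun i hi => ?_)
  · rw [glue_left _ _ (Finset.mem_range.mp hi)]
  · rw [glue_right _ _ (Finset.mem_range.mp hi)]

/-- In the wide row, only the configurations whose horizontal spin at the junction also equals `s`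
are kept. -/
theorem seamMatrix_glue [NeZero (L₁ + L₂)] {c : ℝ} (hc : 0 ≤ c) (w₁ w₁' : ZMod L₁ → Bool)
    (w₂ w₂' : ZMod L₂ → Bool) (s : Bool) :
    matProd (columnMatrix c w₁ w₁') L₁ s s * matProd (columnMatrix c w₂ w₂') L₂ s s ≤
      matProd (columnMatrix c (glue w₁ w₂) (glue w₁' w₂')) (L₁ + L₂) s s := by
  have h1 : matProd (columnMatrix c (glue w₁ w₂) (glue w₁' w₂')) L₁ =
      matProd (columnMatrix c w₁ w₁') L₁ := matProd_congr fun i hi => by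
    ext a b
    simp only [columnMatrix, glue_left _ _ hi]
  have h2 : matProd (fun i => columnMatrix c (glue w₁ w₂) (glue w₁' w₂') (L₁ + i)) L₂ =
      matProd (columnMatrix c w₂ w₂') L₂ := matProd_congr fun i hi => by
    ext a b
    simp only [columnMatrix, glue_right _ _ hi]
  rw [matProd_add, h1, h2, Matrix.mul_apply]
  exact Finset.single_le_sum (f := fun k => matProd (columnMatrix c w₁ w₁') L₁ s k *
    matProd (columnMatrix c w₂ w₂') L₂ k s) (fun k _ => mul_nonneg
    (matProd_nonneg (columnMatrix_nonneg hc _ _) _ _ _)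
    (matProd_nonneg (columnMatrix_nonneg hc _ _) _ _ _)) (Finset.mem_univ s)

/-- Strips with the same spins along their seams can be put side by side. The product of the traces
is the trace for the Kronecker product, whose entries are dominated by those of the wide strip. -/
theorem seamTrace_mul_le [NeZero (L₁ + L₂)] {c : ℝ} (hc : 0 ≤ c) (m₁ m₂ : ℤ) (s : List Bool) :
    seamTrace L₁ c m₁ s * seamTrace L₂ c m₂ s ≤ seamTrace (L₁ + L₂) c (m₁ + m₂) s := by
  rw [seamTrace, seamTrace, ← Matrix.trace_kronecker, ← prod_map_kronecker]
  refine trace_prod_map_le (ι := fun w : Sector L₁ m₁ × Sector L₂ m₂ =>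
    (⟨glue w.1.1 w.2.1, by rw [flux_glue, w.1.2, w.2.2]⟩ : Sector (L₁ + L₂) (m₁ + m₂))) ?_
    (fun b i j => mul_nonneg (seamMatrix_nonneg hc _ _ _ _) (seamMatrix_nonneg hc _ _ _ _))
    (seamMatrix_nonneg hc _) (fun b i j => seamMatrix_glue hc _ _ _ _ b) s
  rintro ⟨w₁, w₂⟩ ⟨w₁', w₂'⟩ h
  have h' : glue w₁.1 w₂.1 = glue w₁'.1 w₂'.1 := congrArg Subtype.val h
  refine Prod.ext (Subtype.ext (funext fun x => ?_)) (Subtype.ext (funext fun x => ?_))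
  · rw [← ZMod.natCast_zmod_val x, ← glue_left w₁.1 w₂.1 (ZMod.val_lt x), h', glue_left _ _ (ZMod.val_lt x)]
  · rw [← ZMod.natCast_zmod_val x, ← glue_right w₁.1 w₂.1 (ZMod.val_lt x), h', glue_right _ _ (ZMod.val_lt x)]

/-- Constant horizontal arrows in each row, following the seam, and the same vertical arrows in all
rows form an admissible configuration without vertices of type `c`. -/
theorem one_le_seamTrace {c : ℝ} (hc : 0 ≤ c) (hL : Even L) {k : ℤ} (h : 2 * |k| ≤ L) (s : List Bool) :
    1 ≤ seamTrace L c (2 * k) s := by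
  obtain ⟨w⟩ := sector_nonempty hL h
  have := trace_prod_map_le (S := Unit) (ι := fun _ => w) (fun _ _ _ => rfl) (A := fun _ => 1)
    (B := seamMatrix L c (2 * k)) (fun _ _ _ => by simp) (seamMatrix_nonneg hc _) (fun b _ _ => by
      simp only [Matrix.one_apply_eq]
      exact one_le_matProd (columnMatrix_nonneg hc _ _) b (fun i => by simp [columnMatrix, vertexWeight]) _) s
  simpa [seamTrace] using this

theorem seamTrace_pow_le {c : ℝ} (hc : 0 ≤ c) (m : ℤ) (s : List Bool) (n : ℕ) :
    ∀ (L' : ℕ) [NeZero L'], L' = (n + 1) * L → (seamTrace L c m s) ^ (n + 1) ≤ seamTrace L' c ((n + 1) * m) s := by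
  have h0 : ∀ (L : ℕ) [NeZero L] (m : ℤ), 0 ≤ seamTrace L c m s := fun L _ m =>
    Finset.sum_nonneg fun i _ => prod_map_nonneg (seamMatrix_nonneg hc m) s i i
  induction n with
  | zero =>
    intro L' _ h
    have h' : L' = L := by omega
    subst h'
    simp
  | succ n ih =>
    intro L' _ h
    have hne : NeZero ((n + 1) * L) := ⟨by have := NeZero.ne L; positivity⟩
    have h' : L' = (n + 1) * L + L := by rw [h]; ring
    subst h'
    have h1 := ih ((n + 1) * L) rfl
    have h2 := seamTrace_mul_le (L₁ := (n + 1) * L) (L₂ := L) hc ((n + 1) * m) m s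
    rw [pow_succ]
    refine (mul_le_mul_of_nonneg_right h1 (h0 _ _)).trans (h2.trans (le_of_eq ?_))
    congr 1
    push_cast; ring

theorem seamTrace_le {c : ℝ} (hc : 0 ≤ c) (m : ℤ) (s : List Bool) :
    seamTrace L c m s ≤ (transferMatrix L c m ^ s.length).trace := by
  have := trace_prod_map_le (ι := id) Function.injective_id (A := seamMatrix L c m)
    (B := fun _ => transferMatrix L c m) (seamMatrix_nonneg hc m)
    (fun _ => transferMatrix_nonneg hc m) (fun b i j => by
      rw [transferMatrix_eq, Matrix.add_apply]
      have h1 := seamMatrix_nonneg hc m true i j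
      have h2 := seamMatrix_nonneg hc m false i j
      cases b <;> simp only [id] <;> linarith) s
  simpa [seamTrace] using this

/-- After a best seam has been chosen for the narrow strip, `n + 1` copies with this seam are placed
next to a strip of width `r` and sector `j`, which adjusts both the width and the slope and
contributes at least `1`. -/
theorem trace_pow_le_trace {c : ℝ} (hc : 0 ≤ c) {k j : ℤ} (n : ℕ) {r : ℕ} (hr0 : 0 < r) (hr : Even r)
    (hj : 2 * |j| ≤ r) (L' : ℕ) [NeZero L'] (h : L' = (n + 1) * L + r) (hk : 2 * |k| ≤ L) (hL : Even L) (M : ℕ) :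
    ((transferMatrix L c (2 * k) ^ M).trace) ^ (n + 1) ≤
      (2 ^ M) ^ (n + 1) * (transferMatrix L' c (2 * ((n + 1) * k + j)) ^ M).trace := by
  subst h
  have hne : NeZero r := ⟨hr0.ne'⟩
  have hne' : NeZero ((n + 1) * L) := ⟨by have := NeZero.ne L; positivity⟩
  obtain ⟨s, hs, h⟩ := exists_seam (seamMatrix L c (2 * k)) M 1
  rw [one_mul, one_mul, ← transferMatrix_eq] at h
  have h1 := seamTrace_pow_le hc (2 * k) s n ((n + 1) * L) rfl
  have h2 := seamTrace_mul_le (L₁ := (n + 1) * L) (L₂ := r) hc ((n + 1) * (2 * k)) (2 * j) s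
  have h3 := one_le_seamTrace hc hr hj s
  have h4 := seamTrace_le (L := (n + 1) * L + r) hc ((n + 1) * (2 * k) + 2 * j) s
  have h5 : 0 ≤ seamTrace L c (2 * k) s := by linarith [one_le_seamTrace hc hL hk s]
  rw [hs] at h4
  have e : 2 * (((n : ℤ) + 1) * k + j) = (n + 1) * (2 * k) + 2 * j := by ring
  rw [e]
  calc ((transferMatrix L c (2 * k) ^ M).trace) ^ (n + 1)
      ≤ (2 ^ M * seamTrace L c (2 * k) s) ^ (n + 1) := by
        refine pow_le_pow_left₀ ?_ h _
        linarith [one_le_trace hc hL hk M]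
    _ = (2 ^ M) ^ (n + 1) * seamTrace L c (2 * k) s ^ (n + 1) := mul_pow _ _ _
    _ ≤ _ := by
        gcongr
        refine h1.trans (le_trans ?_ (h2.trans h4))
        exact le_mul_of_one_le_right ((pow_nonneg h5 _).trans h1) h3

theorem stripRate_superadditive {c : ℝ} (hc : 0 ≤ c) {k j : ℤ} (n : ℕ) {r : ℕ} (hr0 : 0 < r) (hr : Even r)
    (hj : 2 * |j| ≤ r) (L' : ℕ) [NeZero L'] (h : L' = (n + 1) * L + r) (hk : 2 * |k| ≤ L) (hL : Even L) :
    (n + 1) * (stripRate L c k - 2 * Real.log 2) ≤ stripRate L' c ((n + 1) * k + j) := by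
  have hL' : Even L' := by rw [h]; exact (hL.mul_left _).add hr
  have hk' : 2 * |((n : ℤ) + 1) * k + j| ≤ L' := by
    have h1 := abs_add_le (((n : ℤ) + 1) * k) j
    rw [abs_mul, abs_of_nonneg (show (0 : ℤ) ≤ n + 1 by positivity)] at h1
    rw [h]
    push_cast
    nlinarith [abs_nonneg k]
  refine le_of_tendsto_of_tendsto (((tendsto_stripRate hc hL hk).sub_const (2 * Real.log 2)).const_mul _)
    (tendsto_stripRate hc hL' hk') ?_
  filter_upwards [eventually_gt_atTop 0] with m hm
  have hm' : (0 : ℝ) < m := by exact_mod_cast hm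
  have h1 := trace_pow_le_trace hc n hr0 hr hj L' h hk hL (2 * m)
  have h2 := one_le_trace hc hL hk (2 * m)
  have h3 := one_le_trace hc hL' hk' (2 * m)
  have h4 := Real.log_le_log (by positivity) h1
  rw [Real.log_mul (by positivity) (by positivity), Real.log_pow, Real.log_pow, Real.log_pow] at h4
  push_cast at h4
  rw [le_div_iff₀ hm']
  have e : ((n : ℝ) + 1) * (Real.log ((transferMatrix L c (2 * k) ^ (2 * m)).trace) / m - 2 * Real.log 2) * m
    = (n + 1) * Real.log ((transferMatrix L c (2 * k) ^ (2 * m)).trace) - (n + 1) * (2 * m * Real.log 2) := by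
    field_simp
  rw [e]
  linarith

end gluing

end BKW

end

noncomputable section

namespace BKW

/-! ### Bounds and symmetries of the growth rates -/

section bounds

variable {L : ℕ} [NeZero L]

theorem pow_apply_le {S : Type*} [Fintype S] [DecidableEq S] {A : Matrix S S ℝ} {E : ℝ} (hE : 0 ≤ E)
    (h0 : ∀ i j, 0 ≤ A i j) (h : ∀ i j, A i j ≤ E) (m : ℕ) (i j : S) :
    (A ^ m) i j ≤ (Fintype.card S * E) ^ m := by
  induction m generalizing j with
  | zero => rw [pow_zero, pow_zero, Matrix.one_apply]; split_ifs <;> norm_num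
  | succ m ih =>
    rw [pow_succ, Matrix.mul_apply]
    refine (Finset.sum_le_sum fun k _ => mul_le_mul (ih k) (h k j) (h0 _ _) (by positivity)).trans
      (le_of_eq ?_)
    rw [Finset.sum_const, Finset.card_univ, nsmul_eq_mul, pow_succ]
    ring

theorem stripRate_nonneg {c : ℝ} (hc : 0 ≤ c) {k : ℤ} (hL : Even L) (h : 2 * |k| ≤ L) :
    0 ≤ stripRate L c k :=
  ge_of_tendsto' (tendsto_stripRate hc hL h) fun m =>
    div_nonneg (Real.log_nonneg (one_le_trace hc hL h _)) (Nat.cast_nonneg _)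

theorem stripRate_le {c : ℝ} (hc : 0 ≤ c) {k : ℤ} (hL : Even L) (h : 2 * |k| ≤ L) {E : ℝ} (hE : 0 < E)
    (hT : ∀ i j, transferMatrix L c (2 * k) i j ≤ E) :
    stripRate L c k ≤ 2 * Real.log (Fintype.card (Sector L (2 * k)) * E) := by
  set K := (Fintype.card (Sector L (2 * k)) : ℝ) with hK
  have hK0 : 0 < K := by
    have := sector_nonempty hL h
    exact Nat.cast_pos.mpr Fintype.card_pos
  have h1 : Tendsto (fun m : ℕ => Real.log K / m + 2 * Real.log (K * E)) atTop
      (𝓝 (2 * Real.log (K * E))) := by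
    simpa using (tendsto_const_div_atTop_nhds_zero_nat (Real.log K)).add_const (2 * Real.log (K * E))
  refine le_of_tendsto_of_tendsto (tendsto_stripRate hc hL h) h1 ?_
  filter_upwards [eventually_gt_atTop 0] with m hm
  have hm' : (0 : ℝ) < m := by exact_mod_cast hm
  have h2 : (transferMatrix L c (2 * k) ^ (2 * m)).trace ≤ K * (K * E) ^ (2 * m) := by
    rw [hK, ← nsmul_eq_mul, ← Finset.card_univ, ← Finset.sum_const]
    exact Finset.sum_le_sum fun i _ => pow_apply_le hE.le (transferMatrix_nonneg hc _) hT _ i i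
  have h3 := Real.log_le_log (by linarith [one_le_trace hc hL h (2 * m)]) h2
  rw [Real.log_mul hK0.ne' (by positivity), Real.log_pow] at h3
  rw [div_le_iff₀ hm', add_mul, div_mul_cancel₀ _ hm'.ne']
  push_cast at h3
  linarith

theorem rowWeight_le {c : ℝ} (hc : 1 ≤ c) (w w' : ZMod L → Bool) : rowWeight c w w' ≤ (2 * c) ^ L := by
  have h : ∀ h : ZMod L → Bool, ∏ x, vertexWeight c (h (x - 1)) (w x) (h x) (w' x) ≤ c ^ L := by
    intro h
    refine (Finset.prod_le_prod (g := fun _ => c)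
      (fun _ _ => vertexWeight_nonneg (by linarith) _ _ _ _) fun x _ => ?_).trans (le_of_eq ?_)
    · unfold vertexWeight
      split_ifs <;> linarith
    · rw [Finset.prod_const, Finset.card_univ, ZMod.card]
  refine (Finset.sum_le_sum fun g _ => h g).trans (le_of_eq ?_)
  rw [Finset.sum_const, Finset.card_univ, Fintype.card_fun, ZMod.card, Fintype.card_bool, nsmul_eq_mul,
    mul_pow]
  push_cast; rfl

theorem stripRate_le_mul {c : ℝ} (hc : 1 ≤ c) {k : ℤ} (hL : Even L) (h : 2 * |k| ≤ L) :
    stripRate L c k ≤ 2 * Real.log (4 * c) * L := by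
  refine (stripRate_le (by linarith) hL h (E := (2 * c) ^ L) (by positivity)
    fun i j => rowWeight_le hc _ _).trans ?_
  have h1 : (Fintype.card (Sector L (2 * k)) : ℝ) ≤ 2 ^ L := by
    have := Fintype.card_subtype_le fun w : ZMod L → Bool => flux w = 2 * k
    rw [Fintype.card_fun, ZMod.card, Fintype.card_bool] at this
    exact_mod_cast this
  have h2 : (0 : ℝ) < Fintype.card (Sector L (2 * k)) := by
    have := sector_nonempty hL h
    exact Nat.cast_pos.mpr Fintype.card_pos
  have h3 : (Fintype.card (Sector L (2 * k)) : ℝ) * (2 * c) ^ L ≤ (4 * c) ^ L := by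
    rw [show (4 * c) ^ L = 2 ^ L * (2 * c) ^ L by rw [← mul_pow]; ring]
    gcongr
  have h4 := Real.log_le_log (by positivity) h3
  rw [Real.log_pow] at h4
  linarith

theorem rowWeight_not (c : ℝ) (w w' : ZMod L → Bool) :
    rowWeight c (fun x => !w x) (fun x => !w' x) = rowWeight c w w' := by
  have e := Equiv.sum_comp (Equiv.arrowCongr (Equiv.refl (ZMod L)) Equiv.boolNot)
    (fun h => ∏ x, vertexWeight c (h (x - 1)) (!w x) (h x) (!w' x))
  rw [rowWeight, ← e, rowWeight]
  refine Finset.sum_congr rfl fun h _ => Finset.prod_congr rfl fun x _ => ?_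
  simp only [Equiv.arrowCongr_apply, Function.comp, Equiv.refl_symm, Equiv.refl_apply,
    Equiv.boolNot_apply]
  cases h (x - 1) <;> cases h x <;> cases w x <;> cases w' x <;> simp [vertexWeight]

theorem flux_not (w : ZMod L → Bool) : flux (fun x => !w x) = -flux w := by
  rw [flux, flux, ← Finset.sum_neg_distrib]
  refine Finset.sum_congr rfl fun x _ => ?_
  cases w x <;> simp

theorem trace_neg {c : ℝ} (hc : 0 ≤ c) (m : ℤ) (M : ℕ) :
    (transferMatrix L c (-m) ^ M).trace = (transferMatrix L c m ^ M).trace := by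
  have key : ∀ m, (transferMatrix L c m ^ M).trace ≤ (transferMatrix L c (-m) ^ M).trace := by
    intro m
    have := trace_prod_map_le (ι := fun w : Sector L m =>
      (⟨fun x => !w.1 x, by rw [flux_not, w.2]⟩ : Sector L (-m)))
      (fun w w' h => Subtype.ext (funext fun x => by
        have := congrFun (congrArg Subtype.val h) x
        simpa using this))
      (A := fun _ => transferMatrix L c m) (B := fun _ => transferMatrix L c (-m))
      (fun _ => transferMatrix_nonneg hc _) (fun _ => transferMatrix_nonneg hc _)
      (fun _ i j => (rowWeight_not c i.1 j.1).ge) (List.replicate M true)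
    simpa using this
  refine le_antisymm ?_ (key m)
  have := key (-m)
  rwa [neg_neg] at this

theorem stripRate_neg {c : ℝ} (hc : 0 ≤ c) (k : ℤ) : stripRate L c (-k) = stripRate L c k := by
  rw [stripRate, stripRate, mul_neg]
  simp only [trace_neg hc]

/-- All vertical arrows point up, so the ice rule makes each row of horizontal arrows constant: two
possibilities per row. -/
theorem stripRate_extremal {c : ℝ} (hc : 0 ≤ c) {k : ℤ} (hL : Even L) (h : 2 * k = L) :
    stripRate L c k ≤ 2 * Real.log 2 := by
  have hk : 2 * |k| ≤ L := by rw [abs_of_nonneg (by omega)]; omega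
  have hw : ∀ w : Sector L (2 * k), w.1 = fun _ => true := by
    intro w
    have h1 := w.2
    rw [flux_eq, ZMod.card] at h1
    have h2 : (Finset.univ.filter fun i => w.1 i = true).card = Fintype.card (ZMod L) := by
      rw [ZMod.card]; omega
    funext x
    have h3 := (Finset.card_eq_iff_eq_univ _).mp h2
    have h4 : x ∈ Finset.univ.filter fun i => w.1 i = true := by rw [h3]; exact Finset.mem_univ x
    exact (Finset.mem_filter.mp h4).2
  have hs : Subsingleton (Sector L (2 * k)) := ⟨fun w w' => Subtype.ext ((hw w).trans (hw w').symm)⟩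
  have hT : ∀ i j, transferMatrix L c (2 * k) i j ≤ 2 := by
    intro i j
    have h1 : matProd (columnMatrix c i.1 j.1) L = 1 := by
      rw [matProd_congr (B := fun _ => 1), matProd_const, one_pow]
      intro x _
      ext a b
      rw [columnMatrix, hw i, hw j]
      cases a <;> cases b <;> simp [vertexWeight]
    rw [transferMatrix_eq, Matrix.add_apply, seamMatrix, seamMatrix, h1]
    norm_num
  have := stripRate_le hc hL hk two_pos hT
  obtain ⟨w⟩ := sector_nonempty hL hk
  rw [Fintype.card_eq_one_iff.mpr ⟨w, fun y => Subsingleton.elim _ _⟩] at this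
  simpa using this

end bounds

/-! ### Convergence of the slopes -/

/-- Values close to the limsup occur at arbitrarily late indices, and from then on the sequence
stays close to them from below; so the limsup is the limit. -/
theorem exists_tendsto_of_almost_monotone {g : ℕ → ℝ} {B : ℝ} (h0 : ∀ l, 0 ≤ g l) (hB : ∀ l, g l ≤ B)
    (h : ∀ ε > 0, ∀ᶠ l in atTop, ∀ᶠ l' in atTop, g l - ε ≤ g l') : ∃ a, Tendsto g atTop (𝓝 a) := by
  have hb1 : IsBoundedUnder (· ≤ ·) atTop g := isBoundedUnder_of ⟨B, hB⟩
  have hb2 : IsBoundedUnder (· ≥ ·) atTop g := isBoundedUnder_of ⟨0, h0⟩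
  refine ⟨limsup g atTop, tendsto_order.mpr ⟨fun a ha => ?_, fun a ha => ?_⟩⟩
  · set ε := (limsup g atTop - a) / 2 with hε
    have hf : ∃ᶠ l in atTop, limsup g atTop - ε < g l :=
      frequently_lt_of_lt_limsup hb2.isCoboundedUnder_le (by linarith)
    obtain ⟨l, hl1, hl2⟩ := (hf.and_eventually (h ε (by linarith))).exists
    filter_upwards [hl2] with l' hl'
    linarith
  · exact eventually_lt_of_limsup_lt ha hb1

theorem two_abs_ceil_le {α : ℝ} (h : |α| ≤ 1 / 2) {L : ℕ} (hL : Even L) : 2 * |⌈α * L⌉| ≤ (L : ℤ) := by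
  obtain ⟨l, rfl⟩ := hL
  obtain ⟨h1, h2⟩ := abs_le.mp h
  have hl : (0 : ℝ) ≤ l := Nat.cast_nonneg l
  have h3 : ⌈α * ((l + l : ℕ) : ℝ)⌉ ≤ (l : ℤ) := by
    rw [Int.ceil_le]; push_cast; nlinarith
  have h4 : (-(l : ℤ)) ≤ ⌈α * ((l + l : ℕ) : ℝ)⌉ := by
    have h5 : ((-(l : ℤ) : ℤ) : ℝ) ≤ α * ((l + l : ℕ) : ℝ) := by push_cast; nlinarith
    exact_mod_cast h5.trans (Int.le_ceil _)
  have := abs_le.mpr ⟨h4, h3⟩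
  omega

/-- The growth rate in the sector of slope `α` per vertex, in even width `2 (l + 1)`. -/
def slopeRate (c α : ℝ) (l : ℕ) : ℝ :=
  stripRate (2 * (l + 1)) c ⌈α * ((2 * (l + 1) : ℕ) : ℝ)⌉ / (2 * ((2 * (l + 1) : ℕ) : ℝ))

theorem slopeRate_nonneg {c α : ℝ} (hc : 0 ≤ c) (h : |α| ≤ 1 / 2) (l : ℕ) : 0 ≤ slopeRate c α l :=
  div_nonneg (stripRate_nonneg hc (even_two_mul _) (two_abs_ceil_le h (even_two_mul _))) (by positivity)

theorem slopeRate_le {c α : ℝ} (hc : 1 ≤ c) (h : |α| ≤ 1 / 2) (l : ℕ) :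
    slopeRate c α l ≤ Real.log (4 * c) := by
  rw [slopeRate, div_le_iff₀ (by positivity)]
  have := stripRate_le_mul hc (even_two_mul (l + 1)) (two_abs_ceil_le h (even_two_mul (l + 1)))
  linarith

/-- The leftover width must carry the leftover flux. Rounding creates an error of at most one per
copy, and the slack `1 - 2|α|` per unit of width absorbs it once each copy comes with `R` extra
columns. This is where `|α| < 1/2` is needed. -/
theorem gluing_ceil {α : ℝ} {R L L' m : ℕ} (hm : 0 < m) (hα : |α| < 1 / 2)
    (hR : 2 / (1 - 2 * |α|) ≤ R) (h : m * (L + R) ≤ L') :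
    2 * |⌈α * (L' : ℝ)⌉ - m * ⌈α * (L : ℝ)⌉| ≤ ((L' - m * L : ℕ) : ℤ) := by
  have h1 : (0 : ℝ) < 1 - 2 * |α| := by linarith
  have hle : m * L ≤ L' := le_trans (by nlinarith) h
  have hm1 : (1 : ℝ) ≤ m := by exact_mod_cast hm
  have hr : (m : ℝ) * R ≤ L' - m * L := by
    have : ((m * (L + R) : ℕ) : ℝ) ≤ L' := by exact_mod_cast h
    push_cast at this
    linarith
  have h2 : 2 * (m : ℝ) ≤ (1 - 2 * |α|) * (L' - m * L) := by
    rw [div_le_iff₀ h1] at hR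
    nlinarith
  have c1 := Int.le_ceil (α * (L' : ℝ))
  have c2 := Int.ceil_lt_add_one (α * (L' : ℝ))
  have c3 := Int.le_ceil (α * (L : ℝ))
  have c4 := Int.ceil_lt_add_one (α * (L : ℝ))
  have h3 : |α * ((L' : ℝ) - m * L)| = |α| * (L' - m * L) := by
    rw [abs_mul, abs_of_nonneg (a := (L' : ℝ) - m * L)]
    have : (0 : ℝ) ≤ m * R := by positivity
    linarith
  obtain ⟨h4, h5⟩ := abs_le.mp h3.le
  have h6 : |((⌈α * (L' : ℝ)⌉ : ℝ) - m * ⌈α * (L : ℝ)⌉)| ≤ |α| * (L' - m * L) + m := by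
    rw [abs_le]
    constructor <;> nlinarith
  have h7 : 2 * |((⌈α * (L' : ℝ)⌉ : ℝ) - m * ⌈α * (L : ℝ)⌉)| ≤ (L' : ℝ) - m * L := by linarith
  have e : (((L' - m * L : ℕ) : ℤ) : ℝ) = (L' : ℝ) - m * L := by
    push_cast [Nat.cast_sub hle]; ring
  have h8 : ((2 * |⌈α * (L' : ℝ)⌉ - m * ⌈α * (L : ℝ)⌉| : ℤ) : ℝ) ≤ ((L' - m * L : ℕ) : ℤ) := by
    rw [e]; push_cast; exact h7
  exact_mod_cast h8

theorem stripRate_ceil_superadditive {c α : ℝ} (hc : 0 ≤ c) (hα : |α| < 1 / 2) {R L L' m : ℕ} [NeZero L]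
    [NeZero L'] (hL : Even L) (hL' : Even L') (hm : 0 < m) (hR0 : 0 < R) (hR : 2 / (1 - 2 * |α|) ≤ R)
    (h : m * (L + R) ≤ L') :
    m * (stripRate L c ⌈α * (L : ℝ)⌉ - 2 * Real.log 2) ≤ stripRate L' c ⌈α * (L' : ℝ)⌉ := by
  obtain ⟨n, rfl⟩ : ∃ n, m = n + 1 := ⟨m - 1, by omega⟩
  have hj := gluing_ceil (Nat.succ_pos n) hα hR h
  have hpos : (n + 1) * L + 1 ≤ L' := le_trans (by nlinarith) h
  have := stripRate_superadditive hc n (r := L' - (n + 1) * L) (by omega)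
    ((Nat.even_sub (by omega)).mpr ⟨fun _ => hL.mul_left _, fun _ => hL'⟩) hj L' (by omega)
    (two_abs_ceil_le hα.le hL) hL
  push_cast at this ⊢
  rwa [add_sub_cancel] at this

theorem exists_tendsto_slopeRate_of_lt {c α : ℝ} (hc : 1 ≤ c) (hα : |α| < 1 / 2) :
    ∃ a, Tendsto (slopeRate c α) atTop (𝓝 a) := by
  have hc0 : 0 ≤ c := by linarith
  refine exists_tendsto_of_almost_monotone (slopeRate_nonneg hc0 hα.le) (slopeRate_le hc hα.le)
    fun ε hε => ?_
  obtain ⟨R, hR⟩ := exists_nat_ge (2 / (1 - 2 * |α|))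
  have hR0 : 0 < R := by
    have : 0 < 2 / (1 - 2 * |α|) := div_pos two_pos (by linarith)
    exact_mod_cast this.trans_le hR
  set K := Real.log (4 * c) with hK
  have hK0 : 0 ≤ K := Real.log_nonneg (by linarith)
  have hlog : 0 < Real.log 2 := Real.log_pos one_lt_two
  -- Chosen so that the two relative losses, `K R / D` from the extra columns and `log 2 / D` from
  -- the seams, add up to at most `ε / 2`.
  obtain ⟨l₀, hl₀⟩ := exists_nat_ge (2 * (K * R + Real.log 2) / ε)
  filter_upwards [eventually_ge_atTop l₀] with l hl
  set L := 2 * (l + 1) with hL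
  set s := stripRate L c ⌈α * (L : ℝ)⌉ with hs
  have hs0 : 0 ≤ s := stripRate_nonneg hc0 (even_two_mul _) (two_abs_ceil_le hα.le (even_two_mul _))
  have hsK : s ≤ 2 * K * L := stripRate_le_mul hc (even_two_mul _) (two_abs_ceil_le hα.le (even_two_mul _))
  have hLpos : (0 : ℝ) < L := by rw [hL]; positivity
  set D : ℝ := L + R with hD
  have hDpos : 0 < D := by positivity
  have hbig : 2 * (K * R + Real.log 2) ≤ ε * D := by
    rw [div_le_iff₀ hε] at hl₀
    have h1 : (l₀ : ℝ) ≤ L := by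
      rw [hL]; exact_mod_cast (show l₀ ≤ 2 * (l + 1) by omega)
    have h2 : (0 : ℝ) ≤ R := Nat.cast_nonneg _
    nlinarith
  -- Chosen so that the width not filled by complete copies costs at most `ε / 2`.
  obtain ⟨l₁, hl₁⟩ := exists_nat_ge (s / ε)
  filter_upwards [eventually_ge_atTop (l₁ + L + R)] with l' hl'
  set L' := 2 * (l' + 1) with hL'
  have hL'pos : (0 : ℝ) < L' := by rw [hL']; positivity
  have hs' : s ≤ ε * L' := by
    rw [div_le_iff₀ hε] at hl₁
    have h1 : (l₁ : ℝ) ≤ L' := by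
      rw [hL']; exact_mod_cast (show l₁ ≤ 2 * (l' + 1) by omega)
    nlinarith
  have h4 : s / (2 * L) - s / (2 * D) ≤ K * R / D := by
    have : s / (2 * L) - s / (2 * D) = s * R / (2 * L * D) := by
      field_simp; rw [hD]; ring
    rw [this, div_le_div_iff₀ (by positivity) hDpos]
    have hR' : (0 : ℝ) ≤ R * D := by positivity
    nlinarith [mul_le_mul_of_nonneg_right hsK hR']
  have h6 : K * R / D + Real.log 2 / D ≤ ε / 2 := by
    rw [← add_div, div_le_iff₀ hDpos]; linarith
  have e1 : slopeRate c α l = s / (2 * L) := rfl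
  -- If a copy does not even pay for its seam, the rate is already below `ε` and gluing is
  -- unnecessary.
  by_cases hsl : s < 2 * Real.log 2
  · have h1 : slopeRate c α l ≤ ε := by
      have h1 : s / (2 * D) ≤ Real.log 2 / D := by
        rw [div_le_div_iff₀ (by positivity) hDpos]; nlinarith
      rw [e1]
      linarith
    linarith [slopeRate_nonneg hc0 hα.le l']
  · set m := L' / (L + R) with hm
    have hmpos : 0 < m := Nat.div_pos (by omega) (by omega)
    have hsup := stripRate_ceil_superadditive (L := L) (L' := L') hc0 hα (even_two_mul _) (even_two_mul _)
      hmpos hR0 hR (Nat.div_mul_le_self _ _)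
    rw [← hs] at hsup
    have hmD : (L' : ℝ) ≤ (m + 1) * D := by
      have := Nat.lt_div_mul_add (a := L') (b := L + R) (by omega)
      rw [← hm] at this
      have h1 : ((L' : ℕ) : ℝ) ≤ ((m * (L + R) + (L + R) : ℕ) : ℝ) := by exact_mod_cast this.le
      push_cast at h1
      rw [hD]; linarith
    have e2 : slopeRate c α l' = stripRate L' c ⌈α * (L' : ℝ)⌉ / (2 * L') := rfl
    have h1 : m * (s - 2 * Real.log 2) / (2 * L') ≤ slopeRate c α l' := by
      rw [e2]; gcongr
    refine le_trans ?_ h1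
    have h2 : (L' / D - 1) * (s - 2 * Real.log 2) / (2 * L') ≤ m * (s - 2 * Real.log 2) / (2 * L') := by
      have : L' / D - 1 ≤ m := by rw [sub_le_iff_le_add, div_le_iff₀ hDpos]; exact hmD
      have : 0 ≤ s - 2 * Real.log 2 := by linarith
      gcongr
    refine le_trans ?_ h2
    have h3 : (L' / D - 1) * (s - 2 * Real.log 2) / (2 * L') =
        s / (2 * D) - Real.log 2 / D - s / (2 * L') + Real.log 2 / L' := by
      field_simp; ring
    have h5 : s / (2 * L') ≤ ε / 2 := by
      rw [div_le_iff₀ (by positivity)]; linarith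
    have h7 : 0 ≤ Real.log 2 / L' := by positivity
    rw [e1, h3]
    linarith

end BKW

end

noncomputable section

namespace BKW

/-! ### Comparison of growth rates -/

theorem ceil_half (l : ℕ) : ⌈(1 / 2 : ℝ) * ((2 * (l + 1) : ℕ) : ℝ)⌉ = l + 1 := by
  rw [show (1 / 2 : ℝ) * ((2 * (l + 1) : ℕ) : ℝ) = ((l + 1 : ℤ) : ℝ) by push_cast; ring, Int.ceil_intCast]

theorem ceil_neg_half (l : ℕ) : ⌈(-1 / 2 : ℝ) * ((2 * (l + 1) : ℕ) : ℝ)⌉ = -(l + 1) := by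
  rw [show (-1 / 2 : ℝ) * ((2 * (l + 1) : ℕ) : ℝ) = ((-(l + 1) : ℤ) : ℝ) by push_cast; ring,
    Int.ceil_intCast]

theorem exists_tendsto_slopeRate {c α : ℝ} (hc : 1 ≤ c) (hα : α ∈ Set.Icc (-1 / 2 : ℝ) (1 / 2)) :
    ∃ a, Tendsto (slopeRate c α) atTop (𝓝 a) := by
  have hc0 : 0 ≤ c := by linarith
  have hle : |α| ≤ 1 / 2 := abs_le.mpr ⟨by linarith [hα.1], hα.2⟩
  rcases hle.lt_or_eq with h | h
  · exact exists_tendsto_slopeRate_of_lt hc h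
  · have hext : ∀ l : ℕ, stripRate (2 * (l + 1)) c ⌈α * ((2 * (l + 1) : ℕ) : ℝ)⌉ ≤ 2 * Real.log 2 := by
      intro l
      have h1 := stripRate_extremal (L := 2 * (l + 1)) hc0 (k := l + 1) (even_two_mul _) (by push_cast; ring)
      rcases (abs_eq (by norm_num)).mp h with rfl | rfl
      · rwa [ceil_half]
      · rw [← neg_div, ceil_neg_half, stripRate_neg hc0]; exact h1
    have h0 : Tendsto (fun l : ℕ => Real.log 2 / ((l + 1 : ℕ) : ℝ)) atTop (𝓝 0) :=
      (tendsto_const_div_atTop_nhds_zero_nat (Real.log 2)).comp (tendsto_add_atTop_nat 1)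
    refine ⟨0, squeeze_zero (slopeRate_nonneg hc0 hle) (fun l => ?_) h0⟩
    have hlog : 0 < Real.log 2 := Real.log_pos one_lt_two
    rw [slopeRate, div_le_div_iff₀ (by positivity) (by positivity)]
    have := hext l
    have h2 : (0 : ℝ) ≤ ((l + 1 : ℕ) : ℝ) := Nat.cast_nonneg _
    have e : ((2 * (l + 1) : ℕ) : ℝ) = 2 * ((l + 1 : ℕ) : ℝ) := by push_cast; ring
    rw [e] at this ⊢
    nlinarith [mul_le_mul_of_nonneg_right this h2]

/-- A bounded error and a change of the width by `4` do not affect the limit per column. -/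
theorem tendsto_of_shifts {u v : ℕ → ℝ} {a C : ℝ}
    (hu : Tendsto (fun l : ℕ => u l / ((2 * (l + 1) : ℕ) : ℝ)) atTop (𝓝 a))
    (h1 : ∀ᶠ l in atTop, u l - C ≤ v (l + 2)) (h2 : ∀ᶠ l in atTop, v l - C ≤ u (l + 2)) :
    Tendsto (fun l : ℕ => v l / ((2 * (l + 1) : ℕ) : ℝ)) atTop (𝓝 a) := by
  have hc : ∀ C : ℝ, Tendsto (fun l : ℕ => C / ((l + 1 : ℕ) : ℝ)) atTop (𝓝 0) := fun C =>
    (tendsto_const_div_atTop_nhds_zero_nat C).comp (tendsto_add_atTop_nat 1)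
  have hc3 : ∀ C : ℝ, Tendsto (fun l : ℕ => C / ((l + 3 : ℕ) : ℝ)) atTop (𝓝 0) := fun C =>
    (tendsto_const_div_atTop_nhds_zero_nat C).comp (tendsto_add_atTop_nat 3)
  rw [← tendsto_add_atTop_iff_nat 2]
  have lo : Tendsto (fun l : ℕ => u l / ((2 * (l + 1) : ℕ) : ℝ) * (1 - 2 / ((l + 3 : ℕ) : ℝ)) -
      C / 2 / ((l + 3 : ℕ) : ℝ)) atTop (𝓝 (a * (1 - 0) - 0)) :=
    (hu.mul ((hc3 2).const_sub 1)).sub (hc3 (C / 2))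
  have up : Tendsto (fun l : ℕ => u (l + 2 + 2) / ((2 * (l + 2 + 2 + 1) : ℕ) : ℝ) *
      (1 + 2 / ((l + 3 : ℕ) : ℝ)) + C / 2 / ((l + 3 : ℕ) : ℝ)) atTop (𝓝 (a * (1 + 0) + 0)) :=
    ((hu.comp (tendsto_add_atTop_nat 4)).mul ((hc3 2).const_add 1)).add (hc3 (C / 2))
  simp only [sub_zero, mul_one] at lo
  simp only [add_zero, mul_one] at up
  refine tendsto_of_tendsto_of_tendsto_of_le_of_le' lo up ?_ ?_
  · filter_upwards [h1] with l hl
    have e : u l / ((2 * (l + 1) : ℕ) : ℝ) * (1 - 2 / ((l + 3 : ℕ) : ℝ)) - C / 2 / ((l + 3 : ℕ) : ℝ) =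
        (u l - C) / ((2 * (l + 2 + 1) : ℕ) : ℝ) := by
      push_cast; field_simp; ring
    rw [e]
    gcongr
  · filter_upwards [(tendsto_add_atTop_nat 2).eventually h2] with l hl
    have e : u (l + 2 + 2) / ((2 * (l + 2 + 2 + 1) : ℕ) : ℝ) * (1 + 2 / ((l + 3 : ℕ) : ℝ)) +
        C / 2 / ((l + 3 : ℕ) : ℝ) = (u (l + 2 + 2) + C) / ((2 * (l + 2 + 1) : ℕ) : ℝ) := by
      push_cast; field_simp; ring
    rw [e]
    have : v (l + 2) ≤ u (l + 2 + 2) + C := by linarith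
    gcongr

/-- A single copy is glued to a strip of width `4`, whose sectors `j` with `|j| ≤ 2` shift the
slope. -/
theorem stripRate_le_shift {c : ℝ} (hc : 0 ≤ c) (l : ℕ) {k j : ℤ} (hk : 2 * |k| ≤ ((2 * (l + 1) : ℕ) : ℤ))
    (hj : |j| ≤ 2) :
    stripRate (2 * (l + 1)) c k - 2 * Real.log 2 ≤ stripRate (2 * (l + 2 + 1)) c (k + j) := by
  have := stripRate_superadditive (L := 2 * (l + 1)) hc 0 (r := 4) (j := j) (by norm_num) (by decide)
    (by push_cast; omega) (2 * (l + 2 + 1)) (by ring) hk (even_two_mul _)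
  simpa using this

/-! ### Percolation rates against six-vertex rates on a strip. -/

section rates

variable {y : ℂ} {r c : ℝ}

/-- The correspondence at fixed width. The term `(L + 1) log r / 2` from the vertices of the helix,
minus `log r / 2` from its forced edges, leaves `L log r / 2`. -/
theorem fkRate_eq (hy : y ≠ 0) (hr : y ^ (4 : ℤ) + y ^ (-4 : ℤ) = r)
    (hc : y ^ (2 : ℤ) + y ^ (-2 : ℤ) = c) (hr1 : 1 ≤ r) (hc1 : 1 ≤ c) {L : ℕ} [NeZero L] (hL : Even L)
    {n : ℕ} (hn : 2 ≤ n) (hnL : 2 * n ≤ L) :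
    fkRate L r n = stripRate L c n / 2 + L * (Real.log r / 2 - Real.log (1 + r)) := by
  rw [fkRate, tendsto_nhds_unique (tendsto_helixRate hy hr hc hr1 hc1 hL hnL).2
    (tendsto_helixSum_two hy hr hc hr1 hc1 hL hn hnL).2]
  ring

theorem fkRate_anti (hy : y ≠ 0) (hr : y ^ (4 : ℤ) + y ^ (-4 : ℤ) = r)
    (hc : y ^ (2 : ℤ) + y ^ (-2 : ℤ) = c) (hr1 : 1 ≤ r) (hc1 : 1 ≤ c) {L : ℕ} [NeZero L] (hL : Even L)
    {n : ℕ} (hnL : 2 * n ≤ L) : fkRate L r n ≤ fkRate L r 0 := by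
  have hr0 : 0 < r := by linarith
  obtain ⟨p1, h1⟩ := tendsto_helixRate hy hr hc hr1 hc1 hL hnL
  obtain ⟨p2, h2⟩ := tendsto_helixRate hy hr hc hr1 hc1 hL (show 2 * 0 ≤ L by omega)
  have := le_of_tendsto_of_tendsto' h1 h2 fun m => div_le_div_of_nonneg_right
    (Real.log_le_log (p1 m) (helixSum_anti hr0 _ _ _ (Nat.zero_le n))) (Nat.cast_nonneg m)
  rw [fkRate, fkRate]
  linarith

/-- The cost of two crossings is four columns, each with a factor `2 * r ^ 3` per row, independently
of the width. -/
theorem fkRate_zero_le (hy : y ≠ 0) (hr : y ^ (4 : ℤ) + y ^ (-4 : ℤ) = r)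
    (hc : y ^ (2 : ℤ) + y ^ (-2 : ℤ) = c) (hr1 : 1 ≤ r) (hc1 : 1 ≤ c) {L : ℕ} [NeZero L] (hL : Even L)
    (hL4 : 4 ≤ L) : fkRate L r 0 ≤ fkRate L r 2 + 4 * Real.log (2 * r ^ 3) := by
  have hr0 : 0 < r := by linarith
  obtain ⟨p1, h1⟩ := tendsto_helixRate hy hr hc hr1 hc1 hL (show 2 * 0 ≤ L by omega)
  obtain ⟨p2, h2⟩ := tendsto_helixRate hy hr hc hr1 hc1 hL (show 2 * 2 ≤ L by omega)
  have := le_of_tendsto_of_tendsto h1 (h2.add_const (8 * Real.log (2 * r ^ 3))) (by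
    filter_upwards [eventually_gt_atTop 0] with m hm
    have hm' : (0 : ℝ) < m := by exact_mod_cast hm
    have h3 := Real.log_le_log (p1 m) (helixSum_zero_le_two hL hL4 (even_two_mul m) hr1)
    rw [Real.log_mul (by positivity) (p2 m).ne', Real.log_pow] at h3
    push_cast at h3
    rw [div_add' _ _ _ hm'.ne']
    refine div_le_div_of_nonneg_right ?_ hm'.le
    linarith)
  rw [fkRate, fkRate]
  linarith

end rates

/-! ### The total partition function -/

/-- A finite sum of positive terms lies between its maximum and the number of terms times its
maximum. -/
theorem tendsto_log_sum {ι : Type*} (K : Finset ι) (hK : K.Nonempty) {u : ι → ℕ → ℝ} {a : ι → ℝ}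
    (hu : ∀ k ∈ K, ∀ m, 0 < u k m)
    (h : ∀ k ∈ K, Tendsto (fun m : ℕ => Real.log (u k m) / m) atTop (𝓝 (a k))) :
    Tendsto (fun m : ℕ => Real.log (∑ k ∈ K, u k m) / m) atTop (𝓝 (K.sup' hK a)) := by
  have hcard : 0 < (K.card : ℝ) := by exact_mod_cast hK.card_pos
  have hmax : ∀ m, ∃ k ∈ K, K.sup' hK (fun k => u k m) = u k m := fun m => K.exists_mem_eq_sup' hK _
  refine growth_congr (u := fun m => K.sup' hK fun k => u k m) (C₁ := 1) (C₂ := K.card) one_pos hcard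
    (fun m => ?_) (fun m => ?_) (fun m => ?_) ?_
  · obtain ⟨k, hk, e⟩ := hmax m
    simp only [e]; exact hu k hk m
  · obtain ⟨k, hk, e⟩ := hmax m
    simp only [e, one_mul]
    exact Finset.single_le_sum (f := fun k => u k m) (fun k hk => (hu k hk m).le) hk
  · rw [← nsmul_eq_mul]
    exact Finset.sum_le_card_nsmul _ _ _ fun k hk => Finset.le_sup' (fun k => u k m) hk
  · refine (Tendsto.finset_sup'_nhds_apply hK h).congr fun m => ?_
    obtain ⟨k, hk, e⟩ := hmax m
    refine le_antisymm (Finset.sup'_le _ _ fun j hj => ?_) ?_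
    · exact div_le_div_of_nonneg_right (Real.log_le_log (hu j hj m)
        (Finset.le_sup' (fun k => u k m) hj)) (Nat.cast_nonneg m)
    · rw [e]
      exact Finset.le_sup' (fun k => Real.log (u k m) / m) hk

/-- The range of the slopes. -/
def slopeRange (l : ℕ) : Finset ℤ :=
  Finset.Icc (-(((2 * (l + 1) : ℕ) : ℤ) / 2)) (((2 * (l + 1) : ℕ) : ℤ) / 2)

theorem mem_slopeRange {l : ℕ} {k : ℤ} : k ∈ slopeRange l ↔ 2 * |k| ≤ ((2 * (l + 1) : ℕ) : ℤ) := by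
  rw [slopeRange, Finset.mem_Icc, ← abs_le]
  push_cast
  omega

theorem slopeRange_nonempty (l : ℕ) : (slopeRange l).Nonempty := ⟨0, by rw [mem_slopeRange]; simp; positivity⟩

/-- The growth rate of the six-vertex model, per two rows. -/
def totalRate (c : ℝ) (l : ℕ) : ℝ :=
  (slopeRange l).sup' (slopeRange_nonempty l) fun k => stripRate (2 * (l + 1)) c k

theorem tendsto_slopedZ {c : ℝ} (hc : 0 ≤ c) (l : ℕ) {k : ℤ} (hk : 2 * |k| ≤ ((2 * (l + 1) : ℕ) : ℤ)) :
    Tendsto (fun m : ℕ => 1 / (((2 * (l + 1) : ℕ) : ℝ) * ((2 * (m + 1) : ℕ) : ℝ)) *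
      Real.log (slopedZ (2 * (l + 1)) (2 * (m + 1)) c k)) atTop
      (𝓝 (stripRate (2 * (l + 1)) c k / (2 * ((2 * (l + 1) : ℕ) : ℝ)))) := by
  have h := ((tendsto_stripRate hc (even_two_mul (l + 1)) hk).comp (tendsto_add_atTop_nat 1)).div_const
    (2 * ((2 * (l + 1) : ℕ) : ℝ))
  refine h.congr fun m => ?_
  rw [slopedZ_eq_trace (even_two_mul _)]
  simp only [Function.comp]
  rw [div_div, one_div, inv_mul_eq_div]
  congr 1
  push_cast; ring

theorem tendsto_sixVertexZ {c : ℝ} (hc : 0 ≤ c) (l : ℕ) :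
    Tendsto (fun m : ℕ => 1 / (((2 * (l + 1) : ℕ) : ℝ) * ((2 * (m + 1) : ℕ) : ℝ)) *
      Real.log (sixVertexZ (2 * (l + 1)) (2 * (m + 1)) c)) atTop
      (𝓝 (totalRate c l / 2 / ((2 * (l + 1) : ℕ) : ℝ))) := by
  have h1 := tendsto_log_sum (slopeRange l) (slopeRange_nonempty l)
    (u := fun k m => (transferMatrix (2 * (l + 1)) c (2 * k) ^ (2 * m)).trace)
    (a := fun k => stripRate (2 * (l + 1)) c k)
    (fun k hk m => lt_of_lt_of_le one_pos (one_le_trace hc (even_two_mul _) (mem_slopeRange.mp hk) _))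
    (fun k hk => tendsto_stripRate hc (even_two_mul _) (mem_slopeRange.mp hk))
  have h := ((h1.comp (tendsto_add_atTop_nat 1)).div_const 2).div_const ((2 * (l + 1) : ℕ) : ℝ)
  refine h.congr fun m => ?_
  simp only [sixVertexZ, slopedZ_eq_trace (even_two_mul (l + 1)), Function.comp, slopeRange]
  rw [div_div, div_div, one_div, inv_mul_eq_div]
  congr 1
  push_cast; ring

theorem stripRate_le_totalRate (c : ℝ) {l : ℕ} {k : ℤ} (hk : 2 * |k| ≤ ((2 * (l + 1) : ℕ) : ℤ)) :
    stripRate (2 * (l + 1)) c k ≤ totalRate c l :=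
  Finset.le_sup' (fun k => stripRate (2 * (l + 1)) c k) (mem_slopeRange.mpr hk)

/-! ### Limits in the width. -/

section limits

variable {y : ℂ} {r c : ℝ}

/-- For `n ≥ 2` the rate of the sector is a percolation rate, which is at most the rate without
condition, hence by finite energy at most that of sector `2` plus a constant. Sectors up to `2` are
moved to sector `0` by widening the strip, and negative sectors are reflected. -/
theorem totalRate_le (hy : y ≠ 0) (hr : y ^ (4 : ℤ) + y ^ (-4 : ℤ) = r)
    (hc : y ^ (2 : ℤ) + y ^ (-2 : ℤ) = c) (hr1 : 1 ≤ r) (hc1 : 1 ≤ c) (l : ℕ) :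
    totalRate c l ≤ stripRate (2 * (l + 2 + 1)) c 0 + (2 * Real.log 2 + 8 * Real.log (2 * r ^ 3)) := by
  have hc0 : 0 ≤ c := by linarith
  have hlog : 0 ≤ Real.log (2 * r ^ 3) := Real.log_nonneg (by nlinarith [one_le_pow₀ hr1 (n := 3)])
  have key : ∀ n : ℕ, 2 * n ≤ 2 * (l + 1) → stripRate (2 * (l + 1)) c n ≤
      stripRate (2 * (l + 2 + 1)) c 0 + (2 * Real.log 2 + 8 * Real.log (2 * r ^ 3)) := by
    have small : ∀ n : ℕ, n ≤ 2 → 2 * n ≤ 2 * (l + 1) → stripRate (2 * (l + 1)) c n ≤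
        stripRate (2 * (l + 2 + 1)) c 0 + 2 * Real.log 2 := by
      intro n hn h
      have := stripRate_le_shift hc0 l (k := n) (j := -n) (by rw [Nat.abs_cast]; exact_mod_cast h)
        (by rw [abs_neg, Nat.abs_cast]; exact_mod_cast hn)
      rw [add_neg_cancel] at this
      linarith
    intro n hn
    rcases Nat.lt_or_ge n 2 with h | h
    · linarith [small n h.le hn]
    · have h1 := fkRate_anti hy hr hc hr1 hc1 (even_two_mul (l + 1)) hn
      have h2 := fkRate_zero_le hy hr hc hr1 hc1 (even_two_mul (l + 1)) (by omega)
      rw [fkRate_eq hy hr hc hr1 hc1 (even_two_mul (l + 1)) h hn] at h1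
      rw [fkRate_eq hy hr hc hr1 hc1 (even_two_mul (l + 1)) le_rfl (by omega)] at h2
      have := small 2 le_rfl (by omega)
      push_cast at h1 h2 this ⊢
      linarith
  refine Finset.sup'_le _ _ fun k hk => ?_
  rw [mem_slopeRange] at hk
  have := key k.natAbs (by have := Int.natCast_natAbs k; omega)
  rcases Int.natAbs_eq k with e | e
  · rwa [← e] at this
  · rw [e, stripRate_neg hc0]; exact this

theorem slopeRate_zero (c : ℝ) (l : ℕ) :
    slopeRate c 0 l = stripRate (2 * (l + 1)) c 0 / 2 / ((2 * (l + 1) : ℕ) : ℝ) := by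
  rw [slopeRate, zero_mul, Int.ceil_zero, div_div]

theorem tendsto_totalRate (hy : y ≠ 0) (hr : y ^ (4 : ℤ) + y ^ (-4 : ℤ) = r)
    (hc : y ^ (2 : ℤ) + y ^ (-2 : ℤ) = c) (hr1 : 1 ≤ r) (hc1 : 1 ≤ c) {a : ℝ}
    (h : Tendsto (slopeRate c 0) atTop (𝓝 a)) :
    Tendsto (fun l : ℕ => totalRate c l / 2 / ((2 * (l + 1) : ℕ) : ℝ)) atTop (𝓝 a) := by
  have hc0 : 0 ≤ c := by linarith
  have hlog : 0 ≤ Real.log (2 * r ^ 3) := Real.log_nonneg (by nlinarith [one_le_pow₀ hr1 (n := 3)])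
  refine tendsto_of_shifts (u := fun l => stripRate (2 * (l + 1)) c 0 / 2) (v := fun l => totalRate c l / 2)
    (C := Real.log 2 + 4 * Real.log (2 * r ^ 3)) (h.congr (slopeRate_zero c))
    (Eventually.of_forall fun l => ?_) (Eventually.of_forall fun l => ?_)
  · have h1 := stripRate_le_shift hc0 l (k := 0) (j := 0) (by simp; positivity) (by simp)
    have h2 := stripRate_le_totalRate c (l := l + 2) (k := 0) (by simp; positivity)
    rw [add_zero] at h1
    linarith
  · have h1 := totalRate_le hy hr hc hr1 hc1 l
    linarith

/-- Unconditioned percolation is sandwiched between sector `2` and sector `2` plus a constant, and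
sector `2` is compared with sector `0` by gluing a strip of width `4`. -/
theorem tendsto_fkRate_zero (hy : y ≠ 0) (hr : y ^ (4 : ℤ) + y ^ (-4 : ℤ) = r)
    (hc : y ^ (2 : ℤ) + y ^ (-2 : ℤ) = c) (hr1 : 1 ≤ r) (hc1 : 1 ≤ c) {a : ℝ}
    (h : Tendsto (slopeRate c 0) atTop (𝓝 a)) :
    Tendsto (fun l : ℕ => fkRate (2 * (l + 1)) r 0 / ((2 * (l + 1) : ℕ) : ℝ)) atTop
      (𝓝 (a + (Real.log r / 2 - Real.log (1 + r)))) := by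
  have hc0 : 0 ≤ c := by linarith
  set κ := Real.log r / 2 - Real.log (1 + r) with hκ
  have hlog : 0 ≤ Real.log (2 * r ^ 3) := Real.log_nonneg (by nlinarith [one_le_pow₀ hr1 (n := 3)])
  have h1 : Tendsto (fun l : ℕ => (fkRate (2 * (l + 1)) r 0 - ((2 * (l + 1) : ℕ) : ℝ) * κ) /
      ((2 * (l + 1) : ℕ) : ℝ)) atTop (𝓝 a) := by
    refine tendsto_of_shifts (u := fun l => stripRate (2 * (l + 1)) c 0 / 2)
      (v := fun l => fkRate (2 * (l + 1)) r 0 - ((2 * (l + 1) : ℕ) : ℝ) * κ)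
      (C := Real.log 2 + 4 * Real.log (2 * r ^ 3)) (h.congr (slopeRate_zero c))
      (Eventually.of_forall fun l => ?_) ?_
    · have h1 := stripRate_le_shift hc0 l (k := 0) (j := 2) (by simp; positivity) (by simp)
      have h2 := fkRate_anti hy hr hc hr1 hc1 (even_two_mul (l + 2 + 1)) (n := 2) (by omega)
      rw [fkRate_eq hy hr hc hr1 hc1 (even_two_mul (l + 2 + 1)) le_rfl (by omega), ← hκ] at h2
      rw [zero_add] at h1
      push_cast at h2 ⊢
      linarith
    · filter_upwards [eventually_ge_atTop 1] with l hl
      have h1 := stripRate_le_shift hc0 l (k := 2) (j := -2) (by push_cast; norm_num; omega) (by simp)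
      have h2 := fkRate_zero_le hy hr hc hr1 hc1 (even_two_mul (l + 1)) (by omega)
      rw [fkRate_eq hy hr hc hr1 hc1 (even_two_mul (l + 1)) le_rfl (by omega), ← hκ] at h2
      rw [add_neg_cancel] at h1
      push_cast at h2 ⊢
      linarith
  refine (h1.add_const κ).congr fun l => ?_
  have : ((2 * (l + 1) : ℕ) : ℝ) ≠ 0 := by positivity
  field_simp
  ring

theorem tendsto_fkRate_slope (hy : y ≠ 0) (hr : y ^ (4 : ℤ) + y ^ (-4 : ℤ) = r)
    (hc : y ^ (2 : ℤ) + y ^ (-2 : ℤ) = c) (hr1 : 1 ≤ r) (hc1 : 1 ≤ c) {α a : ℝ} (h0 : 0 < α)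
    (hα : α ≤ 1 / 2) (h : Tendsto (slopeRate c α) atTop (𝓝 a)) :
    Tendsto (fun l : ℕ => fkRate (2 * (l + 1)) r ⌈α * ((2 * (l + 1) : ℕ) : ℝ)⌉₊ / ((2 * (l + 1) : ℕ) : ℝ)) atTop
      (𝓝 (a + (Real.log r / 2 - Real.log (1 + r)))) := by
  refine (h.add_const (Real.log r / 2 - Real.log (1 + r))).congr' ?_
  obtain ⟨l₀, hl₀⟩ := exists_nat_ge (1 / α)
  filter_upwards [eventually_ge_atTop l₀] with l hl
  have hpos : 0 ≤ α * ((2 * (l + 1) : ℕ) : ℝ) := by positivity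
  have habs := two_abs_ceil_le (L := 2 * (l + 1)) (abs_le.mpr ⟨by linarith, hα⟩) (even_two_mul _)
  rw [← Int.natCast_ceil_eq_ceil hpos, Nat.abs_cast] at habs
  -- Since `α > 0`, wide strips require at least two crossings, so the exact correspondence applies.
  have h2 : 2 ≤ ⌈α * ((2 * (l + 1) : ℕ) : ℝ)⌉₊ := by
    refine Nat.lt_ceil.mpr ?_
    rw [div_le_iff₀ h0] at hl₀
    have : (l₀ : ℝ) ≤ l := by exact_mod_cast hl
    push_cast
    nlinarith
  rw [fkRate_eq hy hr hc hr1 hc1 (even_two_mul _) h2 (by exact_mod_cast habs), slopeRate,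
    Int.natCast_ceil_eq_ceil hpos]
  have : ((2 * (l + 1) : ℕ) : ℝ) ≠ 0 := by positivity
  field_simp

end limits

/-! ### The percolation measure -/

section measure

variable {L M : ℕ} [NeZero L] [NeZero M]

theorem fkZ_eq (p q : ℝ) : fkZ L M p q = fkSum L M p q 0 := by
  classical
  simp [fkZ, fkSum]

theorem fkProb_eq (p q t : ℝ) :
    fkProb L M p q (crossingEvent L M t) = fkSum L M p q ⌈t⌉₊ / fkSum L M p q 0 := by
  classical
  rw [fkProb, fkZ_eq, fkSum]
  congr 1
  refine Finset.sum_congr rfl fun ω _ => ?_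
  have h : ω ∈ crossingEvent L M t ↔ ⌈t⌉₊ ≤ numCrossing ω := by
    rw [crossingEvent, Set.mem_ofPred_eq, Nat.ceil_le]
  by_cases h' : ω ∈ crossingEvent L M t
  · rw [if_pos h', if_pos (h.mp h')]
  · rw [if_neg h', if_neg fun g => h' (h.mpr g)]

theorem fkSum_pos {y : ℂ} {r c p q : ℝ} (hy : y ≠ 0) (hr : y ^ (4 : ℤ) + y ^ (-4 : ℤ) = r)
    (hc : y ^ (2 : ℤ) + y ^ (-2 : ℤ) = c) (hr1 : 1 ≤ r) (hc1 : 1 ≤ c)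
    (hp : p = r / (1 + r)) (hq : q = r ^ 2) (hL : Even L) (hM : Even M) {k : ℕ} (hk : 2 * k ≤ L) :
    0 < fkSum L M p q k := by
  have hr0 : 0 < r := by linarith
  obtain ⟨m, rfl⟩ := hM.two_dvd
  have h := lt_of_lt_of_le ((tendsto_helixRate hy hr hc hr1 hc1 hL hk).1 m)
    (fkSum_bounds hL (even_two_mul m) hr1 hp hq k).2
  by_contra hle
  have h5 : 0 ≤ r ^ (4 * L) * ((1 + r) ^ (L * (2 * m)) * r ^ (2 * m / 2 + 1)) := by positivity
  rw [← mul_assoc] at h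
  exact absurd h (not_lt.mpr (mul_nonpos_of_nonneg_of_nonpos h5 (not_lt.mp hle)))

end measure

/-- `y ^ 2` is a root of `X² - c X + 1`, and squaring `y² + y⁻² = c` gives `y⁴ + y⁻⁴ = c² - 2 = r`.
For `c < 2` the roots are not real, which is why the operators act over `ℂ`. -/
theorem exists_parameter {c r : ℝ} (hcr : c ^ 2 = 2 + r) : ∃ y : ℂ, y ≠ 0 ∧ y ^ (4 : ℤ) + y ^ (-4 : ℤ) = r ∧
    y ^ (2 : ℤ) + y ^ (-2 : ℤ) = c := by
  obtain ⟨z, hz⟩ := IsAlgClosed.exists_pow_nat_eq (((c : ℂ)) ^ 2 - 4) (n := 2) two_pos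
  obtain ⟨y, hy⟩ := IsAlgClosed.exists_pow_nat_eq (((c : ℂ) + z) / 2) (n := 2) two_pos
  have h1 : (y ^ 2) ^ 2 - c * y ^ 2 + 1 = 0 := by rw [hy]; linear_combination hz / 4
  have hy0 : y ≠ 0 := by
    rintro rfl
    simp at h1
  have hcr' : ((c : ℂ)) ^ 2 = 2 + r := by exact_mod_cast hcr
  have h2 : y ^ (2 : ℤ) + y ^ (-2 : ℤ) = c := by
    rw [zpow_neg, zpow_ofNat]
    field_simp
    linear_combination h1
  refine ⟨y, hy0, ?_, h2⟩
  have h3 : y ^ (4 : ℤ) + y ^ (-4 : ℤ) = (y ^ (2 : ℤ) + y ^ (-2 : ℤ)) ^ 2 - 2 := by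
    simp only [zpow_neg, zpow_ofNat]
    field_simp
    ring
  rw [h3, h2, hcr']
  ring

end BKW

end

/-! ### Assembling the limits. -/

theorem mainTheorem10 (q p c : ℝ) (hq : 1 ≤ q)
    (hp : p = Real.sqrt q / (1 + Real.sqrt q)) (hc : c = Real.sqrt (2 + Real.sqrt q)) :
    ∃ (fFK f6V : ℝ) (f6Vslope : ℝ → ℝ),
      BKW.HasIteratedLimit
        (fun L M _ _ => 1 / ((L : ℝ) * M) * Real.log (BKW.fkZ L M p q)) fFK ∧
      BKW.HasIteratedLimit
        (fun L M _ _ => 1 / ((L : ℝ) * M) * Real.log (BKW.sixVertexZ L M c)) f6V ∧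
      (∀ α ∈ Set.Icc (-1 / 2 : ℝ) (1 / 2),
        BKW.HasIteratedLimit
          (fun L M _ _ => 1 / ((L : ℝ) * M) * Real.log (BKW.slopedZ L M c ⌈α * L⌉))
          (f6Vslope α)) ∧
      fFK = f6V + 1 / 4 * Real.log q - Real.log (1 + Real.sqrt q) ∧
      ∀ α : ℝ, 0 < α → α ≤ 1 / 2 →
        ∃ o : ℕ → ℕ → ℝ,
          BKW.HasIteratedLimit (fun L M _ _ => o L M) 0 ∧
          ∀ (L M : ℕ) [NeZero L] [NeZero M], Even L → Even M →
            BKW.fkProb L M p q (BKW.crossingEvent L M (α * L)) ^ (1 / ((L : ℝ) * M)) =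
              Real.exp (f6Vslope α - f6Vslope 0 + o L M) := by
  classical
  set r := Real.sqrt q with hr
  have hr1 : 1 ≤ r := Real.one_le_sqrt.mpr hq
  have hr0 : 0 < r := by linarith
  have hqr : q = r ^ 2 := (Real.sq_sqrt (by linarith)).symm
  have hc2 : c ^ 2 = 2 + r := by rw [hc, Real.sq_sqrt (by linarith)]
  have hc1 : 1 ≤ c := by rw [hc]; exact Real.one_le_sqrt.mpr (by linarith)
  have hc0 : 0 ≤ c := by linarith
  obtain ⟨y, hy0, hy4, hy2⟩ := BKW.exists_parameter hc2
  have hlim : ∀ α : ℝ, ∃ a, α ∈ Set.Icc (-1 / 2 : ℝ) (1 / 2) → Tendsto (BKW.slopeRate c α) atTop (𝓝 a) := by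
    intro α
    by_cases h : α ∈ Set.Icc (-1 / 2 : ℝ) (1 / 2)
    · obtain ⟨a, ha⟩ := BKW.exists_tendsto_slopeRate hc1 h
      exact ⟨a, fun _ => ha⟩
    · exact ⟨0, fun h' => absurd h' h⟩
  choose f hf using hlim
  have hf0 := hf 0 ⟨by norm_num, by norm_num⟩
  set κ := Real.log r / 2 - Real.log (1 + r) with hκ
  have hfk : ∀ (l k : ℕ), 2 * k ≤ 2 * (l + 1) →
      Tendsto (fun m : ℕ => 1 / (((2 * (l + 1) : ℕ) : ℝ) * ((2 * (m + 1) : ℕ) : ℝ)) *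
        Real.log (BKW.fkSum (2 * (l + 1)) (2 * (m + 1)) p q k)) atTop
        (𝓝 (BKW.fkRate (2 * (l + 1)) r k / ((2 * (l + 1) : ℕ) : ℝ))) := by
    intro l k hk
    refine ((BKW.tendsto_fkSum hy0 hy4 hy2 hr1 hc1 hp hqr (even_two_mul (l + 1)) hk).div_const
      ((2 * (l + 1) : ℕ) : ℝ)).congr fun m => ?_
    rw [div_div, one_div, inv_mul_eq_div, mul_comm ((2 * (m + 1) : ℕ) : ℝ)]
  have hk : ∀ (α : ℝ), 0 < α → α ≤ 1 / 2 → ∀ L : ℕ, Even L → 2 * ⌈α * (L : ℝ)⌉₊ ≤ L := by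
    intro α h0 hα L hL
    have h := BKW.two_abs_ceil_le (abs_le.mpr ⟨by linarith, hα⟩) hL
    rw [← Int.natCast_ceil_eq_ceil (by positivity), Nat.abs_cast] at h
    exact_mod_cast h
  refine ⟨f 0 + κ, f 0, f, ⟨_, fun l => ?_, BKW.tendsto_fkRate_zero hy0 hy4 hy2 hr1 hc1 hf0⟩,
    ⟨_, BKW.tendsto_sixVertexZ hc0, BKW.tendsto_totalRate hy0 hy4 hy2 hr1 hc1 hf0⟩,
    fun α hα => ⟨_, fun l => BKW.tendsto_slopedZ hc0 l (BKW.two_abs_ceil_le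
      (abs_le.mpr ⟨by linarith [hα.1], hα.2⟩) (even_two_mul _)), hf α hα⟩, ?_, fun α h0 hα => ?_⟩
  · simp only [BKW.fkZ_eq]
    exact hfk l 0 (by omega)
  · rw [hκ, hqr, Real.log_pow]
    push_cast; ring
  -- The error is defined by solving the required identity for it, with the value `0` for degenerate
  -- sizes; what remains to be shown is its iterated limit.
  · refine ⟨fun L M => if h : L ≠ 0 ∧ M ≠ 0 then
      haveI : NeZero L := ⟨h.1⟩
      haveI : NeZero M := ⟨h.2⟩
      1 / ((L : ℝ) * M) * Real.log (BKW.fkProb L M p q (BKW.crossingEvent L M (α * L))) - (f α - f 0)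
      else 0, ⟨fun l => (BKW.fkRate (2 * (l + 1)) r ⌈α * ((2 * (l + 1) : ℕ) : ℝ)⌉₊ /
        ((2 * (l + 1) : ℕ) : ℝ) - BKW.fkRate (2 * (l + 1)) r 0 / ((2 * (l + 1) : ℕ) : ℝ)) - (f α - f 0),
        fun l => ?_, ?_⟩, ?_⟩
    · refine (((hfk l _ (hk α h0 hα _ (even_two_mul _))).sub (hfk l 0 (by omega))).sub_const
        (f α - f 0)).congr fun m => ?_
      beta_reduce
      rw [dif_pos ⟨by omega, by omega⟩, BKW.fkProb_eq, Real.log_div, mul_sub]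
      · exact (BKW.fkSum_pos hy0 hy4 hy2 hr1 hc1 hp hqr (even_two_mul _) (even_two_mul _)
          (hk α h0 hα _ (even_two_mul _))).ne'
      · exact (BKW.fkSum_pos hy0 hy4 hy2 hr1 hc1 hp hqr (even_two_mul _) (even_two_mul _) (by omega)).ne'
    · have h := ((BKW.tendsto_fkRate_slope hy0 hy4 hy2 hr1 hc1 h0 hα
        (hf α ⟨by linarith, hα⟩)).sub (BKW.tendsto_fkRate_zero hy0 hy4 hy2 hr1 hc1 hf0)).sub_const
        (f α - f 0)
      rwa [show f α + κ - (f 0 + κ) - (f α - f 0) = 0 by ring] at h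
    · intro L M _ _ hL hM
      have h1 := BKW.fkSum_pos hy0 hy4 hy2 hr1 hc1 hp hqr hL hM (hk α h0 hα L hL)
      have h2 := BKW.fkSum_pos hy0 hy4 hy2 hr1 hc1 hp hqr hL hM (show 2 * 0 ≤ L by omega)
      have hpos : 0 < BKW.fkProb L M p q (BKW.crossingEvent L M (α * L)) := by
        rw [BKW.fkProb_eq]; exact div_pos h1 h2
      beta_reduce
      rw [dif_pos ⟨NeZero.ne L, NeZero.ne M⟩, add_sub_cancel, Real.rpow_def_of_pos hpos, mul_comm]
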